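/- **Setting.** Let $d\ge 2$, let $f$ be a probability density on $\mathbb{R}^d$, $X\sim f$, and let $\mathbb{S}$ be a non-empty collection of subsets of $[d]$ with $[d]\notin\mathbb{S}$. For $x\in\mathbb{R}^d$ write $x_S=(x_j:j\in S)$ and let $f_S$ be the density of $X_S$. For $S\in\mathbb{S}$ let $r_S:\mathbb{R}^S\to(0,\infty)$ and $\lambda_S\in(0,\infty)$ be known, put $\bar r_S=r_S/\mathbb{E}\{r_S(X_S)\}$, $\lambda_{\min}=\min_S\lambda_S$, $\lambda_{\max}=\max_S\lambda_S$, and write $r_S(x)=r_S(x_S)$. Let $a:\mathbb{R}^d\to\mathbb{R}$ be bounded and $\theta=\mathbb{E}\,a(X)$. We observe independent data $X_1,\dots,X_n\sim f$ and $X_{S,1},\dots,X_{S,n_S}\sim\bar r_Sf_S$ on $\mathbb{R}^S$ ($S\in\mathbb{S}$), with $n,n_S\geq 1$. Let $\mathcal{L}(\alpha_{\mathbb{S}})=\mathrm{Var}\{a(X)-\sum_{S}\alpha_S(X_S)\}+\sum_{S}\mathbb{E}\{\alpha_S(X_S)^2/(\lambda_S\bar r_S(X_S))\}$ for $\alpha_{\mathbb{S}}=(\alpha_S)_{S\in\mathbb{S}}$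 in the space $H_{\mathbb{S}}$ of families of functions $\alpha_S$ on $\mathbb{R}^S$ with $\mathbb{E}\,\alpha_S(X_S)^2<\infty$ and $\mathbb{E}\,\alpha_S(X_S)=0$. **Estimator.** Fix $M\in\mathbb{N}$, $T\ge1$, $h>0$. Let $\mathcal{D}_1=\{X_1,\dots,X_{\lceil n/2\rceil}\}$, let $\mathcal{D}_2$ be the remaining complete data, and split each $\mathcal{D}_\ell$ (by index) into $M$ pieces $\mathcal{D}_{\ell,1},\dots,\mathcal{D}_{\ell,M}$ whose sizes differ by at most one. Let $K(z)=2^{-d}\mathbf{1}\{\|z\|_\infty\le1\}$, $K^S(u_S)=\int K(u_S,v)\,dv$, $K_h^S(u)=h^{-|S|}K^S(u/h)$ and $B_T=\{x:\|x\|_\infty\le T\}$. For a finite sample $\mathcal{D}$ let $\hat r_{S,\mathcal{D}}=|\mathcal{D}|^{-1}\sum_{x\in\mathcal{D}}r_S(x)$, $\hat f_{S,\mathcal{D}}(x_S)=|\mathcal{D}|^{-1}\sum_{y\in\mathcal{D}}K_h^S(x_S-y_S)$ and $\hat w_{S,\mathcal{D}}(x_S)=\lambda_Sr_S(x_S)/\{\hat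 r_{S,\mathcal{D}}+\lambda_Sr_S(x_S)\}$. Put $\hat a^{(0)}=a$ and, for $0\le m<M$, a sequence $\mathbf{S}=(S_1,\dots,S_m)\in\mathbb{S}^m$, $S\in\mathbb{S}$ and $\mathcal{D}=\mathcal{D}_{\ell,m+1}$, $$\hat a^{(m+1)}_{(\mathbf{S},S),(\ell)}(x_S)=\hat w_{S,\mathcal{D}}(x_S)\Bigl\{\frac1{|\mathcal{D}|}\sum_{y\in\mathcal{D}}\hat a^{(m)}_{\mathbf{S},(\ell)}(y)\mathbf{1}_{B_T}(y)\frac{K_h^S(x_S-y_S)}{\hat f_{S,\mathcal{D}}(x_S)}-\frac{\sum_{y\in\mathcal{D}}\hat w_{S,\mathcal{D}}(y_S)\hat a^{(m)}_{\mathbf{S},(\ell)}(y)\mathbf{1}_{B_T}(y)}{\sum_{y\in\mathcal{D}}\hat w_{S,\mathcal{D}}(y_S)}\Bigr\}$$ if $\|x_S\|_\infty\le T$, and $0$ otherwise (all quotients with denominator $0$ are read as $0$, including for empty pieces). With $\mathbb{S}^{(m)}$ the set of sequences in $\mathbb{S}^m$ whose consecutive entries differ and $b_M(m)=\mathbb{P}(\mathrm{Bin}(M,1/|\mathbb{S}|)\ge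 m)$ set, if $\|x_S\|_\infty\le T$, $$\hat\alpha_{S,(\ell)}(x_S)=\sum_{m=1}^M(-1)^{m-1}\sum_{\mathbf{S}\in\mathbb{S}^{(m)}:S_m=S}b_M(m)\,\hat a^{(m)}_{\mathbf{S},(\ell)}(x_S),$$ and $\hat\alpha_{S,(\ell)}(x_S)=0$ otherwise. Finally let $\hat\theta=(|\mathcal{D}_2|\hat\theta_{(1)}+|\mathcal{D}_1|\hat\theta_{(2)})/n$, where $$\hat\theta_{(\ell)}=\frac1{|\mathcal{D}_{3-\ell}|}\sum_{x\in\mathcal{D}_{3-\ell}}\Bigl\{a(x)-\sum_{S\in\mathbb{S}}\hat\alpha_{S,(\ell)}(x_S)\Bigr\}+\sum_{S\in\mathbb{S}}\frac1{n_S}\sum_{j=1}^{n_S}\frac{\hat\alpha_{S,(\ell)}(X_{S,j})\,\hat r_{S,\mathcal{D}_{3-\ell}}}{r_S(X_{S,j})}.$$ **Assumptions.** There are $0<c\le C<\infty$ with $c\le\bar r_S\le C$ on $\mathbb{R}^S$ for all $S\in\mathbb{S}$, and $\beta_1,\beta_2,\beta_3\in(0,1]$, $L_1,L_2,L_3\in(0,\infty)$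 such that (A1) $|a(x)-a(x')|\le L_1\|x-x'\|_\infty^{\beta_1}$ for all $x,x'\in\mathbb{R}^d$ with $\|x-x'\|_\infty\le1$; (A2) for each $S\in\mathbb{S}$ there is a version of the conditional law of $X_{S^c}$ given $X_S$ with $d_{\mathrm{TV}}(\mathrm{Law}(X_{S^c}|X_S=x_S),\mathrm{Law}(X_{S^c}|X_S=x_S'))\le L_2\|x_S-x_S'\|_\infty^{\beta_2}$ for all $x_S,x_S'\in\mathbb{R}^S$ with $\|x_S-x'_S\|_\infty\le1$; (A3) $|\bar r_S(x_S)-\bar r_S(x_S')|\le L_3\|x_S-x_S'\|_\infty^{\beta_3}$ for all $S\in\mathbb{S}$ and $x_S,x_S'\in\mathbb{R}^S$ with $\|x_S-x_S'\|_\infty\le1$. Put $\beta_\wedge=\min(\beta_1,\beta_2,\beta_3)$, $A=28(C/c+2^d)$, $B=16\max(\|a\|_\infty^2,1)\max\{(C/c)^2,(L_1+L_2+L_3)^2,8^d\}$, $D=200|\mathbb{S}|^2(C/c)(1+\lambda_{\min}^{-1})B$ and $\kappa=|\mathbb{S}|(1+C\lambda_{\max})$. **Theorem.** Under these assumptions $\mathcal{L}$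 has a minimiser $\alpha^*_{\mathbb{S}}$ over $H_{\mathbb{S}}$, and the following hold. (i) If $|n\lambda_S/n_S-1|\le1/n$ for all $S\in\mathbb{S}$, $M\ge1$, $T\ge1$ and $h\in[T(M/n)^{1/d},1]$, then $(\hat\theta-\theta)^2$ is integrable and $$n\,\mathbb{E}\{(\hat\theta-\theta)^2\}-\mathcal{L}(\alpha^*_{\mathbb{S}})\le A^MD\Bigl\{\frac{MT^d}{nh^d}+h^{2\beta_\wedge}+\mathbb{P}(\|X\|_\infty\ge T)\Bigr\}^{1/2}+4\kappa\,\{\mathrm{Var}\,a(X)\}\,e^{-M/\kappa}.$$ (ii) Hold $d,\mathbb{S},f,a,(r_S),(\lambda_S)$ and all the constants above fixed, and let $n\to\infty$ along any sequence of sample sizes for which $|n\lambda_S/n_S-1|\le1/n$ for all $S\in\mathbb{S}$. If $h>0$, $T$ and $M$ are chosen such that $T,M\to\infty$ and $A^{2M}\{MT^d/(nh^d)+h^{2\beta_\wedge}+\mathbb{P}(\|X\|_\infty\ge T)\}\to0$, then $$\mathbb{E}\{(\hat\theta-\theta)^2\}=\frac1n\mathcal{L}(\alpha^*_{\mathbb{S}})+o(1/n).$$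 -/

import Mathlib

open MeasureTheory ProbabilityTheory Filter Topology Asymptotics

noncomputable section

namespace DataFusion

/-- The subvector `x_S = (x_j : j ∈ S)` of `x ∈ ℝ^d`. -/
def proj {d : ℕ} (S : Finset (Fin d)) (x : Fin d → ℝ) : S → ℝ := fun j => x j

/-- The point of `ℝ^d` with coordinates `u` on `S` and `v` on the complement of `S`. -/
def glue {d : ℕ} (S : Finset (Fin d)) (u : S → ℝ) (v : (Sᶜ : Finset (Fin d)) → ℝ) : Fin d → ℝ :=
  fun j => if hj : j ∈ S then u ⟨j, hj⟩ else v ⟨j, Finset.mem_compl.2 hj⟩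

/-- `‖a‖_∞ = sup_x |a(x)|`. -/
def supNorm {d : ℕ} (a : (Fin d → ℝ) → ℝ) : ℝ := ⨆ x, |a x|

/-- Total variation distance `sup_A |P(A) - Q(A)|`. -/
def tvDist {α : Type*} [MeasurableSpace α] (P Q : Measure α) : ℝ :=
  ⨆ A : {A : Set α // MeasurableSet A}, |P.real A.1 - Q.real A.1|

/-! ### The model -/

/-- The distribution of the complete observation `X`, with Lebesgue density `f`. -/
def law {d : ℕ} (f : (Fin d → ℝ) → ℝ) : Measure (Fin d → ℝ) :=
  volume.withDensity fun x => ENNReal.ofReal (f x)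

/-- The distribution of `X_S`. -/
def marginal {d : ℕ} (f : (Fin d → ℝ) → ℝ) (S : Finset (Fin d)) : Measure (S → ℝ) :=
  (law f).map (proj S)

/-- The target `θ = E a(X)`. -/
def theta {d : ℕ} (f a : (Fin d → ℝ) → ℝ) : ℝ := ∫ x, a x ∂law f

/-- The normalised shift `r̄_S = r_S / E r_S(X_S)`. -/
def rbar {d : ℕ} {SS : Finset (Finset (Fin d))} (f : (Fin d → ℝ) → ℝ)
    (r : (S : SS) → (S.1 → ℝ) → ℝ) (S : SS) (x : S.1 → ℝ) : ℝ :=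
  r S x / ∫ y, r S (proj S.1 y) ∂law f

/-- The distribution of an incomplete observation on the variables in `S`: it has density `r̄_S`
with respect to the law of `X_S`, i.e. Lebesgue density `r̄_S f_S`. -/
def shiftedLaw {d : ℕ} {SS : Finset (Finset (Fin d))} (f : (Fin d → ℝ) → ℝ)
    (r : (S : SS) → (S.1 → ℝ) → ℝ) (S : SS) : Measure (S.1 → ℝ) :=
  (marginal f S.1).withDensity fun x => ENNReal.ofReal (rbar f r S x)

/-- The data: `n` complete observations and, for each `S ∈ SS`, `N S` observations of the
variables in `S`. -/
abbrev Data {d : ℕ} (SS : Finset (Finset (Fin d))) (n : ℕ) (N : SS → ℕ) : Type :=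
  (Fin n → Fin d → ℝ) × ((S : SS) → Fin (N S) → S.1 → ℝ)

/-- The joint distribution of the data: all observations are independent. -/
def dataLaw {d : ℕ} {SS : Finset (Finset (Fin d))} (f : (Fin d → ℝ) → ℝ)
    (r : (S : SS) → (S.1 → ℝ) → ℝ) (n : ℕ) (N : SS → ℕ) : Measure (Data SS n N) :=
  (Measure.pi fun _ : Fin n => law f).prod
    (Measure.pi fun S : SS => Measure.pi fun _ : Fin (N S) => shiftedLaw f r S)

/-! ### The limiting variance -/

/-- Families `(α_S : S ∈ SS)` of square-integrable mean-zero functions `α_S` of `x_S`. -/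
def HSpace {d : ℕ} (SS : Finset (Finset (Fin d))) (f : (Fin d → ℝ) → ℝ) :
    Set ((S : SS) → (S.1 → ℝ) → ℝ) :=
  {α | ∀ S, MemLp (α S) 2 (marginal f S.1) ∧ ∫ x, α S x ∂marginal f S.1 = 0}

/-- `𝓛(α) = Var(a(X) - ∑_S α_S(X_S)) + ∑_S E[α_S(X_S)² / (λ_S r̄_S(X_S))]`. -/
def objective {d : ℕ} {SS : Finset (Finset (Fin d))} (f a : (Fin d → ℝ) → ℝ)
    (r : (S : SS) → (S.1 → ℝ) → ℝ) (lam : SS → ℝ) (α : (S : SS) → (S.1 → ℝ) → ℝ) : ℝ :=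
  variance (fun x => a x - ∑ S : SS, α S (proj S.1 x)) (law f)
    + ∑ S : SS, ∫ x, α S x ^ 2 / (lam S * rbar f r S x) ∂marginal f S.1

/-! ### Smoothness assumptions -/

/-- `a` is `β`-Hölder with constant `L` at distances at most one. -/
def SmoothTarget {d : ℕ} (a : (Fin d → ℝ) → ℝ) (β L : ℝ) : Prop :=
  ∀ x x' : Fin d → ℝ, ‖x - x'‖ ≤ 1 → |a x - a x'| ≤ L * ‖x - x'‖ ^ β

/-- For each `S`, (a version of) the conditional distribution of `X_{Sᶜ}` given `X_S = x_S` is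
`β`-Hölder in `x_S`, in total variation. -/
def SmoothConditionals {d : ℕ} (SS : Finset (Finset (Fin d))) (f : (Fin d → ℝ) → ℝ)
    (β L : ℝ) : Prop :=
  ∀ S ∈ SS, ∃ Q : Kernel (S → ℝ) ((Sᶜ : Finset (Fin d)) → ℝ), IsMarkovKernel Q ∧
    (marginal f S).compProd Q = (law f).map (fun x => (proj S x, proj Sᶜ x)) ∧
    ∀ x x' : S → ℝ, ‖x - x'‖ ≤ 1 → tvDist (Q x) (Q x') ≤ L * ‖x - x'‖ ^ β

/-- Each `r̄_S` is `β`-Hölder with constant `L` at distances at most one. -/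
def SmoothShifts {d : ℕ} {SS : Finset (Finset (Fin d))} (f : (Fin d → ℝ) → ℝ)
    (r : (S : SS) → (S.1 → ℝ) → ℝ) (β L : ℝ) : Prop :=
  ∀ (S : SS) (x x' : S.1 → ℝ), ‖x - x'‖ ≤ 1 →
    |rbar f r S x - rbar f r S x'| ≤ L * ‖x - x'‖ ^ β

/-! ### Sample splitting -/

/-- Indices of the two halves of the complete data: `half n false` consists of the first `⌈n/2⌉`
observations and `half n true` of the others. -/
def half (n : ℕ) (l : Bool) : Finset (Fin n) :=
  Finset.univ.filter fun i => decide ((n + 1) / 2 ≤ (i : ℕ)) = l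

/-- The `m`-th piece (counted from `0`) of half `l`, when the `i`-th observation is assigned to
piece number `g i` of its half. -/
def piece {n M : ℕ} (g : Fin n → Fin M) (l : Bool) (m : ℕ) : Finset (Fin n) :=
  (half n l).filter fun i => (g i : ℕ) = m

/-- Each half is split into `M` pieces whose sizes differ by at most one. -/
def Balanced {n M : ℕ} (g : Fin n → Fin M) : Prop :=
  ∀ (l : Bool) (p q : Fin M), (piece g l p).card ≤ (piece g l q).card + 1

/-! ### The estimator

Division by zero gives zero, so the convention `0/0 = 0` is built in, also for empty pieces. -/

/-- The uniform kernel `K(z) = 2^{-d} 1{‖z‖_∞ ≤ 1}` on `ℝ^d`. -/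
def unifKernel (d : ℕ) (z : Fin d → ℝ) : ℝ :=
  (2 : ℝ)⁻¹ ^ d * (if ‖z‖ ≤ 1 then 1 else 0)

/-- `K_h^S(u) = h^{-|S|} K^S(u/h)`, where `K^S(u) = ∫ K(u, v) dv`. -/
def kernelS {d : ℕ} (S : Finset (Fin d)) (h : ℝ) (u : S → ℝ) : ℝ :=
  (h ^ S.card)⁻¹ * ∫ v : (Sᶜ : Finset (Fin d)) → ℝ, unifKernel d (glue S (h⁻¹ • u) v)

/-- The average of `r_S` over the observations with index in `I`. -/
def rhat {d n : ℕ} {SS : Finset (Finset (Fin d))} (r : (S : SS) → (S.1 → ℝ) → ℝ)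
    (X : Fin n → Fin d → ℝ) (I : Finset (Fin n)) (S : SS) : ℝ :=
  (∑ i ∈ I, r S (proj S.1 (X i))) / I.card

/-- The kernel density estimator of `f_S` from the observations with index in `I`. -/
def fhat {d n : ℕ} (X : Fin n → Fin d → ℝ) (I : Finset (Fin n)) (h : ℝ) (S : Finset (Fin d))
    (x : S → ℝ) : ℝ :=
  (∑ i ∈ I, kernelS S h (x - proj S (X i))) / I.card

/-- The estimated weight `λ_S r_S(x) / (r̂_S + λ_S r_S(x))`. -/
def what {d n : ℕ} {SS : Finset (Finset (Fin d))} (r : (S : SS) → (S.1 → ℝ) → ℝ) (lam : SS → ℝ)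
    (X : Fin n → Fin d → ℝ) (I : Finset (Fin n)) (S : SS) (x : S.1 → ℝ) : ℝ :=
  lam S * r S x / (rhat r X I S + lam S * r S x)

/-- The function `φ` truncated to the ball `B_T`. -/
def trunc {d : ℕ} (T : ℝ) (φ : (Fin d → ℝ) → ℝ) (x : Fin d → ℝ) : ℝ :=
  if ‖x‖ ≤ T then φ x else 0

/-- One step of the iterated regression: from an estimate `φ` on `ℝ^d`, and the
observations with index in `I`, to an estimate on `ℝ^S`. -/
def regStep {d n : ℕ} {SS : Finset (Finset (Fin d))} (r : (S : SS) → (S.1 → ℝ) → ℝ)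
    (lam : SS → ℝ) (X : Fin n → Fin d → ℝ) (h T : ℝ) (I : Finset (Fin n)) (S : SS)
    (φ : (Fin d → ℝ) → ℝ) (x : S.1 → ℝ) : ℝ :=
  if ‖x‖ ≤ T then
    what r lam X I S x *
      ((I.card : ℝ)⁻¹ * ∑ i ∈ I, trunc T φ (X i) *
          (kernelS S.1 h (x - proj S.1 (X i)) / fhat X I h S.1 x)
        - (∑ i ∈ I, what r lam X I S (proj S.1 (X i)) * trunc T φ (X i)) /
          (∑ i ∈ I, what r lam X I S (proj S.1 (X i))))
  else 0

/-- The iterated estimates `â_s^{(m)}` based on half `l`, for `s = (S_1, …, S_m)`, as functions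
on `ℝ^d` (depending on `x_{S_m}` only when `m ≥ 1`); `â^{(0)} = a`. -/
def ahat {d n M : ℕ} {SS : Finset (Finset (Fin d))} (a : (Fin d → ℝ) → ℝ)
    (r : (S : SS) → (S.1 → ℝ) → ℝ) (lam : SS → ℝ) (X : Fin n → Fin d → ℝ) (h T : ℝ)
    (g : Fin n → Fin M) (l : Bool) : (m : ℕ) → (Fin m → SS) → (Fin d → ℝ) → ℝ
  | 0, _ => a
  | m + 1, s => fun x =>
      regStep r lam X h T (piece g l m) (s (Fin.last m))
        (ahat a r lam X h T g l m (Fin.init s)) (proj (s (Fin.last m)).1 x)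

/-- `b_{M,η}(m) = P(Bin(M, η) ≥ m)`. -/
def binTail (M : ℕ) (η : ℝ) (m : ℕ) : ℝ :=
  ∑ k ∈ Finset.Icc m M, (M.choose k : ℝ) * η ^ k * (1 - η) ^ (M - k)

/-- Consecutive entries of the sequence `(s, S)` differ. -/
def Admissible {d m : ℕ} {SS : Finset (Finset (Fin d))} (s : Fin m → SS) (S : SS) : Prop :=
  (∀ i j : Fin m, (i : ℕ) + 1 = j → s i ≠ s j) ∧ ∀ i : Fin m, (i : ℕ) + 1 = m → s i ≠ S

open Classical in
/-- `α̂_{S,(l)}^{(M)}`, with `η = 1/|SS|`. The term of index `m` collects the sequences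
`(s, S)` of length `m + 1` that end in `S`. -/
def alphaHat {d n M : ℕ} {SS : Finset (Finset (Fin d))} (a : (Fin d → ℝ) → ℝ)
    (r : (S : SS) → (S.1 → ℝ) → ℝ) (lam : SS → ℝ) (X : Fin n → Fin d → ℝ) (h T : ℝ)
    (g : Fin n → Fin M) (l : Bool) (S : SS) (x : S.1 → ℝ) : ℝ :=
  if ‖x‖ ≤ T then
    ∑ m ∈ Finset.range M, (-1 : ℝ) ^ m *
      ∑ s ∈ Finset.univ.filter (fun s : Fin m → SS => Admissible s S),
        binTail M (SS.card : ℝ)⁻¹ (m + 1) *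
          regStep r lam X h T (piece g l m) S (ahat a r lam X h T g l m s) x
  else 0

/-- `θ̂_{(l)}^{(M)}`: the nuisance functions are fitted on half `l` and evaluated on the other. -/
def thetaHatHalf {d n M : ℕ} {SS : Finset (Finset (Fin d))} {N : SS → ℕ}
    (a : (Fin d → ℝ) → ℝ) (r : (S : SS) → (S.1 → ℝ) → ℝ) (lam : SS → ℝ) (h T : ℝ)
    (g : Fin n → Fin M) (Z : Data SS n N) (l : Bool) : ℝ :=
  ((half n (!l)).card : ℝ)⁻¹ * ∑ i ∈ half n (!l),
      (a (Z.1 i) - ∑ S : SS, alphaHat a r lam Z.1 h T g l S (proj S.1 (Z.1 i)))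
    + ∑ S : SS, (N S : ℝ)⁻¹ * ∑ j : Fin (N S),
      alphaHat a r lam Z.1 h T g l S (Z.2 S j) * rhat r Z.1 (half n (!l)) S / r S (Z.2 S j)

/-- The cross-fitted estimator `θ̂`. -/
def thetaHat {d n M : ℕ} {SS : Finset (Finset (Fin d))} {N : SS → ℕ}
    (a : (Fin d → ℝ) → ℝ) (r : (S : SS) → (S.1 → ℝ) → ℝ) (lam : SS → ℝ) (h T : ℝ)
    (g : Fin n → Fin M) (Z : Data SS n N) : ℝ :=
  (((half n true).card : ℝ) * thetaHatHalf a r lam h T g Z false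
    + ((half n false).card : ℝ) * thetaHatHalf a r lam h T g Z true) / n

/-- The mean squared error `E (θ̂ - θ)²`. -/
def risk {d n M : ℕ} {SS : Finset (Finset (Fin d))} (f a : (Fin d → ℝ) → ℝ)
    (r : (S : SS) → (S.1 → ℝ) → ℝ) (lam : SS → ℝ) (N : SS → ℕ) (h T : ℝ)
    (g : Fin n → Fin M) : ℝ :=
  ∫ Z : Data SS n N, (thetaHat a r lam h T g Z - theta f a) ^ 2 ∂dataLaw f r n N

/-! ### Constants of the bound -/

/-- `A = 28 (C/c + 2^d)`. -/
def constA (d : ℕ) (c C : ℝ) : ℝ := 28 * (C / c + 2 ^ d)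

/-- `B = 16 max(‖a‖_∞², 1) max{(C/c)², (L₁+L₂+L₃)², 8^d}`. -/
def constB {d : ℕ} (a : (Fin d → ℝ) → ℝ) (c C L₁ L₂ L₃ : ℝ) : ℝ :=
  16 * max (supNorm a ^ 2) 1 * max (max ((C / c) ^ 2) ((L₁ + L₂ + L₃) ^ 2)) (8 ^ d)

/-- `D = 200 |SS|² (C/c) (1 + 1/λ_min) B`. -/
def constD {d : ℕ} {SS : Finset (Finset (Fin d))} (a : (Fin d → ℝ) → ℝ) (lam : SS → ℝ)
    (c C L₁ L₂ L₃ : ℝ) : ℝ :=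
  200 * (SS.card : ℝ) ^ 2 * (C / c) * (1 + (⨅ S, lam S)⁻¹) * constB a c C L₁ L₂ L₃

/-- `κ = |SS| (1 + C λ_max)`. -/
def condNumber {d : ℕ} {SS : Finset (Finset (Fin d))} (lam : SS → ℝ) (C : ℝ) : ℝ :=
  (SS.card : ℝ) * (1 + C * ⨆ S, lam S)

/-- `M T^d / (n h^d) + h^{2β} + P(‖X‖_∞ ≥ T)`. -/
def errTerm {d : ℕ} (f : (Fin d → ℝ) → ℝ) (β : ℝ) (n M : ℕ) (T h : ℝ) : ℝ :=
  M * T ^ d / (n * h ^ d) + h ^ (2 * β) + (law f).real {x | T ≤ ‖x‖}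

end DataFusion

end

noncomputable section

open scoped ENNReal

set_option linter.unusedSectionVars false

namespace DataFusion

/-! ### Resampling coordinates of a product measure -/

section Product

variable {ι : Type*} [Fintype ι] [DecidableEq ι] {α : ι → Type*} [∀ i, MeasurableSpace (α i)]

/-! The objective `energy` is a convex quadratic in the family of functions. With all blocks but one
held fixed, its minimiser in block S is explicit: the conditional expectation given X_S, centred by
a weighted mean and multiplied by w = λr/(1+λr) (`popStep`). Updating all blocks simultaneously with
damping 1/|SS| is a damped Jacobi iteration. Started at zero and unrolled, it is an alternating sum
of iterated regressions along sequences of sets whose consecutive entries differ. The number of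
updates actually used among M damped steps is binomial, whence the weights `binTail`. The estimated
nuisance functions are therefore plug-in versions of the M-th Jacobi iterate `alphaPop`
(`alphaPop_succ`).

Optimisation. The diagonal blocks of the quadratic form are weighted by 1/w = 1 + 1/(λr). In the
corresponding norm `wnorm` the gradient is a multiple of the Jacobi update (`BddH.first_order`). The
form is at most |SS| times this norm, so a damped step decreases the energy
(`BddH.energy_jacobi_le`). The excess energy over any competitor is at most 1 + C λ_max times the
norm of the update (`BddH.energy_sub_le`). Together these contract the excess energy by 1 - 1/κ at
each step. The same estimates make the iterates Cauchy in L², and their limit is a minimiser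
(`exists_minimiser`).

Estimation. For the uniform kernel a regression step is a local average minus a weighted sample
mean. No lower bound on the density is needed. Exchangeability gives E[1/(N+1)] ≤ 1/(|I| μ(B)) for
the number N of points in a set B, and the integral of 1/μ(ball) over a region is at most the number
of small cubes that cover it. This bounds both the operator norm of local averaging in L² and its
variance; the smoothness assumptions bound the bias. One step thus turns an input error e into at
most 3(C/c + 2^d) e plus a small term (`lintegral_sq_regStep_sub_popStep_le`). Every step uses a
fresh piece of data, so the bound can be iterated. A weighted Cauchy–Schwarz inequality and the
generating function of binomial tails then sum over the exponentially many sequences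
(`lintegral_sq_alphaHat_sub_le`), which produces the factor A^M.

Risk. With the true functions `alphaPop` in place of the estimates one has an `oracle`, whose mean
squared error is computed exactly and is, after multiplication by n, the energy up to a relative
error 1/n. Thanks to cross-fitting, the difference between estimator and oracle is a sum of
conditionally centred terms and of products of two independent centred means
(`mul_thetaHat_sub_oracle`), so its mean square is of order 1/n times a small quantity. Expanding
the square costs a Cauchy–Schwarz cross term, which is where the square root in the bound comes
from. Finally, the energy of the iterate lies between the minimum and the minimum plus Var(a)
e^{-M/κ}. -/

theorem measurable_piecewise_prod (J : Finset ι) :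
    Measurable fun p : ((i : ι) → α i) × ((i : ι) → α i) => J.piecewise p.1 p.2 := by
  refine measurable_pi_lambda _ fun i => ?_
  by_cases hi : i ∈ J
  · simp only [Finset.piecewise, hi, if_true]; fun_prop
  · simp only [Finset.piecewise, hi, if_false]; fun_prop

/-- Replacing the coordinates in `J` by those of an independent copy does not change a product
distribution. -/
theorem measurePreserving_piecewise (μ : (i : ι) → Measure (α i)) [∀ i, IsProbabilityMeasure (μ i)]
    (J : Finset ι) :
    MeasurePreserving (fun p : ((i : ι) → α i) × ((i : ι) → α i) => J.piecewise p.1 p.2)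
      ((Measure.pi μ).prod (Measure.pi μ)) (Measure.pi μ) := by
  refine ⟨measurable_piecewise_prod J, ?_⟩
  refine (Measure.pi_eq fun s hs => ?_).symm
  rw [Measure.map_apply (measurable_piecewise_prod J) (MeasurableSet.univ_pi hs)]
  -- A box pulls back to a product of two boxes: each coordinate constraint falls on exactly one of
  -- the two copies.
  have : (fun p : ((i : ι) → α i) × ((i : ι) → α i) => J.piecewise p.1 p.2) ⁻¹'
      (Set.univ.pi s) = (Set.univ.pi fun i => if i ∈ J then s i else Set.univ) ×ˢ
        (Set.univ.pi fun i => if i ∈ J then Set.univ else s i) := by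
    ext p
    simp only [Set.mem_preimage, Set.mem_univ_pi, Set.mem_prod, ← forall_and]
    refine forall_congr' fun i => ?_
    by_cases hi : i ∈ J <;> simp [hi]
  rw [this, Measure.prod_prod, Measure.pi_pi, Measure.pi_pi, ← Finset.prod_mul_distrib]
  refine Finset.prod_congr rfl fun i _ => ?_
  by_cases hi : i ∈ J <;> simp [hi]

variable {μ : (i : ι) → Measure (α i)} [∀ i, IsProbabilityMeasure (μ i)]

theorem lintegral_pi_piecewise (J : Finset ι) {F : ((i : ι) → α i) → ℝ≥0∞} (hF : Measurable F) :
    ∫⁻ X, F X ∂Measure.pi μ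
      = ∫⁻ X, ∫⁻ Y, F (J.piecewise X Y) ∂Measure.pi μ ∂Measure.pi μ := by
  rw [← (measurePreserving_piecewise μ J).lintegral_comp hF, lintegral_prod]
  exact (hF.comp (measurable_piecewise_prod J)).aemeasurable

theorem integrable_of_bound {Ω : Type*} [MeasurableSpace Ω] {P : Measure Ω} [IsFiniteMeasure P]
    {F : Ω → ℝ} (hF : Measurable F) {B : ℝ} (hB : ∀ x, |F x| ≤ B) : Integrable F P :=
  Integrable.of_bound hF.aestronglyMeasurable B (Eventually.of_forall hB)

theorem memLp_of_bound {Ω : Type*} [MeasurableSpace Ω] {P : Measure Ω} [IsFiniteMeasure P]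
    {F : Ω → ℝ} (hF : Measurable F) {B : ℝ} (hB : ∀ x, |F x| ≤ B) (p : ℝ≥0∞) : MemLp F p P :=
  MemLp.of_bound hF.aestronglyMeasurable B (Eventually.of_forall hB)

theorem integral_pi_piecewise (J : Finset ι) {F : ((i : ι) → α i) → ℝ} (hF : Measurable F)
    {B : ℝ} (hB : ∀ X, |F X| ≤ B) :
    ∫ X, F X ∂Measure.pi μ
      = ∫ X, ∫ Y, F (J.piecewise X Y) ∂Measure.pi μ ∂Measure.pi μ := by
  have h := (measurePreserving_piecewise μ J)
  rw [← h.map_eq, integral_map h.measurable.aemeasurable hF.aestronglyMeasurable, h.map_eq,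
    integral_prod]
  exact integrable_of_bound (hF.comp (measurable_piecewise_prod J)) fun _ => hB _

theorem lintegral_pi_eval (i : ι) {F : α i → ℝ≥0∞} (hF : Measurable F) :
    ∫⁻ X, F (X i) ∂Measure.pi μ = ∫⁻ x, F x ∂μ i :=
  (measurePreserving_eval μ i).lintegral_comp hF

theorem integral_pi_eval (i : ι) {F : α i → ℝ} (hF : Measurable F) :
    ∫ X, F (X i) ∂Measure.pi μ = ∫ x, F x ∂μ i := by
  have h := measurePreserving_eval μ i
  rw [← h.map_eq, integral_map h.measurable.aemeasurable hF.aestronglyMeasurable]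

end Product

/-- A bounded function, as a nonnegative extended real integral. -/
theorem lintegral_ofReal_eq {Ω : Type*} [MeasurableSpace Ω] {P : Measure Ω} [IsFiniteMeasure P]
    {F : Ω → ℝ} (hF : Measurable F) (h0 : ∀ x, 0 ≤ F x) {B : ℝ} (hB : ∀ x, F x ≤ B) :
    ∫⁻ x, ENNReal.ofReal (F x) ∂P = ENNReal.ofReal (∫ x, F x ∂P) :=
  (ofReal_integral_eq_lintegral_ofReal
    (integrable_of_bound hF (B := B) fun x => by rw [abs_of_nonneg (h0 x)]; exact hB x)
    (Eventually.of_forall h0)).symm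

/-- The expected square of a sum of bounded orthogonal variables. -/
theorem integral_sq_sum_of_orthogonal {Ω ι : Type*} [MeasurableSpace Ω] {P : Measure Ω}
    [IsFiniteMeasure P] [DecidableEq ι] (I : Finset ι) {G : ι → Ω → ℝ} (hG : ∀ i ∈ I, MemLp (G i) 2 P)
    (horth : ∀ i ∈ I, ∀ j ∈ I, i ≠ j → ∫ x, G i x * G j x ∂P = 0) :
    ∫ x, (∑ i ∈ I, G i x) ^ 2 ∂P = ∑ i ∈ I, ∫ x, G i x ^ 2 ∂P := by
  have hint : ∀ i ∈ I, ∀ j ∈ I, Integrable (fun x => G i x * G j x) P := fun i hi j hj =>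
    (hG i hi).integrable_mul (hG j hj)
  have h1 : ∀ x, (∑ i ∈ I, G i x) ^ 2 = ∑ i ∈ I, ∑ j ∈ I, G i x * G j x := fun x => by
    rw [sq, Finset.sum_mul_sum]
  simp_rw [h1]
  rw [integral_finsetSum _ fun i hi => integrable_finsetSum _ fun j hj => hint i hi j hj]
  refine Finset.sum_congr rfl fun i hi => ?_
  rw [integral_finsetSum _ fun j hj => hint i hi j hj, Finset.sum_eq_single i]
  · simp [sq]
  · intro j hj hji
    exact horth i hi j hj hji.symm
  · exact fun h => absurd hi h

/-! ### Inverse moments of the number of sample points in a set -/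

section Counting

variable {ι E : Type*} [Fintype ι] [DecidableEq ι] [MeasurableSpace E]

open Classical in
/-- The number of sample points with index in `I` that lie in `B`. -/
def count (I : Finset ι) (B : Set E) (X : ι → E) : ℕ := (I.filter fun i => X i ∈ B).card

theorem measurable_count (I : Finset ι) {B : Set E} (hB : MeasurableSet B) :
    Measurable fun X : ι → E => count I B X := by
  classical
  have : (fun X : ι → E => count I B X)
      = fun X => ∑ i ∈ I, (Set.indicator ((fun X : ι → E => X i) ⁻¹' B) (fun _ => 1) X : ℕ) := by
    funext X
    rw [count, Finset.card_filter]
    simp only [Set.indicator_apply, Set.mem_preimage]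
  rw [this]
  exact Finset.measurable_fun_sum _ fun i _ =>
    measurable_const.indicator ((measurable_pi_apply i) hB)

theorem count_eq_erase_add {I : Finset ι} {i : ι} (hi : i ∈ I) {B : Set E} {X : ι → E}
    (hX : X i ∈ B) : count I B X = count (I.erase i) B X + 1 := by
  classical
  unfold count
  rw [← Finset.insert_erase hi, Finset.filter_insert, if_pos hX,
    Finset.card_insert_of_notMem (by simp)]
  simp

theorem count_congr {I : Finset ι} {B : Set E} {X Y : ι → E} (h : ∀ i ∈ I, X i = Y i) :
    count I B X = count I B Y := by
  classical
  unfold count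
  congr 1
  exact Finset.filter_congr fun i hi => by rw [h i hi]

theorem sum_indicator_div_count_le (I : Finset ι) (B : Set E) (X : ι → E) :
    ∑ i ∈ I, B.indicator 1 (X i) * (count I B X : ℝ≥0∞)⁻¹ ≤ 1 := by
  classical
  rw [← Finset.sum_mul]
  have : ∑ i ∈ I, B.indicator (1 : E → ℝ≥0∞) (X i) = (count I B X : ℝ≥0∞) := by
    rw [count, Finset.card_filter]
    simp only [Set.indicator_apply, Pi.one_apply, Nat.cast_sum, Nat.cast_ite, Nat.cast_one,
      Nat.cast_zero]
  rw [this]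
  exact ENNReal.mul_inv_le_one _

variable (μ : Measure E) [IsProbabilityMeasure μ]

/-- Exchangeability: the |I| ratios 1_B(X_i)/N add up to at most 1, and swapping two coordinates
shows that they all have the same expectation. -/
theorem lintegral_indicator_div_count_le {I : Finset ι} {B : Set E} (hB : MeasurableSet B) {i : ι}
    (hi : i ∈ I) :
    ∫⁻ X, B.indicator 1 (X i) * (count I B X : ℝ≥0∞)⁻¹ ∂Measure.pi (fun _ : ι => μ)
      ≤ (I.card : ℝ≥0∞)⁻¹ := by
  classical
  have hm : ∀ j : ι, Measurable fun X : ι → E =>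
      B.indicator (1 : E → ℝ≥0∞) (X j) * (count I B X : ℝ≥0∞)⁻¹ := fun j =>
    ((measurable_one.indicator hB).comp (measurable_pi_apply j)).mul
      ((measurable_from_nat (f := fun n : ℕ => (n : ℝ≥0∞))).comp (measurable_count I hB)).inv
  have hsymm : ∀ j ∈ I,
      ∫⁻ X, B.indicator 1 (X j) * (count I B X : ℝ≥0∞)⁻¹ ∂Measure.pi (fun _ : ι => μ)
      = ∫⁻ X, B.indicator 1 (X i) * (count I B X : ℝ≥0∞)⁻¹ ∂Measure.pi (fun _ : ι => μ) := by
    intro j hj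
    have hmp := measurePreserving_piCongrLeft (fun _ : ι => μ) (Equiv.swap i j)
    rw [← hmp.lintegral_comp (hm j)]
    refine lintegral_congr fun X => ?_
    have happ : ∀ k, (MeasurableEquiv.piCongrLeft (fun _ : ι => E) (Equiv.swap i j)) X k
        = X (Equiv.swap i j k) := by
      intro k
      have := MeasurableEquiv.piCongrLeft_apply_apply (Equiv.swap i j) (β := fun _ : ι => E) X
        (Equiv.swap i j k)
      simpa using this
    have hc : count I B ((MeasurableEquiv.piCongrLeft (fun _ : ι => E) (Equiv.swap i j)) X)
        = count I B X := by
      unfold count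
      refine Finset.card_bij (fun k _ => Equiv.swap i j k) ?_ ?_ ?_
      · intro k hk
        simp only [Finset.mem_filter, happ] at hk ⊢
        refine ⟨?_, hk.2⟩
        rcases Equiv.swap_apply_eq_iff.1 (rfl : Equiv.swap i j k = Equiv.swap i j k) with _
        by_cases h1 : k = i
        · simpa [h1] using hj
        · by_cases h2 : k = j
          · simpa [h2] using hi
          · rw [Equiv.swap_apply_of_ne_of_ne h1 h2]; exact hk.1
      · intro k _ k' _ h
        exact (Equiv.swap i j).injective h
      · intro k hk
        refine ⟨Equiv.swap i j k, ?_, by simp⟩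
        simp only [Finset.mem_filter, happ, Equiv.swap_apply_self] at hk ⊢
        refine ⟨?_, hk.2⟩
        by_cases h1 : k = i
        · simpa [h1] using hj
        · by_cases h2 : k = j
          · simpa [h2] using hi
          · rw [Equiv.swap_apply_of_ne_of_ne h1 h2]; exact hk.1
    rw [hc, happ, Equiv.swap_apply_right]
  have hsum : (I.card : ℝ≥0∞) *
      ∫⁻ X, B.indicator 1 (X i) * (count I B X : ℝ≥0∞)⁻¹ ∂Measure.pi (fun _ : ι => μ) ≤ 1 := by
    rw [← nsmul_eq_mul, ← Finset.sum_const, ← Finset.sum_congr rfl hsymm,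
      ← lintegral_finsetSum _ fun j _ => hm j]
    calc _ ≤ ∫⁻ _, 1 ∂Measure.pi (fun _ : ι => μ) :=
          lintegral_mono fun X => sum_indicator_div_count_le I B X
      _ = 1 := by simp
  have hI0 : (I.card : ℝ≥0∞) ≠ 0 := by
    simpa using Finset.ne_empty_of_mem hi
  rwa [ENNReal.le_inv_iff_mul_le, mul_comm]

/-- When X_i lies in B, the count is one plus the leave-one-out count, which is independent of X_i;
hence the expectation factorises. -/
theorem lintegral_mul_inv_count_eq {I : Finset ι} {B : Set E} (hB : MeasurableSet B) {i : ι}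
    (hi : i ∈ I) {g : E → ℝ≥0∞} (hg : Measurable g) :
    ∫⁻ X, B.indicator g (X i) * (count I B X : ℝ≥0∞)⁻¹ ∂Measure.pi (fun _ : ι => μ)
      = (∫⁻ x in B, g x ∂μ) *
        ∫⁻ X, ((count (I.erase i) B X : ℝ≥0∞) + 1)⁻¹ ∂Measure.pi (fun _ : ι => μ) := by
  classical
  have hcm : ∀ K : Finset ι, Measurable fun X : ι → E => (count K B X : ℝ≥0∞) := fun K =>
    (measurable_from_nat (f := fun n : ℕ => (n : ℝ≥0∞))).comp (measurable_count K hB)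
  have hpt : ∀ X : ι → E, B.indicator g (X i) * (count I B X : ℝ≥0∞)⁻¹
      = B.indicator g (X i) * ((count (I.erase i) B X : ℝ≥0∞) + 1)⁻¹ := by
    intro X
    by_cases hX : X i ∈ B
    · rw [count_eq_erase_add hi hX]; push_cast; rfl
    · simp [hX]
  simp_rw [hpt]
  have hgm : Measurable fun X : ι → E => B.indicator g (X i) :=
    (hg.indicator hB).comp (measurable_pi_apply i)
  have hpm : Measurable fun X : ι → E =>
      B.indicator g (X i) * ((count (I.erase i) B X : ℝ≥0∞) + 1)⁻¹ :=
    hgm.mul ((hcm _).add_const 1).inv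
  rw [lintegral_pi_piecewise {i} hpm]
  have h2 : ∀ X Y : ι → E, B.indicator g (({i} : Finset ι).piecewise X Y i) *
      ((count (I.erase i) B (({i} : Finset ι).piecewise X Y) : ℝ≥0∞) + 1)⁻¹
      = B.indicator g (X i) * ((count (I.erase i) B Y : ℝ≥0∞) + 1)⁻¹ := by
    intro X Y
    rw [Finset.piecewise_eq_of_mem _ _ _ (Finset.mem_singleton_self i)]
    rw [count_congr (Y := Y)]
    intro k hk
    exact Finset.piecewise_eq_of_notMem _ _ _ (by simpa using (Finset.mem_erase.1 hk).1)
  simp_rw [h2]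
  have hcm' : Measurable fun X : ι → E => ((count (I.erase i) B X : ℝ≥0∞) + 1)⁻¹ :=
    ((hcm (I.erase i)).add_const 1).inv
  simp_rw [lintegral_const_mul _ hcm']
  rw [lintegral_mul_const _ hgm, lintegral_pi_eval i (hg.indicator hB) (μ := fun _ => μ),
    lintegral_indicator hB]

/-- The factorisation with g = 1 converts the exchangeability bound into an inverse moment bound,
without any computation with binomial coefficients. -/
theorem mul_lintegral_inv_count_add_one_le {I : Finset ι} {B : Set E} (hB : MeasurableSet B) {i : ι}
    (hi : i ∈ I) :
    μ B * ∫⁻ X, ((count (I.erase i) B X : ℝ≥0∞) + 1)⁻¹ ∂Measure.pi (fun _ : ι => μ)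
      ≤ (I.card : ℝ≥0∞)⁻¹ := by
  have h := lintegral_mul_inv_count_eq μ hB hi (g := 1) measurable_one
  simp only [Pi.one_apply, lintegral_one, Measure.restrict_apply_univ] at h
  rw [← h]
  exact lintegral_indicator_div_count_le μ hB hi

theorem lintegral_inv_count_add_one_le {I : Finset ι} {B : Set E} (hB : MeasurableSet B) {i : ι}
    (hi : i ∈ I) :
    ∫⁻ X, ((count (I.erase i) B X : ℝ≥0∞) + 1)⁻¹ ∂Measure.pi (fun _ : ι => μ)
      ≤ (I.card : ℝ≥0∞)⁻¹ * (μ B)⁻¹ := by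
  rw [← div_eq_mul_inv]
  refine ENNReal.le_div_iff_mul_le (Or.inr (by simp)) (Or.inl (measure_ne_top _ _)) |>.2 ?_
  rw [mul_comm]
  exact mul_lintegral_inv_count_add_one_le μ hB hi

/-- Expected local averages are bounded by population local averages. -/
theorem lintegral_sum_mul_inv_count_le (I : Finset ι) {B : Set E} (hB : MeasurableSet B)
    {g : E → ℝ≥0∞} (hg : Measurable g) :
    ∫⁻ X, ∑ i ∈ I, B.indicator g (X i) * (count I B X : ℝ≥0∞)⁻¹ ∂Measure.pi (fun _ : ι => μ)
      ≤ (∫⁻ x in B, g x ∂μ) * (μ B)⁻¹ := by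
  classical
  rcases I.eq_empty_or_nonempty with rfl | hI
  · simp
  have hm : ∀ j : ι, Measurable fun X : ι → E =>
      B.indicator g (X j) * (count I B X : ℝ≥0∞)⁻¹ := fun j =>
    ((hg.indicator hB).comp (measurable_pi_apply j)).mul
      ((measurable_from_nat (f := fun n : ℕ => (n : ℝ≥0∞))).comp (measurable_count I hB)).inv
  rw [lintegral_finsetSum _ fun j _ => hm j]
  have : ∀ i ∈ I, ∫⁻ X, B.indicator g (X i) * (count I B X : ℝ≥0∞)⁻¹ ∂Measure.pi (fun _ : ι => μ)
      ≤ (∫⁻ x in B, g x ∂μ) * ((I.card : ℝ≥0∞)⁻¹ * (μ B)⁻¹) := fun i hi => by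
    rw [lintegral_mul_inv_count_eq μ hB hi hg]
    gcongr
    exact lintegral_inv_count_add_one_le μ hB hi
  refine (Finset.sum_le_sum this).trans ?_
  rw [Finset.sum_const, nsmul_eq_mul]
  have hI0 : (I.card : ℝ≥0∞) ≠ 0 := by simpa using hI.ne_empty
  calc (I.card : ℝ≥0∞) * ((∫⁻ x in B, g x ∂μ) * ((I.card : ℝ≥0∞)⁻¹ * (μ B)⁻¹))
      = ((I.card : ℝ≥0∞) * (I.card : ℝ≥0∞)⁻¹) * ((∫⁻ x in B, g x ∂μ) * (μ B)⁻¹) := by ring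
    _ ≤ 1 * ((∫⁻ x in B, g x ∂μ) * (μ B)⁻¹) := by gcongr; exact ENNReal.mul_inv_le_one _
    _ = _ := one_mul _

/-- The expectation of the inverse of the number of points in `B` on the event that there is one,
and the probability of the complementary event. -/
theorem lintegral_two_mul_inv_count_le {I : Finset ι} (hI : I.Nonempty) {B : Set E}
    (hB : MeasurableSet B) :
    ∫⁻ X, ((count I B X : ℝ≥0∞) + 1)⁻¹ ∂Measure.pi (fun _ : ι => μ)
      ≤ (I.card : ℝ≥0∞)⁻¹ * (μ B)⁻¹ := by
  classical
  -- Leaving out an index can only lower the count, so the leave-one-out bound dominates.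
  obtain ⟨i, hi⟩ := hI
  refine le_trans (lintegral_mono fun X => ?_) (lintegral_inv_count_add_one_le μ hB hi)
  refine ENNReal.inv_le_inv.2 ?_
  gcongr
  unfold count
  exact Finset.card_le_card (Finset.filter_subset_filter _ (Finset.erase_subset _ _))

end Counting

/-! ### Covering by cubes and the integral of 1/ν(ball) -/

section Covering

/-- The ball around a point of Q k contains all of Q k, so each covering set contributes at most ν(Q
k)/ν(Q k) ≤ 1. No regularity of ν is involved. -/
theorem setLIntegral_inv_measure_ball_le_card {F σ : Type*} [SeminormedAddCommGroup F]
    [MeasurableSpace F] (ν : Measure F) [Fintype σ] {h : ℝ} {A : Set F} {Q : σ → Set F}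
    (hQ : ∀ k, MeasurableSet (Q k)) (hdiam : ∀ k, ∀ x ∈ Q k, ∀ y ∈ Q k, ‖x - y‖ ≤ h)
    (hcov : A ⊆ ⋃ k, Q k) :
    ∫⁻ x in A, (ν {y | ‖x - y‖ ≤ h})⁻¹ ∂ν ≤ Fintype.card σ := by
  calc ∫⁻ x in A, (ν {y | ‖x - y‖ ≤ h})⁻¹ ∂ν
      ≤ ∫⁻ x in ⋃ k, Q k, (ν {y | ‖x - y‖ ≤ h})⁻¹ ∂ν := lintegral_mono_set hcov
    _ ≤ ∑' k, ∫⁻ x in Q k, (ν {y | ‖x - y‖ ≤ h})⁻¹ ∂ν := lintegral_iUnion_le _ _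
    _ = ∑ k, ∫⁻ x in Q k, (ν {y | ‖x - y‖ ≤ h})⁻¹ ∂ν := tsum_fintype _
    _ ≤ ∑ _k : σ, 1 := by
        refine Finset.sum_le_sum fun k _ => ?_
        calc ∫⁻ x in Q k, (ν {y | ‖x - y‖ ≤ h})⁻¹ ∂ν ≤ ∫⁻ _ in Q k, (ν (Q k))⁻¹ ∂ν := by
              refine setLIntegral_mono' (hQ k) fun x hx => ?_
              exact ENNReal.inv_le_inv.2 (measure_mono fun y hy => hdiam k x hx y hy)
          _ = (ν (Q k))⁻¹ * ν (Q k) := by simp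
          _ ≤ 1 := ENNReal.inv_mul_le_one _
    _ = Fintype.card σ := by simp

variable {κ : Type*} [Fintype κ]

/-- A sup-norm ball of radius `ρ` is covered by `m ^ |κ|` cubes of side `h` if `2 ρ ≤ m h`. -/
theorem setLIntegral_inv_measure_ball_le (ν : Measure (κ → ℝ)) {h ρ : ℝ} (hh : 0 < h) {m : ℕ}
    (hm : 1 ≤ m) (hρ : 2 * ρ ≤ m * h) (y : κ → ℝ) :
    ∫⁻ x in {x | ‖x - y‖ ≤ ρ}, (ν {z | ‖x - z‖ ≤ h})⁻¹ ∂ν ≤ (m : ℝ≥0∞) ^ Fintype.card κ := by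
  classical
  have hcard : (m : ℝ≥0∞) ^ Fintype.card κ = (Fintype.card (κ → Fin m) : ℝ≥0∞) := by simp
  rw [hcard]
  refine setLIntegral_inv_measure_ball_le_card ν
    (Q := fun k : κ → Fin m => Set.univ.pi fun j =>
      Set.Icc (y j - ρ + (k j : ℕ) * h) (y j - ρ + ((k j : ℕ) + 1) * h))
    (fun k => MeasurableSet.univ_pi fun j => measurableSet_Icc) ?_ ?_
  · intro k x hx z hz
    refine (pi_norm_le_iff_of_nonneg hh.le).2 fun j => ?_
    have h1 := hx j trivial
    have h2 := hz j trivial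
    simp only [Set.mem_Icc] at h1 h2
    rw [Pi.sub_apply, Real.norm_eq_abs, abs_le]
    constructor <;> linarith [h1.1, h1.2, h2.1, h2.2]
  · intro x hx
    simp only [Set.mem_ofPred_eq] at hx
    have hρ0 : 0 ≤ ρ := (norm_nonneg _).trans hx
    have hj : ∀ j, |x j - y j| ≤ ρ := fun j => (norm_le_pi_norm (x - y) j).trans hx
    have hk : ∀ j, ∃ k : Fin m, x j ∈
        Set.Icc (y j - ρ + (k : ℕ) * h) (y j - ρ + ((k : ℕ) + 1) * h) := by
      intro j
      have hb := abs_le.1 (hj j)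
      set t := (x j - (y j - ρ)) / h with ht
      have ht0 : 0 ≤ t := div_nonneg (by linarith) hh.le
      have htx : x j = y j - ρ + t * h := by rw [ht]; field_simp; ring
      have htm : t ≤ m := by
        rw [ht, div_le_iff₀ hh]; linarith
      -- The only value excluded by this case is t = m, the far face of the ball; the cubes are
      -- closed, so that face belongs to the last one.
      by_cases hc : ⌊t⌋₊ < m
      · refine ⟨⟨⌊t⌋₊, hc⟩, ?_⟩
        have h1 := Nat.floor_le ht0
        have h2 := (Nat.lt_floor_add_one t).le
        simp only [Set.mem_Icc]
        rw [htx]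
        constructor
        · gcongr
        · gcongr
      · have hmt : (m : ℝ) = t := le_antisymm
          ((Nat.cast_le.2 (not_lt.1 hc)).trans (Nat.floor_le ht0)) htm
        refine ⟨⟨m - 1, by omega⟩, ?_⟩
        simp only [Set.mem_Icc]
        have hcast : ((m - 1 : ℕ) : ℝ) = m - 1 := by push_cast [hm]; ring
        rw [htx, hcast, ← hmt]
        constructor
        · nlinarith
        · nlinarith
    choose k hk using hk
    exact Set.mem_iUnion.2 ⟨k, fun j _ => hk j⟩

end Covering

/-! ### Local averages and their boundedness on L² -/

section LocalAverage

variable {ι E κ : Type*} [Fintype ι] [DecidableEq ι] [MeasurableSpace E] [Fintype κ]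

/-- The indicator that `π y` is within distance `h` of `x`. -/
def ind (π : E → κ → ℝ) (h : ℝ) (x : κ → ℝ) (y : E) : ℝ := if ‖x - π y‖ ≤ h then 1 else 0

/-- The points whose image under `π` is within distance `h` of `x`. -/
def nbhd (π : E → κ → ℝ) (h : ℝ) (x : κ → ℝ) : Set E := {y | ‖x - π y‖ ≤ h}

/-- Local averages of `ψ` over the sample points with index in `I`. -/
def localAvg (π : E → κ → ℝ) (h : ℝ) (I : Finset ι) (X : ι → E) (ψ : E → ℝ) (x : κ → ℝ) : ℝ :=
  (∑ i ∈ I, ind π h x (X i) * ψ (X i)) / ∑ i ∈ I, ind π h x (X i)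

variable {π : E → κ → ℝ} {h : ℝ}

theorem ind_nonneg (x : κ → ℝ) (y : E) : 0 ≤ ind π h x y := by
  unfold ind; split_ifs <;> norm_num

theorem ind_le_one (x : κ → ℝ) (y : E) : ind π h x y ≤ 1 := by
  unfold ind; split_ifs <;> norm_num

theorem sum_ind_eq_count (I : Finset ι) (X : ι → E) (x : κ → ℝ) :
    ∑ i ∈ I, ind π h x (X i) = count I (nbhd π h x) X := by
  classical
  unfold ind
  rw [count, Finset.card_filter, Nat.cast_sum]
  refine Finset.sum_congr rfl fun i _ => ?_
  by_cases hc : ‖x - π (X i)‖ ≤ h <;> simp [nbhd, hc]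

theorem ind_mul_sum_ge {I : Finset ι} {i : ι} (hi : i ∈ I) (X : ι → E) (x : κ → ℝ) :
    ind π h x (X i) ≤ ∑ k ∈ I, ind π h x (X k) :=
  Finset.single_le_sum (f := fun k => ind π h x (X k)) (fun k _ => ind_nonneg x (X k)) hi

theorem measurableSet_nbhd (hπ : Measurable π) (x : κ → ℝ) : MeasurableSet (nbhd π h x) :=
  measurableSet_le (by fun_prop) measurable_const

theorem measurable_ind {Ω : Type*} [MeasurableSpace Ω] (hπ : Measurable π) {u : Ω → κ → ℝ}
    {v : Ω → E} (hu : Measurable u) (hv : Measurable v) : Measurable fun ω => ind π h (u ω) (v ω) := by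
  unfold ind
  exact Measurable.ite (measurableSet_le (by fun_prop) measurable_const) measurable_const
    measurable_const

theorem measurable_localAvg {Ω : Type*} [MeasurableSpace Ω] (hπ : Measurable π) (I : Finset ι)
    {U : Ω → ι → E} {u : Ω → κ → ℝ} (hU : Measurable U) (hu : Measurable u)
    {ψ : Ω → E → ℝ} (hψ : Measurable (Function.uncurry ψ)) :
    Measurable fun ω => localAvg π h I (U ω) (ψ ω) (u ω) := by
  unfold localAvg
  have hUi : ∀ i, Measurable fun ω => U ω i := fun i => (measurable_pi_apply i).comp hU
  have hψi : ∀ i, Measurable fun ω => ψ ω (U ω i) := fun i =>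
    hψ.comp (measurable_id.prodMk (hUi i))
  exact (Finset.measurable_fun_sum _ fun i _ => (measurable_ind hπ hu (hUi i)).mul (hψi i)).div
    (Finset.measurable_fun_sum _ fun i _ => measurable_ind hπ hu (hUi i))

theorem localAvg_sub (I : Finset ι) (X : ι → E) (ψ χ : E → ℝ) (x : κ → ℝ) :
    localAvg π h I X (fun y => ψ y - χ y) x = localAvg π h I X ψ x - localAvg π h I X χ x := by
  unfold localAvg
  rw [← sub_div, ← Finset.sum_sub_distrib]
  simp_rw [mul_sub]

/-- Jensen's inequality for the local weights, in the form of Cauchy–Schwarz; with no point in the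
neighbourhood both sides are 0. -/
theorem sq_localAvg_le (I : Finset ι) (X : ι → E) (ψ : E → ℝ) (x : κ → ℝ) :
    localAvg π h I X ψ x ^ 2 ≤ localAvg π h I X (fun y => ψ y ^ 2) x := by
  unfold localAvg
  have h0 : 0 ≤ ∑ i ∈ I, ind π h x (X i) := Finset.sum_nonneg fun i _ => ind_nonneg _ _
  rcases h0.eq_or_lt with h0 | h0
  · simp [← h0]
  · have hcs := Finset.sum_sq_le_sum_mul_sum_of_sq_le_mul I
      (r := fun i => ind π h x (X i) * ψ (X i)) (f := fun i => ind π h x (X i))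
      (g := fun i => ind π h x (X i) * ψ (X i) ^ 2) (fun i _ => ind_nonneg _ _)
      (fun i _ => mul_nonneg (ind_nonneg _ _) (sq_nonneg _)) (fun i _ => le_of_eq (by ring))
    rw [div_pow, div_le_div_iff₀ (by positivity) h0]
    nlinarith [hcs, mul_le_mul_of_nonneg_right hcs h0.le]

theorem abs_localAvg_le {I : Finset ι} {X : ι → E} {ψ : E → ℝ} {x : κ → ℝ} {b : ℝ} (hb : 0 ≤ b)
    (hψ : ∀ i ∈ I, ‖x - π (X i)‖ ≤ h → |ψ (X i)| ≤ b) : |localAvg π h I X ψ x| ≤ b := by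
  unfold localAvg
  have h0 : 0 ≤ ∑ i ∈ I, ind π h x (X i) := Finset.sum_nonneg fun i _ => ind_nonneg _ _
  rw [abs_div, abs_of_nonneg h0]
  refine div_le_of_le_mul₀ h0 hb ?_
  refine (Finset.abs_sum_le_sum_abs _ _).trans ?_
  rw [Finset.mul_sum]
  refine Finset.sum_le_sum fun i hi => ?_
  unfold ind
  split_ifs with hc
  · simpa using hψ i hi hc
  · simp

/-- Brings local averages into the form covered by the counting lemmas. The conventions agree when
the count is zero: the numerator vanishes, so an infinite inverse is harmless. -/
theorem ofReal_localAvg (I : Finset ι) (X : ι → E) {ψ : E → ℝ} (hψ : ∀ y, 0 ≤ ψ y) (x : κ → ℝ) :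
    ENNReal.ofReal (localAvg π h I X ψ x)
      = ∑ i ∈ I, (nbhd π h x).indicator (fun y => ENNReal.ofReal (ψ y)) (X i) *
          (count I (nbhd π h x) X : ℝ≥0∞)⁻¹ := by
  unfold localAvg
  rw [sum_ind_eq_count, ← Finset.sum_mul]
  have hsum : ENNReal.ofReal (∑ i ∈ I, ind π h x (X i) * ψ (X i))
      = ∑ i ∈ I, (nbhd π h x).indicator (fun y => ENNReal.ofReal (ψ y)) (X i) := by
    rw [ENNReal.ofReal_sum_of_nonneg fun i _ => mul_nonneg (ind_nonneg _ _) (hψ _)]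
    refine Finset.sum_congr rfl fun i _ => ?_
    unfold ind nbhd
    by_cases hc : ‖x - π (X i)‖ ≤ h <;> simp [hc]
  rcases Nat.eq_zero_or_pos (count I (nbhd π h x) X) with hN | hN
  · have : ∀ i ∈ I, ind π h x (X i) = 0 := fun i hi => by
      refine le_antisymm ?_ (ind_nonneg _ _)
      refine (ind_mul_sum_ge hi X x).trans ?_
      rw [sum_ind_eq_count, hN]; simp
    rw [← hsum, Finset.sum_eq_zero fun i hi => by rw [this i hi, zero_mul]]
    simp
  · rw [ENNReal.ofReal_div_of_pos (by exact_mod_cast hN), hsum, div_eq_mul_inv]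
    simp

variable (μ : Measure E) [IsProbabilityMeasure μ]

theorem measure_nbhd (hπ : Measurable π) (x : κ → ℝ) :
    μ (nbhd π h x) = μ.map π {z | ‖x - z‖ ≤ h} := by
  rw [Measure.map_apply hπ (measurableSet_le (by fun_prop) measurable_const)]
  rfl

theorem measurable_measure_ball (ν : Measure (κ → ℝ)) [SFinite ν] :
    Measurable fun x : κ → ℝ => ν {z | ‖x - z‖ ≤ h} := by
  have hs : MeasurableSet {p : (κ → ℝ) × (κ → ℝ) | ‖p.1 - p.2‖ ≤ h} :=
    measurableSet_le (by fun_prop) measurable_const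
  exact measurable_measure_prodMk_left hs

theorem measurable_inv_measure_ball (ν : Measure (κ → ℝ)) [SFinite ν] :
    Measurable fun x : κ → ℝ => (ν {z | ‖x - z‖ ≤ h})⁻¹ :=
  (measurable_measure_ball ν).inv

/-- Local averaging is bounded on `L²`, on average over the sample. -/
theorem lintegral_sq_localAvg_le (hπ : Measurable π) (hh : 0 < h) (I : Finset ι) {ψ : E → ℝ}
    (hψ : Measurable ψ) :
    ∫⁻ X, ∫⁻ x, ENNReal.ofReal (localAvg π h I X ψ x ^ 2) ∂μ.map π ∂Measure.pi (fun _ : ι => μ)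
      ≤ 2 ^ Fintype.card κ * ∫⁻ y, ENNReal.ofReal (ψ y ^ 2) ∂μ := by
  have : IsProbabilityMeasure (μ.map π) := Measure.isProbabilityMeasure_map hπ.aemeasurable
  set g : E → ℝ≥0∞ := fun y => ENNReal.ofReal (ψ y ^ 2) with hg
  have hgm : Measurable g := by fun_prop
  have hmeas : Measurable (Function.uncurry fun (X : ι → E) (x : κ → ℝ) =>
      ENNReal.ofReal (localAvg π h I X ψ x ^ 2)) := by
    refine ENNReal.measurable_ofReal.comp (Measurable.pow_const ?_ 2)
    exact measurable_localAvg hπ I measurable_fst measurable_snd (ψ := fun _ => ψ)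
      (hψ.comp measurable_snd)
  rw [lintegral_lintegral_swap hmeas.aemeasurable]
  calc ∫⁻ x, ∫⁻ X, ENNReal.ofReal (localAvg π h I X ψ x ^ 2) ∂Measure.pi (fun _ : ι => μ) ∂μ.map π
      ≤ ∫⁻ x, (∫⁻ y in nbhd π h x, g y ∂μ) * (μ.map π {z | ‖x - z‖ ≤ h})⁻¹ ∂μ.map π := by
        -- Jensen, then the comparison of expected local averages with population averages over the
        -- same ball.
        refine lintegral_mono fun x => ?_
        rw [← measure_nbhd μ hπ]
        refine le_trans (lintegral_mono fun X => ?_)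
          (lintegral_sum_mul_inv_count_le μ I (measurableSet_nbhd hπ x) hgm)
        rw [← ofReal_localAvg I X (fun y => sq_nonneg (ψ y)) x]
        exact ENNReal.ofReal_le_ofReal (sq_localAvg_le I X ψ x)
    _ = ∫⁻ x, ∫⁻ y, {p : (κ → ℝ) × E | ‖p.1 - π p.2‖ ≤ h}.indicator (fun p =>
          g p.2 * (μ.map π {z | ‖p.1 - z‖ ≤ h})⁻¹) (x, y) ∂μ ∂μ.map π := by
        refine lintegral_congr fun x => ?_
        rw [← lintegral_mul_const _ hgm, ← lintegral_indicator (measurableSet_nbhd hπ x)]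
        refine lintegral_congr fun y => ?_
        simp only [Set.indicator_apply, nbhd, Set.mem_ofPred_eq]
    _ = ∫⁻ y, ∫⁻ x, {p : (κ → ℝ) × E | ‖p.1 - π p.2‖ ≤ h}.indicator (fun p =>
          g p.2 * (μ.map π {z | ‖p.1 - z‖ ≤ h})⁻¹) (x, y) ∂μ.map π ∂μ := by
        refine lintegral_lintegral_swap (Measurable.aemeasurable ?_)
        refine Measurable.indicator ?_ (measurableSet_le (by fun_prop) measurable_const)
        exact (hgm.comp measurable_snd).mul
          ((measurable_measure_ball (μ.map π)).comp measurable_fst).inv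
    -- After the swap, the inner integral is that of 1/ν(ball of radius h at x) over the x within h
    -- of π y; this region is covered by two cubes of side h per coordinate direction.
    _ ≤ ∫⁻ y, g y * 2 ^ Fintype.card κ ∂μ := by
        refine lintegral_mono fun y => ?_
        have hs : MeasurableSet {x : κ → ℝ | ‖x - π y‖ ≤ h} :=
          measurableSet_le (by fun_prop) measurable_const
        have e : ∀ x, {p : (κ → ℝ) × E | ‖p.1 - π p.2‖ ≤ h}.indicator (fun p =>
            g p.2 * (μ.map π {z | ‖p.1 - z‖ ≤ h})⁻¹) (x, y)
            = g y * {x : κ → ℝ | ‖x - π y‖ ≤ h}.indicator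
                (fun x => (μ.map π {z | ‖x - z‖ ≤ h})⁻¹) x := by
          intro x
          simp only [Set.indicator_apply, Set.mem_ofPred_eq]
          split_ifs <;> simp
        simp_rw [e]
        rw [lintegral_const_mul _ ((measurable_inv_measure_ball (μ.map π)).indicator hs),
          lintegral_indicator hs]
        gcongr
        exact_mod_cast setLIntegral_inv_measure_ball_le (μ.map π) hh (m := 2) (by norm_num)
          (ρ := h) (by norm_num) (π y)
    _ = 2 ^ Fintype.card κ * ∫⁻ y, g y ∂μ := by
        rw [lintegral_mul_const _ hgm, mul_comm]

end LocalAverage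

/-! ### Mean squared error of local averaging -/

section LocalAverage

variable {ι E κ : Type*} [Fintype ι] [DecidableEq ι] [MeasurableSpace E] [Fintype κ]
variable {π : E → κ → ℝ} {h : ℝ} (μ : Measure E) [IsProbabilityMeasure μ]

/-- `ε` has conditional mean zero given `π`. -/
def CondMeanZero (μ : Measure E) (π : E → κ → ℝ) (ε : E → ℝ) : Prop :=
  ∀ F : (κ → ℝ) → ℝ, Measurable F → (∃ B, ∀ u, |F u| ≤ B) → ∫ y, F (π y) * ε y ∂μ = 0

theorem count_cast_cases (I : Finset ι) (X : ι → E) (x : κ → ℝ) :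
    ∑ i ∈ I, ind π h x (X i) = 0 ∨ 1 ≤ ∑ i ∈ I, ind π h x (X i) := by
  rw [sum_ind_eq_count]
  rcases Nat.eq_zero_or_pos (count I (nbhd π h x) X) with hN | hN
  · left; simp [hN]
  · right; exact_mod_cast hN

/-- The cross terms vanish although the summands share a random denominator. With all coordinates
but i frozen, the product of the terms i and j is ε(X_i) times a bounded function of π(X_i), because
X_i enters the denominator only through π. -/
theorem integral_sq_localAvg_of_condMeanZero (hπ : Measurable π) (I : Finset ι) {ε : E → ℝ}
    (hε : Measurable ε) {B : ℝ} (hB : ∀ y, |ε y| ≤ B) (hmz : CondMeanZero μ π ε) (x : κ → ℝ) :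
    ∫ X, localAvg π h I X ε x ^ 2 ∂Measure.pi (fun _ : ι => μ)
      = ∑ i ∈ I, ∫ X, (ind π h x (X i) * ε (X i) / ∑ k ∈ I, ind π h x (X k)) ^ 2
          ∂Measure.pi (fun _ : ι => μ) := by
  set G : ι → (ι → E) → ℝ := fun i X => ind π h x (X i) * ε (X i) / ∑ k ∈ I, ind π h x (X k)
  have hB0 : 0 ≤ B := by
    obtain ⟨y⟩ : Nonempty E := by
      by_contra hne
      rw [not_nonempty_iff] at hne
      exact IsProbabilityMeasure.ne_zero μ (Measure.eq_zero_of_isEmpty μ)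
    exact (abs_nonneg _).trans (hB y)
  have hind : ∀ i, Measurable fun X : ι → E => ind π h x (X i) := fun i =>
    measurable_ind hπ measurable_const (measurable_pi_apply i)
  have hGm : ∀ i, Measurable (G i) := fun i =>
    ((hind i).mul (hε.comp (measurable_pi_apply i))).div
      (Finset.measurable_fun_sum _ fun k _ => hind k)
  have hfrac : ∀ i ∈ I, ∀ X : ι → E,
      |ind π h x (X i) / ∑ k ∈ I, ind π h x (X k)| ≤ 1 := fun i hi X => by
    have h0 : 0 ≤ ∑ k ∈ I, ind π h x (X k) := Finset.sum_nonneg fun k _ => ind_nonneg _ _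
    rw [abs_of_nonneg (div_nonneg (ind_nonneg _ _) h0)]
    exact div_le_one_of_le₀ (ind_mul_sum_ge hi X x) h0
  have hGB : ∀ i ∈ I, ∀ X, |G i X| ≤ B := fun i hi X => by
    have : G i X = (ind π h x (X i) / ∑ k ∈ I, ind π h x (X k)) * ε (X i) := by
      simp only [G]; ring
    rw [this, abs_mul]
    calc _ ≤ 1 * B := mul_le_mul (hfrac i hi X) (hB _) (abs_nonneg _) zero_le_one
      _ = B := one_mul B
  have hsum : ∀ X : ι → E, localAvg π h I X ε x = ∑ i ∈ I, G i X := fun X => by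
    simp only [localAvg, G, Finset.sum_div]
  simp_rw [hsum]
  refine integral_sq_sum_of_orthogonal I (fun i hi => memLp_of_bound (hGm i) (hGB i hi) 2) ?_
  intro i hi j hj hij
  have hGij : Measurable fun X => G i X * G j X := (hGm i).mul (hGm j)
  rw [integral_pi_piecewise ({i}ᶜ : Finset ι) hGij (B := B * B)
    (fun X => by
      rw [abs_mul]
      exact mul_le_mul (hGB i hi X) (hGB j hj X) (abs_nonneg _) hB0)]
  refine integral_eq_zero_of_ae (Eventually.of_forall fun X => ?_)
  simp only [Pi.zero_apply]
  -- the only randomness left is in the coordinate `i`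
  set N : (κ → ℝ) → ℝ := fun u => ∑ k ∈ I, if k = i then (if ‖x - u‖ ≤ h then 1 else 0)
    else ind π h x (X k) with hN
  set F : (κ → ℝ) → ℝ := fun u =>
    (if ‖x - u‖ ≤ h then 1 else 0) / N u * (ind π h x (X j) * ε (X j) / N u) with hF
  have hNm : Measurable N := by
    refine Finset.measurable_fun_sum _ fun k _ => ?_
    split_ifs
    · exact Measurable.ite (measurableSet_le (by fun_prop) measurable_const) measurable_const
        measurable_const
    · exact measurable_const
  have hFm : Measurable F := by
    refine Measurable.mul (Measurable.div ?_ hNm) (measurable_const.div hNm)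
    exact Measurable.ite (measurableSet_le (by fun_prop) measurable_const) measurable_const
      measurable_const
  have hpw : ∀ (Y : ι → E) k, ({i}ᶜ : Finset ι).piecewise X Y k = if k = i then Y i else X k := by
    intro Y k
    by_cases hk : k = i
    · subst hk; simp
    · rw [if_neg hk, Finset.piecewise_eq_of_mem _ _ _ (by simpa using hk)]
  have hNY : ∀ Y : ι → E,
      ∑ k ∈ I, ind π h x (({i}ᶜ : Finset ι).piecewise X Y k) = N (π (Y i)) := by
    intro Y
    refine Finset.sum_congr rfl fun k _ => ?_
    rw [hpw]
    split_ifs <;> simp_all [ind]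
  have hval : ∀ Y : ι → E, G i (({i}ᶜ : Finset ι).piecewise X Y) *
      G j (({i}ᶜ : Finset ι).piecewise X Y) = F (π (Y i)) * ε (Y i) := by
    intro Y
    simp only [G, hNY, hF]
    rw [hpw Y i, hpw Y j, if_pos rfl, if_neg (Ne.symm hij)]
    simp only [ind]
    ring
  have hFb : ∀ u, |F u| ≤ B := by
    intro u
    by_cases hu : ‖x - u‖ ≤ h
    · have hge : ∀ t : ℝ, 0 ≤ t → (∀ k ∈ I, 0 ≤ (if k = i then (1 : ℝ) else ind π h x (X k))) := by
        intro _ _ k _; split_ifs; · norm_num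
        · exact ind_nonneg _ _
      -- The point with index i is itself counted, so the denominator is at least 1 wherever the
      -- indicator in `F` is nonzero.
      have hN1 : 1 ≤ N u := by
        simp only [hN, hu, if_true]
        calc (1 : ℝ) = if i = i then (1 : ℝ) else ind π h x (X i) := by simp
          _ ≤ _ := Finset.single_le_sum (f := fun k => if k = i then (1 : ℝ) else ind π h x (X k))
              (hge 0 le_rfl) hi
      simp only [hF, hu, if_true]
      have h1 : |1 / N u| ≤ 1 := by
        rw [abs_of_nonneg (by positivity)]; exact div_le_one_of_le₀ hN1 (by linarith)
      have h2 : |ind π h x (X j) * ε (X j) / N u| ≤ B := by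
        rw [abs_div, abs_mul, abs_of_nonneg (ind_nonneg _ _), abs_of_nonneg (by linarith : 0 ≤ N u)]
        refine div_le_of_le_mul₀ (by linarith) hB0 ?_
        have := mul_le_mul (ind_le_one (π := π) (h := h) x (X j)) (hB (X j)) (abs_nonneg _)
          zero_le_one
        nlinarith
      rw [abs_mul]
      calc _ ≤ 1 * B := mul_le_mul h1 h2 (abs_nonneg _) zero_le_one
        _ = B := one_mul B
    · simp [hF, hu, hB0]
  simp_rw [hval]
  rw [integral_pi_eval (μ := fun _ : ι => μ) i (F := fun y => F (π y) * ε y)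
    ((hFm.comp hπ).mul hε)]
  exact hmz F hFm ⟨B, hFb⟩

/-- By orthogonality the variance is the expected sum of the squared terms. That sum is at most B²/N
≤ 2B²/(N+1) if N ≥ 1 and is 0 if N = 0, so the inverse moment bound applies. -/
theorem lintegral_sq_localAvg_of_condMeanZero_le (hπ : Measurable π) {I : Finset ι}
    (hI : I.Nonempty) {ε : E → ℝ}
    (hε : Measurable ε) {B : ℝ} (hB : ∀ y, |ε y| ≤ B) (hmz : CondMeanZero μ π ε) (x : κ → ℝ) :
    ∫⁻ X, ENNReal.ofReal (localAvg π h I X ε x ^ 2) ∂Measure.pi (fun _ : ι => μ)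
      ≤ ENNReal.ofReal (2 * B ^ 2) * ((I.card : ℝ≥0∞)⁻¹ * (μ.map π {z | ‖x - z‖ ≤ h})⁻¹) := by
  have hind : ∀ i, Measurable fun X : ι → E => ind π h x (X i) := fun i =>
    measurable_ind hπ measurable_const (measurable_pi_apply i)
  have hNm : Measurable fun X : ι → E => ∑ k ∈ I, ind π h x (X k) :=
    Finset.measurable_fun_sum _ fun k _ => hind k
  have hcm : Measurable fun X : ι → E => ((count I (nbhd π h x) X : ℝ≥0∞) + 1)⁻¹ :=
    (((measurable_from_nat (f := fun n : ℕ => (n : ℝ≥0∞))).comp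
      (measurable_count I (measurableSet_nbhd hπ x))).add_const 1).inv
  have hGm : ∀ i, Measurable fun X : ι → E =>
      (ind π h x (X i) * ε (X i) / ∑ k ∈ I, ind π h x (X k)) ^ 2 := fun i =>
    (((hind i).mul (hε.comp (measurable_pi_apply i))).div hNm).pow_const 2
  have hpt : ∀ X : ι → E, ∑ i ∈ I, (ind π h x (X i) * ε (X i) / ∑ k ∈ I, ind π h x (X k)) ^ 2
      ≤ 2 * B ^ 2 * ((∑ k ∈ I, ind π h x (X k)) + 1)⁻¹ := by
    intro X
    set N := ∑ k ∈ I, ind π h x (X k) with hN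
    rcases count_cast_cases (π := π) (h := h) I X x with h0 | h1
    · rw [← hN] at h0
      simp only [h0, div_zero]
      simp; positivity
    · rw [← hN] at h1
      calc ∑ i ∈ I, (ind π h x (X i) * ε (X i) / N) ^ 2
          ≤ ∑ i ∈ I, ind π h x (X i) * (B ^ 2 / N ^ 2) := by
            refine Finset.sum_le_sum fun i _ => ?_
            rw [div_pow, mul_pow, mul_div_assoc]
            have h2 : ε (X i) ^ 2 ≤ B ^ 2 := sq_le_sq.2 ((hB _).trans (le_abs_self B))
            have h3 : ind π h x (X i) ^ 2 = ind π h x (X i) := by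
              unfold ind; split_ifs <;> norm_num
            rw [h3]
            have := ind_nonneg (π := π) (h := h) x (X i)
            gcongr
        _ = B ^ 2 / N := by
            rw [← Finset.sum_mul, ← hN]; field_simp
        _ ≤ 2 * B ^ 2 * (N + 1)⁻¹ := by
            rw [← div_eq_mul_inv, div_le_div_iff₀ (by linarith) (by linarith)]
            nlinarith [sq_nonneg B]
  have hbd : ∀ X : ι → E, ∑ i ∈ I, (ind π h x (X i) * ε (X i) / ∑ k ∈ I, ind π h x (X k)) ^ 2
      ≤ 2 * B ^ 2 := fun X => by
    refine (hpt X).trans (mul_le_of_le_one_right (by positivity) (inv_le_one_of_one_le₀ ?_))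
    have : 0 ≤ ∑ k ∈ I, ind π h x (X k) := Finset.sum_nonneg fun k _ => ind_nonneg _ _
    linarith
  calc ∫⁻ X, ENNReal.ofReal (localAvg π h I X ε x ^ 2) ∂Measure.pi (fun _ : ι => μ)
      = ENNReal.ofReal (∫ X, localAvg π h I X ε x ^ 2 ∂Measure.pi (fun _ : ι => μ)) := by
        refine lintegral_ofReal_eq ?_ (fun _ => sq_nonneg _) (B := |B| ^ 2) fun X => ?_
        · exact (measurable_localAvg hπ I measurable_id measurable_const (ψ := fun _ => ε)
            (hε.comp measurable_snd)).pow_const 2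
        · rw [sq_abs]
          exact sq_le_sq.2 ((abs_localAvg_le (abs_nonneg B) fun i _ _ =>
            (hB _).trans (le_abs_self B)))
    _ = ENNReal.ofReal (∫ X, ∑ i ∈ I, (ind π h x (X i) * ε (X i) / ∑ k ∈ I, ind π h x (X k)) ^ 2
          ∂Measure.pi (fun _ : ι => μ)) := by
        rw [integral_sq_localAvg_of_condMeanZero μ hπ I hε hB hmz, integral_finsetSum]
        intro i hi
        refine integrable_of_bound (hGm i) (B := 2 * B ^ 2) fun X => ?_
        rw [abs_of_nonneg (sq_nonneg _)]
        refine (Finset.single_le_sum (f := fun i => (ind π h x (X i) * ε (X i) /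
          ∑ k ∈ I, ind π h x (X k)) ^ 2) (fun _ _ => sq_nonneg _) hi).trans (hbd X)
    _ = ∫⁻ X, ENNReal.ofReal (∑ i ∈ I, (ind π h x (X i) * ε (X i) /
          ∑ k ∈ I, ind π h x (X k)) ^ 2) ∂Measure.pi (fun _ : ι => μ) :=
        (lintegral_ofReal_eq (Finset.measurable_fun_sum _ fun i _ => hGm i)
          (fun X => Finset.sum_nonneg fun _ _ => sq_nonneg _) hbd).symm
    _ ≤ ∫⁻ X, ENNReal.ofReal (2 * B ^ 2) * ((count I (nbhd π h x) X : ℝ≥0∞) + 1)⁻¹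
          ∂Measure.pi (fun _ : ι => μ) := by
        refine lintegral_mono fun X => ?_
        refine (ENNReal.ofReal_le_ofReal (hpt X)).trans ?_
        rw [ENNReal.ofReal_mul (by positivity), sum_ind_eq_count,
          ENNReal.ofReal_inv_of_pos (by positivity), ENNReal.ofReal_add (by positivity) zero_le_one]
        simp
    _ ≤ _ := by
        rw [lintegral_const_mul _ hcm, ← measure_nbhd μ hπ]
        gcongr
        exact lintegral_two_mul_inv_count_le μ hI (measurableSet_nbhd hπ x)

/-- The indicator of N = 0 is at most 1/(N+1), so empty neighbourhoods cost no more than the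
variance. -/
theorem lintegral_count_eq_zero_le (hπ : Measurable π) {I : Finset ι} (hI : I.Nonempty)
    (x : κ → ℝ) :
    ∫⁻ X, (if ∑ i ∈ I, ind π h x (X i) = 0 then 1 else 0) ∂Measure.pi (fun _ : ι => μ)
      ≤ (I.card : ℝ≥0∞)⁻¹ * (μ.map π {z | ‖x - z‖ ≤ h})⁻¹ := by
  rw [← measure_nbhd μ hπ]
  refine le_trans (lintegral_mono fun X => ?_)
    (lintegral_two_mul_inv_count_le μ hI (measurableSet_nbhd hπ x))
  rw [sum_ind_eq_count]
  split_ifs with h0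
  · have : count I (nbhd π h x) X = 0 := by exact_mod_cast h0
    simp [this]
  · exact zero_le

/-- The mean squared error of local averaging as an estimator of the conditional mean `m`. -/
theorem lintegral_sq_localAvg_sub_le (hπ : Measurable π) (hh : 0 < h) {I : Finset ι}
    (hI : I.Nonempty) {φ ψ : E → ℝ} (hφ : Measurable φ) (hψ : Measurable ψ) {b ω : ℝ}
    (hφb : ∀ y, |φ y| ≤ b) {m : (κ → ℝ) → ℝ} (hm : Measurable m) (hmb : ∀ x, |m x| ≤ b)
    (hω : ∀ x x', ‖x - x'‖ ≤ h → |m x - m x'| ≤ ω)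
    (hmz : CondMeanZero μ π fun y => φ y - m (π y)) {T : ℝ} {K : ℕ} (hK : 1 ≤ K)
    (hKT : 2 * T ≤ K * h) :
    ∫⁻ X, ∫⁻ x in {x | ‖x‖ ≤ T}, ENNReal.ofReal ((localAvg π h I X ψ x - m x) ^ 2) ∂μ.map π
        ∂Measure.pi (fun _ : ι => μ)
      ≤ 3 * (2 ^ Fintype.card κ * ∫⁻ y, ENNReal.ofReal ((φ y - ψ y) ^ 2) ∂μ)
        + ENNReal.ofReal (27 * b ^ 2) * ((I.card : ℝ≥0∞)⁻¹ * K ^ Fintype.card κ)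
        + ENNReal.ofReal (3 * ω ^ 2) := by
  have : IsProbabilityMeasure (μ.map π) := Measure.isProbabilityMeasure_map hπ.aemeasurable
  have hb0 : 0 ≤ b := (abs_nonneg _).trans (hmb 0)
  have hω0 : 0 ≤ ω := (abs_nonneg _).trans (hω 0 0 (by simpa using hh.le))
  set ε : E → ℝ := fun y => φ y - m (π y) with hε
  have hεm : Measurable ε := hφ.sub (hm.comp hπ)
  have hεb : ∀ y, |ε y| ≤ 2 * b := fun y => by
    refine (abs_sub _ _).trans ?_
    linarith [hφb y, hmb (π y)]
  have hpt : ∀ (X : ι → E) (x : κ → ℝ), (localAvg π h I X ψ x - m x) ^ 2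
      ≤ 3 * localAvg π h I X (fun y => φ y - ψ y) x ^ 2 + 3 * localAvg π h I X ε x ^ 2
        + 3 * ω ^ 2 + 3 * b ^ 2 * (if ∑ i ∈ I, ind π h x (X i) = 0 then 1 else 0) := by
    intro X x
    -- Three sources of error: the input ψ differs from φ, the noise of φ around its conditional
    -- mean, and the bias of averaging m over the ball.
    have e1 : localAvg π h I X ψ x - m x = - localAvg π h I X (fun y => φ y - ψ y) x
        + localAvg π h I X ε x + (localAvg π h I X (fun y => m (π y)) x - m x) := by
      rw [localAvg_sub, hε, localAvg_sub]; ring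
    have e2 : (localAvg π h I X (fun y => m (π y)) x - m x) ^ 2 ≤ ω ^ 2 +
        b ^ 2 * (if ∑ i ∈ I, ind π h x (X i) = 0 then 1 else 0) := by
      -- With no observation nearby the local average is 0 by convention and the error is m x
      -- itself; otherwise the bias is an average of increments of m.
      split_ifs with h0
      · have : localAvg π h I X (fun y => m (π y)) x = 0 := by unfold localAvg; rw [h0, div_zero]
        rw [this, zero_sub, neg_sq]
        have := sq_le_sq.2 ((hmb x).trans (le_abs_self b))
        nlinarith [sq_nonneg ω]
      · have e3 : localAvg π h I X (fun y => m (π y)) x - m x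
            = localAvg π h I X (fun y => m (π y) - m x) x := by
          rw [localAvg_sub]
          congr 1
          unfold localAvg
          rw [← Finset.sum_mul]
          field_simp
        rw [e3, mul_zero, add_zero]
        refine sq_le_sq.2 (le_trans (abs_localAvg_le hω0 fun i _ hi => ?_) (le_abs_self ω))
        rw [abs_sub_comm]
        exact hω _ _ hi
    rw [e1]
    set A := localAvg π h I X (fun y => φ y - ψ y) x
    set B := localAvg π h I X ε x
    set D := localAvg π h I X (fun y => m (π y)) x - m x
    have : (-A + B + D) ^ 2 ≤ 3 * A ^ 2 + 3 * B ^ 2 + 3 * D ^ 2 := by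
      nlinarith [sq_nonneg (A + B), sq_nonneg (A + D), sq_nonneg (B - D)]
    linarith
  set R : Set (κ → ℝ) := {x | ‖x‖ ≤ T} with hR
  have hRm : MeasurableSet R := measurableSet_le (by fun_prop) measurable_const
  set P := Measure.pi (fun _ : ι => μ) with hP
  set V : (κ → ℝ) → ℝ≥0∞ := fun x => (I.card : ℝ≥0∞)⁻¹ * (μ.map π {z | ‖x - z‖ ≤ h})⁻¹ with hV
  have hVm : Measurable V := (measurable_inv_measure_ball (μ.map π)).const_mul _
  have hVint : ∫⁻ x in R, V x ∂μ.map π ≤ (I.card : ℝ≥0∞)⁻¹ * K ^ Fintype.card κ := by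
    rw [hV, lintegral_const_mul _ (measurable_inv_measure_ball (μ.map π))]
    gcongr
    have := setLIntegral_inv_measure_ball_le (μ.map π) hh hK hKT 0
    simpa [hR] using this
  have hLm : ∀ χ : E → ℝ, Measurable χ → Measurable (Function.uncurry
      fun (X : ι → E) (x : κ → ℝ) => ENNReal.ofReal (localAvg π h I X χ x ^ 2)) := fun χ hχ => by
    refine ENNReal.measurable_ofReal.comp (Measurable.pow_const ?_ 2)
    exact measurable_localAvg hπ I measurable_fst measurable_snd (ψ := fun _ => χ)
      (hχ.comp measurable_snd)
  have hZm : Measurable (Function.uncurry fun (X : ι → E) (x : κ → ℝ) =>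
      (if ∑ i ∈ I, ind π h x (X i) = 0 then 1 else 0 : ℝ≥0∞)) := by
    refine Measurable.ite (measurableSet_eq_fun ?_ measurable_const) measurable_const
      measurable_const
    exact Finset.measurable_fun_sum _ fun k _ => measurable_ind hπ measurable_snd
      ((measurable_pi_apply k).comp measurable_fst)
  have hm1 := hLm (fun y => φ y - ψ y) (hφ.sub hψ)
  have hm2 := hLm ε hεm
  have hp1 : ∀ X : ι → E, Measurable fun x =>
      ENNReal.ofReal (localAvg π h I X (fun y => φ y - ψ y) x ^ 2) := fun X => hm1.of_uncurry_left
  have hp2 : ∀ X : ι → E, Measurable fun x => ENNReal.ofReal (localAvg π h I X ε x ^ 2) :=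
    fun X => hm2.of_uncurry_left
  have hp3 : ∀ X : ι → E, Measurable fun x =>
      (if ∑ i ∈ I, ind π h x (X i) = 0 then 1 else 0 : ℝ≥0∞) := fun X => hZm.of_uncurry_left
  have key : ∀ X : ι → E, ∫⁻ x in R, ENNReal.ofReal ((localAvg π h I X ψ x - m x) ^ 2) ∂μ.map π
      ≤ 3 * (∫⁻ x, ENNReal.ofReal (localAvg π h I X (fun y => φ y - ψ y) x ^ 2) ∂μ.map π)
        + 3 * (∫⁻ x in R, ENNReal.ofReal (localAvg π h I X ε x ^ 2) ∂μ.map π)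
        + ENNReal.ofReal (3 * ω ^ 2)
        + ENNReal.ofReal (3 * b ^ 2) * (∫⁻ x in R,
          (if ∑ i ∈ I, ind π h x (X i) = 0 then 1 else 0) ∂μ.map π) := by
    intro X
    calc ∫⁻ x in R, ENNReal.ofReal ((localAvg π h I X ψ x - m x) ^ 2) ∂μ.map π
        ≤ ∫⁻ x in R, (3 * ENNReal.ofReal (localAvg π h I X (fun y => φ y - ψ y) x ^ 2)
            + 3 * ENNReal.ofReal (localAvg π h I X ε x ^ 2) + ENNReal.ofReal (3 * ω ^ 2)
            + ENNReal.ofReal (3 * b ^ 2) * (if ∑ i ∈ I, ind π h x (X i) = 0 then 1 else 0))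
            ∂μ.map π := by
          refine lintegral_mono fun x => (ENNReal.ofReal_le_ofReal (hpt X x)).trans ?_
          have h3 : (3 : ℝ≥0∞) = ENNReal.ofReal 3 := by simp
          rw [h3, ← ENNReal.ofReal_mul (by norm_num), ← ENNReal.ofReal_mul (by norm_num),
            ENNReal.ofReal_add (by positivity) (by split_ifs <;> positivity),
            ENNReal.ofReal_add (by positivity) (by positivity),
            ENNReal.ofReal_add (by positivity) (by positivity),
            ENNReal.ofReal_mul (p := 3 * b ^ 2) (by positivity)]
          gcongr
          split_ifs <;> simp
      _ = 3 * (∫⁻ x in R, ENNReal.ofReal (localAvg π h I X (fun y => φ y - ψ y) x ^ 2) ∂μ.map π)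
            + 3 * (∫⁻ x in R, ENNReal.ofReal (localAvg π h I X ε x ^ 2) ∂μ.map π)
            + ENNReal.ofReal (3 * ω ^ 2) * μ.map π R
            + ENNReal.ofReal (3 * b ^ 2) * (∫⁻ x in R,
              (if ∑ i ∈ I, ind π h x (X i) = 0 then 1 else 0) ∂μ.map π) := by
          rw [lintegral_add_right _ ((hp3 X).const_mul _),
            lintegral_add_right _ measurable_const,
            lintegral_add_right _ ((hp2 X).const_mul _),
            lintegral_const_mul _ (hp1 X), lintegral_const_mul _ (hp2 X),
            lintegral_const_mul _ (hp3 X)]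
          simp
      _ ≤ _ := by
          gcongr
          · exact Measure.restrict_le_self
          · exact mul_le_of_le_one_right (by positivity) prob_le_one
  have hsw2 : ∫⁻ X, ∫⁻ x in R, ENNReal.ofReal (localAvg π h I X ε x ^ 2) ∂μ.map π ∂P
      ≤ ENNReal.ofReal (8 * b ^ 2) * ((I.card : ℝ≥0∞)⁻¹ * K ^ Fintype.card κ) := by
    rw [lintegral_lintegral_swap hm2.aemeasurable]
    calc _ ≤ ∫⁻ x in R, ENNReal.ofReal (8 * b ^ 2) * V x ∂μ.map π := by
          refine lintegral_mono fun x => ?_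
          have := lintegral_sq_localAvg_of_condMeanZero_le μ hπ hI hεm hεb hmz x (h := h)
          refine this.trans (le_of_eq ?_)
          congr 2; ring
      _ ≤ _ := by rw [lintegral_const_mul _ hVm]; gcongr
  have hsw3 : ∫⁻ X, ∫⁻ x in R, (if ∑ i ∈ I, ind π h x (X i) = 0 then 1 else 0) ∂μ.map π ∂P
      ≤ (I.card : ℝ≥0∞)⁻¹ * K ^ Fintype.card κ := by
    rw [lintegral_lintegral_swap hZm.aemeasurable]
    exact (lintegral_mono fun x => lintegral_count_eq_zero_le μ hπ hI x).trans hVint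
  have hq1 : Measurable fun X : ι → E =>
      ∫⁻ x, ENNReal.ofReal (localAvg π h I X (fun y => φ y - ψ y) x ^ 2) ∂μ.map π :=
    hm1.lintegral_prod_right
  have hq2 : Measurable fun X : ι → E =>
      ∫⁻ x in R, ENNReal.ofReal (localAvg π h I X ε x ^ 2) ∂μ.map π :=
    hm2.lintegral_prod_right
  have hq3 : Measurable fun X : ι → E =>
      ∫⁻ x in R, (if ∑ i ∈ I, ind π h x (X i) = 0 then 1 else 0 : ℝ≥0∞) ∂μ.map π :=
    hZm.lintegral_prod_right
  refine (lintegral_mono key).trans ?_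
  rw [lintegral_add_right _ (hq3.const_mul _), lintegral_add_right _ measurable_const,
    lintegral_add_right _ (hq2.const_mul _), lintegral_const_mul _ hq1, lintegral_const_mul _ hq2,
    lintegral_const_mul _ hq3]
  -- The noise is bounded by 2b, so its variance carries 2(2b)² = 8b²; the remaining 3b² pays for
  -- empty neighbourhoods.
  have hb27 : ENNReal.ofReal (27 * b ^ 2) = 3 * ENNReal.ofReal (8 * b ^ 2)
      + ENNReal.ofReal (3 * b ^ 2) := by
    have h3 : (3 : ℝ≥0∞) = ENNReal.ofReal 3 := by simp
    rw [h3, ← ENNReal.ofReal_mul (by norm_num), ← ENNReal.ofReal_add (by positivity)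
      (by positivity)]
    congr 1; ring
  rw [hb27]
  calc _ ≤ 3 * (2 ^ Fintype.card κ * ∫⁻ y, ENNReal.ofReal ((φ y - ψ y) ^ 2) ∂μ)
        + 3 * (ENNReal.ofReal (8 * b ^ 2) * ((I.card : ℝ≥0∞)⁻¹ * K ^ Fintype.card κ))
        + ENNReal.ofReal (3 * ω ^ 2)
        + ENNReal.ofReal (3 * b ^ 2) * ((I.card : ℝ≥0∞)⁻¹ * K ^ Fintype.card κ) := by
        gcongr
        · exact lintegral_sq_localAvg_le μ hπ hh I (hφ.sub hψ)
        · simp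
    _ = _ := by ring

end LocalAverage

/-! ### Total variation and integrals of bounded functions -/

theorem abs_measureReal_sub_le_tvDist {α : Type*} [MeasurableSpace α] (P Q : Measure α)
    [IsProbabilityMeasure P] [IsProbabilityMeasure Q] {A : Set α} (hA : MeasurableSet A) :
    |P.real A - Q.real A| ≤ tvDist P Q := by
  unfold tvDist
  refine le_ciSup (f := fun A : {A : Set α // MeasurableSet A} => |P.real A.1 - Q.real A.1|)
    ⟨1, ?_⟩ ⟨A, hA⟩
  rintro _ ⟨B, rfl⟩
  have h1 : P.real B.1 ≤ 1 := measureReal_le_one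
  have h2 : Q.real B.1 ≤ 1 := measureReal_le_one
  have h3 : 0 ≤ P.real B.1 := measureReal_nonneg
  have h4 : 0 ≤ Q.real B.1 := measureReal_nonneg
  exact abs_le.2 ⟨by linarith, by linarith⟩

/-- Layer cake: φ + b takes values in [0, 2b], so its integral is that of its tail probabilities
over an interval of length 2b, and each tail probability changes by at most `tvDist P Q`. -/
theorem abs_integral_sub_le_tvDist {α : Type*} [MeasurableSpace α] (P Q : Measure α)
    [IsProbabilityMeasure P] [IsProbabilityMeasure Q] {φ : α → ℝ} (hφ : Measurable φ) {b : ℝ}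
    (hb : ∀ x, |φ x| ≤ b) : |∫ x, φ x ∂P - ∫ x, φ x ∂Q| ≤ 2 * b * tvDist P Q := by
  have hb0 : 0 ≤ b := by
    obtain ⟨y⟩ : Nonempty α := by
      by_contra hne
      rw [not_nonempty_iff] at hne
      exact IsProbabilityMeasure.ne_zero P (Measure.eq_zero_of_isEmpty P)
    exact (abs_nonneg _).trans (hb y)
  have key : ∀ ν : Measure α, IsProbabilityMeasure ν →
      ∫ x, φ x ∂ν = (∫ t in Set.Ioc 0 (2 * b), ν.real {x | t ≤ φ x + b}) - b := by
    intro ν hν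
    have hint : Integrable φ ν := integrable_of_bound hφ hb
    rw [← Integrable.integral_eq_integral_Ioc_meas_le (f := fun x => φ x + b) (M := 2 * b)]
    · rw [integral_add hint (integrable_const b)]; simp
    · exact hint.add (integrable_const b)
    · exact Eventually.of_forall fun x => by
        have := (abs_le.1 (hb x)).1
        simp only [Pi.zero_apply]; linarith
    · exact Eventually.of_forall fun x => by
        have := (abs_le.1 (hb x)).2
        simp only; linarith
  have hmeas : ∀ ν : Measure α, IsProbabilityMeasure ν →
      IntegrableOn (fun t => ν.real {x | t ≤ φ x + b}) (Set.Ioc 0 (2 * b)) := by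
    intro ν hν
    have hanti : Antitone fun t => ν.real {x | t ≤ φ x + b} := fun s t hst =>
      measureReal_mono fun x hx => le_trans hst hx
    exact integrable_of_bound hanti.measurable (B := 1) fun t => by
      rw [abs_of_nonneg measureReal_nonneg]; exact measureReal_le_one
  rw [key P inferInstance, key Q inferInstance, sub_sub_sub_cancel_right,
    ← integral_sub (hmeas P inferInstance) (hmeas Q inferInstance)]
  have := norm_setIntegral_le_of_norm_le_const (μ := volume) (s := Set.Ioc (0 : ℝ) (2 * b))
    (f := fun t => P.real {x | t ≤ φ x + b} - Q.real {x | t ≤ φ x + b}) (C := tvDist P Q)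
    measure_Ioc_lt_top (fun t _ => by
      rw [Real.norm_eq_abs]
      exact abs_measureReal_sub_le_tvDist P Q
        (measurableSet_le measurable_const (hφ.add_const b)))
  rw [Real.norm_eq_abs] at this
  refine this.trans (le_of_eq ?_)
  rw [Real.volume_real_Ioc_of_le (by linarith)]
  ring

/-! ### Splitting coordinates, the normalised model and the exact regression step -/

section Glue

variable {d : ℕ} (S : Finset (Fin d))

theorem measurable_proj : Measurable (proj S) :=
  measurable_pi_lambda _ fun _ => measurable_pi_apply _

theorem measurable_glue :
    Measurable fun p : (S → ℝ) × ((Sᶜ : Finset (Fin d)) → ℝ) => glue S p.1 p.2 := by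
  refine measurable_pi_lambda _ fun j => ?_
  unfold glue
  by_cases hj : j ∈ S
  · simp only [hj, dif_pos]; fun_prop
  · simp only [hj, dif_neg, not_false_eq_true]; fun_prop

theorem proj_glue (u : S → ℝ) (v : (Sᶜ : Finset (Fin d)) → ℝ) : proj S (glue S u v) = u := by
  funext j
  simp [proj, glue]

theorem glue_proj (x : Fin d → ℝ) : glue S (proj S x) (proj Sᶜ x) = x := by
  funext j
  simp [proj, glue]

theorem norm_proj_le (x : Fin d → ℝ) : ‖proj S x‖ ≤ ‖x‖ :=
  (pi_norm_le_iff_of_nonneg (norm_nonneg _)).2 fun j => norm_le_pi_norm x j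

theorem proj_sub (x y : Fin d → ℝ) : proj S (x - y) = proj S x - proj S y := rfl

theorem norm_glue_sub_le (u u' : S → ℝ) (v : (Sᶜ : Finset (Fin d)) → ℝ) :
    ‖glue S u v - glue S u' v‖ ≤ ‖u - u'‖ := by
  refine (pi_norm_le_iff_of_nonneg (norm_nonneg _)).2 fun j => ?_
  simp only [Pi.sub_apply, glue]
  split_ifs with hj
  · exact norm_le_pi_norm (u - u') ⟨j, hj⟩
  · simp

end Glue

/-- The model with normalised shifts. -/
structure Setting {d : ℕ} (SS : Finset (Finset (Fin d))) where
  μ : Measure (Fin d → ℝ)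
  prob : IsProbabilityMeasure μ
  a : (Fin d → ℝ) → ℝ
  b : ℝ
  a_meas : Measurable a
  a_bdd : ∀ x, |a x| ≤ b
  r : (S : SS) → (S.1 → ℝ) → ℝ
  r_meas : ∀ S, Measurable (r S)
  c : ℝ
  C : ℝ
  c_pos : 0 < c
  r_ge : ∀ S x, c ≤ r S x
  r_le : ∀ S x, r S x ≤ C
  r_mean : ∀ S : SS, ∫ x, r S (proj S.1 x) ∂μ = 1
  lam : SS → ℝ
  lam_pos : ∀ S, 0 < lam S
  Q : (S : SS) → Kernel (S.1 → ℝ) ((S.1ᶜ : Finset (Fin d)) → ℝ)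
  markov : ∀ S, IsMarkovKernel (Q S)
  disint : ∀ S : SS, (μ.map (proj S.1)).compProd (Q S) = μ.map fun x => (proj S.1 x, proj S.1ᶜ x)

namespace Setting

variable {d : ℕ} {SS : Finset (Finset (Fin d))} (P : Setting SS)

instance : IsProbabilityMeasure P.μ := P.prob

instance (S : SS) : IsMarkovKernel (P.Q S) := P.markov S

instance (S : SS) : IsProbabilityMeasure (P.μ.map (proj S.1)) :=
  Measure.isProbabilityMeasure_map (measurable_proj _).aemeasurable

theorem b_nonneg : 0 ≤ P.b := (abs_nonneg _).trans (P.a_bdd 0)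

theorem r_pos (S : SS) (x : S.1 → ℝ) : 0 < P.r S x := P.c_pos.trans_le (P.r_ge S x)

theorem lam_r_pos (S : SS) (x : S.1 → ℝ) : 0 < P.lam S * P.r S x :=
  mul_pos (P.lam_pos S) (P.r_pos S x)

theorem integrable_r (S : SS) : Integrable (fun x => P.r S (proj S.1 x)) P.μ :=
  integrable_of_bound ((P.r_meas S).comp (measurable_proj _)) (B := P.C) fun x => by
    rw [abs_of_pos (P.r_pos _ _)]; exact P.r_le _ _

theorem one_le_C (S : SS) : 1 ≤ P.C := by
  have := integral_mono (P.integrable_r S) (integrable_const P.C) fun x => P.r_le S (proj S.1 x)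
  simpa [P.r_mean] using this

theorem c_le_one (S : SS) : P.c ≤ 1 := by
  have := integral_mono (integrable_const P.c) (P.integrable_r S) fun x => P.r_ge S (proj S.1 x)
  simpa [P.r_mean] using this

theorem c_le_C (S : SS) : P.c ≤ P.C := (P.c_le_one S).trans (P.one_le_C S)

/-- A version of the conditional expectation `E[φ(X) | X_S = x]`. -/
def cexp (S : SS) (φ : (Fin d → ℝ) → ℝ) (x : S.1 → ℝ) : ℝ := ∫ v, φ (glue S.1 x v) ∂P.Q S x

theorem measurable_glue_left (S : Finset (Fin d)) (x : S → ℝ) : Measurable (glue S x) :=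
  (measurable_glue S).comp measurable_prodMk_left

theorem measurable_cexp (S : SS) {φ : (Fin d → ℝ) → ℝ} (hφ : Measurable φ) :
    Measurable (P.cexp S φ) := by
  have h : Measurable fun p : (S.1 → ℝ) × ((S.1ᶜ : Finset (Fin d)) → ℝ) => φ (glue S.1 p.1 p.2) :=
    hφ.comp (measurable_glue S.1)
  exact h.stronglyMeasurable.integral_kernel_prod_right'.measurable

theorem abs_cexp_le (S : SS) {φ : (Fin d → ℝ) → ℝ} {b : ℝ} (hb : ∀ x, |φ x| ≤ b) (x : S.1 → ℝ) :
    |P.cexp S φ x| ≤ b := by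
  have := norm_integral_le_of_norm_le_const (μ := P.Q S x) (f := fun v => φ (glue S.1 x v)) (C := b)
    (Eventually.of_forall fun v => hb _)
  simpa [cexp] using this

theorem integral_eq_integral_compProd (S : SS) {φ : (Fin d → ℝ) → ℝ} (hφ : Integrable φ P.μ) :
    ∫ x, φ x ∂P.μ = ∫ u, ∫ v, φ (glue S.1 u v) ∂P.Q S u ∂P.μ.map (proj S.1) := by
  have hp : Measurable fun x : Fin d → ℝ => (proj S.1 x, proj S.1ᶜ x) :=
    (measurable_proj _).prodMk (measurable_proj _)
  have hmap : (P.μ.map fun x => (proj S.1 x, proj S.1ᶜ x)).map (fun p => glue S.1 p.1 p.2) = P.μ := by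
    rw [Measure.map_map (measurable_glue _) hp]
    have : ((fun p : (S.1 → ℝ) × ((S.1ᶜ : Finset (Fin d)) → ℝ) => glue S.1 p.1 p.2) ∘
        fun x : Fin d → ℝ => (proj S.1 x, proj S.1ᶜ x)) = id := funext fun x => glue_proj S.1 x
    rw [this, Measure.map_id]
  rw [← P.disint S] at hmap
  have hae : AEStronglyMeasurable φ (((P.μ.map (proj S.1)).compProd (P.Q S)).map
      (fun p => glue S.1 p.1 p.2)) := by rw [hmap]; exact hφ.aestronglyMeasurable
  conv_lhs => rw [← hmap]
  rw [integral_map (measurable_glue _).aemeasurable hae, Measure.integral_compProd]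
  rw [← hmap] at hφ
  exact hφ.comp_measurable (measurable_glue _)

/-- The defining property of the conditional expectation. -/
theorem integral_mul_cexp (S : SS) {F : (S.1 → ℝ) → ℝ}
    (hF : Integrable (fun x => F (proj S.1 x)) P.μ) {φ : (Fin d → ℝ) → ℝ} (hφ : Measurable φ)
    {b : ℝ} (hb : ∀ x, |φ x| ≤ b) :
    ∫ x, F (proj S.1 x) * P.cexp S φ (proj S.1 x) ∂P.μ = ∫ x, F (proj S.1 x) * φ x ∂P.μ := by
  have h1 : Integrable (fun x => F (proj S.1 x) * P.cexp S φ (proj S.1 x)) P.μ :=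
    hF.mul_bdd (c := b) ((P.measurable_cexp S hφ).comp (measurable_proj _)).aestronglyMeasurable
      (Eventually.of_forall fun x => P.abs_cexp_le S hb _)
  have h2 : Integrable (fun x => F (proj S.1 x) * φ x) P.μ :=
    hF.mul_bdd (c := b) hφ.aestronglyMeasurable (Eventually.of_forall hb)
  rw [P.integral_eq_integral_compProd S h1, P.integral_eq_integral_compProd S h2]
  refine integral_congr_ae (Eventually.of_forall fun u => ?_)
  simp only [proj_glue]
  rw [integral_const_mul, integral_const_mul]
  congr 1
  simp [cexp]

theorem condMeanZero_sub_cexp (S : SS) {φ : (Fin d → ℝ) → ℝ} (hφ : Measurable φ)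
    {b : ℝ} (hb : ∀ x, |φ x| ≤ b) :
    CondMeanZero P.μ (proj S.1) fun y => φ y - P.cexp S φ (proj S.1 y) := by
  rintro F hF ⟨B, hB⟩
  have hFi : Integrable (fun x => F (proj S.1 x)) P.μ :=
    integrable_of_bound (hF.comp (measurable_proj _)) fun x => hB _
  simp_rw [mul_sub]
  rw [integral_sub, P.integral_mul_cexp S hFi hφ hb, sub_self]
  · exact hFi.mul_bdd (c := b) hφ.aestronglyMeasurable (Eventually.of_forall hb)
  · exact hFi.mul_bdd (c := b)
      ((P.measurable_cexp S hφ).comp (measurable_proj _)).aestronglyMeasurable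
      (Eventually.of_forall fun x => P.abs_cexp_le S hb _)

/-- Moving from x to x' changes the integrand at a fixed complementary coordinate, which costs ω,
and the conditional law, which costs 2bτ by total variation. The function φ therefore need not be
smoothed by the kernel. -/
theorem cexp_sub_cexp_le (S : SS) {φ : (Fin d → ℝ) → ℝ} (hφ : Measurable φ)
    {b : ℝ} (hb : ∀ x, |φ x| ≤ b) {x x' : S.1 → ℝ} {ω τ : ℝ}
    (hω : ∀ v, |φ (glue S.1 x v) - φ (glue S.1 x' v)| ≤ ω)
    (hτ : tvDist (P.Q S x) (P.Q S x') ≤ τ) :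
    |P.cexp S φ x - P.cexp S φ x'| ≤ ω + 2 * b * τ := by
  have hb0 : 0 ≤ b := (abs_nonneg _).trans (hb 0)
  have hi : ∀ u w, Integrable (fun v => φ (glue S.1 u v)) (P.Q S w) := fun u w =>
    integrable_of_bound (hφ.comp (measurable_glue_left S.1 u)) fun _ => hb _
  have e : P.cexp S φ x - P.cexp S φ x' = (∫ v, (φ (glue S.1 x v) - φ (glue S.1 x' v)) ∂P.Q S x)
      + (∫ v, φ (glue S.1 x' v) ∂P.Q S x - ∫ v, φ (glue S.1 x' v) ∂P.Q S x') := by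
    rw [integral_sub (hi x x) (hi x' x)]; simp only [cexp]; ring
  rw [e]
  refine (abs_add_le _ _).trans (add_le_add ?_ ?_)
  · have := norm_integral_le_of_norm_le_const (μ := P.Q S x)
      (f := fun v => φ (glue S.1 x v) - φ (glue S.1 x' v)) (C := ω) (Eventually.of_forall hω)
    simpa using this
  · refine (abs_integral_sub_le_tvDist _ _ (hφ.comp (measurable_glue_left S.1 x'))
      fun _ => hb _).trans ?_
    gcongr

/-- The optimal weight `λ r / (1 + λ r)`. -/
def w (S : SS) (x : S.1 → ℝ) : ℝ := P.lam S * P.r S x / (1 + P.lam S * P.r S x)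

theorem measurable_w (S : SS) : Measurable (P.w S) := by
  unfold w
  exact ((P.r_meas S).const_mul _).div (((P.r_meas S).const_mul _).const_add _)

theorem w_pos (S : SS) (x : S.1 → ℝ) : 0 < P.w S x :=
  div_pos (P.lam_r_pos S x) (by linarith [P.lam_r_pos S x])

theorem w_le_one (S : SS) (x : S.1 → ℝ) : P.w S x ≤ 1 :=
  div_le_one_of_le₀ (by linarith) (by linarith [P.lam_r_pos S x])

theorem inv_w (S : SS) (x : S.1 → ℝ) : (P.w S x)⁻¹ = 1 + 1 / (P.lam S * P.r S x) := by
  have := P.lam_r_pos S x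
  unfold w
  rw [inv_div, add_div, div_self this.ne', add_comm]

/-- The difference of u/(1+u) at u = λr and u' = λr' is (u - u')/((1+u)(1+u')), and (1+u)(1+u') ≥
(1+λc)² ≥ 4λc. This removes λ from the Lipschitz constant. -/
theorem abs_w_sub_le (S : SS) (x x' : S.1 → ℝ) :
    |P.w S x - P.w S x'| ≤ |P.r S x - P.r S x'| / (4 * P.c) := by
  have h1 := P.lam_r_pos S x
  have h2 := P.lam_r_pos S x'
  have hl := P.lam_pos S
  have hc := P.c_pos
  have e : P.w S x - P.w S x' = P.lam S * (P.r S x - P.r S x') /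
      ((1 + P.lam S * P.r S x) * (1 + P.lam S * P.r S x')) := by
    unfold w; field_simp; ring
  rw [e, abs_div, abs_mul, abs_of_pos hl, abs_of_pos (by positivity :
    0 < (1 + P.lam S * P.r S x) * (1 + P.lam S * P.r S x')), div_le_div_iff₀ (by positivity)
    (by positivity)]
  have hx : P.lam S * P.c ≤ P.lam S * P.r S x := by gcongr; exact P.r_ge S x
  have hx' : P.lam S * P.c ≤ P.lam S * P.r S x' := by gcongr; exact P.r_ge S x'
  have hq : 4 * (P.lam S * P.c) ≤ (1 + P.lam S * P.r S x) * (1 + P.lam S * P.r S x') := by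
    have : 0 < P.lam S * P.c := by positivity
    nlinarith [sq_nonneg (1 - P.lam S * P.c)]
  nlinarith [abs_nonneg (P.r S x - P.r S x'), mul_le_mul_of_nonneg_left hq
    (abs_nonneg (P.r S x - P.r S x'))]

theorem integrable_w (S : SS) : Integrable (fun x => P.w S (proj S.1 x)) P.μ :=
  integrable_of_bound ((P.measurable_w S).comp (measurable_proj _)) (B := 1) fun x => by
    rw [abs_of_pos (P.w_pos _ _)]; exact P.w_le_one _ _

theorem integral_w_pos (S : SS) : 0 < ∫ x, P.w S (proj S.1 x) ∂P.μ := by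
  rw [integral_pos_iff_support_of_nonneg (fun x => (P.w_pos S _).le) (P.integrable_w S)]
  have : Function.support (fun x => P.w S (proj S.1 x)) = Set.univ := by
    ext x; simp [(P.w_pos S (proj S.1 x)).ne']
  simp [this]

theorem integrable_w_mul (S : SS) {φ : (Fin d → ℝ) → ℝ} (hφ : Measurable φ)
    {b : ℝ} (hb : ∀ x, |φ x| ≤ b) : Integrable (fun x => P.w S (proj S.1 x) * φ x) P.μ :=
  (P.integrable_w S).mul_bdd (c := b) hφ.aestronglyMeasurable (Eventually.of_forall hb)

/-- The weighted mean `E[w φ] / E[w]`. -/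
def wmean (S : SS) (φ : (Fin d → ℝ) → ℝ) : ℝ :=
  (∫ x, P.w S (proj S.1 x) * φ x ∂P.μ) / ∫ x, P.w S (proj S.1 x) ∂P.μ

theorem abs_wmean_le (S : SS) {φ : (Fin d → ℝ) → ℝ} {b : ℝ} (hb : ∀ x, |φ x| ≤ b) :
    |P.wmean S φ| ≤ b := by
  have hb0 : 0 ≤ b := (abs_nonneg _).trans (hb 0)
  unfold wmean
  rw [abs_div, abs_of_pos (P.integral_w_pos S), div_le_iff₀ (P.integral_w_pos S),
    ← integral_const_mul]
  refine (abs_integral_le_integral_abs).trans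
    (integral_mono_of_nonneg (Eventually.of_forall fun _ => abs_nonneg _)
      ((P.integrable_w S).const_mul b) (Eventually.of_forall fun x => ?_))
  simp only
  rw [abs_mul, abs_of_pos (P.w_pos _ _), mul_comm]
  exact mul_le_mul_of_nonneg_right (hb x) (P.w_pos _ _).le

/-- The exact regression step: the minimiser of `Var(φ - α) + E[α² / (λ r)]` over mean-zero
functions `α` of `x_S`. -/
def popStep (S : SS) (φ : (Fin d → ℝ) → ℝ) (x : S.1 → ℝ) : ℝ :=
  P.w S x * (P.cexp S φ x - P.wmean S φ)

theorem measurable_popStep (S : SS) {φ : (Fin d → ℝ) → ℝ} (hφ : Measurable φ) :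
    Measurable (P.popStep S φ) :=
  (P.measurable_w S).mul ((P.measurable_cexp S hφ).sub_const _)

theorem abs_popStep_le (S : SS) {φ : (Fin d → ℝ) → ℝ} {b : ℝ} (hb : ∀ x, |φ x| ≤ b)
    (x : S.1 → ℝ) : |P.popStep S φ x| ≤ 2 * b := by
  unfold popStep
  rw [abs_mul, abs_of_pos (P.w_pos S x)]
  have h1 : |P.cexp S φ x - P.wmean S φ| ≤ 2 * b :=
    (abs_sub _ _).trans (by linarith [P.abs_cexp_le S hb x, P.abs_wmean_le S hb])
  calc _ ≤ 1 * (2 * b) := mul_le_mul (P.w_le_one S x) h1 (abs_nonneg _) zero_le_one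
    _ = 2 * b := one_mul _

theorem abs_popStep_sub_le (S : SS) {φ : (Fin d → ℝ) → ℝ} {b : ℝ} (hb : ∀ x, |φ x| ≤ b)
    {x x' : S.1 → ℝ} {ω τ : ℝ} (hω : |P.cexp S φ x - P.cexp S φ x'| ≤ ω)
    (hτ : |P.r S x - P.r S x'| ≤ τ) :
    |P.popStep S φ x - P.popStep S φ x'| ≤ ω + 2 * b * (τ / (4 * P.c)) := by
  have hc := P.c_pos
  have e : P.popStep S φ x - P.popStep S φ x' = P.w S x * (P.cexp S φ x - P.cexp S φ x')
      + (P.w S x - P.w S x') * (P.cexp S φ x' - P.wmean S φ) := by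
    unfold popStep; ring
  have h1 : |P.cexp S φ x' - P.wmean S φ| ≤ 2 * b :=
    (abs_sub _ _).trans (by linarith [P.abs_cexp_le S hb x', P.abs_wmean_le S hb])
  rw [e]
  refine (abs_add_le _ _).trans (add_le_add ?_ ?_)
  · rw [abs_mul, abs_of_pos (P.w_pos S x)]
    calc _ ≤ 1 * ω := mul_le_mul (P.w_le_one S x) hω (abs_nonneg _) zero_le_one
      _ = ω := one_mul _
  · rw [abs_mul, mul_comm]
    refine mul_le_mul h1 ((P.abs_w_sub_le S x x').trans ?_) (abs_nonneg _)
      ((abs_nonneg _).trans h1)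
    gcongr

/-- The constant `wmean` is exactly the one that centres the weighted conditional expectation, so
the step stays in the space of mean-zero functions. -/
theorem integral_popStep (S : SS) {φ : (Fin d → ℝ) → ℝ} (hφ : Measurable φ) {b : ℝ}
    (hb : ∀ x, |φ x| ≤ b) : ∫ x, P.popStep S φ (proj S.1 x) ∂P.μ = 0 := by
  unfold popStep
  simp_rw [mul_sub]
  rw [integral_sub, P.integral_mul_cexp S (P.integrable_w S) hφ hb, integral_mul_const, wmean,
    mul_div_cancel₀ _ (P.integral_w_pos S).ne', sub_self]
  · exact (P.integrable_w S).mul_bdd (c := b)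
      ((P.measurable_cexp S hφ).comp (measurable_proj _)).aestronglyMeasurable
      (Eventually.of_forall fun x => P.abs_cexp_le S hb _)
  · exact (P.integrable_w S).mul_const _

/-- The first-order condition for the exact regression step. -/
theorem integral_popStep_mul_div_w (S : SS) {φ : (Fin d → ℝ) → ℝ} (hφ : Measurable φ) {b : ℝ}
    (hb : ∀ x, |φ x| ≤ b) {v : (S.1 → ℝ) → ℝ} (hv : Integrable (fun x => v (proj S.1 x)) P.μ)
    (hv0 : ∫ x, v (proj S.1 x) ∂P.μ = 0) :
    ∫ x, P.popStep S φ (proj S.1 x) * v (proj S.1 x) * (P.w S (proj S.1 x))⁻¹ ∂P.μ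
      = ∫ x, v (proj S.1 x) * φ x ∂P.μ := by
  have e : ∀ x, P.popStep S φ (proj S.1 x) * v (proj S.1 x) * (P.w S (proj S.1 x))⁻¹
      = v (proj S.1 x) * P.cexp S φ (proj S.1 x) - v (proj S.1 x) * P.wmean S φ := fun x => by
    have := (P.w_pos S (proj S.1 x)).ne'
    unfold popStep; field_simp
  simp_rw [e]
  rw [integral_sub, P.integral_mul_cexp S hv hφ hb, integral_mul_const, hv0, zero_mul, sub_zero]
  · exact hv.mul_bdd (c := b)
      ((P.measurable_cexp S hφ).comp (measurable_proj _)).aestronglyMeasurable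
      (Eventually.of_forall fun x => P.abs_cexp_le S hb _)
  · exact hv.mul_const _

end Setting

/-! ### Second moments of sample means -/

section SampleMean

variable {ι E : Type*} [Fintype ι] [DecidableEq ι] [MeasurableSpace E]
variable (μ : Measure E) [IsProbabilityMeasure μ]

theorem integral_eval_mul_eval {F G : E → ℝ} (hF : Measurable F) (hG : Measurable G) {B : ℝ}
    (hFB : ∀ y, |F y| ≤ B) (hGB : ∀ y, |G y| ≤ B) {i j : ι} (hij : i ≠ j) :
    ∫ X, F (X i) * G (X j) ∂Measure.pi (fun _ : ι => μ) = (∫ y, F y ∂μ) * ∫ y, G y ∂μ := by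
  have hFi : Measurable fun X : ι → E => F (X i) := hF.comp (measurable_pi_apply i)
  have hGj : Measurable fun X : ι → E => G (X j) := hG.comp (measurable_pi_apply j)
  have hFG : Measurable fun X : ι → E => F (X i) * G (X j) := hFi.mul hGj
  rw [integral_pi_piecewise (μ := fun _ : ι => μ) {i} hFG (B := B * B) (fun X => by
    rw [abs_mul]
    exact mul_le_mul (hFB _) (hGB _) (abs_nonneg _) ((abs_nonneg _).trans (hFB (X i))))]
  have : ∀ X Y : ι → E, F (({i} : Finset ι).piecewise X Y i) *
      G (({i} : Finset ι).piecewise X Y j) = F (X i) * G (Y j) := fun X Y => by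
    simp [Finset.piecewise, hij.symm]
  simp_rw [this, integral_const_mul]
  rw [integral_mul_const, integral_pi_eval (μ := fun _ : ι => μ) i hF,
    integral_pi_eval (μ := fun _ : ι => μ) j hG]

theorem integral_sq_sum_eval {G : E → ℝ} (hG : Measurable G) {B : ℝ} (hB : ∀ y, |G y| ≤ B)
    (h0 : ∫ y, G y ∂μ = 0) (I : Finset ι) :
    ∫ X, (∑ i ∈ I, G (X i)) ^ 2 ∂Measure.pi (fun _ : ι => μ) = I.card * ∫ y, G y ^ 2 ∂μ := by
  rw [integral_sq_sum_of_orthogonal (P := Measure.pi (fun _ : ι => μ)) I (G := fun i X => G (X i))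
    (fun i _ => memLp_of_bound (hG.comp (measurable_pi_apply i)) (fun _ => hB _) 2)
    (fun i _ j _ hij => by rw [integral_eval_mul_eval μ hG hG hB hB hij, h0, zero_mul])]
  simp_rw [integral_pi_eval (μ := fun _ : ι => μ) _ (hG.pow_const 2)]
  simp

theorem integral_sq_mean_eval {G : E → ℝ} (hG : Measurable G) {B : ℝ} (hB : ∀ y, |G y| ≤ B)
    (h0 : ∫ y, G y ∂μ = 0) (I : Finset ι) :
    ∫ X, ((I.card : ℝ)⁻¹ * ∑ i ∈ I, G (X i)) ^ 2 ∂Measure.pi (fun _ : ι => μ)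
      = (I.card : ℝ)⁻¹ * ∫ y, G y ^ 2 ∂μ := by
  simp_rw [mul_pow]
  rw [integral_const_mul, integral_sq_sum_eval μ hG hB h0]
  rcases I.eq_empty_or_nonempty with rfl | hI
  · simp
  · have : (I.card : ℝ) ≠ 0 := by simpa using hI.ne_empty
    field_simp

theorem sq_mean_le (I : Finset ι) (u : ι → ℝ) :
    ((I.card : ℝ)⁻¹ * ∑ i ∈ I, u i) ^ 2 ≤ (I.card : ℝ)⁻¹ * ∑ i ∈ I, u i ^ 2 := by
  rcases I.eq_empty_or_nonempty with rfl | hI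
  · simp
  have h0 : (0 : ℝ) < I.card := by exact_mod_cast hI.card_pos
  rw [mul_pow]
  calc (I.card : ℝ)⁻¹ ^ 2 * (∑ i ∈ I, u i) ^ 2
      ≤ (I.card : ℝ)⁻¹ ^ 2 * (I.card * ∑ i ∈ I, u i ^ 2) := by
        gcongr; exact sq_sum_le_card_mul_sum_sq
    _ = _ := by field_simp

theorem lintegral_mean_eval {g : E → ℝ≥0∞} (hg : Measurable g) {I : Finset ι} (hI : I.Nonempty) :
    ∫⁻ X, (I.card : ℝ≥0∞)⁻¹ * ∑ i ∈ I, g (X i) ∂Measure.pi (fun _ : ι => μ) = ∫⁻ y, g y ∂μ := by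
  have hm : ∀ i, Measurable fun X : ι → E => g (X i) := fun i => hg.comp (measurable_pi_apply i)
  rw [lintegral_const_mul _ (Finset.measurable_fun_sum _ fun i _ => hm i),
    lintegral_finsetSum _ fun i _ => hm i]
  simp_rw [lintegral_pi_eval (μ := fun _ : ι => μ) _ hg]
  rw [Finset.sum_const, nsmul_eq_mul, ← mul_assoc, ENNReal.inv_mul_cancel, one_mul]
  · simpa using hI.ne_empty
  · simp

theorem ofReal_inv_card_mul_sum {I : Finset ι} (hI : I.Nonempty) {u : ι → ℝ} (hu : ∀ i, 0 ≤ u i) :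
    ENNReal.ofReal ((I.card : ℝ)⁻¹ * ∑ i ∈ I, u i)
      = (I.card : ℝ≥0∞)⁻¹ * ∑ i ∈ I, ENNReal.ofReal (u i) := by
  have h0 : (0 : ℝ) < I.card := by exact_mod_cast hI.card_pos
  rw [ENNReal.ofReal_mul (by positivity), ENNReal.ofReal_inv_of_pos h0,
    ENNReal.ofReal_sum_of_nonneg fun i _ => hu i]
  simp

end SampleMean

/-! ### The kernel estimator as a local average -/

section KernelFormula

variable {d : ℕ}

theorem norm_glue_le_iff (S : Finset (Fin d)) (u : S → ℝ) (v : (Sᶜ : Finset (Fin d)) → ℝ) {t : ℝ}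
    (ht : 0 ≤ t) : ‖glue S u v‖ ≤ t ↔ ‖u‖ ≤ t ∧ ‖v‖ ≤ t := by
  simp only [pi_norm_le_iff_of_nonneg ht]
  constructor
  · intro h
    refine ⟨fun j => ?_, fun j => ?_⟩
    · have := h j
      simpa [glue] using this
    · have := h j
      have hj : (j : Fin d) ∉ S := Finset.mem_compl.1 j.2
      simpa [glue, hj] using this
  · rintro ⟨h1, h2⟩ j
    unfold glue
    split_ifs with hj
    · exact h1 _
    · exact h2 _

/-- The sup-norm ball is a product, so integrating out the other coordinates leaves an indicator.
Only the positivity of the constant matters, since the regression uses ratios. -/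
theorem kernelS_eq (S : Finset (Fin d)) {h : ℝ} (hh : 0 < h) :
    ∃ k : ℝ, 0 < k ∧ ∀ u : S → ℝ, kernelS S h u = k * if ‖u‖ ≤ h then 1 else 0 := by
  set vol : ℝ := (volume : Measure ((Sᶜ : Finset (Fin d)) → ℝ)).real {v | ‖v‖ ≤ 1} with hvol
  have hball : {v : (Sᶜ : Finset (Fin d)) → ℝ | ‖v‖ ≤ 1} = Metric.closedBall 0 1 := by
    ext v; simp
  have hvol0 : 0 < vol := by
    rw [hvol, hball, measureReal_def]
    exact ENNReal.toReal_pos (Metric.measure_closedBall_pos _ _ one_pos).ne'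
      (measure_closedBall_lt_top).ne
  refine ⟨(h ^ S.card)⁻¹ * ((2 : ℝ)⁻¹ ^ d * vol), by positivity, fun u => ?_⟩
  have hu : ‖h⁻¹ • u‖ ≤ 1 ↔ ‖u‖ ≤ h := by
    rw [norm_smul, norm_inv, Real.norm_of_nonneg hh.le, inv_mul_le_iff₀ hh, mul_one]
  have hk : ∀ v : (Sᶜ : Finset (Fin d)) → ℝ, unifKernel d (glue S (h⁻¹ • u) v)
      = (2 : ℝ)⁻¹ ^ d * (if ‖u‖ ≤ h then 1 else 0) *
        ({v : (Sᶜ : Finset (Fin d)) → ℝ | ‖v‖ ≤ 1}.indicator 1 v) := by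
    intro v
    unfold unifKernel
    simp only [norm_glue_le_iff S _ _ zero_le_one, hu, Set.indicator_apply, Set.mem_ofPred_eq,
      Pi.one_apply]
    by_cases h1 : ‖u‖ ≤ h <;> by_cases h2 : ‖v‖ ≤ 1 <;> simp [h1, h2]
  unfold kernelS
  simp_rw [hk]
  rw [integral_const_mul, integral_indicator_one (measurableSet_le (by fun_prop) measurable_const)]
  ring

end KernelFormula

section RegStep

variable {d n : ℕ} {SS : Finset (Finset (Fin d))}

/-- The empirical weighted mean subtracted in a regression step. -/
def wavg (r : (S : SS) → (S.1 → ℝ) → ℝ) (lam : SS → ℝ) (X : Fin n → Fin d → ℝ)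
    (I : Finset (Fin n)) (S : SS) (ψ : (Fin d → ℝ) → ℝ) : ℝ :=
  (∑ i ∈ I, what r lam X I S (proj S.1 (X i)) * ψ (X i)) /
    ∑ i ∈ I, what r lam X I S (proj S.1 (X i))

/-- The normalising constants of the kernel and the sample size cancel between numerator and density
estimate. The zero-denominator conventions also agree: the density estimate vanishes exactly when
the neighbourhood contains no observation. -/
theorem regStep_eq (r : (S : SS) → (S.1 → ℝ) → ℝ) (lam : SS → ℝ) (X : Fin n → Fin d → ℝ) {h : ℝ}
    (hh : 0 < h) (T : ℝ) (I : Finset (Fin n)) (S : SS) (φ : (Fin d → ℝ) → ℝ) (x : S.1 → ℝ) :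
    regStep r lam X h T I S φ x = if ‖x‖ ≤ T then what r lam X I S x *
      (localAvg (proj S.1) h I X (trunc T φ) x - wavg r lam X I S (trunc T φ)) else 0 := by
  unfold regStep
  split_ifs with hx
  · congr 2
    obtain ⟨k, hk0, hk⟩ := kernelS_eq S.1 hh
    have hki : ∀ i, kernelS S.1 h (x - proj S.1 (X i)) = k * ind (proj S.1) h x (X i) := fun i =>
      hk _
    unfold fhat localAvg
    simp_rw [hki]
    rw [← Finset.mul_sum]
    rcases I.eq_empty_or_nonempty with rfl | hI
    · simp
    have h0 : (0 : ℝ) < I.card := by exact_mod_cast hI.card_pos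
    set N := ∑ i ∈ I, ind (proj S.1) h x (X i) with hN
    by_cases hN0 : N = 0
    · simp [hN0]
    · rw [Finset.mul_sum, Finset.sum_div]
      refine Finset.sum_congr rfl fun i _ => ?_
      field_simp
  · rfl

theorem rhat_congr (r : (S : SS) → (S.1 → ℝ) → ℝ) {X Y : Fin n → Fin d → ℝ} {I : Finset (Fin n)}
    (h : ∀ i ∈ I, X i = Y i) (S : SS) : rhat r X I S = rhat r Y I S := by
  unfold rhat
  rw [Finset.sum_congr rfl fun i hi => by rw [h i hi]]

theorem what_congr (r : (S : SS) → (S.1 → ℝ) → ℝ) (lam : SS → ℝ) {X Y : Fin n → Fin d → ℝ}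
    {I : Finset (Fin n)} (h : ∀ i ∈ I, X i = Y i) (S : SS) (x : S.1 → ℝ) :
    what r lam X I S x = what r lam Y I S x := by
  unfold what
  rw [rhat_congr r h]

/-- Locality in the data, needed in order to condition on the other pieces. -/
theorem regStep_congr (r : (S : SS) → (S.1 → ℝ) → ℝ) (lam : SS → ℝ) {X Y : Fin n → Fin d → ℝ}
    (h T : ℝ) {I : Finset (Fin n)} (hXY : ∀ i ∈ I, X i = Y i) (S : SS) (φ : (Fin d → ℝ) → ℝ)
    (x : S.1 → ℝ) : regStep r lam X h T I S φ x = regStep r lam Y h T I S φ x := by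
  have hf : fhat X I h S.1 x = fhat Y I h S.1 x := by
    unfold fhat
    rw [Finset.sum_congr rfl fun i hi => by rw [hXY i hi]]
  have h1 : ∑ i ∈ I, trunc T φ (X i) * (kernelS S.1 h (x - proj S.1 (X i)) / fhat X I h S.1 x)
      = ∑ i ∈ I, trunc T φ (Y i) * (kernelS S.1 h (x - proj S.1 (Y i)) / fhat Y I h S.1 x) :=
    Finset.sum_congr rfl fun i hi => by rw [hXY i hi, hf]
  have h2 : ∑ i ∈ I, what r lam X I S (proj S.1 (X i)) * trunc T φ (X i)
      = ∑ i ∈ I, what r lam Y I S (proj S.1 (Y i)) * trunc T φ (Y i) :=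
    Finset.sum_congr rfl fun i hi => by rw [hXY i hi, what_congr r lam hXY]
  have h3 : ∑ i ∈ I, what r lam X I S (proj S.1 (X i))
      = ∑ i ∈ I, what r lam Y I S (proj S.1 (Y i)) :=
    Finset.sum_congr rfl fun i hi => by rw [hXY i hi, what_congr r lam hXY]
  unfold regStep
  rw [what_congr r lam hXY, h1, h2, h3]

theorem regStep_empty (r : (S : SS) → (S.1 → ℝ) → ℝ) (lam : SS → ℝ) (X : Fin n → Fin d → ℝ)
    (h T : ℝ) (S : SS) (φ : (Fin d → ℝ) → ℝ) (x : S.1 → ℝ) :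
    regStep r lam X h T ∅ S φ x = 0 := by
  simp [regStep]

theorem wavg_sub (r : (S : SS) → (S.1 → ℝ) → ℝ) (lam : SS → ℝ) (X : Fin n → Fin d → ℝ)
    (I : Finset (Fin n)) (S : SS) (ψ χ : (Fin d → ℝ) → ℝ) :
    wavg r lam X I S (fun y => ψ y - χ y) = wavg r lam X I S ψ - wavg r lam X I S χ := by
  unfold wavg
  rw [← sub_div, ← Finset.sum_sub_distrib]
  simp_rw [mul_sub]

end RegStep

/-! ### Estimated weights and the empirical weighted mean -/

namespace Setting

variable {d n : ℕ} {SS : Finset (Finset (Fin d))} (P : Setting SS)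

/-- The upper bound `λ C / (1 + λ C)` for the weight. -/
def wmax (S : SS) : ℝ := P.lam S * P.C / (1 + P.lam S * P.C)

theorem C_pos (S : SS) : 0 < P.C := zero_lt_one.trans_le (P.one_le_C S)

theorem wmax_pos (S : SS) : 0 < P.wmax S := by
  have := P.lam_pos S
  have := P.C_pos S
  unfold wmax; positivity

theorem w_le_wmax (S : SS) (x : S.1 → ℝ) : P.w S x ≤ P.wmax S := by
  have hl := P.lam_pos S
  have hC := P.C_pos S
  have hr := P.lam_r_pos S x
  unfold w wmax
  rw [div_le_div_iff₀ (by positivity) (by positivity)]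
  nlinarith [mul_le_mul_of_nonneg_left (P.r_le S x) hl.le]

/-- All weights are within a factor C/c of `wmax`, uniformly in λ. Measuring everything relative to
`wmax` keeps λ out of the one-step error bound. -/
theorem wmax_mul_le_w (S : SS) (x : S.1 → ℝ) : P.wmax S * (P.c / P.C) ≤ P.w S x := by
  have hl := P.lam_pos S
  have hC := P.C_pos S
  have hc := P.c_pos
  have hr := P.lam_r_pos S x
  have e : P.wmax S * (P.c / P.C) = P.lam S * P.c / (1 + P.lam S * P.C) := by
    unfold wmax; field_simp
  rw [e]
  unfold w
  have h1 : P.lam S * P.c ≤ P.lam S * P.r S x := by gcongr; exact P.r_ge S x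
  have h2 : P.lam S * P.r S x ≤ P.lam S * P.C := by gcongr; exact P.r_le S x
  gcongr

variable (X : Fin n → Fin d → ℝ) {I : Finset (Fin n)}

theorem rhat_le (I : Finset (Fin n)) (S : SS) : rhat P.r X I S ≤ P.C := by
  rcases I.eq_empty_or_nonempty with rfl | hI
  · simpa [rhat] using (P.C_pos S).le
  have h0 : (0 : ℝ) < I.card := by exact_mod_cast hI.card_pos
  unfold rhat
  rw [div_le_iff₀ h0, mul_comm, ← nsmul_eq_mul]
  exact Finset.sum_le_card_nsmul _ _ _ fun i _ => P.r_le _ _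

theorem rhat_nonneg (I : Finset (Fin n)) (S : SS) : 0 ≤ rhat P.r X I S :=
  div_nonneg (Finset.sum_nonneg fun _ _ => (P.r_pos _ _).le) (Nat.cast_nonneg _)

theorem what_pos (I : Finset (Fin n)) (S : SS) (x : S.1 → ℝ) : 0 < what P.r P.lam X I S x :=
  div_pos (P.lam_r_pos S x) (by linarith [P.lam_r_pos S x, P.rhat_nonneg X I S])

theorem what_le_one (I : Finset (Fin n)) (S : SS) (x : S.1 → ℝ) : what P.r P.lam X I S x ≤ 1 :=
  div_le_one_of_le₀ (by linarith [P.rhat_nonneg X I S])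
    (by linarith [P.lam_r_pos S x, P.rhat_nonneg X I S])

/-- The map s ↦ s/(ρ+s) increases sublinearly, so the ratio of two weights is at most the ratio C/c
of the shifts, whatever the value of ρ ≥ 0. -/
theorem what_le_ratio_mul (I : Finset (Fin n)) (S : SS) (x y : S.1 → ℝ) :
    what P.r P.lam X I S x ≤ P.C / P.c * what P.r P.lam X I S y := by
  have hl := P.lam_pos S
  have hc := P.c_pos
  have hC := P.C_pos S
  have hx := P.lam_r_pos S x
  have hy := P.lam_r_pos S y
  have hρ := P.rhat_nonneg X I S
  unfold what
  set ρ := rhat P.r X I S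
  set s := P.lam S * P.r S x with hs
  set t := P.lam S * P.r S y with ht
  have hst : P.c * s ≤ P.C * t := by
    have h1 : P.c * s ≤ P.c * (P.lam S * P.C) := by rw [hs]; gcongr; exact P.r_le S x
    have h2 : P.C * (P.lam S * P.c) ≤ P.C * t := by rw [ht]; gcongr; exact P.r_ge S y
    nlinarith
  rw [div_mul_div_comm, div_le_div_iff₀ (by positivity) (by positivity)]
  have hcC := P.c_le_C S
  nlinarith [mul_le_mul_of_nonneg_right hst hρ, mul_le_mul_of_nonneg_right hcC
    (mul_pos hx hy).le]

/-- With ρ the empirical normalisation, the error of the weight is exactly the weight times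
(1-ρ)/(1+λr). Keeping the weight as a factor lets it cancel inside weighted means. -/
theorem abs_what_sub_w_le (I : Finset (Fin n)) (S : SS) (x : S.1 → ℝ) :
    |what P.r P.lam X I S x - P.w S x| ≤ what P.r P.lam X I S x * |rhat P.r X I S - 1| := by
  have hx := P.lam_r_pos S x
  have hρ := P.rhat_nonneg X I S
  have e : what P.r P.lam X I S x - P.w S x = what P.r P.lam X I S x *
      ((1 - rhat P.r X I S) / (1 + P.lam S * P.r S x)) := by
    unfold what w
    have : rhat P.r X I S + P.lam S * P.r S x ≠ 0 := by positivity
    field_simp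
    ring
  rw [e, abs_mul, abs_of_pos (P.what_pos X I S x), abs_div, abs_sub_comm]
  refine mul_le_mul_of_nonneg_left (div_le_self (abs_nonneg _) ?_) (P.what_pos X I S x).le
  rw [abs_of_pos (by positivity)]
  linarith

theorem sum_what_pos (hI : I.Nonempty) (S : SS) :
    0 < ∑ i ∈ I, what P.r P.lam X I S (proj S.1 (X i)) :=
  Finset.sum_pos (fun _ _ => P.what_pos X I S _) hI

theorem abs_wavg_le {ψ : (Fin d → ℝ) → ℝ} {b : ℝ} (hb : ∀ y, |ψ y| ≤ b) (I : Finset (Fin n))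
    (S : SS) : |wavg P.r P.lam X I S ψ| ≤ b := by
  have hb0 : 0 ≤ b := (abs_nonneg _).trans (hb 0)
  rcases I.eq_empty_or_nonempty with rfl | hI
  · simpa [wavg] using hb0
  have h0 := P.sum_what_pos X hI S
  unfold wavg
  rw [abs_div, abs_of_pos h0, div_le_iff₀ h0, Finset.mul_sum]
  refine (Finset.abs_sum_le_sum_abs _ _).trans (Finset.sum_le_sum fun i _ => ?_)
  rw [abs_mul, abs_of_pos (P.what_pos X I S _), mul_comm]
  exact mul_le_mul_of_nonneg_right (hb _) (P.what_pos X I S _).le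

/-- Jensen for the normalised weights, each of which is at most C/c times the uniform weight 1/|I|.
-/
theorem sq_wavg_le (I : Finset (Fin n)) (S : SS) (g : (Fin d → ℝ) → ℝ) :
    wavg P.r P.lam X I S g ^ 2 ≤ P.C / P.c * ((I.card : ℝ)⁻¹ * ∑ i ∈ I, g (X i) ^ 2) := by
  rcases I.eq_empty_or_nonempty with rfl | hI
  · simp [wavg]
  have h0 := P.sum_what_pos X hI S
  have hn : (0 : ℝ) < I.card := by exact_mod_cast hI.card_pos
  have hq : 0 < P.C / P.c := div_pos (P.C_pos S) P.c_pos
  set v : Fin n → ℝ := fun i => what P.r P.lam X I S (proj S.1 (X i)) with hv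
  have hv0 : ∀ i, 0 < v i := fun i => P.what_pos X I S _
  have hcs := Finset.sum_sq_le_sum_mul_sum_of_sq_le_mul I
    (r := fun i => v i * g (X i)) (f := v) (g := fun i => v i * g (X i) ^ 2)
    (fun i _ => (hv0 i).le) (fun i _ => mul_nonneg (hv0 i).le (sq_nonneg _))
    (fun i _ => le_of_eq (by ring))
  have hvi : ∀ i, v i * I.card ≤ P.C / P.c * ∑ j ∈ I, v j := fun i => by
    rw [Finset.mul_sum, mul_comm, ← nsmul_eq_mul]
    exact Finset.card_nsmul_le_sum _ _ _ fun j _ => P.what_le_ratio_mul X I S _ _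
  have hsum : (∑ i ∈ I, v i * g (X i) ^ 2) * I.card
      ≤ P.C / P.c * (∑ j ∈ I, v j) * ∑ i ∈ I, g (X i) ^ 2 := by
    rw [Finset.sum_mul, Finset.mul_sum]
    refine Finset.sum_le_sum fun i _ => ?_
    have := mul_le_mul_of_nonneg_right (hvi i) (sq_nonneg (g (X i)))
    linarith
  have hdef : wavg P.r P.lam X I S g = (∑ i ∈ I, v i * g (X i)) / ∑ i ∈ I, v i := rfl
  rw [hdef, div_pow, div_le_iff₀ (by positivity)]
  refine hcs.trans ?_
  have : ∑ i ∈ I, v i * g (X i) ^ 2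
      ≤ (P.C / P.c * (∑ j ∈ I, v j) * ∑ i ∈ I, g (X i) ^ 2) * (I.card : ℝ)⁻¹ := by
    rw [← div_eq_mul_inv, le_div_iff₀ hn]; exact hsum
  calc (∑ i ∈ I, v i) * ∑ i ∈ I, v i * g (X i) ^ 2
      ≤ (∑ i ∈ I, v i) * ((P.C / P.c * (∑ j ∈ I, v j) * ∑ i ∈ I, g (X i) ^ 2) *
          (I.card : ℝ)⁻¹) := by gcongr
    _ = _ := by ring

/-- Replacing estimated by population weights costs |ρ - 1|. What remains is a sample mean with
known weights, divided by a sum of estimated weights that must be bounded below. -/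
theorem abs_wavg_sub_le (hI : I.Nonempty) (S : SS) {ψ : (Fin d → ℝ) → ℝ} {b c₀ : ℝ}
    (hb : ∀ y, |ψ y| ≤ b) (hc₀ : |c₀| ≤ b) :
    |wavg P.r P.lam X I S ψ - c₀| ≤ 2 * b * |rhat P.r X I S - 1| +
      2 * (P.C / P.c) / P.wmax S *
        |(I.card : ℝ)⁻¹ * ∑ i ∈ I, P.w S (proj S.1 (X i)) * (ψ (X i) - c₀)| := by
  have hb0 : 0 ≤ b := (abs_nonneg _).trans hc₀
  have hq : 0 < P.C / P.c := div_pos (P.C_pos S) P.c_pos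
  have hwm := P.wmax_pos S
  have hψc : ∀ y, |ψ y - c₀| ≤ 2 * b := fun y => (abs_sub _ _).trans (by linarith [hb y])
  set ρ := rhat P.r X I S with hρ
  set W := (I.card : ℝ)⁻¹ * ∑ i ∈ I, P.w S (proj S.1 (X i)) * (ψ (X i) - c₀) with hW
  -- For ρ > 2 the trivial bound 2b suffices, since then |ρ - 1| ≥ 1. Otherwise ρ + λr ≤ 2(1 + λr),
  -- and the estimated weights are at least half the population weights.
  rcases lt_or_ge 2 ρ with h2 | h2
  · have h1 : |wavg P.r P.lam X I S ψ - c₀| ≤ 2 * b :=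
      (abs_sub _ _).trans (by linarith [P.abs_wavg_le X hb I S])
    have h3 : 1 ≤ |ρ - 1| := by rw [abs_of_pos (by linarith)]; linarith
    have h4 : 0 ≤ 2 * (P.C / P.c) / P.wmax S * |W| := by positivity
    nlinarith
  · have h0 := P.sum_what_pos X hI S
    have hn : (0 : ℝ) < I.card := by exact_mod_cast hI.card_pos
    set v : Fin n → ℝ := fun i => what P.r P.lam X I S (proj S.1 (X i)) with hv
    have hv0 : ∀ i, 0 < v i := fun i => P.what_pos X I S _
    have hlow : P.wmax S / (2 * (P.C / P.c)) * I.card ≤ ∑ i ∈ I, v i := by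
      rw [mul_comm, ← nsmul_eq_mul]
      refine Finset.card_nsmul_le_sum _ _ _ fun i _ => ?_
      have hx := P.lam_r_pos S (proj S.1 (X i))
      have hρ0 := P.rhat_nonneg X I S
      have e1 : P.w S (proj S.1 (X i)) / 2 ≤ v i := by
        simp only [hv, w, what]
        rw [div_div, ← hρ]
        gcongr
        linarith
      have e2 := P.wmax_mul_le_w S (proj S.1 (X i))
      have e3 : P.wmax S / (2 * (P.C / P.c)) = P.wmax S * (P.c / P.C) / 2 := by
        have := P.c_pos; have := P.C_pos S; field_simp
      rw [e3]; linarith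
    have e : wavg P.r P.lam X I S ψ - c₀ = (∑ i ∈ I, (v i - P.w S (proj S.1 (X i))) *
        (ψ (X i) - c₀)) / (∑ i ∈ I, v i) + I.card * W / ∑ i ∈ I, v i := by
      have e1 : I.card * W = ∑ i ∈ I, P.w S (proj S.1 (X i)) * (ψ (X i) - c₀) := by
        rw [hW]; field_simp
      rw [e1, ← add_div, ← Finset.sum_add_distrib]
      have e2 : ∑ i ∈ I, ((v i - P.w S (proj S.1 (X i))) * (ψ (X i) - c₀)
          + P.w S (proj S.1 (X i)) * (ψ (X i) - c₀))
          = ∑ i ∈ I, v i * ψ (X i) - (∑ i ∈ I, v i) * c₀ := by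
        rw [Finset.sum_mul, ← Finset.sum_sub_distrib]
        exact Finset.sum_congr rfl fun i _ => by ring
      rw [e2, sub_div, mul_div_cancel_left₀ _ h0.ne']
      rfl
    rw [e]
    refine (abs_add_le _ _).trans (add_le_add ?_ ?_)
    · rw [abs_div, abs_of_pos h0, div_le_iff₀ h0, Finset.mul_sum]
      refine (Finset.abs_sum_le_sum_abs _ _).trans (Finset.sum_le_sum fun i _ => ?_)
      rw [abs_mul]
      have h1 := P.abs_what_sub_w_le X I S (proj S.1 (X i))
      calc |v i - P.w S (proj S.1 (X i))| * |ψ (X i) - c₀|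
          ≤ (v i * |ρ - 1|) * (2 * b) := mul_le_mul h1 (hψc _) (abs_nonneg _)
            (mul_nonneg (hv0 i).le (abs_nonneg _))
        _ = _ := by ring
    · rw [abs_div, abs_of_pos h0, abs_mul, abs_of_pos hn, div_le_iff₀ h0]
      have : 2 * (P.C / P.c) / P.wmax S * |W| * (P.wmax S / (2 * (P.C / P.c)) * I.card)
          = I.card * |W| := by
        have := P.c_pos; have := P.C_pos S; field_simp
      rw [← this]
      gcongr

end Setting

theorem sq_add_add_le (x y z : ℝ) : (x + y + z) ^ 2 ≤ 3 * x ^ 2 + 3 * y ^ 2 + 3 * z ^ 2 := by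
  nlinarith [sq_nonneg (x - y), sq_nonneg (x - z), sq_nonneg (y - z)]

/-! ### Truncation to a ball -/

section Trunc

variable {d : ℕ}

theorem measurable_trunc {T : ℝ} {φ : (Fin d → ℝ) → ℝ} (hφ : Measurable φ) :
    Measurable (trunc T φ) :=
  Measurable.ite (measurableSet_le (by fun_prop) measurable_const) hφ measurable_const

theorem abs_trunc_le {T : ℝ} {φ : (Fin d → ℝ) → ℝ} {b : ℝ} (hb : ∀ x, |φ x| ≤ b)
    (x : Fin d → ℝ) : |trunc T φ x| ≤ b := by
  unfold trunc
  split_ifs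
  · exact hb x
  · simpa using (abs_nonneg _).trans (hb x)

theorem sq_trunc_sub_trunc_le (T : ℝ) (φ ψ : (Fin d → ℝ) → ℝ) (x : Fin d → ℝ) :
    (trunc T φ x - trunc T ψ x) ^ 2 ≤ (φ x - ψ x) ^ 2 := by
  unfold trunc
  split_ifs
  · exact le_rfl
  · simpa using sq_nonneg _

theorem lintegral_sq_sub_trunc_le (μ : Measure (Fin d → ℝ)) [IsProbabilityMeasure μ] (T : ℝ)
    {φ : (Fin d → ℝ) → ℝ} {b : ℝ} (hb : ∀ x, |φ x| ≤ b) :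
    ∫⁻ y, ENNReal.ofReal ((φ y - trunc T φ y) ^ 2) ∂μ
      ≤ ENNReal.ofReal (b ^ 2 * μ.real {x | T ≤ ‖x‖}) := by
  have hs : MeasurableSet {x : Fin d → ℝ | T ≤ ‖x‖} := measurableSet_le measurable_const (by fun_prop)
  calc ∫⁻ y, ENNReal.ofReal ((φ y - trunc T φ y) ^ 2) ∂μ
      ≤ ∫⁻ y, {x : Fin d → ℝ | T ≤ ‖x‖}.indicator (fun _ => ENNReal.ofReal (b ^ 2)) y ∂μ := by
        refine lintegral_mono fun y => ?_
        simp only [Set.indicator_apply, Set.mem_ofPred_eq, trunc]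
        by_cases h1 : ‖y‖ ≤ T
        · simp [h1]
        · rw [if_neg h1, if_pos (not_le.1 h1).le, sub_zero]
          exact ENNReal.ofReal_le_ofReal (sq_le_sq.2 ((hb y).trans (le_abs_self b)))
    _ = _ := by
        rw [lintegral_indicator hs, lintegral_const, Measure.restrict_apply_univ,
          ENNReal.ofReal_mul (by positivity), ofReal_measureReal]

end Trunc

/-! ### Error of one estimated regression step -/

namespace Setting

variable {d n : ℕ} {SS : Finset (Finset (Fin d))} (P : Setting SS)

theorem measurable_rhat (I : Finset (Fin n)) (S : SS) :
    Measurable fun X : Fin n → Fin d → ℝ => rhat P.r X I S := by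
  unfold rhat
  exact (Finset.measurable_fun_sum _ fun i _ => (P.r_meas S).comp
    ((measurable_proj _).comp (measurable_pi_apply i))).div_const _

theorem integral_sq_r_sub_one_le (S : SS) : ∫ x, (P.r S (proj S.1 x) - 1) ^ 2 ∂P.μ ≤ P.C := by
  have hi := P.integrable_r S
  have hi2 : Integrable (fun x => P.C * P.r S (proj S.1 x)) P.μ := hi.const_mul _
  calc ∫ x, (P.r S (proj S.1 x) - 1) ^ 2 ∂P.μ
      ≤ ∫ x, (P.C * P.r S (proj S.1 x) - 2 * P.r S (proj S.1 x) + 1) ∂P.μ := by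
        refine integral_mono_of_nonneg (Eventually.of_forall fun _ => sq_nonneg _)
          ((hi2.sub (hi.const_mul 2)).add (integrable_const 1)) (Eventually.of_forall fun x => ?_)
        simp only
        nlinarith [P.r_le S (proj S.1 x), P.r_pos S (proj S.1 x)]
    _ = P.C - 1 := by
        have hi3 : Integrable (fun x => P.C * P.r S (proj S.1 x) - 2 * P.r S (proj S.1 x)) P.μ :=
          hi2.sub (hi.const_mul 2)
        rw [integral_add hi3 (integrable_const 1),
          integral_sub hi2 (hi.const_mul 2), integral_const_mul, integral_const_mul, P.r_mean]
        simp; ring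
    _ ≤ P.C := by linarith

theorem abs_r_sub_one_le (S : SS) (x : S.1 → ℝ) : |P.r S x - 1| ≤ P.C := by
  have := P.one_le_C S
  exact abs_le.2 ⟨by linarith [P.r_pos S x], by linarith [P.r_le S x]⟩

theorem rhat_sub_one {I : Finset (Fin n)} (hI : I.Nonempty) (X : Fin n → Fin d → ℝ) (S : SS) :
    rhat P.r X I S - 1 = (I.card : ℝ)⁻¹ * ∑ i ∈ I, (P.r S (proj S.1 (X i)) - 1) := by
  have h0 : (I.card : ℝ) ≠ 0 := by simpa using hI.ne_empty
  unfold rhat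
  rw [Finset.sum_sub_distrib]
  simp
  field_simp

theorem integral_sq_rhat_sub_one_le {I : Finset (Fin n)} (hI : I.Nonempty) (S : SS) :
    ∫ X, (rhat P.r X I S - 1) ^ 2 ∂Measure.pi (fun _ : Fin n => P.μ) ≤ P.C / I.card := by
  simp_rw [P.rhat_sub_one hI]
  have h0 : ∫ x, (P.r S (proj S.1 x) - 1) ∂P.μ = 0 := by
    rw [integral_sub (P.integrable_r S) (integrable_const 1), P.r_mean]; simp
  rw [integral_sq_mean_eval P.μ (G := fun x => P.r S (proj S.1 x) - 1)
    (((P.r_meas S).comp (measurable_proj _)).sub_const 1) (fun x => P.abs_r_sub_one_le S _) h0 I,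
    div_eq_inv_mul]
  gcongr
  exact P.integral_sq_r_sub_one_le S

theorem lintegral_sq_rhat_sub_one_le {I : Finset (Fin n)} (hI : I.Nonempty) (S : SS) :
    ∫⁻ X, ENNReal.ofReal ((rhat P.r X I S - 1) ^ 2) ∂Measure.pi (fun _ : Fin n => P.μ)
      ≤ ENNReal.ofReal (P.C / I.card) := by
  rw [lintegral_ofReal_eq (((P.measurable_rhat I S).sub_const 1).pow_const 2)
    (fun _ => sq_nonneg _) (B := P.C ^ 2)]
  · exact ENNReal.ofReal_le_ofReal (P.integral_sq_rhat_sub_one_le hI S)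
  · intro X
    have := P.one_le_C S
    refine sq_le_sq.2 ((abs_le.2 ⟨?_, ?_⟩).trans (le_abs_self P.C)) <;>
      linarith [P.rhat_nonneg X I S, P.rhat_le X I S]

/-- Bound one factor w by `wmax`; then E[w(φ-m)²] = E[wφ²] - m² E[w] is at most `wmax` b². The
resulting `wmax`² cancels the 1/`wmax`² that arises from dividing by the sum of weights. -/
theorem integral_sq_w_mul_sub_wmean_le (S : SS) {φ : (Fin d → ℝ) → ℝ} (hφ : Measurable φ) {b : ℝ}
    (hb : ∀ x, |φ x| ≤ b) :
    ∫ x, (P.w S (proj S.1 x) * (φ x - P.wmean S φ)) ^ 2 ∂P.μ ≤ P.wmax S ^ 2 * b ^ 2 := by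
  set m := P.wmean S φ with hm
  have hw := P.integrable_w S
  have hwφ := P.integrable_w_mul S hφ hb
  have hb2 : ∀ x, |φ x ^ 2| ≤ b ^ 2 := fun x => by
    rw [abs_pow]; exact pow_le_pow_left₀ (abs_nonneg _) (hb x) 2
  have hwφ2 := P.integrable_w_mul S (hφ.pow_const 2) hb2
  have hmw : (∫ x, P.w S (proj S.1 x) * φ x ∂P.μ) = m * ∫ x, P.w S (proj S.1 x) ∂P.μ := by
    rw [hm, wmean, div_mul_cancel₀ _ (P.integral_w_pos S).ne']
  have hint : Integrable (fun x => P.w S (proj S.1 x) * φ x ^ 2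
      - 2 * m * (P.w S (proj S.1 x) * φ x) + m ^ 2 * P.w S (proj S.1 x)) P.μ :=
    (hwφ2.sub (hwφ.const_mul _)).add (hw.const_mul _)
  have hmax := P.wmax_pos S
  calc ∫ x, (P.w S (proj S.1 x) * (φ x - m)) ^ 2 ∂P.μ
      ≤ ∫ x, P.wmax S * (P.w S (proj S.1 x) * φ x ^ 2
          - 2 * m * (P.w S (proj S.1 x) * φ x) + m ^ 2 * P.w S (proj S.1 x)) ∂P.μ := by
        refine integral_mono_of_nonneg (Eventually.of_forall fun _ => sq_nonneg _)
          (hint.const_mul _) (Eventually.of_forall fun x => ?_)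
        simp only
        have h1 := P.w_le_wmax S (proj S.1 x)
        have h2 := P.w_pos S (proj S.1 x)
        have : P.w S (proj S.1 x) * (P.w S (proj S.1 x) * (φ x - m) ^ 2)
            ≤ P.wmax S * (P.w S (proj S.1 x) * (φ x - m) ^ 2) := by gcongr
        nlinarith
    _ = P.wmax S * ((∫ x, P.w S (proj S.1 x) * φ x ^ 2 ∂P.μ)
          - m ^ 2 * ∫ x, P.w S (proj S.1 x) ∂P.μ) := by
        have hsub : Integrable (fun x => P.w S (proj S.1 x) * φ x ^ 2
            - 2 * m * (P.w S (proj S.1 x) * φ x)) P.μ := hwφ2.sub (hwφ.const_mul _)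
        rw [integral_const_mul, integral_add hsub (hw.const_mul _),
          integral_sub hwφ2 (hwφ.const_mul _), integral_const_mul, integral_const_mul, hmw]
        ring
    _ ≤ P.wmax S * (P.wmax S * b ^ 2) := by
        gcongr
        have h1 : ∫ x, P.w S (proj S.1 x) * φ x ^ 2 ∂P.μ ≤ ∫ _, P.wmax S * b ^ 2 ∂P.μ := by
          refine integral_mono hwφ2 (integrable_const _) fun x => ?_
          simp only
          refine mul_le_mul (P.w_le_wmax S _) ((le_abs_self _).trans (hb2 x)) (sq_nonneg _) hmax.le
        have h2 : 0 ≤ m ^ 2 * ∫ x, P.w S (proj S.1 x) ∂P.μ :=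
          mul_nonneg (sq_nonneg _) (P.integral_w_pos S).le
        simp only [integral_const, probReal_univ, smul_eq_mul, one_mul] at h1
        linarith
    _ = _ := by ring

/-- Split ψ into φ and ψ - φ: the first gives a mean of independent centred terms, of variance of
order 1/|I|; the second is bounded by Jensen. It is applied with ψ the truncation of φ. -/
theorem lintegral_sq_mean_w_le {I : Finset (Fin n)} (hI : I.Nonempty) (S : SS)
    {φ ψ : (Fin d → ℝ) → ℝ} (hφ : Measurable φ) (hψ : Measurable ψ) {b : ℝ}
    (hb : ∀ x, |φ x| ≤ b) :
    ∫⁻ X, ENNReal.ofReal (((I.card : ℝ)⁻¹ * ∑ i ∈ I, P.w S (proj S.1 (X i)) *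
        (ψ (X i) - P.wmean S φ)) ^ 2) ∂Measure.pi (fun _ : Fin n => P.μ)
      ≤ ENNReal.ofReal (2 * P.wmax S ^ 2) * (ENNReal.ofReal (b ^ 2 / I.card)
        + ∫⁻ y, ENNReal.ofReal ((φ y - ψ y) ^ 2) ∂P.μ) := by
  set G : (Fin d → ℝ) → ℝ := fun x => P.w S (proj S.1 x) * (φ x - P.wmean S φ) with hG
  have hmax := P.wmax_pos S
  have hwm : Measurable fun x : Fin d → ℝ => P.w S (proj S.1 x) :=
    (P.measurable_w S).comp (measurable_proj _)
  have hGm : Measurable G := hwm.mul (hφ.sub_const _)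
  have hGb : ∀ x, |G x| ≤ 2 * b := fun x => by
    rw [hG, abs_mul, abs_of_pos (P.w_pos _ _)]
    have h1 : |φ x - P.wmean S φ| ≤ 2 * b :=
      (abs_sub _ _).trans (by linarith [hb x, P.abs_wmean_le S hb])
    calc _ ≤ 1 * (2 * b) := mul_le_mul (P.w_le_one _ _) h1 (abs_nonneg _) zero_le_one
      _ = 2 * b := one_mul _
  have hG0 : ∫ x, G x ∂P.μ = 0 := by
    simp only [hG, mul_sub]
    rw [integral_sub (P.integrable_w_mul S hφ hb) ((P.integrable_w S).mul_const _),
      integral_mul_const, wmean, mul_div_cancel₀ _ (P.integral_w_pos S).ne', sub_self]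
  set H : (Fin d → ℝ) → ℝ := fun x => P.w S (proj S.1 x) * (φ x - ψ x) with hH
  have hHm : Measurable H := hwm.mul (hφ.sub hψ)
  have hpt : ∀ X : Fin n → Fin d → ℝ, ((I.card : ℝ)⁻¹ * ∑ i ∈ I, P.w S (proj S.1 (X i)) *
        (ψ (X i) - P.wmean S φ)) ^ 2 ≤ 2 * ((I.card : ℝ)⁻¹ * ∑ i ∈ I, G (X i)) ^ 2
        + 2 * ((I.card : ℝ)⁻¹ * ∑ i ∈ I, H (X i) ^ 2) := by
    intro X
    have e : (I.card : ℝ)⁻¹ * ∑ i ∈ I, P.w S (proj S.1 (X i)) * (ψ (X i) - P.wmean S φ)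
        = (I.card : ℝ)⁻¹ * ∑ i ∈ I, G (X i) - (I.card : ℝ)⁻¹ * ∑ i ∈ I, H (X i) := by
      rw [← mul_sub, ← Finset.sum_sub_distrib]
      congr 1
      exact Finset.sum_congr rfl fun i _ => by simp only [hG, hH]; ring
    rw [e]
    have h1 := sq_mean_le I fun i => H (X i)
    nlinarith [sq_nonneg ((I.card : ℝ)⁻¹ * ∑ i ∈ I, G (X i) + (I.card : ℝ)⁻¹ * ∑ i ∈ I, H (X i))]
  have hm1 : Measurable fun X : Fin n → Fin d → ℝ =>
      ((I.card : ℝ)⁻¹ * ∑ i ∈ I, G (X i)) ^ 2 :=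
    ((Finset.measurable_fun_sum _ fun i _ => hGm.comp (measurable_pi_apply i)).const_mul
      _).pow_const 2
  have hGI : ∀ X : Fin n → Fin d → ℝ, ((I.card : ℝ)⁻¹ * ∑ i ∈ I, G (X i)) ^ 2 ≤ (2 * b) ^ 2 := by
    intro X
    refine (sq_mean_le I _).trans ?_
    have h0 : (0 : ℝ) < I.card := by exact_mod_cast hI.card_pos
    rw [inv_mul_le_iff₀ h0, ← nsmul_eq_mul]
    exact Finset.sum_le_card_nsmul _ _ _ fun i _ => sq_le_sq.2 ((hGb _).trans (le_abs_self _))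
  calc _ ≤ ∫⁻ X, (2 * ENNReal.ofReal (((I.card : ℝ)⁻¹ * ∑ i ∈ I, G (X i)) ^ 2)
        + 2 * ((I.card : ℝ≥0∞)⁻¹ * ∑ i ∈ I, ENNReal.ofReal (H (X i) ^ 2)))
        ∂Measure.pi (fun _ : Fin n => P.μ) := by
        refine lintegral_mono fun X => (ENNReal.ofReal_le_ofReal (hpt X)).trans ?_
        rw [← ofReal_inv_card_mul_sum hI fun i => sq_nonneg _]
        have h2 : (2 : ℝ≥0∞) = ENNReal.ofReal 2 := by simp
        rw [h2, ← ENNReal.ofReal_mul (by norm_num), ← ENNReal.ofReal_mul (by norm_num)]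
        exact ENNReal.ofReal_add_le
    _ = 2 * ENNReal.ofReal ((I.card : ℝ)⁻¹ * ∫ y, G y ^ 2 ∂P.μ)
        + 2 * ∫⁻ y, ENNReal.ofReal (H y ^ 2) ∂P.μ := by
        rw [lintegral_add_left (hm1.ennreal_ofReal.const_mul 2),
          lintegral_const_mul _ hm1.ennreal_ofReal,
          lintegral_ofReal_eq hm1 (fun _ => sq_nonneg _) hGI,
          integral_sq_mean_eval P.μ hGm hGb hG0,
          lintegral_const_mul' _ _ (by simp),
          lintegral_mean_eval P.μ (hHm.pow_const 2).ennreal_ofReal hI]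
    _ ≤ 2 * ENNReal.ofReal ((I.card : ℝ)⁻¹ * (P.wmax S ^ 2 * b ^ 2))
        + 2 * ∫⁻ y, ENNReal.ofReal (P.wmax S ^ 2) * ENNReal.ofReal ((φ y - ψ y) ^ 2) ∂P.μ := by
        gcongr with y
        · exact P.integral_sq_w_mul_sub_wmean_le S hφ hb
        · rw [← ENNReal.ofReal_mul (by positivity)]
          refine ENNReal.ofReal_le_ofReal ?_
          rw [hH, mul_pow]
          gcongr
          · exact (P.w_pos _ _).le
          · exact P.w_le_wmax _ _
    _ = _ := by
        have hd : Measurable fun y => ENNReal.ofReal ((φ y - ψ y) ^ 2) :=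
          ((hφ.sub hψ).pow_const 2).ennreal_ofReal
        rw [lintegral_const_mul _ hd, mul_add,
          ENNReal.ofReal_mul (p := 2) (by norm_num)]
        have h2 : ENNReal.ofReal 2 = (2 : ℝ≥0∞) := by simp
        rw [h2, mul_assoc, mul_assoc, ← ENNReal.ofReal_mul (by positivity)]
        congr 3
        ring

/-- The deterministic part of the error of one estimated regression step. -/
def stepErr (b p ω : ℝ) (K N : ℕ) : ℝ :=
  b ^ 2 * p * (27 * 2 ^ d + 72 * (P.C / P.c) ^ 2 + 4)
    + b ^ 2 / N * (243 * (K : ℝ) ^ d + 144 * P.C + 72 * (P.C / P.c) ^ 2) + 27 * ω ^ 2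

/-- Separates the propagated input error (in the local average and in the weighted mean, factor 3
each) from the remainder R made at the exact input: the errors of the local average, of the centring
constant and of the weight. -/
theorem sq_regStep_sub_popStep_le {h T : ℝ} (hh : 0 < h) {I : Finset (Fin n)} (hI : I.Nonempty)
    (S : SS) (X : Fin n → Fin d → ℝ) (φh : (Fin d → ℝ) → ℝ) {φ : (Fin d → ℝ) → ℝ} {b : ℝ}
    (hb : ∀ x, |φ x| ≤ b) {x : S.1 → ℝ} (hx : ‖x‖ ≤ T) :
    (regStep P.r P.lam X h T I S φh x - P.popStep S φ x) ^ 2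
      ≤ 3 * localAvg (proj S.1) h I X (fun y => trunc T φh y - trunc T φ y) x ^ 2
        + 9 * (localAvg (proj S.1) h I X (trunc T φ) x - P.cexp S φ x) ^ 2
        + (3 * wavg P.r P.lam X I S (fun y => trunc T φh y - trunc T φ y) ^ 2
          + 144 * b ^ 2 * (rhat P.r X I S - 1) ^ 2
          + 36 * (P.C / P.c) ^ 2 / P.wmax S ^ 2 * ((I.card : ℝ)⁻¹ *
            ∑ i ∈ I, P.w S (proj S.1 (X i)) * (trunc T φ (X i) - P.wmean S φ)) ^ 2) := by
  rw [regStep_eq P.r P.lam X hh, if_pos hx]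
  have hb0 : 0 ≤ b := (abs_nonneg _).trans (hb 0)
  have hq : 0 < P.C / P.c := div_pos (P.C_pos S) P.c_pos
  have hmax := P.wmax_pos S
  set v := what P.r P.lam X I S x with hv
  have hv0 : 0 < v := P.what_pos X I S x
  have hv1 : v ≤ 1 := P.what_le_one X I S x
  have hvw := P.abs_what_sub_w_le X I S x
  rw [← hv] at hvw
  set W := (I.card : ℝ)⁻¹ * ∑ i ∈ I, P.w S (proj S.1 (X i)) * (trunc T φ (X i) - P.wmean S φ)
    with hW
  set ρ := |rhat P.r X I S - 1| with hρ
  have hρ0 : 0 ≤ ρ := abs_nonneg _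
  have hcavg := P.abs_wavg_sub_le X hI S (ψ := trunc T φ) (abs_trunc_le hb) (P.abs_wmean_le S hb)
  rw [← hW, ← hρ] at hcavg
  rw [localAvg_sub, wavg_sub]
  set l₁ := localAvg (proj S.1) h I X (trunc T φh) x
  set l₂ := localAvg (proj S.1) h I X (trunc T φ) x
  set k₁ := wavg P.r P.lam X I S (trunc T φh)
  set k₂ := wavg P.r P.lam X I S (trunc T φ)
  unfold popStep
  have hmc : |P.cexp S φ x - P.wmean S φ| ≤ 2 * b :=
    (abs_sub _ _).trans (by linarith [P.abs_cexp_le S hb x, P.abs_wmean_le S hb])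
  set m := P.cexp S φ x
  set c₀ := P.wmean S φ
  set R := v * (l₂ - m) - v * (k₂ - c₀) + (v - P.w S x) * (m - c₀) with hR
  have e : v * (l₁ - k₁) - P.w S x * (m - c₀) = v * (l₁ - l₂) - v * (k₁ - k₂) + R := by
    rw [hR]; ring
  set s := 2 * (P.C / P.c) / P.wmax S * |W| with hs
  have hs0 : 0 ≤ s := by positivity
  have hRb : |R| ≤ |l₂ - m| + 4 * b * ρ + s := by
    have h1 : |v * (l₂ - m)| ≤ |l₂ - m| := by
      rw [abs_mul, abs_of_pos hv0]; exact mul_le_of_le_one_left (abs_nonneg _) hv1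
    have h2 : |v * (k₂ - c₀)| ≤ 2 * b * ρ + s := by
      rw [abs_mul, abs_of_pos hv0]
      exact (mul_le_of_le_one_left (abs_nonneg _) hv1).trans hcavg
    have h3 : |(v - P.w S x) * (m - c₀)| ≤ 2 * b * ρ := by
      rw [abs_mul]
      have : |v - P.w S x| ≤ ρ := hvw.trans (mul_le_of_le_one_left hρ0 hv1)
      calc _ ≤ ρ * (2 * b) := mul_le_mul this hmc (abs_nonneg _) hρ0
        _ = _ := by ring
    calc |R| ≤ |v * (l₂ - m) - v * (k₂ - c₀)| + |(v - P.w S x) * (m - c₀)| := abs_add_le _ _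
      _ ≤ |v * (l₂ - m)| + |v * (k₂ - c₀)| + |(v - P.w S x) * (m - c₀)| := by
          gcongr; exact abs_sub _ _
      _ ≤ _ := by linarith
  -- The normalisation error enters twice with 2bρ, once through the centring constant and once
  -- through the weight, hence 3·4² = 48. The outer factor 3 turns 3, 48, 3 into 9, 144, 9.
  have hR2 : R ^ 2 ≤ 3 * (l₂ - m) ^ 2 + 48 * b ^ 2 * ρ ^ 2 + 3 * s ^ 2 := by
    have h1 : R ^ 2 ≤ (|l₂ - m| + 4 * b * ρ + s) ^ 2 := sq_le_sq' (by
      linarith [neg_abs_le R]) ((le_abs_self R).trans hRb)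
    refine h1.trans ((sq_add_add_le _ _ _).trans (le_of_eq ?_))
    rw [sq_abs]; ring
  have hs2 : s ^ 2 = 4 * (P.C / P.c) ^ 2 / P.wmax S ^ 2 * W ^ 2 := by
    rw [hs, mul_pow, sq_abs]; ring
  have hρ2 : ρ ^ 2 = (rhat P.r X I S - 1) ^ 2 := sq_abs _
  rw [e]
  have hA : (v * (l₁ - l₂)) ^ 2 ≤ (l₁ - l₂) ^ 2 := by
    rw [mul_pow]; exact mul_le_of_le_one_left (sq_nonneg _) (pow_le_one₀ hv0.le hv1)
  have hB : (v * (k₁ - k₂)) ^ 2 ≤ (k₁ - k₂) ^ 2 := by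
    rw [mul_pow]; exact mul_le_of_le_one_left (sq_nonneg _) (pow_le_one₀ hv0.le hv1)
  have h3 : (v * (l₁ - l₂) - v * (k₁ - k₂) + R) ^ 2 ≤ 3 * (v * (l₁ - l₂)) ^ 2
      + 3 * (v * (k₁ - k₂)) ^ 2 + 3 * R ^ 2 := by
    have := sq_add_add_le (v * (l₁ - l₂)) (-(v * (k₁ - k₂))) R
    rwa [neg_sq, ← sub_eq_add_neg] at this
  have hs3 : 9 * s ^ 2 = 36 * (P.C / P.c) ^ 2 / P.wmax S ^ 2 * W ^ 2 := by rw [hs2]; ring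
  rw [← hs3, ← hρ2]
  linarith

end Setting

namespace Setting

variable {d n : ℕ} {SS : Finset (Finset (Fin d))} (P : Setting SS)

theorem measure_norm_proj_gt_le (S : Finset (Fin d)) (T : ℝ) :
    P.μ.map (proj S) {x | ‖x‖ ≤ T}ᶜ ≤ ENNReal.ofReal (P.μ.real {x | T ≤ ‖x‖}) := by
  have hs : MeasurableSet {x : S → ℝ | ‖x‖ ≤ T} := measurableSet_le (by fun_prop) measurable_const
  rw [Measure.map_apply (measurable_proj _) hs.compl, ofReal_measureReal]
  refine measure_mono fun x hx => ?_
  simp only [Set.mem_preimage, Set.mem_compl_iff, Set.mem_ofPred_eq, not_le] at hx ⊢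
  exact hx.le.trans (norm_proj_le S x)

theorem lintegral_sq_wavg_le {I : Finset (Fin n)} (hI : I.Nonempty) (S : SS)
    {g : (Fin d → ℝ) → ℝ} (hg : Measurable g) :
    ∫⁻ X, ENNReal.ofReal (wavg P.r P.lam X I S g ^ 2) ∂Measure.pi (fun _ : Fin n => P.μ)
      ≤ ENNReal.ofReal (P.C / P.c) * ∫⁻ y, ENNReal.ofReal (g y ^ 2) ∂P.μ := by
  have hq : 0 < P.C / P.c := div_pos (P.C_pos S) P.c_pos
  rw [← lintegral_mean_eval P.μ (hg.pow_const 2).ennreal_ofReal hI,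
    ← lintegral_const_mul' _ _ (by simp)]
  refine lintegral_mono fun X => ?_
  rw [← ofReal_inv_card_mul_sum hI fun i => sq_nonneg _, ← ENNReal.ofReal_mul hq.le]
  exact ENNReal.ofReal_le_ofReal (P.sq_wavg_le X I S g)

/-- The mean squared error of one estimated regression step, in terms of that of its input. -/
theorem lintegral_sq_regStep_sub_popStep_le {h T : ℝ} (hh : 0 < h) {I : Finset (Fin n)}
    (hI : I.Nonempty) (S : SS) {φh φ : (Fin d → ℝ) → ℝ} (hφh : Measurable φh) (hφ : Measurable φ)
    {b : ℝ} (hb : ∀ x, |φ x| ≤ b) {ω : ℝ}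
    (hω : ∀ x x', ‖x - x'‖ ≤ h → |P.cexp S φ x - P.cexp S φ x'| ≤ ω) {K : ℕ} (hK : 1 ≤ K)
    (hKT : 2 * T ≤ K * h) :
    ∫⁻ X, ∫⁻ x, ENNReal.ofReal ((regStep P.r P.lam X h T I S φh x - P.popStep S φ x) ^ 2)
        ∂P.μ.map (proj S.1) ∂Measure.pi (fun _ : Fin n => P.μ)
      ≤ ENNReal.ofReal (3 * (P.C / P.c + 2 ^ d)) * ∫⁻ y, ENNReal.ofReal ((φh y - φ y) ^ 2) ∂P.μ
        + ENNReal.ofReal (P.stepErr b (P.μ.real {x | T ≤ ‖x‖}) ω K I.card) := by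
  have hb0 : 0 ≤ b := (abs_nonneg _).trans (hb 0)
  have hq : 0 < P.C / P.c := div_pos (P.C_pos S) P.c_pos
  have hmax := P.wmax_pos S
  have hC := P.C_pos S
  have hn : (0 : ℝ) < I.card := by exact_mod_cast hI.card_pos
  set p := P.μ.real {x : Fin d → ℝ | T ≤ ‖x‖} with hp
  have hp0 : 0 ≤ p := measureReal_nonneg
  set ν := P.μ.map (proj S.1) with hν
  set Pn := Measure.pi (fun _ : Fin n => P.μ) with hPn
  set R : Set (S.1 → ℝ) := {x | ‖x‖ ≤ T} with hR
  have hRm : MeasurableSet R := measurableSet_le (by fun_prop) measurable_const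
  set g : (Fin d → ℝ) → ℝ := fun y => trunc T φh y - trunc T φ y with hg
  have hgm : Measurable g := (measurable_trunc hφh).sub (measurable_trunc hφ)
  have hge : ∫⁻ y, ENNReal.ofReal (g y ^ 2) ∂P.μ ≤ ∫⁻ y, ENNReal.ofReal ((φh y - φ y) ^ 2) ∂P.μ :=
    lintegral_mono fun y => ENNReal.ofReal_le_ofReal (sq_trunc_sub_trunc_le T φh φ y)
  set e := ∫⁻ y, ENNReal.ofReal ((φh y - φ y) ^ 2) ∂P.μ with he
  have htail := lintegral_sq_sub_trunc_le P.μ T hb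
  rw [← hp] at htail
  have htm := measurable_trunc (T := T) hφ
  set W : (Fin n → Fin d → ℝ) → ℝ := fun X => (I.card : ℝ)⁻¹ *
    ∑ i ∈ I, P.w S (proj S.1 (X i)) * (trunc T φ (X i) - P.wmean S φ) with hW
  have hWm : Measurable W := by
    refine (Finset.measurable_fun_sum _ fun i _ => ?_).const_mul _
    exact ((P.measurable_w S).comp ((measurable_proj _).comp (measurable_pi_apply i))).mul
      ((htm.comp (measurable_pi_apply i)).sub_const _)
  set k := 36 * (P.C / P.c) ^ 2 / P.wmax S ^ 2 with hk
  have hk0 : 0 ≤ k := by positivity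
  have hwavgm : Measurable fun X : Fin n → Fin d → ℝ => wavg P.r P.lam X I S g := by
    have hv : ∀ i, Measurable fun X : Fin n → Fin d → ℝ =>
        what P.r P.lam X I S (proj S.1 (X i)) := fun i => by
      have h1 : Measurable fun X : Fin n → Fin d → ℝ => P.lam S * P.r S (proj S.1 (X i)) :=
        ((P.r_meas S).comp ((measurable_proj _).comp (measurable_pi_apply i))).const_mul _
      exact h1.div ((P.measurable_rhat I S).add h1)
    exact (Finset.measurable_fun_sum _ fun i _ =>
      (hv i).mul (hgm.comp (measurable_pi_apply i))).div
      (Finset.measurable_fun_sum _ fun i _ => hv i)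
  -- the integral over `x`, for a fixed sample
  have hin : ∀ X : Fin n → Fin d → ℝ,
      ∫⁻ x, ENNReal.ofReal ((regStep P.r P.lam X h T I S φh x - P.popStep S φ x) ^ 2) ∂ν
      ≤ 3 * (∫⁻ x, ENNReal.ofReal (localAvg (proj S.1) h I X g x ^ 2) ∂ν)
        + 9 * (∫⁻ x in R, ENNReal.ofReal ((localAvg (proj S.1) h I X (trunc T φ) x
            - P.cexp S φ x) ^ 2) ∂ν)
        + (3 * ENNReal.ofReal (wavg P.r P.lam X I S g ^ 2)
          + ENNReal.ofReal (144 * b ^ 2) * ENNReal.ofReal ((rhat P.r X I S - 1) ^ 2)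
          + ENNReal.ofReal k * ENNReal.ofReal (W X ^ 2))
        + ENNReal.ofReal (4 * b ^ 2 * p) := by
    intro X
    have h3 : (3 : ℝ≥0∞) = ENNReal.ofReal 3 := by simp
    have h9 : (9 : ℝ≥0∞) = ENNReal.ofReal 9 := by simp
    have hm1 : Measurable fun x => ENNReal.ofReal (localAvg (proj S.1) h I X g x ^ 2) :=
      ((measurable_localAvg (measurable_proj S.1) I measurable_const measurable_id
        (ψ := fun _ => g) (hgm.comp measurable_snd)).pow_const 2).ennreal_ofReal
    have hm2 : Measurable fun x => ENNReal.ofReal ((localAvg (proj S.1) h I X (trunc T φ) x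
            - P.cexp S φ x) ^ 2) :=
      (((measurable_localAvg (measurable_proj S.1) I measurable_const measurable_id
        (ψ := fun _ => trunc T φ) (htm.comp measurable_snd)).sub
        (P.measurable_cexp S hφ)).pow_const 2).ennreal_ofReal
    rw [← lintegral_add_compl _ hRm]
    refine add_le_add ?_ ?_
    · calc _ ≤ ∫⁻ x in R, (3 * ENNReal.ofReal (localAvg (proj S.1) h I X g x ^ 2)
            + 9 * ENNReal.ofReal ((localAvg (proj S.1) h I X (trunc T φ) x - P.cexp S φ x) ^ 2)
            + (3 * ENNReal.ofReal (wavg P.r P.lam X I S g ^ 2)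
              + ENNReal.ofReal (144 * b ^ 2) * ENNReal.ofReal ((rhat P.r X I S - 1) ^ 2)
              + ENNReal.ofReal k * ENNReal.ofReal (W X ^ 2))) ∂ν := by
            refine setLIntegral_mono' hRm fun x hx => ?_
            refine (ENNReal.ofReal_le_ofReal
              (P.sq_regStep_sub_popStep_le hh hI S X φh hb hx)).trans ?_
            rw [h3, h9, ← ENNReal.ofReal_mul (by norm_num), ← ENNReal.ofReal_mul (by norm_num),
              ← ENNReal.ofReal_mul (by norm_num), ← ENNReal.ofReal_mul (by positivity),
              ← ENNReal.ofReal_mul hk0]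
            refine ENNReal.ofReal_add_le.trans (add_le_add ENNReal.ofReal_add_le ?_)
            exact ENNReal.ofReal_add_le.trans (add_le_add ENNReal.ofReal_add_le le_rfl)
        _ ≤ _ := by
            rw [lintegral_add_right _ measurable_const, lintegral_add_left (hm1.const_mul 3),
              lintegral_const_mul _ hm1, lintegral_const_mul _ hm2, lintegral_const]
            gcongr
            · exact Measure.restrict_le_self
            · refine mul_le_of_le_one_right (by positivity) ?_
              rw [Measure.restrict_apply_univ]
              exact prob_le_one
    -- Outside the ball the estimate is 0, so the error is the exact step, which is bounded by 2b.
    · calc _ ≤ ∫⁻ _ in Rᶜ, ENNReal.ofReal (4 * b ^ 2) ∂ν := by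
            refine setLIntegral_mono' hRm.compl fun x hx => ENNReal.ofReal_le_ofReal ?_
            rw [regStep_eq P.r P.lam X hh, if_neg (show ¬ ‖x‖ ≤ T from hx), zero_sub, neg_sq]
            have := sq_le_sq.2 ((P.abs_popStep_le S hb x).trans (le_abs_self _))
            linarith
        _ = ENNReal.ofReal (4 * b ^ 2) * ν Rᶜ := by simp
        _ ≤ ENNReal.ofReal (4 * b ^ 2) * ENNReal.ofReal p := by
            gcongr; exact P.measure_norm_proj_gt_le S.1 T
        _ = _ := by rw [← ENNReal.ofReal_mul (by positivity)]
  have hM1 : Measurable fun X : Fin n → Fin d → ℝ =>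
      ∫⁻ x, ENNReal.ofReal (localAvg (proj S.1) h I X g x ^ 2) ∂ν := by
    refine Measurable.lintegral_prod_right' (f := fun q : (Fin n → Fin d → ℝ) × (S.1 → ℝ) =>
      ENNReal.ofReal (localAvg (proj S.1) h I q.1 g q.2 ^ 2)) ?_
    exact ((measurable_localAvg (measurable_proj S.1) I measurable_fst measurable_snd
        (ψ := fun _ => g) (hgm.comp measurable_snd)).pow_const 2).ennreal_ofReal
  have hM2 : Measurable fun X : Fin n → Fin d → ℝ =>
      ∫⁻ x in R, ENNReal.ofReal ((localAvg (proj S.1) h I X (trunc T φ) x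
            - P.cexp S φ x) ^ 2) ∂ν := by
    refine Measurable.lintegral_prod_right' (f := fun q : (Fin n → Fin d → ℝ) × (S.1 → ℝ) =>
      ENNReal.ofReal ((localAvg (proj S.1) h I q.1 (trunc T φ) q.2 - P.cexp S φ q.2) ^ 2)) ?_
    exact (((measurable_localAvg (measurable_proj S.1) I measurable_fst measurable_snd
        (ψ := fun _ => trunc T φ) (htm.comp measurable_snd)).sub
        ((P.measurable_cexp S hφ).comp measurable_snd)).pow_const 2).ennreal_ofReal
  have hM3 : Measurable fun X : Fin n → Fin d → ℝ =>
      3 * ENNReal.ofReal (wavg P.r P.lam X I S g ^ 2) :=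
    (hwavgm.pow_const 2).ennreal_ofReal.const_mul _
  have hM4 : Measurable fun X : Fin n → Fin d → ℝ =>
      ENNReal.ofReal ((rhat P.r X I S - 1) ^ 2) :=
    (((P.measurable_rhat I S).sub_const 1).pow_const 2).ennreal_ofReal
  have hM5 : Measurable fun X : Fin n → Fin d → ℝ => ENNReal.ofReal (W X ^ 2) :=
    (hWm.pow_const 2).ennreal_ofReal
  refine (lintegral_mono hin).trans ?_
  rw [lintegral_add_right _ measurable_const,
    lintegral_add_left ((hM1.const_mul 3).fun_add (hM2.const_mul 9)),
    lintegral_add_left (hM1.const_mul 3),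
    lintegral_add_left (hM3.fun_add (hM4.const_mul _)), lintegral_add_left hM3,
    lintegral_const_mul _ hM1, lintegral_const_mul _ hM2,
    lintegral_const_mul _ (hwavgm.pow_const 2).ennreal_ofReal,
    lintegral_const_mul _ hM4, lintegral_const_mul _ hM5, lintegral_const]
  have hcard : Fintype.card S.1 ≤ d := by
    simpa using Finset.card_le_univ S.1
  have B1 := lintegral_sq_localAvg_le (ι := Fin n) P.μ (measurable_proj S.1) hh I hgm
  -- Here the perturbed input is the truncation of φ, whose mean squared distance to φ is at most b²
  -- times the tail probability.
  have B2 := lintegral_sq_localAvg_sub_le (ι := Fin n) P.μ (measurable_proj S.1) hh hI hφ htm hb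
    (P.measurable_cexp S hφ) (P.abs_cexp_le S hb) hω (P.condMeanZero_sub_cexp S hφ hb) hK hKT
  have B3 := P.lintegral_sq_wavg_le hI S hgm
  have B4 := P.lintegral_sq_rhat_sub_one_le hI S
  have B5 := P.lintegral_sq_mean_w_le hI S hφ htm hb
  have p2 : (2 : ℝ≥0∞) ^ Fintype.card S.1 ≤ ENNReal.ofReal (2 ^ d) := by
    rw [ENNReal.ofReal_pow (by norm_num)]
    simp only [ENNReal.ofReal_ofNat]
    exact pow_le_pow_right₀ (by norm_num) hcard
  have pK : (I.card : ℝ≥0∞)⁻¹ * (K : ℝ≥0∞) ^ Fintype.card S.1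
      ≤ ENNReal.ofReal ((I.card : ℝ)⁻¹ * (K : ℝ) ^ d) := by
    rw [ENNReal.ofReal_mul (by positivity), ENNReal.ofReal_inv_of_pos hn,
      ENNReal.ofReal_pow (by positivity)]
    simp only [ENNReal.ofReal_natCast]
    gcongr
    exact_mod_cast hK
  have h3 : (3 : ℝ≥0∞) = ENNReal.ofReal 3 := by simp
  have h9 : (9 : ℝ≥0∞) = ENNReal.ofReal 9 := by simp
  calc _ ≤ 3 * (ENNReal.ofReal (2 ^ d) * e)
        + 9 * (3 * (ENNReal.ofReal (2 ^ d) * ENNReal.ofReal (b ^ 2 * p))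
          + ENNReal.ofReal (27 * b ^ 2) * ENNReal.ofReal ((I.card : ℝ)⁻¹ * (K : ℝ) ^ d)
          + ENNReal.ofReal (3 * ω ^ 2))
        + (3 * (ENNReal.ofReal (P.C / P.c) * e)
          + ENNReal.ofReal (144 * b ^ 2) * ENNReal.ofReal (P.C / I.card)
          + ENNReal.ofReal k * (ENNReal.ofReal (2 * P.wmax S ^ 2) *
              (ENNReal.ofReal (b ^ 2 / I.card) + ENNReal.ofReal (b ^ 2 * p))))
        + ENNReal.ofReal (4 * b ^ 2 * p) * 1 := by
        gcongr
        · exact B1.trans (by gcongr)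
        · exact B2.trans (by gcongr)
        · exact B3.trans (by gcongr)
        · exact B5.trans (by gcongr)
        · simp [hPn]
    _ = (3 * ENNReal.ofReal (P.C / P.c) + 3 * ENNReal.ofReal (2 ^ d)) * e
        + (9 * (3 * (ENNReal.ofReal (2 ^ d) * ENNReal.ofReal (b ^ 2 * p))
          + ENNReal.ofReal (27 * b ^ 2) * ENNReal.ofReal ((I.card : ℝ)⁻¹ * (K : ℝ) ^ d)
          + ENNReal.ofReal (3 * ω ^ 2))
        + (ENNReal.ofReal (144 * b ^ 2) * ENNReal.ofReal (P.C / I.card)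
          + ENNReal.ofReal k * (ENNReal.ofReal (2 * P.wmax S ^ 2) *
              (ENNReal.ofReal (b ^ 2 / I.card) + ENNReal.ofReal (b ^ 2 * p))))
        + ENNReal.ofReal (4 * b ^ 2 * p)) := by ring
    _ = _ := by
        rw [h3, h9]
        congr 1
        · rw [← ENNReal.ofReal_mul (by norm_num), ← ENNReal.ofReal_mul (by norm_num),
            ← ENNReal.ofReal_add (by positivity) (by positivity)]
          congr 2; ring
        · rw [← ENNReal.ofReal_mul (by positivity), ← ENNReal.ofReal_mul (by positivity),
            ← ENNReal.ofReal_mul (by positivity), ← ENNReal.ofReal_add (by positivity)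
            (by positivity), ← ENNReal.ofReal_add (by positivity) (by positivity),
            ← ENNReal.ofReal_mul (by positivity), ← ENNReal.ofReal_mul (by positivity),
            ← ENNReal.ofReal_add (by positivity) (by positivity),
            ← ENNReal.ofReal_mul (by positivity), ← ENNReal.ofReal_mul (by positivity),
            ← ENNReal.ofReal_add (by positivity) (by positivity),
            ← ENNReal.ofReal_add (by positivity) (by positivity),
            ← ENNReal.ofReal_add (by positivity) (by positivity)]
          congr 1
          -- The constants are 9·3 = 27 for truncation and bias, 9·27 = 243 for the local variance,
          -- and 36·2 = 72 for the centring constant; `wmax` cancels in the last.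
          rw [hk, stepErr]
          field_simp
          ring

end Setting

/-! ### Iterated regressions: oscillation and propagation of errors -/

namespace Setting

variable {d n M : ℕ} {SS : Finset (Finset (Fin d))} (P : Setting SS)

/-- The population version of the iterated regressions `ahat`. -/
def apop : (m : ℕ) → (Fin m → SS) → (Fin d → ℝ) → ℝ
  | 0, _ => P.a
  | m + 1, s => fun x => P.popStep (s (Fin.last m)) (apop m (Fin.init s)) (proj (s (Fin.last m)).1 x)

theorem measurable_apop : ∀ (m : ℕ) (s : Fin m → SS), Measurable (P.apop m s)
  | 0, _ => P.a_meas
  | m + 1, s => (P.measurable_popStep _ (measurable_apop m (Fin.init s))).comp (measurable_proj _)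

theorem abs_apop_le : ∀ (m : ℕ) (s : Fin m → SS) (x : Fin d → ℝ), |P.apop m s x| ≤ 2 ^ m * P.b
  | 0, _, x => by simpa [apop] using P.a_bdd x
  | m + 1, s, x => by
      have := P.abs_popStep_le (s (Fin.last m)) (abs_apop_le m (Fin.init s))
        (proj (s (Fin.last m)).1 x)
      calc |P.apop (m + 1) s x| ≤ 2 * (2 ^ m * P.b) := this
        _ = _ := by ring

/-- Bounds on the oscillation at scale `h` of the ingredients of the model. -/
structure OscBound (h t L₁ L₂ L₃ : ℝ) : Prop where
  target : ∀ x x', ‖x - x'‖ ≤ h → |P.a x - P.a x'| ≤ L₁ * t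
  cond : ∀ (S : SS) x x', ‖x - x'‖ ≤ h → tvDist (P.Q S x) (P.Q S x') ≤ L₂ * t
  shift : ∀ (S : SS) x x', ‖x - x'‖ ≤ h → |P.r S x - P.r S x'| ≤ L₃ * t

/-- A bound for the oscillation of the conditional expectation of the `m`-th iterate. -/
def oscC (t L₁ L₂ L₃ : ℝ) (m : ℕ) : ℝ :=
  t * (L₁ + (2 ^ (m + 1) - 2) * P.b * (L₂ + L₃ / (4 * P.c)) + 2 ^ (m + 1) * P.b * L₂)

variable {P} {h t L₁ L₂ L₃ : ℝ}

/-- The m-th iterate is bounded by 2^m b, so the next step adds 2^(m+1) b (L₂ + L₃/(4c)) t to the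
oscillation; summing the geometric series gives the coefficient 2^(m+1) - 2. The target's own
modulus is never amplified. -/
theorem OscBound.abs_apop_sub_le (hO : P.OscBound h t L₁ L₂ L₃) :
    ∀ (m : ℕ) (s : Fin m → SS) (x x' : Fin d → ℝ), ‖x - x'‖ ≤ h →
      |P.apop m s x - P.apop m s x'|
        ≤ t * (L₁ + (2 ^ (m + 1) - 2) * P.b * (L₂ + L₃ / (4 * P.c)))
  | 0, _, x, x', hx => by
      refine (hO.target x x' hx).trans (le_of_eq ?_)
      ring
  | m + 1, s, x, x', hx => by
      have hx' : ‖proj (s (Fin.last m)).1 x - proj (s (Fin.last m)).1 x'‖ ≤ h := by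
        rw [← proj_sub]; exact (norm_proj_le _ _).trans hx
      have h1 := P.cexp_sub_cexp_le (s (Fin.last m)) (P.measurable_apop m (Fin.init s))
        (P.abs_apop_le m (Fin.init s))
        (fun v => abs_apop_sub_le hO m (Fin.init s) (glue _ (proj (s (Fin.last m)).1 x) v)
          (glue _ (proj (s (Fin.last m)).1 x') v) ((norm_glue_sub_le _ _ _ v).trans hx'))
        (hO.cond (s (Fin.last m)) _ _ hx')
      have h2 := P.abs_popStep_sub_le (s (Fin.last m)) (P.abs_apop_le m (Fin.init s)) h1
        (hO.shift (s (Fin.last m)) _ _ hx')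
      refine h2.trans (le_of_eq ?_)
      have := P.c_pos.ne'
      field_simp
      ring

theorem OscBound.abs_cexp_apop_sub_le (hO : P.OscBound h t L₁ L₂ L₃) (S : SS) (m : ℕ)
    (s : Fin m → SS) (x x' : S.1 → ℝ) (hx : ‖x - x'‖ ≤ h) :
    |P.cexp S (P.apop m s) x - P.cexp S (P.apop m s) x'| ≤ P.oscC t L₁ L₂ L₃ m := by
  refine (P.cexp_sub_cexp_le S (P.measurable_apop m s) (P.abs_apop_le m s)
    (fun v => hO.abs_apop_sub_le m s _ _ ((norm_glue_sub_le _ _ _ v).trans hx))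
    (hO.cond S _ _ hx)).trans (le_of_eq ?_)
  unfold oscC
  ring

variable (P)

theorem measurable_what {Ω : Type*} [MeasurableSpace Ω] (I : Finset (Fin n)) (S : SS)
    {U : Ω → Fin n → Fin d → ℝ} {u : Ω → S.1 → ℝ} (hU : Measurable U) (hu : Measurable u) :
    Measurable fun ω => what P.r P.lam (U ω) I S (u ω) := by
  unfold what
  exact (((P.r_meas S).comp hu).const_mul _).div
    (((P.measurable_rhat I S).comp hU).add (((P.r_meas S).comp hu).const_mul _))

theorem measurable_regStep {Ω : Type*} [MeasurableSpace Ω] (hh : 0 < h) (T : ℝ)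
    (I : Finset (Fin n)) (S : SS) {U : Ω → Fin n → Fin d → ℝ} {u : Ω → S.1 → ℝ}
    (hU : Measurable U) (hu : Measurable u) {φ : Ω → (Fin d → ℝ) → ℝ}
    (hφ : Measurable (Function.uncurry φ)) :
    Measurable fun ω => regStep P.r P.lam (U ω) h T I S (φ ω) (u ω) := by
  simp_rw [regStep_eq P.r P.lam _ hh]
  have ht : Measurable (Function.uncurry fun ω => trunc T (φ ω)) := by
    unfold trunc
    exact Measurable.ite (measurableSet_le (by fun_prop) measurable_const) hφ measurable_const
  have hUi : ∀ i, Measurable fun ω => U ω i := fun i => (measurable_pi_apply i).comp hU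
  have hv : ∀ i, Measurable fun ω => what P.r P.lam (U ω) I S (proj S.1 (U ω i)) := fun i =>
    P.measurable_what I S hU ((measurable_proj _).comp (hUi i))
  refine Measurable.ite (measurableSet_le (by fun_prop) measurable_const) ?_ measurable_const
  refine (P.measurable_what I S hU hu).mul
    ((measurable_localAvg (measurable_proj _) I hU hu ht).sub ?_)
  unfold wavg
  exact (Finset.measurable_fun_sum _ fun i _ =>
    (hv i).mul (ht.comp (measurable_id.prodMk (hUi i)))).div
    (Finset.measurable_fun_sum _ fun i _ => hv i)

theorem abs_regStep_le (hh : 0 < h) (T : ℝ) (I : Finset (Fin n)) (S : SS)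
    (X : Fin n → Fin d → ℝ) {φ : (Fin d → ℝ) → ℝ} {b : ℝ} (hb : ∀ x, |φ x| ≤ b) (x : S.1 → ℝ) :
    |regStep P.r P.lam X h T I S φ x| ≤ 2 * b := by
  have hb0 : 0 ≤ b := (abs_nonneg _).trans (hb 0)
  rw [regStep_eq P.r P.lam X hh]
  split_ifs
  · rw [abs_mul, abs_of_pos (P.what_pos X I S x)]
    have h1 : |localAvg (proj S.1) h I X (trunc T φ) x - wavg P.r P.lam X I S (trunc T φ)|
        ≤ 2 * b := by
      refine (abs_sub _ _).trans ?_
      have := abs_localAvg_le (π := proj S.1) (h := h) (I := I) (X := X) (ψ := trunc T φ)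
        (x := x) hb0 fun i _ _ => abs_trunc_le hb _
      linarith [P.abs_wavg_le X (abs_trunc_le (T := T) hb) I S]
    calc _ ≤ 1 * (2 * b) := mul_le_mul (P.what_le_one X I S x) h1 (abs_nonneg _) zero_le_one
      _ = 2 * b := one_mul _
  · simpa using hb0

theorem measurable_ahat (hh : 0 < h) (T : ℝ) (g : Fin n → Fin M) (l : Bool) :
    ∀ (m : ℕ) (s : Fin m → SS), Measurable (Function.uncurry fun X : Fin n → Fin d → ℝ =>
      ahat P.a P.r P.lam X h T g l m s)
  | 0, _ => P.a_meas.comp measurable_snd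
  | m + 1, s => by
      have ih := measurable_ahat hh T g l m (Fin.init s)
      exact P.measurable_regStep hh T (piece g l m) (s (Fin.last m)) measurable_fst
        ((measurable_proj _).comp measurable_snd)
        (φ := fun ω : (Fin n → Fin d → ℝ) × (Fin d → ℝ) =>
          ahat P.a P.r P.lam ω.1 h T g l m (Fin.init s))
        (ih.comp ((measurable_fst.comp measurable_fst).prodMk measurable_snd))

theorem abs_ahat_le (hh : 0 < h) (T : ℝ) (g : Fin n → Fin M) (l : Bool)
    (X : Fin n → Fin d → ℝ) : ∀ (m : ℕ) (s : Fin m → SS) (x : Fin d → ℝ),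
      |ahat P.a P.r P.lam X h T g l m s x| ≤ 2 ^ m * P.b
  | 0, _, x => by simpa [ahat] using P.a_bdd x
  | m + 1, s, x => by
      have := P.abs_regStep_le hh T (piece g l m) (s (Fin.last m)) X
        (abs_ahat_le hh T g l X m (Fin.init s)) (proj (s (Fin.last m)).1 x)
      calc _ ≤ 2 * (2 ^ m * P.b) := this
        _ = _ := by ring

end Setting

section Congr

variable {d n M : ℕ} {SS : Finset (Finset (Fin d))}

/-- The m-th iterate reads only the pieces with number below m, so piece m is independent of it. -/
theorem ahat_congr (a : (Fin d → ℝ) → ℝ) (r : (S : SS) → (S.1 → ℝ) → ℝ) (lam : SS → ℝ)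
    {X Y : Fin n → Fin d → ℝ} (h T : ℝ) (g : Fin n → Fin M) (l : Bool) :
    ∀ (m : ℕ) (s : Fin m → SS), (∀ k < m, ∀ i ∈ piece g l k, X i = Y i) →
      ahat a r lam X h T g l m s = ahat a r lam Y h T g l m s
  | 0, _, _ => rfl
  | m + 1, s, hXY => by
      funext x
      simp only [ahat]
      rw [ahat_congr a r lam h T g l m (Fin.init s) fun k hk => hXY k (hk.trans (Nat.lt_succ_self m))]
      exact regStep_congr r lam h T (hXY m (Nat.lt_succ_self m)) _ _ _

theorem disjoint_piece (g : Fin n → Fin M) (l : Bool) {k m : ℕ} (hkm : k ≠ m) {i : Fin n}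
    (hi : i ∈ piece g l k) : i ∉ piece g l m := by
  simp only [piece, Finset.mem_filter, not_and] at hi ⊢
  exact fun _ h => hkm (hi.2.symm.trans h)

end Congr

namespace Setting

variable {d n M : ℕ} {SS : Finset (Finset (Fin d))} (P : Setting SS)

/-- The factor `C/c + 2^d`. -/
def amp : ℝ := P.C / P.c + 2 ^ d

theorem amp_nonneg (S : SS) : 0 ≤ P.amp := by
  have := div_pos (P.C_pos S) P.c_pos
  unfold amp; positivity

/-- Control of the per-step errors by `Err`. -/
def StepBound (g : Fin n → Fin M) (l : Bool) (T t L₁ L₂ L₃ : ℝ) (K : ℕ) (Err : ℝ) : Prop :=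
  ∀ m < M,
    ((piece g l m).Nonempty → P.stepErr (2 ^ m * P.b) (P.μ.real {x | T ≤ ‖x‖})
      (P.oscC t L₁ L₂ L₃ m) K (piece g l m).card ≤ 4 ^ m * P.amp ^ (m + 1) * Err) ∧
    (piece g l m = ∅ → (2 * (2 ^ m * P.b)) ^ 2 ≤ 4 ^ m * P.amp ^ (m + 1) * Err)

variable {h T t L₁ L₂ L₃ Err : ℝ} {K : ℕ} {g : Fin n → Fin M} {l : Bool}

/-- Conditionally on the earlier pieces the input is a fixed function and the one-step bound
applies. The recursion closes because 3·4^m + 4^m = 4^(m+1). -/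
theorem lintegral_sq_regStep_ahat_le (hh : 0 < h) (hO : P.OscBound h t L₁ L₂ L₃) (hK : 1 ≤ K)
    (hKT : 2 * T ≤ K * h) (hErr : 0 ≤ Err) (hSB : P.StepBound g l T t L₁ L₂ L₃ K Err) {m : ℕ}
    (hm : m < M) (s : Fin m → SS) (S : SS)
    (ih : ∫⁻ X, ∫⁻ x, ENNReal.ofReal ((ahat P.a P.r P.lam X h T g l m s x - P.apop m s x) ^ 2) ∂P.μ
      ∂Measure.pi (fun _ : Fin n => P.μ) ≤ ENNReal.ofReal ((4 * P.amp) ^ m * Err)) :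
    ∫⁻ X, ∫⁻ x, ENNReal.ofReal ((regStep P.r P.lam X h T (piece g l m) S
        (ahat P.a P.r P.lam X h T g l m s) x - P.popStep S (P.apop m s) x) ^ 2) ∂P.μ.map (proj S.1)
      ∂Measure.pi (fun _ : Fin n => P.μ) ≤ ENNReal.ofReal ((4 * P.amp) ^ (m + 1) * Err) := by
  have hamp := P.amp_nonneg S
  have hgoal : 4 ^ m * P.amp ^ (m + 1) * Err ≤ (4 * P.amp) ^ (m + 1) * Err := by
    rw [mul_pow, pow_succ (4 : ℝ) m]
    have : 0 ≤ (4 : ℝ) ^ m * P.amp ^ (m + 1) * Err := by positivity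
    nlinarith
  rcases (piece g l m).eq_empty_or_nonempty with hI | hI
  -- On an empty piece the estimate is 0 by convention, and the second half of `StepBound` absorbs
  -- the whole exact step.
  · calc _ ≤ ∫⁻ _, ∫⁻ _, ENNReal.ofReal ((4 * P.amp) ^ (m + 1) * Err) ∂P.μ.map (proj S.1)
          ∂Measure.pi (fun _ : Fin n => P.μ) := by
          refine lintegral_mono fun X => lintegral_mono fun x => ENNReal.ofReal_le_ofReal ?_
          rw [hI, regStep_empty, zero_sub, neg_sq]
          refine le_trans ?_ (((hSB m hm).2 hI).trans hgoal)
          exact sq_le_sq.2 ((P.abs_popStep_le S (P.abs_apop_le m s) x).trans (le_abs_self _))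
      _ = _ := by simp
  · set J := piece g l m with hJ
    have hmeas : Measurable fun X : Fin n → Fin d → ℝ => ∫⁻ x, ENNReal.ofReal
        ((regStep P.r P.lam X h T J S (ahat P.a P.r P.lam X h T g l m s) x
          - P.popStep S (P.apop m s) x) ^ 2) ∂P.μ.map (proj S.1) := by
      refine Measurable.lintegral_prod_right' (f := fun q : (Fin n → Fin d → ℝ) × (S.1 → ℝ) =>
        ENNReal.ofReal ((regStep P.r P.lam q.1 h T J S (ahat P.a P.r P.lam q.1 h T g l m s) q.2
          - P.popStep S (P.apop m s) q.2) ^ 2)) ?_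
      refine (((P.measurable_regStep hh T J S measurable_fst measurable_snd
        (φ := fun q : (Fin n → Fin d → ℝ) × (S.1 → ℝ) => ahat P.a P.r P.lam q.1 h T g l m s)
        ((P.measurable_ahat hh T g l m s).comp
          ((measurable_fst.comp measurable_fst).prodMk measurable_snd))).sub
        ((P.measurable_popStep S (P.measurable_apop m s)).comp measurable_snd)).pow_const
          2).ennreal_ofReal
    -- Conditioning as resampling: the observations in piece m come from Y, all others from X.
    rw [lintegral_pi_piecewise Jᶜ hmeas]
    have hcongr : ∀ X Y : Fin n → Fin d → ℝ, ∀ x,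
        regStep P.r P.lam (Jᶜ.piecewise X Y) h T J S
          (ahat P.a P.r P.lam (Jᶜ.piecewise X Y) h T g l m s) x
        = regStep P.r P.lam Y h T J S (ahat P.a P.r P.lam X h T g l m s) x := by
      intro X Y x
      rw [regStep_congr P.r P.lam h T (Y := Y), ahat_congr P.a P.r P.lam h T g l m s (Y := X)]
      · intro k hk i hi
        exact Finset.piecewise_eq_of_mem _ _ _
          (Finset.mem_compl.2 (disjoint_piece g l hk.ne hi))
      · intro i hi
        exact Finset.piecewise_eq_of_notMem _ _ _ (by simpa using hi)
    simp_rw [hcongr]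
    have hah : ∀ X : Fin n → Fin d → ℝ, Measurable (ahat P.a P.r P.lam X h T g l m s) := fun X =>
      (P.measurable_ahat hh T g l m s).comp measurable_prodMk_left
    calc _ ≤ ∫⁻ X, (ENNReal.ofReal (3 * P.amp) *
          (∫⁻ y, ENNReal.ofReal ((ahat P.a P.r P.lam X h T g l m s y - P.apop m s y) ^ 2) ∂P.μ)
          + ENNReal.ofReal (4 ^ m * P.amp ^ (m + 1) * Err)) ∂Measure.pi (fun _ : Fin n => P.μ) := by
          refine lintegral_mono fun X => ?_
          refine (P.lintegral_sq_regStep_sub_popStep_le hh hI S (hah X) (P.measurable_apop m s)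
            (P.abs_apop_le m s) (fun x x' hx => hO.abs_cexp_apop_sub_le S m s x x' hx) hK
            hKT).trans ?_
          exact add_le_add le_rfl (ENNReal.ofReal_le_ofReal ((hSB m hm).1 hI))
      _ ≤ ENNReal.ofReal (3 * P.amp) * ENNReal.ofReal ((4 * P.amp) ^ m * Err)
          + ENNReal.ofReal (4 ^ m * P.amp ^ (m + 1) * Err) := by
          rw [lintegral_add_right _ measurable_const, lintegral_const_mul' _ _ ENNReal.ofReal_ne_top]
          simp only [lintegral_const, measure_univ, mul_one]
          gcongr
      _ = _ := by
          rw [← ENNReal.ofReal_mul (by positivity), ← ENNReal.ofReal_add (by positivity)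
            (by positivity)]
          congr 1
          rw [mul_pow, mul_pow]
          ring

theorem lintegral_sq_ahat_sub_apop_le (hh : 0 < h) (hO : P.OscBound h t L₁ L₂ L₃) (hK : 1 ≤ K)
    (hKT : 2 * T ≤ K * h) (hErr : 0 ≤ Err) (hSB : P.StepBound g l T t L₁ L₂ L₃ K Err) :
    ∀ (m : ℕ), m ≤ M → ∀ (s : Fin m → SS),
    ∫⁻ X, ∫⁻ x, ENNReal.ofReal ((ahat P.a P.r P.lam X h T g l m s x - P.apop m s x) ^ 2) ∂P.μ
      ∂Measure.pi (fun _ : Fin n => P.μ) ≤ ENNReal.ofReal ((4 * P.amp) ^ m * Err)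
  | 0, _, s => by simp [ahat, apop]
  | m + 1, hm, s => by
      have ih := lintegral_sq_ahat_sub_apop_le hh hO hK hKT hErr hSB m (Nat.le_of_succ_le hm)
        (Fin.init s)
      have hstep := P.lintegral_sq_regStep_ahat_le hh hO hK hKT hErr hSB (Nat.lt_of_succ_le hm)
        (Fin.init s) (s (Fin.last m)) ih
      refine le_trans (le_of_eq ?_) hstep
      refine lintegral_congr fun X => ?_
      rw [lintegral_map _ (measurable_proj _)]
      · rfl
      · exact (((P.measurable_regStep hh T _ _ measurable_const measurable_id
          (φ := fun _ => ahat P.a P.r P.lam X h T g l m (Fin.init s))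
          ((P.measurable_ahat hh T g l m _).comp
            (measurable_const.prodMk measurable_snd))).sub
          (P.measurable_popStep _ (P.measurable_apop m _))).pow_const 2).ennreal_ofReal

theorem lintegral_sq_regStep_ahat_sub_le (hh : 0 < h) (hO : P.OscBound h t L₁ L₂ L₃) (hK : 1 ≤ K)
    (hKT : 2 * T ≤ K * h) (hErr : 0 ≤ Err) (hSB : P.StepBound g l T t L₁ L₂ L₃ K Err) {m : ℕ}
    (hm : m < M) (s : Fin m → SS) (S : SS) :
    ∫⁻ X, ∫⁻ x, ENNReal.ofReal ((regStep P.r P.lam X h T (piece g l m) S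
        (ahat P.a P.r P.lam X h T g l m s) x - P.popStep S (P.apop m s) x) ^ 2) ∂P.μ.map (proj S.1)
      ∂Measure.pi (fun _ : Fin n => P.μ) ≤ ENNReal.ofReal ((4 * P.amp) ^ (m + 1) * Err) :=
  P.lintegral_sq_regStep_ahat_le hh hO hK hKT hErr hSB hm s S
    (P.lintegral_sq_ahat_sub_apop_le hh hO hK hKT hErr hSB m hm.le s)

end Setting

theorem lintegral_lintegral_const_mul_sum {Ω Ω' ι : Type*} [MeasurableSpace Ω]
    [MeasurableSpace Ω'] (ρ : Measure Ω) (σ : Measure Ω') [SFinite σ] (J : Finset ι) {A : ℝ≥0∞}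
    {k : ι → ℝ≥0∞} {G : ι → Ω → Ω' → ℝ≥0∞} (hA : A ≠ ∞) (hk : ∀ j, k j ≠ ∞)
    (hG : ∀ j, Measurable fun z : Ω × Ω' => G j z.1 z.2) :
    ∫⁻ X, ∫⁻ x, A * ∑ j ∈ J, k j * G j X x ∂σ ∂ρ
      = A * ∑ j ∈ J, k j * ∫⁻ X, ∫⁻ x, G j X x ∂σ ∂ρ := by
  have h1 : ∀ X, ∫⁻ x, A * ∑ j ∈ J, k j * G j X x ∂σ
      = A * ∑ j ∈ J, k j * ∫⁻ x, G j X x ∂σ := by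
    intro X
    have hm : ∀ j, Measurable fun x => G j X x := fun j => (hG j).comp measurable_prodMk_left
    rw [lintegral_const_mul' _ _ hA, lintegral_finsetSum _ fun j _ => (hm j).const_mul _]
    simp_rw [lintegral_const_mul' _ _ (hk _)]
  simp_rw [h1]
  rw [lintegral_const_mul' _ _ hA,
    lintegral_finsetSum _ fun j _ => ((hG j).lintegral_prod_right').const_mul _]
  simp_rw [lintegral_const_mul' _ _ (hk _)]

/-! ### Binomial tail weights -/

section BinTail

theorem binTail_zero (t : ℕ) (η : ℝ) : binTail t η 0 = 1 := by
  have h := add_pow η (1 - η) t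
  rw [add_sub_cancel, one_pow] at h
  refine Eq.trans ?_ h.symm
  rw [binTail, ← Nat.range_succ_eq_Icc_zero]
  exact Finset.sum_congr rfl fun k _ => by ring

theorem binTail_of_lt {t m : ℕ} (h : t < m) (η : ℝ) : binTail t η m = 0 := by
  rw [binTail, Finset.Icc_eq_empty (by omega), Finset.sum_empty]

theorem binTail_nonneg (t m : ℕ) {η : ℝ} (h0 : 0 ≤ η) (h1 : η ≤ 1) : 0 ≤ binTail t η m :=
  Finset.sum_nonneg fun k _ => by
    have : 0 ≤ 1 - η := by linarith
    positivity

/-- Pascal's recursion for binomial tail probabilities. -/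
theorem binTail_succ_succ (t m : ℕ) (η : ℝ) :
    binTail (t + 1) η (m + 1) = (1 - η) * binTail t η (m + 1) + η * binTail t η m := by
  have e1 : binTail (t + 1) η (m + 1)
      = ∑ j ∈ Finset.Icc m t, ((t + 1).choose (j + 1) : ℝ) * η ^ (j + 1) * (1 - η) ^ (t - j) := by
    rw [binTail, ← Finset.map_add_right_Icc m t 1, Finset.sum_map]
    refine Finset.sum_congr rfl fun j _ => ?_
    simp
  have e2 : (1 - η) * binTail t η (m + 1)
      = ∑ j ∈ Finset.Icc m t, (t.choose (j + 1) : ℝ) * η ^ (j + 1) * (1 - η) ^ (t - j) := by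
    have e3 : ∑ k ∈ Finset.Icc (m + 1) t, (t.choose k : ℝ) * η ^ k * (1 - η) ^ (t - k)
        = ∑ k ∈ Finset.Icc (m + 1) (t + 1), (t.choose k : ℝ) * η ^ k * (1 - η) ^ (t - k) := by
      refine Finset.sum_subset (Finset.Icc_subset_Icc_right (Nat.le_succ t)) fun k hk hk' => ?_
      rw [Finset.mem_Icc] at hk hk'
      rw [Nat.choose_eq_zero_of_lt (by omega)]; simp
    rw [binTail, e3, ← Finset.map_add_right_Icc m t 1, Finset.sum_map, Finset.mul_sum]
    refine Finset.sum_congr rfl fun j hj => ?_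
    rw [Finset.mem_Icc] at hj
    simp only [addRightEmbedding_apply]
    -- At j = t the natural subtraction t - (j+1) truncates, but there the binomial coefficient is
    -- 0.
    rcases hj.2.eq_or_lt with rfl | hlt
    · simp
    · have : t - j = (t - (j + 1)) + 1 := by omega
      rw [this, pow_succ]; ring
  rw [e1, e2, binTail, Finset.mul_sum, ← Finset.sum_add_distrib]
  refine Finset.sum_congr rfl fun j _ => ?_
  rw [Nat.choose_succ_succ]
  push_cast
  ring

/-- Recursion for the generating function of binomial tails. -/
theorem sum_binTail_mul_succ (t : ℕ) (η : ℝ) (u : ℕ → ℝ) :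
    ∑ m ∈ Finset.range (t + 1), binTail (t + 1) η (m + 1) * u m
      = (1 - η) * ∑ m ∈ Finset.range t, binTail t η (m + 1) * u m
        + η * (u 0 + ∑ m ∈ Finset.range t, binTail t η (m + 1) * u (m + 1)) := by
  have h1 : ∑ m ∈ Finset.range (t + 1), binTail t η (m + 1) * u m
      = ∑ m ∈ Finset.range t, binTail t η (m + 1) * u m := by
    rw [Finset.sum_range_succ, binTail_of_lt (Nat.lt_succ_self t)]; simp
  have h2 : ∑ m ∈ Finset.range (t + 1), binTail t η m * u m
      = u 0 + ∑ m ∈ Finset.range t, binTail t η (m + 1) * u (m + 1) := by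
    rw [Finset.sum_range_succ', binTail_zero]; ring
  rw [← h1, ← h2, Finset.mul_sum, Finset.mul_sum, ← Finset.sum_add_distrib]
  exact Finset.sum_congr rfl fun m _ => by rw [binTail_succ_succ]; ring

/-- With G_t the sum, the recursion reads kG_{t+1} = (1-η+k) kG_t + ηk. Bounding 1-η+k by 1+k makes
it a geometric recursion with the stated solution. It is applied with x = |SS| k: the number of
sequences is offset by η = 1/|SS|. -/
theorem mul_sum_binTail_mul_pow_le {η k : ℝ} (h0 : 0 ≤ η) (h1 : η ≤ 1) (hk : 0 ≤ k) {x : ℝ}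
    (hx : 0 ≤ x) (hηx : η * x = k) (t : ℕ) :
    k * ∑ m ∈ Finset.range t, binTail t η (m + 1) * x ^ m ≤ η * ((1 + k) ^ t - 1) := by
  induction t with
  | zero => simp
  | succ t ih =>
    rw [sum_binTail_mul_succ]
    have e : ∑ m ∈ Finset.range t, binTail t η (m + 1) * x ^ (m + 1)
        = x * ∑ m ∈ Finset.range t, binTail t η (m + 1) * x ^ m := by
      rw [Finset.mul_sum]; exact Finset.sum_congr rfl fun m _ => by ring
    rw [e]
    set G := ∑ m ∈ Finset.range t, binTail t η (m + 1) * x ^ m with hG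
    have hG0 : 0 ≤ G := Finset.sum_nonneg fun m _ =>
      mul_nonneg (binTail_nonneg _ _ h0 h1) (pow_nonneg hx _)
    have e2 : k * ((1 - η) * G + η * (x ^ 0 + x * G)) = (1 - η + k) * (k * G) + η * k := by
      rw [← hηx]; ring
    rw [e2, pow_succ]
    have : (1 - η + k) * (k * G) ≤ (1 + k) * (k * G) := by
      gcongr; linarith
    nlinarith

end BinTail

/-! ### The estimated nuisance functions and their population counterparts -/

section AlphaHat

variable {d n M : ℕ} {SS : Finset (Finset (Fin d))}

open Classical in
/-- The index set of the sum defining `alphaHat`. -/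
def seqIndex (M : ℕ) (S : SS) : Finset (Σ m : ℕ, Fin m → SS) :=
  (Finset.range M).sigma fun m => Finset.univ.filter fun s : Fin m → SS => Admissible s S

theorem lt_of_mem_seqIndex {S : SS} {j : Σ m : ℕ, Fin m → SS} (hj : j ∈ seqIndex M S) : j.1 < M := by
  simp only [seqIndex, Finset.mem_sigma, Finset.mem_range] at hj
  exact hj.1

/-- The outer restriction to ‖x‖ ≤ T is redundant, as each regression step vanishes outside it; this
gives an unconditional finite sum. -/
theorem alphaHat_eq_sum (a : (Fin d → ℝ) → ℝ) (r : (S : SS) → (S.1 → ℝ) → ℝ) (lam : SS → ℝ)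
    (X : Fin n → Fin d → ℝ) (h T : ℝ) (g : Fin n → Fin M) (l : Bool) (S : SS) (x : S.1 → ℝ) :
    alphaHat a r lam X h T g l S x = ∑ j ∈ seqIndex M S, (-1 : ℝ) ^ j.1 *
      (binTail M (SS.card : ℝ)⁻¹ (j.1 + 1) *
        regStep r lam X h T (piece g l j.1) S (ahat a r lam X h T g l j.1 j.2) x) := by
  unfold alphaHat
  split_ifs with hx
  · rw [seqIndex, Finset.sum_sigma]
    exact Finset.sum_congr rfl fun m _ => Finset.mul_sum _ _ _
  · symm
    refine Finset.sum_eq_zero fun j _ => ?_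
    simp [regStep, hx]

theorem alphaHat_congr (a : (Fin d → ℝ) → ℝ) (r : (S : SS) → (S.1 → ℝ) → ℝ) (lam : SS → ℝ)
    {X Y : Fin n → Fin d → ℝ} (h T : ℝ) (g : Fin n → Fin M) (l : Bool)
    (hXY : ∀ i ∈ half n l, X i = Y i) (S : SS) (x : S.1 → ℝ) :
    alphaHat a r lam X h T g l S x = alphaHat a r lam Y h T g l S x := by
  have hp : ∀ k, ∀ i ∈ piece g l k, X i = Y i := fun k i hi =>
    hXY i (Finset.mem_filter.1 hi).1
  rw [alphaHat_eq_sum, alphaHat_eq_sum]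
  refine Finset.sum_congr rfl fun j _ => ?_
  rw [ahat_congr a r lam h T g l j.1 j.2 fun k _ => hp k, regStep_congr r lam h T (hp j.1)]

end AlphaHat

namespace Setting

variable {d n M : ℕ} {SS : Finset (Finset (Fin d))} (P : Setting SS)

/-- The population version of `alphaHat`. -/
def alphaPop (M : ℕ) (S : SS) (x : S.1 → ℝ) : ℝ :=
  ∑ j ∈ seqIndex M S, (-1 : ℝ) ^ j.1 *
    (binTail M (SS.card : ℝ)⁻¹ (j.1 + 1) * P.popStep S (P.apop j.1 j.2) x)

theorem measurable_alphaPop (M : ℕ) (S : SS) : Measurable (P.alphaPop M S) :=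
  Finset.measurable_fun_sum _ fun j _ =>
    ((P.measurable_popStep S (P.measurable_apop j.1 j.2)).const_mul _).const_mul _

theorem integral_alphaPop (M : ℕ) (S : SS) : ∫ x, P.alphaPop M S (proj S.1 x) ∂P.μ = 0 := by
  unfold alphaPop
  rw [integral_finsetSum]
  · refine Finset.sum_eq_zero fun j _ => ?_
    rw [integral_const_mul, integral_const_mul,
      P.integral_popStep S (P.measurable_apop j.1 j.2) (P.abs_apop_le j.1 j.2)]
    simp
  · intro j _
    refine Integrable.const_mul (Integrable.const_mul ?_ _) _
    exact integrable_of_bound ((P.measurable_popStep S (P.measurable_apop j.1 j.2)).comp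
      (measurable_proj _)) fun x => P.abs_popStep_le S (P.abs_apop_le j.1 j.2) _

/-- A common bound for the functions `alphaPop` and `alphaHat`. -/
def alphaBound (M : ℕ) (S : SS) : ℝ :=
  ∑ j ∈ seqIndex M S, |binTail M (SS.card : ℝ)⁻¹ (j.1 + 1)| * (2 * (2 ^ j.1 * P.b))

theorem abs_alphaPop_le (M : ℕ) (S : SS) (x : S.1 → ℝ) : |P.alphaPop M S x| ≤ P.alphaBound M S := by
  refine (Finset.abs_sum_le_sum_abs _ _).trans (Finset.sum_le_sum fun j _ => ?_)
  rw [abs_mul, abs_mul, abs_pow, abs_neg, abs_one, one_pow, one_mul]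
  gcongr
  exact P.abs_popStep_le S (P.abs_apop_le j.1 j.2) x

variable {h T t L₁ L₂ L₃ Err : ℝ} {K : ℕ} {g : Fin n → Fin M} {l : Bool}

theorem abs_alphaHat_le (hh : 0 < h) (X : Fin n → Fin d → ℝ) (S : SS) (x : S.1 → ℝ) :
    |alphaHat P.a P.r P.lam X h T g l S x| ≤ P.alphaBound M S := by
  rw [alphaHat_eq_sum]
  refine (Finset.abs_sum_le_sum_abs _ _).trans (Finset.sum_le_sum fun j _ => ?_)
  rw [abs_mul, abs_mul, abs_pow, abs_neg, abs_one, one_pow, one_mul]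
  gcongr
  exact P.abs_regStep_le hh T _ S X (P.abs_ahat_le hh T g l X j.1 j.2) x

theorem measurable_alphaHat (hh : 0 < h) (T : ℝ) (g : Fin n → Fin M) (l : Bool) (S : SS)
    {Ω : Type*} [MeasurableSpace Ω] {U : Ω → Fin n → Fin d → ℝ} {u : Ω → S.1 → ℝ}
    (hU : Measurable U) (hu : Measurable u) :
    Measurable fun ω => alphaHat P.a P.r P.lam (U ω) h T g l S (u ω) := by
  simp_rw [alphaHat_eq_sum]
  refine Finset.measurable_fun_sum _ fun j _ => ((P.measurable_regStep hh T _ S hU hu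
    (φ := fun ω => ahat P.a P.r P.lam (U ω) h T g l j.1 j.2) ?_).const_mul _).const_mul _
  exact (P.measurable_ahat hh T g l j.1 j.2).comp
    ((hU.comp measurable_fst).prodMk measurable_snd)

/-- The mean squared error of `alphaHat` as an estimator of `alphaPop`. -/
theorem lintegral_sq_alphaHat_sub_le (hh : 0 < h) (hO : P.OscBound h t L₁ L₂ L₃) (hK : 1 ≤ K)
    (hKT : 2 * T ≤ K * h) (hErr : 0 ≤ Err) (hSB : P.StepBound g l T t L₁ L₂ L₃ K Err) (S : SS) :
    ∫⁻ X, ∫⁻ x, ENNReal.ofReal ((alphaHat P.a P.r P.lam X h T g l S x - P.alphaPop M S x) ^ 2)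
        ∂P.μ.map (proj S.1) ∂Measure.pi (fun _ : Fin n => P.μ)
      ≤ ENNReal.ofReal (((SS.card : ℝ)⁻¹ * (1 + 2 * √P.amp) ^ M) ^ 2 * Err) := by
  classical
  set η := (SS.card : ℝ)⁻¹ with hη
  have hcard : 1 ≤ SS.card := Finset.card_pos.2 ⟨S.1, S.2⟩
  have hcard' : (1 : ℝ) ≤ SS.card := by exact_mod_cast hcard
  have hη0 : 0 ≤ η := by positivity
  have hη1 : η ≤ 1 := inv_le_one_of_one_le₀ hcard'
  have hamp : 0 < P.amp := by
    have := div_pos (P.C_pos S) P.c_pos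
    unfold amp; positivity
  -- The root mean square error grows by k per step. Using k^(m+1) as Cauchy–Schwarz weights makes
  -- both resulting sums equal to F, up to the factor `Err`.
  set k := 2 * √P.amp with hk
  have hk0 : 0 < k := by positivity
  have hk2 : k ^ 2 = 4 * P.amp := by rw [hk, mul_pow, Real.sq_sqrt hamp.le]; ring
  set J := seqIndex M S with hJ
  set p : (Σ m : ℕ, Fin m → SS) → ℝ := fun j => binTail M η (j.1 + 1) with hp
  have hp0 : ∀ j, 0 ≤ p j := fun j => binTail_nonneg _ _ hη0 hη1
  set q : (Σ m : ℕ, Fin m → SS) → ℝ := fun j => k ^ (j.1 + 1) with hq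
  have hq0 : ∀ j, 0 < q j := fun j => by positivity
  set F := ∑ j ∈ J, p j * q j with hF
  have hF0 : 0 ≤ F := Finset.sum_nonneg fun j _ => mul_nonneg (hp0 j) (hq0 j).le
  -- Admissibility is dropped, leaving |SS|^m sequences at level m; the generating function of
  -- binomial tails does the rest.
  have hFle : F ≤ η * (1 + k) ^ M := by
    have h1 : F ≤ ∑ m ∈ Finset.range M, (SS.card : ℝ) ^ m * (binTail M η (m + 1) * k ^ (m + 1)) := by
      rw [hF, hJ, seqIndex, Finset.sum_sigma]
      refine Finset.sum_le_sum fun m _ => ?_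
      simp only [hp, hq]
      rw [Finset.sum_const, nsmul_eq_mul]
      refine mul_le_mul_of_nonneg_right ?_ (mul_nonneg (hp0 ⟨m, fun _ => S⟩) (by positivity))
      have := Finset.card_filter_le (Finset.univ : Finset (Fin m → SS)) fun s => Admissible s S
      calc _ ≤ ((Finset.univ : Finset (Fin m → SS)).card : ℝ) := by exact_mod_cast this
        _ = _ := by simp
    have h2 := mul_sum_binTail_mul_pow_le hη0 hη1 hk0.le (x := SS.card * k) (by positivity)
      (by rw [hη]; field_simp) M
    have h3 : ∑ m ∈ Finset.range M, (SS.card : ℝ) ^ m * (binTail M η (m + 1) * k ^ (m + 1))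
        = k * ∑ m ∈ Finset.range M, binTail M η (m + 1) * (SS.card * k) ^ m := by
      rw [Finset.mul_sum]
      exact Finset.sum_congr rfl fun m _ => by rw [mul_pow]; ring
    rw [h3] at h1
    nlinarith
  set D : (Σ m : ℕ, Fin m → SS) → (Fin n → Fin d → ℝ) → (S.1 → ℝ) → ℝ := fun j X x =>
    regStep P.r P.lam X h T (piece g l j.1) S (ahat P.a P.r P.lam X h T g l j.1 j.2) x
      - P.popStep S (P.apop j.1 j.2) x with hD
  have hpt : ∀ X x, (alphaHat P.a P.r P.lam X h T g l S x - P.alphaPop M S x) ^ 2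
      ≤ F * ∑ j ∈ J, p j / q j * D j X x ^ 2 := by
    intro X x
    have e : alphaHat P.a P.r P.lam X h T g l S x - P.alphaPop M S x
        = ∑ j ∈ J, (-1 : ℝ) ^ j.1 * (p j * D j X x) := by
      rw [alphaHat_eq_sum, alphaPop, ← Finset.sum_sub_distrib]
      exact Finset.sum_congr rfl fun j _ => by simp only [hp, hD, hη]; ring
    rw [e]
    refine Finset.sum_sq_le_sum_mul_sum_of_sq_le_mul J
      (fun j _ => mul_nonneg (hp0 j) (hq0 j).le)
      (fun j _ => mul_nonneg (div_nonneg (hp0 j) (hq0 j).le) (sq_nonneg _)) fun j _ => ?_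
    rw [mul_pow, ← pow_mul, mul_comm j.1 2, pow_mul, neg_one_sq, one_pow, one_mul]
    have := (hq0 j).ne'
    refine le_of_eq ?_
    field_simp
  have hDm : ∀ j, Measurable fun z : (Fin n → Fin d → ℝ) × (S.1 → ℝ) =>
      ENNReal.ofReal (D j z.1 z.2 ^ 2) := fun j => by
    refine (((P.measurable_regStep hh T _ S measurable_fst measurable_snd
      (φ := fun z : (Fin n → Fin d → ℝ) × (S.1 → ℝ) => ahat P.a P.r P.lam z.1 h T g l j.1 j.2)
      ((P.measurable_ahat hh T g l j.1 j.2).comp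
        ((measurable_fst.comp measurable_fst).prodMk measurable_snd))).sub
      ((P.measurable_popStep S (P.measurable_apop j.1 j.2)).comp measurable_snd)).pow_const
        2).ennreal_ofReal
  calc _ ≤ ∫⁻ X, ∫⁻ x, ENNReal.ofReal F * ∑ j ∈ J, ENNReal.ofReal (p j / q j) *
        ENNReal.ofReal (D j X x ^ 2) ∂P.μ.map (proj S.1) ∂Measure.pi (fun _ : Fin n => P.μ) := by
        refine lintegral_mono fun X => lintegral_mono fun x => ?_
        refine (ENNReal.ofReal_le_ofReal (hpt X x)).trans (le_of_eq ?_)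
        rw [ENNReal.ofReal_mul hF0, ENNReal.ofReal_sum_of_nonneg fun j _ =>
          mul_nonneg (div_nonneg (hp0 j) (hq0 j).le) (sq_nonneg _)]
        congr 1
        exact Finset.sum_congr rfl fun j _ =>
          ENNReal.ofReal_mul (div_nonneg (hp0 j) (hq0 j).le)
    _ = ENNReal.ofReal F * ∑ j ∈ J, ENNReal.ofReal (p j / q j) *
        ∫⁻ X, ∫⁻ x, ENNReal.ofReal (D j X x ^ 2) ∂P.μ.map (proj S.1)
          ∂Measure.pi (fun _ : Fin n => P.μ) := by
        exact lintegral_lintegral_const_mul_sum _ _ J ENNReal.ofReal_ne_top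
          (fun _ => ENNReal.ofReal_ne_top) hDm
    _ ≤ ENNReal.ofReal F * ∑ j ∈ J, ENNReal.ofReal (p j / q j) *
        ENNReal.ofReal ((4 * P.amp) ^ (j.1 + 1) * Err) := by
        gcongr with j hj
        exact P.lintegral_sq_regStep_ahat_sub_le hh hO hK hKT hErr hSB
          (lt_of_mem_seqIndex hj) j.2 S
    _ = ENNReal.ofReal (F * (F * Err)) := by
        rw [ENNReal.ofReal_mul hF0, hF, Finset.sum_mul, ENNReal.ofReal_sum_of_nonneg fun j _ =>
          mul_nonneg (mul_nonneg (hp0 j) (hq0 j).le) hErr]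
        congr 1
        refine Finset.sum_congr rfl fun j _ => ?_
        rw [← ENNReal.ofReal_mul (div_nonneg (hp0 j) (hq0 j).le), ← hk2]
        congr 1
        have := (hq0 j).ne'
        have e : (k ^ 2) ^ (j.1 + 1) = q j * q j := by
          simp only [hq, ← pow_mul, ← pow_add]; congr 1; omega
        rw [e]
        field_simp
    _ ≤ _ := by
        refine ENNReal.ofReal_le_ofReal ?_
        rw [← mul_assoc, ← sq]
        gcongr

end Setting

/-- Bounded measurable functions. -/
def BddMeas {E : Type*} [MeasurableSpace E] (φ : E → ℝ) : Prop :=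
  Measurable φ ∧ ∃ b, ∀ x, |φ x| ≤ b

section BddMeas

variable {E : Type*} [MeasurableSpace E] {φ ψ : E → ℝ}

theorem BddMeas.integrable (hφ : BddMeas φ) (μ : Measure E) [IsFiniteMeasure μ] : Integrable φ μ :=
  hφ.2.elim fun _ hb => integrable_of_bound hφ.1 hb

theorem BddMeas.memLp (hφ : BddMeas φ) (μ : Measure E) [IsFiniteMeasure μ] (p : ℝ≥0∞) :
    MemLp φ p μ :=
  hφ.2.elim fun _ hb => memLp_of_bound hφ.1 hb p

theorem BddMeas.comp {E' : Type*} [MeasurableSpace E'] (hφ : BddMeas φ) {p : E' → E}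
    (hp : Measurable p) : BddMeas fun x => φ (p x) :=
  ⟨hφ.1.comp hp, hφ.2.imp fun _ hb x => hb (p x)⟩

theorem BddMeas.mul (hφ : BddMeas φ) (hψ : BddMeas ψ) : BddMeas fun x => φ x * ψ x := by
  obtain ⟨b, hb⟩ := hφ.2
  obtain ⟨b', hb'⟩ := hψ.2
  refine ⟨hφ.1.mul hψ.1, b * b', fun x => ?_⟩
  rw [abs_mul]
  exact mul_le_mul (hb x) (hb' x) (abs_nonneg _) ((abs_nonneg _).trans (hb x))

theorem bddMeas_const (k : ℝ) : BddMeas fun _ : E => k := ⟨measurable_const, |k|, fun _ => le_rfl⟩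

theorem BddMeas.const_mul (hφ : BddMeas φ) (k : ℝ) : BddMeas fun x => k * φ x :=
  (bddMeas_const k).mul hφ

theorem BddMeas.add (hφ : BddMeas φ) (hψ : BddMeas ψ) : BddMeas fun x => φ x + ψ x := by
  obtain ⟨b, hb⟩ := hφ.2
  obtain ⟨b', hb'⟩ := hψ.2
  exact ⟨hφ.1.add hψ.1, b + b', fun x => (abs_add_le _ _).trans (add_le_add (hb x) (hb' x))⟩

theorem BddMeas.sub (hφ : BddMeas φ) (hψ : BddMeas ψ) : BddMeas fun x => φ x - ψ x := by
  obtain ⟨b, hb⟩ := hφ.2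
  obtain ⟨b', hb'⟩ := hψ.2
  exact ⟨hφ.1.sub hψ.1, b + b', fun x => (abs_sub _ _).trans (add_le_add (hb x) (hb' x))⟩

theorem BddMeas.sum {ι : Type*} (J : Finset ι) {φ : ι → E → ℝ} (hφ : ∀ j, BddMeas (φ j)) :
    BddMeas fun x => ∑ j ∈ J, φ j x := by
  choose b hb using fun j => (hφ j).2
  exact ⟨Finset.measurable_fun_sum _ fun j _ => (hφ j).1, ∑ j ∈ J, b j, fun x =>
    (Finset.abs_sum_le_sum_abs _ _).trans (Finset.sum_le_sum fun j _ => hb j x)⟩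

end BddMeas

/-! ### Unrolling the damped Jacobi iteration -/

namespace Setting

variable {d : ℕ} {SS : Finset (Finset (Fin d))} (P : Setting SS)

theorem bddMeas_a : BddMeas P.a := ⟨P.a_meas, P.b, P.a_bdd⟩

theorem bddMeas_w (S : SS) : BddMeas (P.w S) :=
  ⟨P.measurable_w S, 1, fun x => by rw [abs_of_pos (P.w_pos S x)]; exact P.w_le_one S x⟩

theorem bddMeas_popStep (S : SS) {φ : (Fin d → ℝ) → ℝ} (hφ : BddMeas φ) :
    BddMeas (P.popStep S φ) :=
  ⟨P.measurable_popStep S hφ.1, hφ.2.elim fun b hb => ⟨2 * b, P.abs_popStep_le S hb⟩⟩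

theorem bddMeas_apop (m : ℕ) (s : Fin m → SS) : BddMeas (P.apop m s) :=
  ⟨P.measurable_apop m s, _, P.abs_apop_le m s⟩

theorem bddMeas_alphaPop (M : ℕ) (S : SS) : BddMeas (P.alphaPop M S) :=
  ⟨P.measurable_alphaPop M S, _, P.abs_alphaPop_le M S⟩

theorem popStep_sub (S : SS) {φ ψ : (Fin d → ℝ) → ℝ} (hφ : BddMeas φ) (hψ : BddMeas ψ)
    (x : S.1 → ℝ) :
    P.popStep S (fun y => φ y - ψ y) x = P.popStep S φ x - P.popStep S ψ x := by
  have hw := (P.bddMeas_w S).comp (measurable_proj S.1)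
  unfold popStep cexp wmean
  rw [integral_sub ((hφ.comp (measurable_glue_left S.1 x)).integrable _)
    ((hψ.comp (measurable_glue_left S.1 x)).integrable _)]
  simp_rw [mul_sub]
  rw [integral_sub ((hw.mul hφ).integrable _) ((hw.mul hψ).integrable _)]
  ring

theorem popStep_const_mul (S : SS) (φ : (Fin d → ℝ) → ℝ) (k : ℝ) (x : S.1 → ℝ) :
    P.popStep S (fun y => k * φ y) x = k * P.popStep S φ x := by
  unfold popStep cexp wmean
  simp_rw [mul_left_comm _ k]
  rw [integral_const_mul, integral_const_mul]
  ring

theorem popStep_sum (S : SS) {ι : Type*} (J : Finset ι) {φ : ι → (Fin d → ℝ) → ℝ}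
    (hφ : ∀ j, BddMeas (φ j)) (x : S.1 → ℝ) :
    P.popStep S (fun y => ∑ j ∈ J, φ j y) x = ∑ j ∈ J, P.popStep S (φ j) x := by
  have hw := (P.bddMeas_w S).comp (measurable_proj S.1)
  unfold popStep cexp wmean
  rw [integral_finsetSum _ fun j _ => ((hφ j).comp (measurable_glue_left S.1 x)).integrable _]
  simp_rw [Finset.mul_sum]
  rw [integral_finsetSum _ fun j _ => (hw.mul (hφ j)).integrable _, Finset.sum_div,
    ← Finset.sum_sub_distrib, Finset.mul_sum]

open Classical in
/-- The sum of the population estimates over the admissible sequences of length `m + 1` that end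
in `S`. -/
def levelSum (m : ℕ) (S : SS) (x : S.1 → ℝ) : ℝ :=
  ∑ s ∈ Finset.univ.filter (fun s : Fin m → SS => Admissible s S), P.popStep S (P.apop m s) x

theorem bddMeas_levelSum (m : ℕ) (S : SS) : BddMeas (P.levelSum m S) :=
  BddMeas.sum _ fun s => P.bddMeas_popStep S (P.bddMeas_apop m s)

theorem alphaPop_eq (M : ℕ) (S : SS) (x : S.1 → ℝ) :
    P.alphaPop M S x = ∑ m ∈ Finset.range M,
      binTail M (SS.card : ℝ)⁻¹ (m + 1) * ((-1) ^ m * P.levelSum m S x) := by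
  rw [alphaPop, seqIndex, Finset.sum_sigma]
  refine Finset.sum_congr rfl fun m _ => ?_
  rw [levelSum, Finset.mul_sum, Finset.mul_sum]
  exact Finset.sum_congr rfl fun s _ => by ring

theorem levelSum_zero (S : SS) (x : S.1 → ℝ) : P.levelSum 0 S x = P.popStep S P.a x := by
  classical
  have : (Finset.univ.filter fun s : Fin 0 → SS => Admissible s S) = Finset.univ :=
    Finset.filter_true_of_mem fun s _ => ⟨fun i => i.elim0, fun i => i.elim0⟩
  rw [levelSum, this]
  simp [apop]

theorem admissible_snoc {m : ℕ} (s : Fin m → SS) (S S' : SS) :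
    Admissible (Fin.snoc (α := fun _ => SS) s S' : Fin (m + 1) → SS) S ↔
      S' ≠ S ∧ Admissible s S' := by
  constructor
  · rintro ⟨h1, h2⟩
    refine ⟨by simpa using h2 (Fin.last m) rfl, fun i j hij => ?_, fun i hi => ?_⟩
    · simpa using h1 i.castSucc j.castSucc (by simpa using hij)
    · simpa using h1 i.castSucc (Fin.last m) (by simpa using hi)
  · rintro ⟨h1, h2, h3⟩
    refine ⟨fun i j hij => ?_, fun i hi => ?_⟩
    · induction j using Fin.lastCases with
      | last =>
        induction i using Fin.lastCases with
        | last => simp at hij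
        | cast i => simpa using h3 i (by simpa using hij)
      | cast j =>
        induction i using Fin.lastCases with
        | last =>
          exfalso
          simp only [Fin.val_last, Fin.val_castSucc] at hij
          omega
        | cast i => simpa using h2 i j (by simpa using hij)
    · have : i = Fin.last m := Fin.ext (by simpa using hi)
      simpa [this] using h1

theorem apop_snoc {m : ℕ} (s : Fin m → SS) (S : SS) :
    P.apop (m + 1) (Fin.snoc (α := fun _ => SS) s S)
      = fun y => P.popStep S (P.apop m s) (proj S.1 y) := by
  have h : ∀ s' : Fin (m + 1) → SS, s' (Fin.last m) = S → Fin.init s' = s →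
      P.apop (m + 1) s' = fun y => P.popStep S (P.apop m s) (proj S.1 y) := by
    rintro s' rfl rfl
    rfl
  exact h _ (by simp) (by simp)

/-- Peel off the entry S' preceding S. Admissibility says S' ≠ S and that the rest is admissible
before S', and `popStep` is linear on bounded functions. -/
theorem levelSum_succ (m : ℕ) (S : SS) (x : S.1 → ℝ) :
    P.levelSum (m + 1) S x = ∑ S' ∈ Finset.univ.erase S,
      P.popStep S (fun y => P.levelSum m S' (proj S'.1 y)) x := by
  classical
  rw [levelSum, Finset.sum_filter, ← (Fin.snocEquiv fun _ : Fin (m + 1) => SS).sum_comp,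
    Fintype.sum_prod_type]
  have h1 : ∀ S' : SS, ∑ s : Fin m → SS,
      (if Admissible ((Fin.snocEquiv fun _ : Fin (m + 1) => SS) (S', s)) S then
        P.popStep S (P.apop (m + 1) ((Fin.snocEquiv fun _ : Fin (m + 1) => SS) (S', s))) x else 0)
      = if S' ≠ S then P.popStep S (fun y => P.levelSum m S' (proj S'.1 y)) x else 0 := by
    intro S'
    have h2 : ∀ s : Fin m → SS, (Fin.snocEquiv fun _ : Fin (m + 1) => SS) (S', s)
        = (Fin.snoc (α := fun _ => SS) s S' : Fin (m + 1) → SS) := fun s => rfl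
    simp_rw [h2, admissible_snoc]
    split_ifs with hS
    · simp only [hS, ne_eq, not_false_eq_true, true_and]
      unfold levelSum
      rw [P.popStep_sum S _ fun s => (P.bddMeas_popStep S' (P.bddMeas_apop m s)).comp
        (measurable_proj _), Finset.sum_filter]
      refine Finset.sum_congr rfl fun s _ => ?_
      split_ifs
      · rw [apop_snoc]
      · rfl
    · simp [hS]
  simp_rw [h1]
  rw [← Finset.sum_filter]
  congr 1
  ext S'; simp

/-- The population functions follow a damped Jacobi iteration. -/
theorem alphaPop_succ (t : ℕ) (S : SS) (x : S.1 → ℝ) :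
    P.alphaPop (t + 1) S x = (1 - (SS.card : ℝ)⁻¹) * P.alphaPop t S x + (SS.card : ℝ)⁻¹ *
      P.popStep S (fun y => P.a y - ∑ S' ∈ Finset.univ.erase S, P.alphaPop t S' (proj S'.1 y)) x := by
  have hb : ∀ S' : SS, BddMeas fun y => P.alphaPop t S' (proj S'.1 y) := fun S' =>
    (P.bddMeas_alphaPop t S').comp (measurable_proj _)
  rw [P.popStep_sub S P.bddMeas_a (BddMeas.sum _ hb), P.popStep_sum S _ hb]
  have h1 : ∀ S' : SS, P.popStep S (fun y => P.alphaPop t S' (proj S'.1 y)) x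
      = ∑ m ∈ Finset.range t, binTail t (SS.card : ℝ)⁻¹ (m + 1) * ((-1) ^ m *
        P.popStep S (fun y => P.levelSum m S' (proj S'.1 y)) x) := by
    intro S'
    simp_rw [alphaPop_eq]
    rw [P.popStep_sum S _ fun m => (((P.bddMeas_levelSum m S').comp
      (measurable_proj _)).const_mul _).const_mul _]
    simp_rw [popStep_const_mul]
  simp_rw [h1]
  -- Pascal's recursion splits the weights into a part without update, with factor 1-η, and a part
  -- with update, in which every level moves up by one; `levelSum_succ` identifies the shifted
  -- levels.
  rw [Finset.sum_comm, P.alphaPop_eq (t + 1), sum_binTail_mul_succ, ← alphaPop_eq]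
  congr 2
  rw [pow_zero, one_mul, levelSum_zero, sub_eq_add_neg, ← Finset.sum_neg_distrib]
  congr 1
  refine Finset.sum_congr rfl fun m _ => ?_
  rw [levelSum_succ, ← Finset.mul_sum, ← Finset.mul_sum]
  ring

end Setting

/-! ### Expansion of the objective, descent and a gradient bound -/

namespace Setting

variable {d : ℕ} {SS : Finset (Finset (Fin d))} (P : Setting SS)

/-- Families of square-integrable mean-zero functions. -/
def MemH (α : (S : SS) → (S.1 → ℝ) → ℝ) : Prop :=
  ∀ S, MemLp (α S) 2 (P.μ.map (proj S.1)) ∧ ∫ x, α S x ∂P.μ.map (proj S.1) = 0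

/-- The objective function with normalised shifts. -/
def energy (α : (S : SS) → (S.1 → ℝ) → ℝ) : ℝ :=
  variance (fun x => P.a x - ∑ S : SS, α S (proj S.1 x)) P.μ
    + ∑ S : SS, ∫ x, α S x ^ 2 / (P.lam S * P.r S x) ∂P.μ.map (proj S.1)

/-- `1 / (λ r)`. -/
def invShift (S : SS) (x : S.1 → ℝ) : ℝ := (P.lam S * P.r S x)⁻¹

theorem invShift_pos (S : SS) (x : S.1 → ℝ) : 0 < P.invShift S x := inv_pos.2 (P.lam_r_pos S x)

theorem inv_w_eq (S : SS) (x : S.1 → ℝ) : (P.w S x)⁻¹ = 1 + P.invShift S x := by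
  rw [P.inv_w, invShift, one_div]

theorem invShift_le (S : SS) (x : S.1 → ℝ) : P.invShift S x ≤ (P.lam S * P.c)⁻¹ :=
  inv_anti₀ (mul_pos (P.lam_pos S) P.c_pos)
    (mul_le_mul_of_nonneg_left (P.r_ge S x) (P.lam_pos S).le)

theorem bddMeas_invShift (S : SS) : BddMeas (P.invShift S) := by
  refine ⟨((P.r_meas S).const_mul _).inv, (P.lam S * P.c)⁻¹, fun x => ?_⟩
  rw [abs_of_pos (P.invShift_pos S x)]
  exact P.invShift_le S x

theorem bddMeas_inv_w (S : SS) : BddMeas fun x => (P.w S x)⁻¹ := by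
  simp_rw [inv_w_eq]
  exact (bddMeas_const 1).add (P.bddMeas_invShift S)

theorem integrable_mul_bddMeas {E : Type*} [MeasurableSpace E] {μ : Measure E} {F G : E → ℝ}
    (hF : Integrable F μ) (hG : BddMeas G) : Integrable (fun x => F x * G x) μ :=
  hG.2.elim fun b hb => hF.mul_bdd (c := b) hG.1.aestronglyMeasurable (Eventually.of_forall hb)

variable {P} {α v : (S : SS) → (S.1 → ℝ) → ℝ}

theorem MemH.memLp (hα : P.MemH α) (S : SS) : MemLp (fun x => α S (proj S.1 x)) 2 P.μ :=
  (hα S).1.comp_measurePreserving ⟨measurable_proj S.1, rfl⟩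

theorem MemH.mean (hα : P.MemH α) (S : SS) : ∫ x, α S (proj S.1 x) ∂P.μ = 0 := by
  rw [← (hα S).2, integral_map (measurable_proj S.1).aemeasurable (hα S).1.1]

theorem MemH.integrable (hα : P.MemH α) (S : SS) : Integrable (fun x => α S (proj S.1 x)) P.μ :=
  (hα.memLp S).integrable one_le_two

theorem MemH.memLp_sum (hα : P.MemH α) : MemLp (fun x => ∑ S : SS, α S (proj S.1 x)) 2 P.μ :=
  memLp_finsetSum _ fun S _ => hα.memLp S

theorem MemH.integrable_mul (hα : P.MemH α) (hv : P.MemH v) (S : SS) :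
    Integrable (fun x => α S (proj S.1 x) * v S (proj S.1 x)) P.μ :=
  (hα.memLp S).integrable_mul (hv.memLp S)

theorem MemH.integrable_mul_mul (hα : P.MemH α) (hv : P.MemH v) (S : SS)
    {G : (S.1 → ℝ) → ℝ} (hG : BddMeas G) :
    Integrable (fun x => α S (proj S.1 x) * v S (proj S.1 x) * G (proj S.1 x)) P.μ :=
  integrable_mul_bddMeas (hα.integrable_mul hv S) (hG.comp (measurable_proj _))

theorem MemH.add (hα : P.MemH α) (hv : P.MemH v) : P.MemH fun S x => α S x + v S x := by
  intro S
  refine ⟨(hα S).1.add (hv S).1, ?_⟩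
  rw [integral_add ((hα S).1.integrable one_le_two) ((hv S).1.integrable one_le_two), (hα S).2,
    (hv S).2, add_zero]

theorem MemH.sub (hα : P.MemH α) (hv : P.MemH v) : P.MemH fun S x => α S x - v S x := by
  intro S
  refine ⟨(hα S).1.sub (hv S).1, ?_⟩
  rw [integral_sub ((hα S).1.integrable one_le_two) ((hv S).1.integrable one_le_two), (hα S).2,
    (hv S).2, sub_zero]

theorem MemH.const_mul (hα : P.MemH α) (k : ℝ) : P.MemH fun S x => k * α S x := by
  intro S
  refine ⟨(hα S).1.const_mul k, ?_⟩
  rw [integral_const_mul, (hα S).2, mul_zero]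

variable (P)

/-- The target. -/
def θ : ℝ := ∫ x, P.a x ∂P.μ

variable {P}

theorem MemH.memLp_resid (hα : P.MemH α) :
    MemLp (fun x => P.a x - P.θ - ∑ S : SS, α S (proj S.1 x)) 2 P.μ :=
  ((P.bddMeas_a.memLp P.μ 2).sub (memLp_const P.θ)).sub hα.memLp_sum

theorem MemH.energy_eq (hα : P.MemH α) :
    P.energy α = ∫ x, (P.a x - P.θ - ∑ S : SS, α S (proj S.1 x)) ^ 2 ∂P.μ
      + ∑ S : SS, ∫ x, α S (proj S.1 x) * α S (proj S.1 x) * P.invShift S (proj S.1 x) ∂P.μ := by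
  unfold energy
  have ha := P.bddMeas_a.integrable P.μ
  have hs : Integrable (fun x => ∑ S : SS, α S (proj S.1 x)) P.μ :=
    hα.memLp_sum.integrable one_le_two
  congr 1
  · rw [variance_eq_integral (ha.sub' hs).aestronglyMeasurable.aemeasurable, integral_sub ha hs,
      integral_finsetSum _ fun S _ => hα.integrable S]
    simp_rw [hα.mean, Finset.sum_const_zero, sub_zero]
    exact integral_congr_ae (Eventually.of_forall fun x => by simp only [θ]; ring)
  · refine Finset.sum_congr rfl fun S _ => ?_
    rw [integral_map (measurable_proj S.1).aemeasurable]
    · exact integral_congr_ae (Eventually.of_forall fun x => by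
        simp only [invShift, div_eq_mul_inv, sq])
    · simp_rw [div_eq_mul_inv]
      exact ((hα S).1.integrable_sq.aestronglyMeasurable).mul
        (P.bddMeas_invShift S).1.aestronglyMeasurable

/-- Second-order expansion of the objective function. -/
theorem MemH.energy_add (hα : P.MemH α) (hv : P.MemH v) :
    P.energy (fun S x => α S x + v S x) = P.energy α
      - 2 * ∑ S : SS, (∫ x, v S (proj S.1 x) * (P.a x - P.θ - ∑ S' : SS, α S' (proj S'.1 x)) ∂P.μ
        - ∫ x, α S (proj S.1 x) * v S (proj S.1 x) * P.invShift S (proj S.1 x) ∂P.μ)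
      + (∫ x, (∑ S : SS, v S (proj S.1 x)) ^ 2 ∂P.μ
        + ∑ S : SS, ∫ x, v S (proj S.1 x) * v S (proj S.1 x) * P.invShift S (proj S.1 x) ∂P.μ) := by
  rw [(hα.add hv).energy_eq, hα.energy_eq]
  have hu := hα.memLp_resid
  have hV := hv.memLp_sum
  have e1 : ∫ x, (P.a x - P.θ - ∑ S : SS, (α S (proj S.1 x) + v S (proj S.1 x))) ^ 2 ∂P.μ
      = ∫ x, (P.a x - P.θ - ∑ S : SS, α S (proj S.1 x)) ^ 2 ∂P.μ
        - 2 * ∑ S : SS, ∫ x, v S (proj S.1 x) *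
          (P.a x - P.θ - ∑ S' : SS, α S' (proj S'.1 x)) ∂P.μ
        + ∫ x, (∑ S : SS, v S (proj S.1 x)) ^ 2 ∂P.μ := by
    have hi : ∀ S : SS, Integrable (fun x => v S (proj S.1 x) *
        (P.a x - P.θ - ∑ S' : SS, α S' (proj S'.1 x))) P.μ := fun S =>
      (hv.memLp S).integrable_mul hu
    have hi' : Integrable (fun x => ∑ S : SS, v S (proj S.1 x) *
        (P.a x - P.θ - ∑ S' : SS, α S' (proj S'.1 x))) P.μ := integrable_finsetSum _ fun S _ => hi S
    rw [← integral_finsetSum _ fun S _ => hi S, ← integral_const_mul,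
      ← integral_sub hu.integrable_sq (hi'.const_mul 2),
      ← integral_add (hu.integrable_sq.sub' (hi'.const_mul 2)) hV.integrable_sq]
    refine integral_congr_ae (Eventually.of_forall fun x => ?_)
    simp only
    rw [← Finset.sum_mul, Finset.sum_add_distrib]
    ring
  have e2 : ∀ S : SS, ∫ x, (α S (proj S.1 x) + v S (proj S.1 x)) *
      (α S (proj S.1 x) + v S (proj S.1 x)) * P.invShift S (proj S.1 x) ∂P.μ
      = ∫ x, α S (proj S.1 x) * α S (proj S.1 x) * P.invShift S (proj S.1 x) ∂P.μ
        + 2 * ∫ x, α S (proj S.1 x) * v S (proj S.1 x) * P.invShift S (proj S.1 x) ∂P.μ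
        + ∫ x, v S (proj S.1 x) * v S (proj S.1 x) * P.invShift S (proj S.1 x) ∂P.μ := by
    intro S
    have h1 := hα.integrable_mul_mul hα S (P.bddMeas_invShift S)
    have h2 := (hα.integrable_mul_mul hv S (P.bddMeas_invShift S)).const_mul 2
    have h3 := hv.integrable_mul_mul hv S (P.bddMeas_invShift S)
    rw [← integral_const_mul, ← integral_add h1 h2, ← integral_add (h1.fun_add h2) h3]
    exact integral_congr_ae (Eventually.of_forall fun x => by simp only; ring)
  rw [e1]
  simp_rw [e2]
  rw [Finset.sum_add_distrib, Finset.sum_add_distrib, Finset.sum_sub_distrib, ← Finset.mul_sum]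
  ring

variable (P)

/-- The update of one Jacobi step. -/
def jacobi (α : (S : SS) → (S.1 → ℝ) → ℝ) (S : SS) (x : S.1 → ℝ) : ℝ :=
  P.popStep S (fun y => P.a y - ∑ S' ∈ Finset.univ.erase S, α S' (proj S'.1 y)) x - α S x

/-- Families of bounded measurable mean-zero functions. -/
def BddH (α : (S : SS) → (S.1 → ℝ) → ℝ) : Prop :=
  ∀ S, BddMeas (α S) ∧ ∫ x, α S (proj S.1 x) ∂P.μ = 0

variable {P}

theorem BddH.memH (hα : P.BddH α) : P.MemH α := fun S =>
  ⟨(hα S).1.memLp _ 2, by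
    rw [integral_map (measurable_proj S.1).aemeasurable (hα S).1.1.aestronglyMeasurable]
    exact (hα S).2⟩

theorem BddH.bddMeas_others (hα : P.BddH α) (S : SS) :
    BddMeas fun y => P.a y - ∑ S' ∈ Finset.univ.erase S, α S' (proj S'.1 y) :=
  P.bddMeas_a.sub (BddMeas.sum _ fun S' => (hα S').1.comp (measurable_proj _))

theorem BddH.jacobi (hα : P.BddH α) : P.BddH (P.jacobi α) := by
  intro S
  have h := hα.bddMeas_others S
  have h1 := P.bddMeas_popStep S h
  refine ⟨h1.sub (hα S).1, ?_⟩
  obtain ⟨b, hb⟩ := h.2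
  unfold Setting.jacobi
  rw [integral_sub ((h1.comp (measurable_proj _)).integrable _)
    (((hα S).1.comp (measurable_proj _)).integrable _), (hα S).2, P.integral_popStep S h.1 hb,
    sub_zero]

/-- Up to a factor, the left side is the derivative of the objective in direction v_S. It is the
1/w-weighted inner product of v_S with the Jacobi update: the identity 1/w = 1 + 1/(λr) moves the
diagonal term α_S into the update. -/
theorem BddH.first_order (hα : P.BddH α) (hv : P.MemH v) (S : SS) :
    ∫ x, v S (proj S.1 x) * (P.a x - P.θ - ∑ S' : SS, α S' (proj S'.1 x)) ∂P.μ
        - ∫ x, α S (proj S.1 x) * v S (proj S.1 x) * P.invShift S (proj S.1 x) ∂P.μ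
      = ∫ x, P.jacobi α S (proj S.1 x) * v S (proj S.1 x) * (P.w S (proj S.1 x))⁻¹ ∂P.μ := by
  have h := hα.bddMeas_others S
  obtain ⟨b, hb⟩ := h.2
  have key := P.integral_popStep_mul_div_w S h.1 hb (hv.integrable S) (hv.mean S)
  have h1 : Integrable (fun x => P.popStep S
      (fun y => P.a y - ∑ S' ∈ Finset.univ.erase S, α S' (proj S'.1 y)) (proj S.1 x) *
      v S (proj S.1 x) * (P.w S (proj S.1 x))⁻¹) P.μ := by
    refine integrable_mul_bddMeas ?_ ((P.bddMeas_inv_w S).comp (measurable_proj _))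
    simp_rw [mul_comm _ (v S _)]
    exact integrable_mul_bddMeas (hv.integrable S)
      ((P.bddMeas_popStep S h).comp (measurable_proj _))
  have h2 := hα.memH.integrable_mul_mul hv S (P.bddMeas_inv_w S)
  have h3 := hα.memH.integrable_mul hv S
  have h4 := hα.memH.integrable_mul_mul hv S (P.bddMeas_invShift S)
  have h5 := integrable_mul_bddMeas (hv.integrable S) h
  have e1 : ∫ x, P.jacobi α S (proj S.1 x) * v S (proj S.1 x) * (P.w S (proj S.1 x))⁻¹ ∂P.μ
      = ∫ x, v S (proj S.1 x) *
          (P.a x - ∑ S' ∈ Finset.univ.erase S, α S' (proj S'.1 x)) ∂P.μ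
        - ∫ x, α S (proj S.1 x) * v S (proj S.1 x) * (P.w S (proj S.1 x))⁻¹ ∂P.μ := by
    rw [← key, ← integral_sub h1 h2]
    exact integral_congr_ae (Eventually.of_forall fun x => by simp only [Setting.jacobi]; ring)
  have e2 : ∫ x, α S (proj S.1 x) * v S (proj S.1 x) * (P.w S (proj S.1 x))⁻¹ ∂P.μ
      = ∫ x, α S (proj S.1 x) * v S (proj S.1 x) ∂P.μ
        + ∫ x, α S (proj S.1 x) * v S (proj S.1 x) * P.invShift S (proj S.1 x) ∂P.μ := by
    rw [← integral_add h3 h4]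
    exact integral_congr_ae (Eventually.of_forall fun x => by simp only [inv_w_eq]; ring)
  have e3 : ∫ x, v S (proj S.1 x) * (P.a x - P.θ - ∑ S' : SS, α S' (proj S'.1 x)) ∂P.μ
      = ∫ x, v S (proj S.1 x) *
          (P.a x - ∑ S' ∈ Finset.univ.erase S, α S' (proj S'.1 x)) ∂P.μ
        - ∫ x, α S (proj S.1 x) * v S (proj S.1 x) ∂P.μ := by
    -- Directions are centred, so the constant θ does not contribute.
    have h6 : ∫ x, v S (proj S.1 x) * P.θ ∂P.μ = 0 := by
      rw [integral_mul_const, hv.mean, zero_mul]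
    rw [← sub_zero (∫ x, v S (proj S.1 x) *
          (P.a x - ∑ S' ∈ Finset.univ.erase S, α S' (proj S'.1 x)) ∂P.μ
        - ∫ x, α S (proj S.1 x) * v S (proj S.1 x) ∂P.μ), ← h6, ← integral_sub h5 h3,
      ← integral_sub (h5.sub' h3) ((hv.integrable S).mul_const _)]
    refine integral_congr_ae (Eventually.of_forall fun x => ?_)
    simp only
    rw [← Finset.add_sum_erase _ _ (Finset.mem_univ S)]
    ring
  rw [e1, e2, e3]
  ring

/-- The increment of the objective function, before integration. -/
def increment (P : Setting SS) (δ v : (S : SS) → (S.1 → ℝ) → ℝ) (x : Fin d → ℝ) : ℝ :=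
  -2 * ∑ S : SS, δ S (proj S.1 x) * v S (proj S.1 x) * (P.w S (proj S.1 x))⁻¹
    + ((∑ S : SS, v S (proj S.1 x)) ^ 2
      + ∑ S : SS, v S (proj S.1 x) * v S (proj S.1 x) * P.invShift S (proj S.1 x))

/-- `∑ v² / w`. -/
def wnorm (P : Setting SS) (v : (S : SS) → (S.1 → ℝ) → ℝ) (x : Fin d → ℝ) : ℝ :=
  ∑ S : SS, v S (proj S.1 x) * v S (proj S.1 x) * (P.w S (proj S.1 x))⁻¹

theorem MemH.integrable_wnorm (hv : P.MemH v) : Integrable (P.wnorm v) P.μ :=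
  integrable_finsetSum _ fun S _ => hv.integrable_mul_mul hv S (P.bddMeas_inv_w S)

theorem MemH.integrable_increment {δ : (S : SS) → (S.1 → ℝ) → ℝ} (hδ : P.MemH δ)
    (hv : P.MemH v) : Integrable (P.increment δ v) P.μ :=
  ((integrable_finsetSum _ fun S _ =>
      hδ.integrable_mul_mul hv S (P.bddMeas_inv_w S)).const_mul (-2)).add
    (hv.memLp_sum.integrable_sq.add (integrable_finsetSum _ fun S _ =>
      hv.integrable_mul_mul hv S (P.bddMeas_invShift S)))

theorem BddH.energy_add (hα : P.BddH α) (hv : P.MemH v) :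
    P.energy (fun S x => α S x + v S x)
      = P.energy α + ∫ x, P.increment (P.jacobi α) v x ∂P.μ := by
  rw [hα.memH.energy_add hv]
  simp_rw [hα.first_order hv]
  have hδ := hα.jacobi.memH
  have h1 : ∀ S : SS, Integrable (fun x => P.jacobi α S (proj S.1 x) * v S (proj S.1 x) *
      (P.w S (proj S.1 x))⁻¹) P.μ := fun S => hδ.integrable_mul_mul hv S (P.bddMeas_inv_w S)
  have h2 : ∀ S : SS, Integrable (fun x => v S (proj S.1 x) * v S (proj S.1 x) *
      P.invShift S (proj S.1 x)) P.μ := fun S => hv.integrable_mul_mul hv S (P.bddMeas_invShift S)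
  unfold increment
  rw [integral_add ((integrable_finsetSum _ fun S _ => h1 S).const_mul (-2))
    (hv.memLp_sum.integrable_sq.fun_add (integrable_finsetSum _ fun S _ => h2 S)),
    integral_add hv.memLp_sum.integrable_sq (integrable_finsetSum _ fun S _ => h2 S),
    integral_const_mul, integral_finsetSum _ fun S _ => h1 S, integral_finsetSum _ fun S _ => h2 S]
  ring

/-- Cauchy–Schwarz over the blocks: the full quadratic form is at most |SS| times its block-diagonal
part. This dictates the damping 1/|SS|. -/
theorem sq_sum_add_le_wnorm (hSS : SS.Nonempty) (v : (S : SS) → (S.1 → ℝ) → ℝ) (x : Fin d → ℝ) :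
    (∑ S : SS, v S (proj S.1 x)) ^ 2
      + ∑ S : SS, v S (proj S.1 x) * v S (proj S.1 x) * P.invShift S (proj S.1 x)
      ≤ SS.card * P.wnorm v x := by
  have hcard : (1 : ℝ) ≤ SS.card := by exact_mod_cast hSS.card_pos
  have h1 : (∑ S : SS, v S (proj S.1 x)) ^ 2 ≤ SS.card * ∑ S : SS, v S (proj S.1 x) ^ 2 := by
    have := sq_sum_le_card_mul_sum_sq (s := (Finset.univ : Finset SS))
      (f := fun S => v S (proj S.1 x))
    simpa using this
  have h2 : 0 ≤ ∑ S : SS, v S (proj S.1 x) * v S (proj S.1 x) * P.invShift S (proj S.1 x) :=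
    Finset.sum_nonneg fun S _ => mul_nonneg (mul_self_nonneg _) (P.invShift_pos S _).le
  have h3 : P.wnorm v x = ∑ S : SS, v S (proj S.1 x) ^ 2
      + ∑ S : SS, v S (proj S.1 x) * v S (proj S.1 x) * P.invShift S (proj S.1 x) := by
    rw [wnorm, ← Finset.sum_add_distrib]
    exact Finset.sum_congr rfl fun S _ => by rw [P.inv_w_eq]; ring
  rw [h3]
  nlinarith

/-- With η = 1/|SS| and update δ, the linear term gives -2η‖δ‖² and the quadratic term at most |SS|
η² ‖δ‖² = η‖δ‖². -/
theorem BddH.energy_jacobi_le (hSS : SS.Nonempty) (hα : P.BddH α) :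
    P.energy (fun S x => α S x + (SS.card : ℝ)⁻¹ * P.jacobi α S x)
      ≤ P.energy α - (SS.card : ℝ)⁻¹ * ∫ x, P.wnorm (P.jacobi α) x ∂P.μ := by
  have hcard : (0 : ℝ) < SS.card := by exact_mod_cast hSS.card_pos
  have hδ := hα.jacobi.memH
  rw [hα.energy_add (hδ.const_mul _), sub_eq_add_neg, ← neg_mul, ← integral_const_mul]
  refine add_le_add le_rfl (integral_mono (hδ.integrable_increment (hδ.const_mul _))
    (hδ.integrable_wnorm.const_mul _) fun x => ?_)
  have h := sq_sum_add_le_wnorm (P := P) hSS (fun S x => (SS.card : ℝ)⁻¹ * P.jacobi α S x) x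
  have h1 : P.wnorm (fun S x => (SS.card : ℝ)⁻¹ * P.jacobi α S x) x
      = (SS.card : ℝ)⁻¹ ^ 2 * P.wnorm (P.jacobi α) x := by
    rw [wnorm, wnorm, Finset.mul_sum]
    exact Finset.sum_congr rfl fun S _ => by ring
  have h2 : ∑ S : SS, P.jacobi α S (proj S.1 x) * ((SS.card : ℝ)⁻¹ * P.jacobi α S (proj S.1 x)) *
      (P.w S (proj S.1 x))⁻¹ = (SS.card : ℝ)⁻¹ * P.wnorm (P.jacobi α) x := by
    rw [wnorm, Finset.mul_sum]
    exact Finset.sum_congr rfl fun S _ => by ring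
  rw [h1] at h
  unfold increment
  rw [h2]
  have e : (SS.card : ℝ) * ((SS.card : ℝ)⁻¹ ^ 2 * P.wnorm (P.jacobi α) x)
      = (SS.card : ℝ)⁻¹ * P.wnorm (P.jacobi α) x := by field_simp
  rw [e] at h
  simp only
  linarith

/-- A gradient-dominance bound. Discard the square of the sum from the quadratic term; the rest
decouples over blocks and points, and 2δv/w - v²/(λr) is largest at v = (1+λr)δ, with value
(1+λr)δ²/w. The bound 1 + Cλ_max is uniform in v. -/
theorem BddH.energy_sub_le (hα : P.BddH α) (hv : P.MemH v) :
    P.energy α - P.energy (fun S x => α S x + v S x)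
      ≤ (1 + P.C * ⨆ S, P.lam S) * ∫ x, P.wnorm (P.jacobi α) x ∂P.μ := by
  have hδ := hα.jacobi.memH
  rw [hα.energy_add hv, sub_add_cancel_left, ← integral_neg, ← integral_const_mul]
  refine integral_mono (hδ.integrable_increment hv).neg
    (hδ.integrable_wnorm.const_mul _) fun x => ?_
  simp only [increment, wnorm]
  have h0 := sq_nonneg (∑ S : SS, v S (proj S.1 x))
  suffices hs : 2 * ∑ S : SS, P.jacobi α S (proj S.1 x) * v S (proj S.1 x) * (P.w S (proj S.1 x))⁻¹
      - ∑ S : SS, v S (proj S.1 x) * v S (proj S.1 x) * P.invShift S (proj S.1 x)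
      ≤ (1 + P.C * ⨆ S, P.lam S) * ∑ S : SS, P.jacobi α S (proj S.1 x) *
        P.jacobi α S (proj S.1 x) * (P.w S (proj S.1 x))⁻¹ by linarith
  rw [Finset.mul_sum, Finset.mul_sum, ← Finset.sum_sub_distrib]
  refine Finset.sum_le_sum fun S _ => ?_
  set D := P.jacobi α S (proj S.1 x)
  set V := v S (proj S.1 x)
  have hl : P.lam S ≤ ⨆ S, P.lam S := le_ciSup (Set.finite_range _).bddAbove S
  have hr := P.lam_r_pos S (proj S.1 x)
  have hlr : P.lam S * P.r S (proj S.1 x) ≤ P.C * ⨆ S, P.lam S := by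
    rw [mul_comm]
    exact mul_le_mul (P.r_le _ _) hl (P.lam_pos S).le
      ((P.r_pos S (proj S.1 x)).le.trans (P.r_le _ _))
  rw [P.inv_w_eq, invShift]
  set y := P.lam S * P.r S (proj S.1 x)
  have hD : 0 ≤ D * D * (1 + y⁻¹) := mul_nonneg (mul_self_nonneg _) (by positivity)
  have : 2 * (D * V * (1 + y⁻¹)) - V * V * y⁻¹ ≤ (1 + y) * (D * D * (1 + y⁻¹)) := by
    have e : (1 + y) * (D * D * (1 + y⁻¹)) - (2 * (D * V * (1 + y⁻¹)) - V * V * y⁻¹)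
        = y⁻¹ * ((1 + y) * D - V) ^ 2 := by field_simp; ring
    have : 0 ≤ y⁻¹ * ((1 + y) * D - V) ^ 2 := by positivity
    linarith
  refine this.trans (mul_le_mul_of_nonneg_right (by linarith) hD)

/-- A one-sided continuity estimate for the objective at a bounded family, used to pass to the limit
of the iterates, which need not be bounded. -/
theorem BddH.energy_add_le (hSS : SS.Nonempty) (hα : P.BddH α) (hv : P.MemH v) :
    P.energy (fun S x => α S x + v S x) ≤ P.energy α + ∫ x, P.wnorm (P.jacobi α) x ∂P.μ
      + (1 + SS.card) * ∫ x, P.wnorm v x ∂P.μ := by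
  have hδ := hα.jacobi.memH
  rw [hα.energy_add hv, add_assoc, ← integral_const_mul,
    ← integral_add hδ.integrable_wnorm (hv.integrable_wnorm.const_mul _)]
  refine add_le_add le_rfl (integral_mono (hδ.integrable_increment hv)
    (hδ.integrable_wnorm.add (hv.integrable_wnorm.const_mul _)) fun x => ?_)
  have h := sq_sum_add_le_wnorm (P := P) hSS v x
  have h1 : -2 * ∑ S : SS, P.jacobi α S (proj S.1 x) * v S (proj S.1 x) * (P.w S (proj S.1 x))⁻¹
      ≤ P.wnorm (P.jacobi α) x + P.wnorm v x := by
    rw [wnorm, wnorm, ← Finset.sum_add_distrib, Finset.mul_sum]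
    refine Finset.sum_le_sum fun S _ => ?_
    have := mul_nonneg (sq_nonneg (P.jacobi α S (proj S.1 x) + v S (proj S.1 x)))
      (inv_pos.2 (P.w_pos S (proj S.1 x))).le
    nlinarith
  unfold increment
  simp only
  linarith

end Setting

theorem norm_toLp_sq {E : Type*} [MeasurableSpace E] {μ : Measure E} {F : E → ℝ}
    (hF : MemLp F 2 μ) : ‖hF.toLp F‖ ^ 2 = ∫ x, F x ^ 2 ∂μ := by
  rw [← real_inner_self_eq_norm_sq, L2.inner_def]
  refine integral_congr_ae ?_
  filter_upwards [hF.coeFn_toLp] with x hx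
  rw [hx]
  simp [sq]

theorem sq_integral_le {E : Type*} [MeasurableSpace E] {μ : Measure E} [IsProbabilityMeasure μ]
    {F : E → ℝ} (hF : MemLp F 2 μ) : (∫ x, F x ∂μ) ^ 2 ≤ ∫ x, F x ^ 2 ∂μ := by
  have h := variance_nonneg F μ
  rw [variance_eq_sub hF] at h
  simp only [Pi.pow_apply] at h
  linarith

/-! ### Linear convergence and existence of a minimiser -/

namespace Setting

variable {d : ℕ} {SS : Finset (Finset (Fin d))} (P : Setting SS)

theorem bddH_alphaPop (t : ℕ) : P.BddH (P.alphaPop t) := fun S =>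
  ⟨P.bddMeas_alphaPop t S, P.integral_alphaPop t S⟩

theorem alphaPop_zero (S : SS) (x : S.1 → ℝ) : P.alphaPop 0 S x = 0 := by
  simp [alphaPop_eq]

theorem alphaPop_succ_eq (t : ℕ) :
    P.alphaPop (t + 1) = fun S x => P.alphaPop t S x
      + (SS.card : ℝ)⁻¹ * P.jacobi (P.alphaPop t) S x := by
  funext S x
  rw [alphaPop_succ, jacobi]
  ring

/-- The condition number of the problem. -/
def kappa : ℝ := condNumber P.lam P.C

theorem one_le_kappa (hSS : SS.Nonempty) : 1 ≤ P.kappa := by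
  have hcard : (1 : ℝ) ≤ SS.card := by exact_mod_cast hSS.card_pos
  obtain ⟨S, hS⟩ := hSS
  have h1 := P.C_pos ⟨S, hS⟩
  have h2 : 0 ≤ ⨆ S, P.lam S := Real.iSup_nonneg fun S => (P.lam_pos S).le
  have h3 := mul_nonneg h1.le h2
  unfold kappa condNumber
  nlinarith

theorem energy_nonneg (α : (S : SS) → (S.1 → ℝ) → ℝ) : 0 ≤ P.energy α :=
  add_nonneg (variance_nonneg _ _) (Finset.sum_nonneg fun S _ => integral_nonneg fun x =>
    div_nonneg (sq_nonneg _) (P.lam_r_pos S x).le)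

theorem energy_alphaPop_zero : P.energy (P.alphaPop 0) = variance P.a P.μ := by
  simp [energy, alphaPop_zero]

theorem integral_wnorm_jacobi_le (hSS : SS.Nonempty) (t : ℕ) :
    ∫ x, P.wnorm (P.jacobi (P.alphaPop t)) x ∂P.μ
      ≤ SS.card * (P.energy (P.alphaPop t) - P.energy (P.alphaPop (t + 1))) := by
  have hcard : (0 : ℝ) < SS.card := by exact_mod_cast hSS.card_pos
  have h := (P.bddH_alphaPop t).energy_jacobi_le hSS
  rw [← alphaPop_succ_eq] at h
  rw [← div_le_iff₀' hcard, div_eq_inv_mul]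
  linarith

/-- The excess over α is at most 1 + Cλ_max times the squared norm of the update, which is at most
|SS| times the decrease in one step. The product of the two constants is κ, so each step removes at
least a fraction 1/κ of the excess. -/
theorem energy_sub_le_mul (hSS : SS.Nonempty) {α : (S : SS) → (S.1 → ℝ) → ℝ} (hα : P.MemH α)
    (t : ℕ) : P.energy (P.alphaPop (t + 1)) - P.energy α
      ≤ (1 - 1 / P.kappa) * (P.energy (P.alphaPop t) - P.energy α) := by
  have hk := P.one_le_kappa hSS
  have h1 := (P.bddH_alphaPop t).energy_sub_le (hα.sub (P.bddH_alphaPop t).memH)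
  simp only [add_sub_cancel] at h1
  have h2 := P.integral_wnorm_jacobi_le hSS t
  have h3 : 0 ≤ 1 + P.C * ⨆ S, P.lam S := by
    have hcard : (0 : ℝ) < SS.card := by exact_mod_cast hSS.card_pos
    by_contra hneg
    have : P.kappa < 0 := mul_neg_of_pos_of_neg hcard (not_le.1 hneg)
    linarith
  have h4 := mul_le_mul_of_nonneg_left h2 h3
  have h5 : P.energy (P.alphaPop t) - P.energy α
      ≤ P.kappa * (P.energy (P.alphaPop t) - P.energy (P.alphaPop (t + 1))) := by
    refine h1.trans (h4.trans (le_of_eq ?_))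
    unfold kappa condNumber
    ring
  have h6 : (P.energy (P.alphaPop t) - P.energy α) / P.kappa
      ≤ P.energy (P.alphaPop t) - P.energy (P.alphaPop (t + 1)) := by
    rw [div_le_iff₀' (by linarith)]; exact h5
  have h7 : (1 - 1 / P.kappa) * (P.energy (P.alphaPop t) - P.energy α)
      = P.energy (P.alphaPop t) - P.energy α - (P.energy (P.alphaPop t) - P.energy α) / P.kappa := by
    ring
  linarith

theorem rate_nonneg (hSS : SS.Nonempty) : 0 ≤ 1 - 1 / P.kappa := by
  have hk := P.one_le_kappa hSS
  rw [sub_nonneg, div_le_one (by linarith)]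
  exact hk

theorem energy_sub_le_pow (hSS : SS.Nonempty) {α : (S : SS) → (S.1 → ℝ) → ℝ} (hα : P.MemH α)
    (t : ℕ) : P.energy (P.alphaPop t) - P.energy α
      ≤ (1 - 1 / P.kappa) ^ t * variance P.a P.μ := by
  have h0 := P.rate_nonneg hSS
  induction t with
  | zero =>
    rw [energy_alphaPop_zero, pow_zero, one_mul]
    linarith [P.energy_nonneg α]
  | succ t ih =>
    refine (P.energy_sub_le_mul hSS hα t).trans ?_
    rw [pow_succ', mul_assoc]
    exact mul_le_mul_of_nonneg_left ih h0

/-- Linear convergence of the iteration. -/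
theorem energy_alphaPop_le (hSS : SS.Nonempty) {α : (S : SS) → (S.1 → ℝ) → ℝ} (hα : P.MemH α)
    (t : ℕ) : P.energy (P.alphaPop t)
      ≤ P.energy α + variance P.a P.μ * Real.exp (-(t / P.kappa)) := by
  have h1 := P.energy_sub_le_pow hSS hα t
  have h2 : (1 - 1 / P.kappa) ^ t ≤ Real.exp (-(t / P.kappa)) := by
    calc _ ≤ Real.exp (-(1 / P.kappa)) ^ t :=
          pow_le_pow_left₀ (P.rate_nonneg hSS) (Real.one_sub_le_exp_neg _) t
      _ = _ := by rw [← Real.exp_nat_mul]; congr 1; ring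
  have := mul_le_mul_of_nonneg_right h2 (variance_nonneg P.a P.μ)
  linarith

/-- The increment is the update divided by |SS|, and the update is controlled by the decrease of the
objective. Taking the next iterate as competitor makes this decrease geometrically small, before a
minimiser is known to exist. -/
theorem integral_sq_sub_alphaPop_le (hSS : SS.Nonempty) (t : ℕ) (S : SS) :
    ∫ x, (P.alphaPop t S x - P.alphaPop (t + 1) S x) ^ 2 ∂P.μ.map (proj S.1)
      ≤ (1 - 1 / P.kappa) ^ t * variance P.a P.μ := by
  have hcard : (1 : ℝ) ≤ SS.card := by exact_mod_cast hSS.card_pos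
  have hδ := (P.bddH_alphaPop t).jacobi
  have h1 := P.integral_wnorm_jacobi_le hSS t
  have h2 := P.energy_sub_le_pow hSS (P.bddH_alphaPop (t + 1)).memH t
  have h0 : 0 ≤ (1 - 1 / P.kappa) ^ t * variance P.a P.μ :=
    mul_nonneg (pow_nonneg (P.rate_nonneg hSS) t) (variance_nonneg _ _)
  have h3 : ∫ x, P.jacobi (P.alphaPop t) S (proj S.1 x) ^ 2 ∂P.μ
      ≤ ∫ x, P.wnorm (P.jacobi (P.alphaPop t)) x ∂P.μ := by
    refine integral_mono (hδ.memH.memLp S).integrable_sq hδ.memH.integrable_wnorm fun x => ?_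
    have hS : P.jacobi (P.alphaPop t) S (proj S.1 x) * P.jacobi (P.alphaPop t) S (proj S.1 x) *
        (P.w S (proj S.1 x))⁻¹ ≤ P.wnorm (P.jacobi (P.alphaPop t)) x :=
      Finset.single_le_sum (f := fun S => P.jacobi (P.alphaPop t) S (proj S.1 x) *
        P.jacobi (P.alphaPop t) S (proj S.1 x) * (P.w S (proj S.1 x))⁻¹)
        (fun S _ => mul_nonneg (mul_self_nonneg _) (inv_pos.2 (P.w_pos _ _)).le)
        (Finset.mem_univ S)
    refine le_trans ?_ hS
    rw [P.inv_w_eq]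
    nlinarith [mul_nonneg (mul_self_nonneg (P.jacobi (P.alphaPop t) S (proj S.1 x)))
      (P.invShift_pos S (proj S.1 x)).le]
  have e : ∫ x, (P.alphaPop t S x - P.alphaPop (t + 1) S x) ^ 2 ∂P.μ.map (proj S.1)
      = (SS.card : ℝ)⁻¹ ^ 2 * ∫ x, P.jacobi (P.alphaPop t) S (proj S.1 x) ^ 2 ∂P.μ := by
    rw [integral_map (measurable_proj _).aemeasurable
      (((P.bddMeas_alphaPop t S).sub
        (P.bddMeas_alphaPop (t + 1) S)).1.pow_const 2).aestronglyMeasurable, ← integral_const_mul]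
    refine integral_congr_ae (Eventually.of_forall fun x => ?_)
    simp only [alphaPop_succ_eq]
    ring
  rw [e]
  calc _ ≤ (SS.card : ℝ)⁻¹ ^ 2 * (SS.card * ((1 - 1 / P.kappa) ^ t * variance P.a P.μ)) := by
        refine mul_le_mul_of_nonneg_left (h3.trans (h1.trans ?_)) (by positivity)
        gcongr
    _ = (SS.card : ℝ)⁻¹ * ((1 - 1 / P.kappa) ^ t * variance P.a P.μ) := by
        have : (SS.card : ℝ) ≠ 0 := by positivity
        field_simp
    _ ≤ 1 * ((1 - 1 / P.kappa) ^ t * variance P.a P.μ) :=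
        mul_le_mul_of_nonneg_right (inv_le_one_of_one_le₀ hcard) h0
    _ = _ := one_mul _

/-- The iterates converge in mean square. -/
theorem exists_tendsto_alphaPop (hSS : SS.Nonempty) (S : SS) :
    ∃ β : (S.1 → ℝ) → ℝ, MemLp β 2 (P.μ.map (proj S.1)) ∧
      Tendsto (fun t => ∫ x, (β x - P.alphaPop t S x) ^ 2 ∂P.μ.map (proj S.1)) atTop (𝓝 0) := by
  have hm : ∀ t, MemLp (P.alphaPop t S) 2 (P.μ.map (proj S.1)) := fun t =>
    (P.bddMeas_alphaPop t S).memLp _ 2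
  have h0 := P.rate_nonneg hSS
  have hk := P.one_le_kappa hSS
  have hV := variance_nonneg P.a P.μ
  set F : ℕ → Lp ℝ 2 (P.μ.map (proj S.1)) := fun t => (hm t).toLp _ with hF
  have hc : CauchySeq F := by
    refine cauchySeq_of_le_geometric (√(1 - 1 / P.kappa)) (√(variance P.a P.μ)) ?_ fun t => ?_
    · rw [Real.sqrt_lt' one_pos, one_pow]
      have : 0 < 1 / P.kappa := by positivity
      linarith
    · rw [dist_eq_norm, hF, ← MemLp.toLp_sub]
      refine abs_le_of_sq_le_sq' ?_ (by positivity) |>.2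
      rw [norm_toLp_sq, mul_pow, Real.sq_sqrt hV, ← pow_mul, mul_comm t 2, pow_mul,
        Real.sq_sqrt h0, mul_comm]
      exact P.integral_sq_sub_alphaPop_le hSS t S
  obtain ⟨G, hG⟩ := cauchySeq_tendsto_of_complete hc
  refine ⟨G, Lp.memLp G, ?_⟩
  have h1 : Tendsto (fun t => ‖G - F t‖ ^ 2) atTop (𝓝 0) := by
    have := ((tendsto_const_nhds (x := G)).sub hG).norm.pow 2
    simpa using this
  refine h1.congr fun t => ?_
  have e : G - F t = ((Lp.memLp G).sub (hm t)).toLp _ := by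
    rw [MemLp.toLp_sub (Lp.memLp G) (hm t), Lp.toLp_coeFn]
  rw [e, norm_toLp_sq]
  rfl

/-- The objective function has a minimiser. -/
theorem exists_minimiser (hSS : SS.Nonempty) :
    ∃ αs, P.MemH αs ∧ ∀ α, P.MemH α → P.energy αs ≤ P.energy α := by
  choose β hβ hlim using P.exists_tendsto_alphaPop hSS
  have hb := fun t => P.bddH_alphaPop t
  have hmem : P.MemH β := by
    intro S
    refine ⟨hβ S, ?_⟩
    -- The iterates are centred, so the squared mean of the limit is at most its squared L² distance
    -- to each iterate.
    have h1 : ∀ t, (∫ x, β S x ∂P.μ.map (proj S.1)) ^ 2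
        ≤ ∫ x, (β S x - P.alphaPop t S x) ^ 2 ∂P.μ.map (proj S.1) := by
      intro t
      have hm := ((hb t).memH S).1
      have h2 := sq_integral_le ((hβ S).sub hm)
      simp only [Pi.sub_apply] at h2
      rwa [integral_sub ((hβ S).integrable one_le_two) (hm.integrable one_le_two),
        ((hb t).memH S).2, sub_zero] at h2
    have h3 := ge_of_tendsto (hlim S) (Eventually.of_forall h1)
    exact pow_eq_zero_iff two_ne_zero |>.1 (le_antisymm h3 (sq_nonneg _))
  refine ⟨β, hmem, fun α hα => ?_⟩
  set V := variance P.a P.μ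
  set ρ := 1 - 1 / P.kappa with hρ
  have hw : ∀ t, ∫ x, P.wnorm (fun S x => β S x - P.alphaPop t S x) x ∂P.μ
      ≤ ∑ S : SS, (1 + (P.lam S * P.c)⁻¹) *
        ∫ x, (β S x - P.alphaPop t S x) ^ 2 ∂P.μ.map (proj S.1) := by
    intro t
    have hv := hmem.sub (hb t).memH
    unfold wnorm
    rw [integral_finsetSum _ fun S _ => hv.integrable_mul_mul hv S (P.bddMeas_inv_w S)]
    refine Finset.sum_le_sum fun S _ => ?_
    rw [integral_map (measurable_proj _).aemeasurable (hv S).1.integrable_sq.aestronglyMeasurable,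
      ← integral_const_mul]
    refine integral_mono (hv.integrable_mul_mul hv S (P.bddMeas_inv_w S))
      ((hv.memLp S).integrable_sq.const_mul _) fun x => ?_
    simp only
    rw [P.inv_w_eq, mul_comm, sq]
    exact mul_le_mul_of_nonneg_right (by linarith [P.invShift_le S (proj S.1 x)])
      (mul_self_nonneg _)
  -- Expand at the t-th iterate in the direction of the limit: the excess over α, the Jacobi update
  -- and the distance to the limit all tend to 0.
  have hbound : ∀ t, P.energy β ≤ P.energy α + (ρ ^ t * V + SS.card * (ρ ^ t * V)
      + (1 + SS.card) * ∑ S : SS, (1 + (P.lam S * P.c)⁻¹) *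
        ∫ x, (β S x - P.alphaPop t S x) ^ 2 ∂P.μ.map (proj S.1)) := by
    intro t
    have h1 := (hb t).energy_add_le hSS (hmem.sub (hb t).memH)
    simp only [add_sub_cancel] at h1
    have h2 := P.energy_sub_le_pow hSS hα t
    have h3 := P.integral_wnorm_jacobi_le hSS t
    have h4 := P.energy_sub_le_pow hSS (hb (t + 1)).memH t
    have h5 : (SS.card : ℝ) * (P.energy (P.alphaPop t) - P.energy (P.alphaPop (t + 1)))
        ≤ SS.card * (ρ ^ t * V) := by gcongr
    have h6 : (1 + (SS.card : ℝ)) * ∫ x, P.wnorm (fun S x => β S x - P.alphaPop t S x) x ∂P.μ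
        ≤ (1 + SS.card) * ∑ S : SS, (1 + (P.lam S * P.c)⁻¹) *
          ∫ x, (β S x - P.alphaPop t S x) ^ 2 ∂P.μ.map (proj S.1) :=
      mul_le_mul_of_nonneg_left (hw t) (by positivity)
    linarith
  have hρt : Tendsto (fun t => ρ ^ t) atTop (𝓝 0) := by
    refine tendsto_pow_atTop_nhds_zero_of_lt_one (P.rate_nonneg hSS) ?_
    have : 0 < 1 / P.kappa := by have := P.one_le_kappa hSS; positivity
    linarith
  have hsum : Tendsto (fun t => ∑ S : SS, (1 + (P.lam S * P.c)⁻¹) *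
      ∫ x, (β S x - P.alphaPop t S x) ^ 2 ∂P.μ.map (proj S.1)) atTop (𝓝 0) := by
    have := tendsto_finsetSum (Finset.univ : Finset SS) fun S _ =>
      (hlim S).const_mul (1 + (P.lam S * P.c)⁻¹)
    simpa using this
  have hl : Tendsto (fun t => P.energy α + (ρ ^ t * V + SS.card * (ρ ^ t * V)
      + (1 + SS.card) * ∑ S : SS, (1 + (P.lam S * P.c)⁻¹) *
        ∫ x, (β S x - P.alphaPop t S x) ^ 2 ∂P.μ.map (proj S.1))) atTop
      (𝓝 (P.energy α + (0 * V + SS.card * (0 * V) + (1 + SS.card) * 0))) :=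
    tendsto_const_nhds.add (((hρt.mul_const V).add ((hρt.mul_const V).const_mul _)).add
      (hsum.const_mul _))
  have := ge_of_tendsto hl (Eventually.of_forall hbound)
  simpa using this

end Setting

theorem BddMeas.pow {E : Type*} [MeasurableSpace E] {φ : E → ℝ} (hφ : BddMeas φ) :
    BddMeas fun x => φ x ^ 2 := by
  simp_rw [sq]; exact hφ.mul hφ

theorem integral_pi_mul_of_ne {ι : Type*} [Fintype ι] [DecidableEq ι] {α : ι → Type*}
    [∀ i, MeasurableSpace (α i)] (μ : (i : ι) → Measure (α i)) [∀ i, IsProbabilityMeasure (μ i)]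
    {i j : ι} (hij : i ≠ j) {F : α i → ℝ} {G : α j → ℝ} (hF : BddMeas F) (hG : BddMeas G) :
    ∫ X, F (X i) * G (X j) ∂Measure.pi μ = (∫ y, F y ∂μ i) * ∫ y, G y ∂μ j := by
  have hFG := (hF.comp (measurable_pi_apply i)).mul (hG.comp (measurable_pi_apply j))
  obtain ⟨B, hB⟩ := hFG.2
  rw [integral_pi_piecewise (μ := μ) {i} hFG.1 hB]
  have : ∀ X Y : (i : ι) → α i, F (({i} : Finset ι).piecewise X Y i) *
      G (({i} : Finset ι).piecewise X Y j) = F (X i) * G (Y j) := fun X Y => by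
    simp [Finset.piecewise, hij.symm]
  simp_rw [this, integral_const_mul]
  rw [integral_mul_const, integral_pi_eval (μ := μ) i hF.1, integral_pi_eval (μ := μ) j hG.1]

/-- Mean square of a sum of independent centred functions. -/
theorem integral_sq_add_sum_prod {Ω ι : Type*} [MeasurableSpace Ω] (ρ : Measure Ω)
    [IsProbabilityMeasure ρ] [Fintype ι] [DecidableEq ι] {α : ι → Type*}
    [∀ i, MeasurableSpace (α i)] (μ : (i : ι) → Measure (α i)) [∀ i, IsProbabilityMeasure (μ i)]
    {U : Ω → ℝ} {W : (i : ι) → α i → ℝ} (hU : BddMeas U) (hW : ∀ i, BddMeas (W i))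
    (hU0 : ∫ x, U x ∂ρ = 0) (hW0 : ∀ i, ∫ y, W i y ∂μ i = 0) :
    ∫ Z : Ω × ((i : ι) → α i), (U Z.1 + ∑ i, W i (Z.2 i)) ^ 2 ∂ρ.prod (Measure.pi μ)
      = ∫ x, U x ^ 2 ∂ρ + ∑ i, ∫ y, W i y ^ 2 ∂μ i := by
  have hWi : ∀ i, BddMeas fun Y : (i : ι) → α i => W i (Y i) := fun i =>
    (hW i).comp (measurable_pi_apply i)
  have hs : BddMeas fun Y : (i : ι) → α i => ∑ i, W i (Y i) := BddMeas.sum _ hWi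
  have h1 : BddMeas fun Z : Ω × ((i : ι) → α i) => U Z.1 := hU.comp measurable_fst
  have h2 : BddMeas fun Z : Ω × ((i : ι) → α i) => ∑ i, W i (Z.2 i) := hs.comp measurable_snd
  have e : ∀ Z : Ω × ((i : ι) → α i), (U Z.1 + ∑ i, W i (Z.2 i)) ^ 2
      = U Z.1 ^ 2 * 1 + 2 * (U Z.1 * ∑ i, W i (Z.2 i)) + 1 * (∑ i, W i (Z.2 i)) ^ 2 := fun Z => by
    ring
  simp_rw [e]
  rw [integral_add (((h1.pow.mul (bddMeas_const 1)).add ((h1.mul h2).const_mul 2)).integrable _)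
    ((h2.pow.const_mul 1).integrable _),
    integral_add ((h1.pow.mul (bddMeas_const 1)).integrable _)
    (((h1.mul h2).const_mul 2).integrable _), integral_const_mul,
    integral_prod_mul (fun x => U x ^ 2) (fun _ => (1 : ℝ)),
    integral_prod_mul U (fun Y : (i : ι) → α i => ∑ i, W i (Y i)),
    integral_prod_mul (fun _ : Ω => (1 : ℝ)) (fun Y : (i : ι) → α i => (∑ i, W i (Y i)) ^ 2), hU0,
    integral_sq_sum_of_orthogonal (P := Measure.pi μ) Finset.univ (G := fun i Y => W i (Y i))
      (fun i _ => (hWi i).memLp _ 2)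
      (fun i _ j _ hij => by rw [integral_pi_mul_of_ne μ hij (hW i) (hW j), hW0, zero_mul])]
  simp_rw [integral_pi_eval (μ := μ) _ ((hW _).1.pow_const 2)]
  simp

/-! ### The oracle estimator and its risk -/

namespace Setting

variable {d : ℕ} {SS : Finset (Finset (Fin d))} (P : Setting SS)

/-- The distribution of the incomplete observations. -/
def shifted (S : SS) : Measure (S.1 → ℝ) :=
  (P.μ.map (proj S.1)).withDensity fun x => ENNReal.ofReal (P.r S x)

theorem integral_shifted (S : SS) {F : (S.1 → ℝ) → ℝ} (hF : Measurable F) :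
    ∫ x, F x ∂P.shifted S = ∫ x, P.r S (proj S.1 x) * F (proj S.1 x) ∂P.μ := by
  have hr := P.r_meas S
  rw [shifted, integral_withDensity_eq_integral_toReal_smul hr.ennreal_ofReal
    (Eventually.of_forall fun _ => ENNReal.ofReal_lt_top)]
  simp_rw [ENNReal.toReal_ofReal (P.r_pos S _).le, smul_eq_mul]
  exact integral_map (measurable_proj _).aemeasurable (hr.mul hF).aestronglyMeasurable

instance (S : SS) : IsProbabilityMeasure (P.shifted S) := by
  constructor
  have hr := P.r_meas S
  rw [shifted, withDensity_apply _ MeasurableSet.univ, Measure.restrict_univ,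
    lintegral_map hr.ennreal_ofReal (measurable_proj _),
    ← ofReal_integral_eq_lintegral_ofReal (P.integrable_r S)
      (Eventually.of_forall fun x => (P.r_pos S _).le), P.r_mean, ENNReal.ofReal_one]

theorem bddMeas_r (S : SS) : BddMeas (P.r S) :=
  ⟨P.r_meas S, P.C, fun x => by rw [abs_of_pos (P.r_pos S x)]; exact P.r_le S x⟩

theorem bddMeas_inv_r (S : SS) : BddMeas fun x => (P.r S x)⁻¹ :=
  ⟨(P.r_meas S).inv, P.c⁻¹, fun x => by
    rw [abs_of_pos (inv_pos.2 (P.r_pos S x))]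
    exact inv_anti₀ P.c_pos (P.r_ge S x)⟩

theorem bddMeas_div_r (S : SS) {F : (S.1 → ℝ) → ℝ} (hF : BddMeas F) :
    BddMeas fun x => F x / P.r S x := by
  simp_rw [div_eq_mul_inv]
  exact hF.mul (P.bddMeas_inv_r S)

/-- Importance weighting: dividing by the density r undoes the shift, so the incomplete-data
averages are unbiased for means under the law of X. -/
theorem integral_shifted_div (S : SS) {F : (S.1 → ℝ) → ℝ} (hF : BddMeas F) :
    ∫ x, F x / P.r S x ∂P.shifted S = ∫ x, F (proj S.1 x) ∂P.μ := by
  rw [P.integral_shifted S (P.bddMeas_div_r S hF).1]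
  exact integral_congr_ae (Eventually.of_forall fun x => by
    have := (P.r_pos S (proj S.1 x)).ne'
    simp only
    field_simp)

theorem integral_shifted_sq_div (S : SS) {F : (S.1 → ℝ) → ℝ} (hF : BddMeas F) :
    ∫ x, (F x / P.r S x) ^ 2 ∂P.shifted S
      = ∫ x, F (proj S.1 x) ^ 2 * (P.r S (proj S.1 x))⁻¹ ∂P.μ := by
  rw [P.integral_shifted S ((P.bddMeas_div_r S hF).1.pow_const 2)]
  exact integral_congr_ae (Eventually.of_forall fun x => by
    have := (P.r_pos S (proj S.1 x)).ne'
    simp only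
    field_simp)

variable {n : ℕ} {N : SS → ℕ}

/-- The joint distribution of the data. -/
def dataM (n : ℕ) (N : SS → ℕ) : Measure (Data SS n N) :=
  (Measure.pi fun _ : Fin n => P.μ).prod
    (Measure.pi fun S : SS => Measure.pi fun _ : Fin (N S) => P.shifted S)

instance : IsProbabilityMeasure (P.dataM n N) := by unfold dataM; infer_instance

/-- The estimator with known nuisance functions. -/
def oracle (α : (S : SS) → (S.1 → ℝ) → ℝ) (Z : Data SS n N) : ℝ :=
  (n : ℝ)⁻¹ * ∑ i, (P.a (Z.1 i) - ∑ S : SS, α S (proj S.1 (Z.1 i)))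
    + ∑ S : SS, (N S : ℝ)⁻¹ * ∑ j, α S (Z.2 S j) / P.r S (Z.2 S j)

variable {P} {α : (S : SS) → (S.1 → ℝ) → ℝ}

theorem BddH.bddMeas_resid (hα : P.BddH α) :
    BddMeas fun x => P.a x - P.θ - ∑ S : SS, α S (proj S.1 x) :=
  (P.bddMeas_a.sub (bddMeas_const _)).sub
    (BddMeas.sum _ fun S => (hα S).1.comp (measurable_proj _))

theorem BddH.integral_resid (hα : P.BddH α) :
    ∫ x, (P.a x - P.θ - ∑ S : SS, α S (proj S.1 x)) ∂P.μ = 0 := by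
  have h1 := P.bddMeas_a.integrable P.μ
  rw [integral_sub (h1.sub' (integrable_const _)) (hα.memH.memLp_sum.integrable one_le_two),
    integral_sub h1 (integrable_const _), integral_finsetSum _ fun S _ => hα.memH.integrable S]
  simp [(hα _).2, θ]

theorem bddMeas_mean {E : Type*} [MeasurableSpace E] {k : ℕ} {F : E → ℝ} (hF : BddMeas F) :
    BddMeas fun X : Fin k → E => (k : ℝ)⁻¹ * ∑ i, F (X i) :=
  (BddMeas.sum _ fun i => hF.comp (measurable_pi_apply i)).const_mul _

theorem integral_mean_eq_zero {E : Type*} [MeasurableSpace E] (ν : Measure E)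
    [IsProbabilityMeasure ν] {k : ℕ} {F : E → ℝ} (hF : BddMeas F) (h0 : ∫ x, F x ∂ν = 0) :
    ∫ X : Fin k → E, (k : ℝ)⁻¹ * ∑ i, F (X i) ∂Measure.pi (fun _ => ν) = 0 := by
  rw [integral_const_mul, integral_finsetSum _ fun i _ =>
    (hF.comp (measurable_pi_apply i)).integrable _]
  simp_rw [integral_pi_eval (μ := fun _ : Fin k => ν) _ hF.1, h0]
  simp

theorem integral_sq_mean_eq {E : Type*} [MeasurableSpace E] (ν : Measure E)
    [IsProbabilityMeasure ν] {k : ℕ} {F : E → ℝ} (hF : BddMeas F) (h0 : ∫ x, F x ∂ν = 0) :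
    ∫ X : Fin k → E, ((k : ℝ)⁻¹ * ∑ i, F (X i)) ^ 2 ∂Measure.pi (fun _ => ν)
      = (k : ℝ)⁻¹ * ∫ x, F x ^ 2 ∂ν := by
  obtain ⟨B, hB⟩ := hF.2
  have := integral_sq_mean_eval ν hF.1 hB h0 (Finset.univ : Finset (Fin k))
  simpa using this

/-- The mean squared error of the oracle estimator. -/
theorem BddH.integral_sq_oracle_sub (hα : P.BddH α) (hn : 1 ≤ n) :
    ∫ Z, (P.oracle α Z - P.θ) ^ 2 ∂P.dataM n N
      = (n : ℝ)⁻¹ * ∫ x, (P.a x - P.θ - ∑ S : SS, α S (proj S.1 x)) ^ 2 ∂P.μ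
        + ∑ S : SS, (N S : ℝ)⁻¹ * ∫ x, α S (proj S.1 x) ^ 2 * (P.r S (proj S.1 x))⁻¹ ∂P.μ := by
  have hn0 : (n : ℝ) ≠ 0 := by positivity
  have hd : ∀ S : SS, BddMeas fun x => α S x / P.r S x := fun S => P.bddMeas_div_r S (hα S).1
  have hd0 : ∀ S : SS, ∫ x, α S x / P.r S x ∂P.shifted S = 0 := fun S => by
    rw [P.integral_shifted_div S (hα S).1, (hα S).2]
  have e : ∀ Z : Data SS n N, P.oracle α Z - P.θ
      = (n : ℝ)⁻¹ * ∑ i, (P.a (Z.1 i) - P.θ - ∑ S : SS, α S (proj S.1 (Z.1 i)))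
        + ∑ S : SS, (N S : ℝ)⁻¹ * ∑ j, α S (Z.2 S j) / P.r S (Z.2 S j) := by
    intro Z
    have : ∑ i, (P.a (Z.1 i) - P.θ - ∑ S : SS, α S (proj S.1 (Z.1 i)))
        = ∑ i, (P.a (Z.1 i) - ∑ S : SS, α S (proj S.1 (Z.1 i))) - n * P.θ := by
      simp_rw [sub_right_comm _ P.θ]
      rw [Finset.sum_sub_distrib]
      simp
    rw [this, oracle]
    field_simp
    ring
  simp_rw [e]
  rw [dataM, integral_sq_add_sum_prod (Measure.pi fun _ : Fin n => P.μ)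
    (fun S : SS => Measure.pi fun _ : Fin (N S) => P.shifted S)
    (U := fun X => (n : ℝ)⁻¹ * ∑ i, (P.a (X i) - P.θ - ∑ S : SS, α S (proj S.1 (X i))))
    (W := fun S Y => (N S : ℝ)⁻¹ * ∑ j, α S (Y j) / P.r S (Y j))
    (bddMeas_mean hα.bddMeas_resid) (fun S => bddMeas_mean (hd S))
    (integral_mean_eq_zero P.μ hα.bddMeas_resid hα.integral_resid)
    (fun S => integral_mean_eq_zero (P.shifted S) (hd S) (hd0 S)),
    integral_sq_mean_eq P.μ hα.bddMeas_resid hα.integral_resid]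
  congr 1
  refine Finset.sum_congr rfl fun S _ => ?_
  rw [integral_sq_mean_eq (P.shifted S) (hd S) (hd0 S), P.integral_shifted_sq_div S (hα S).1]

theorem BddH.energy_eq (hα : P.BddH α) :
    P.energy α = ∫ x, (P.a x - P.θ - ∑ S : SS, α S (proj S.1 x)) ^ 2 ∂P.μ
      + ∑ S : SS, (P.lam S)⁻¹ * ∫ x, α S (proj S.1 x) ^ 2 * (P.r S (proj S.1 x))⁻¹ ∂P.μ := by
  rw [hα.memH.energy_eq]
  congr 1
  refine Finset.sum_congr rfl fun S _ => ?_
  rw [← integral_const_mul]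
  exact integral_congr_ae (Eventually.of_forall fun x => by
    simp only [invShift, mul_inv]; ring)

theorem integral_sq_mul_inv_r_nonneg (P : Setting SS) (α : (S : SS) → (S.1 → ℝ) → ℝ) (S : SS) :
    0 ≤ ∫ x, α S (proj S.1 x) ^ 2 * (P.r S (proj S.1 x))⁻¹ ∂P.μ :=
  integral_nonneg fun _ => mul_nonneg (sq_nonneg _) (inv_pos.2 (P.r_pos _ _)).le

/-- The mean squared error of the oracle estimator, compared with the objective function. -/
theorem BddH.abs_mul_integral_sq_oracle_sub_le (hα : P.BddH α) (hn : 1 ≤ n)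
    (hN : ∀ S, |(n : ℝ) * P.lam S / N S - 1| ≤ 1 / n) :
    |n * ∫ Z, (P.oracle α Z - P.θ) ^ 2 ∂P.dataM n N - P.energy α| ≤ P.energy α / n := by
  have hn0 : (n : ℝ) ≠ 0 := by positivity
  have hn1 : (0 : ℝ) < n := by positivity
  have hV : 0 ≤ ∫ x, (P.a x - P.θ - ∑ S : SS, α S (proj S.1 x)) ^ 2 ∂P.μ :=
    integral_nonneg fun _ => sq_nonneg _
  rw [hα.integral_sq_oracle_sub hn, hα.energy_eq, mul_add, mul_inv_cancel_left₀ hn0,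
    add_sub_add_left_eq_sub, Finset.mul_sum, ← Finset.sum_sub_distrib, add_div, Finset.sum_div]
  refine (Finset.abs_sum_le_sum_abs _ _).trans (le_add_of_nonneg_of_le (by positivity)
    (Finset.sum_le_sum fun S _ => ?_))
  have hI := integral_sq_mul_inv_r_nonneg P α S
  set I := ∫ x, α S (proj S.1 x) ^ 2 * (P.r S (proj S.1 x))⁻¹ ∂P.μ
  have hl := P.lam_pos S
  -- Only the incomplete-data terms deviate from the objective, by the relative discrepancy between
  -- nλ and the sample size.
  have e : n * ((N S : ℝ)⁻¹ * I) - (P.lam S)⁻¹ * I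
      = (n * P.lam S / N S - 1) * ((P.lam S)⁻¹ * I) := by
    field_simp
  rw [e, abs_mul, abs_of_nonneg (by positivity : 0 ≤ (P.lam S)⁻¹ * I)]
  calc _ ≤ 1 / n * ((P.lam S)⁻¹ * I) := mul_le_mul_of_nonneg_right (hN S) (by positivity)
    _ = _ := by ring

end Setting

theorem bddMeas_integral {Ω Ω' : Type*} [MeasurableSpace Ω] [MeasurableSpace Ω'] (ν : Measure Ω')
    [IsProbabilityMeasure ν] {G : Ω → Ω' → ℝ} (hG : BddMeas fun z : Ω × Ω' => G z.1 z.2) :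
    BddMeas fun X => ∫ y, G X y ∂ν := by
  obtain ⟨B, hB⟩ := hG.2
  refine ⟨(hG.1.stronglyMeasurable.integral_prod_right (ν := ν) (f := G)).measurable, B,
    fun X => ?_⟩
  have := norm_integral_le_of_norm_le_const (μ := ν) (f := fun y => G X y) (C := B)
    (Eventually.of_forall fun y => hB (X, y))
  simpa using this

/-! ### Sums over observations independent of the fitted functions -/

section Fresh

variable {ι E : Type*} [Fintype ι] [DecidableEq ι] [MeasurableSpace E] (μ : Measure E)
  [IsProbabilityMeasure μ] {H : Finset ι}

/-- Mean square of a centred sum over fresh observations. -/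
theorem integral_sq_sum_fresh {G : (ι → E) → E → ℝ}
    (hG : BddMeas fun z : (ι → E) × E => G z.1 z.2) (h0 : ∀ X, ∫ y, G X y ∂μ = 0)
    (hdep : ∀ X Y, (∀ i ∉ H, X i = Y i) → G X = G Y) :
    ∫ X, (∑ i ∈ H, G X (X i)) ^ 2 ∂Measure.pi (fun _ : ι => μ)
      = H.card * ∫ X, ∫ y, G X y ^ 2 ∂μ ∂Measure.pi (fun _ : ι => μ) := by
  have hs : BddMeas fun X : ι → E => (∑ i ∈ H, G X (X i)) ^ 2 :=
    (BddMeas.sum H fun i => hG.comp (measurable_id.prodMk (measurable_pi_apply i))).pow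
  obtain ⟨B, hB⟩ := hs.2
  obtain ⟨B', hB'⟩ := hG.2
  -- Resample the observations in H. As G reads only the others, for fixed X this is the mean square
  -- of a sum of independent centred terms.
  rw [integral_pi_piecewise (μ := fun _ : ι => μ) Hᶜ hs.1 hB, ← integral_const_mul]
  refine integral_congr_ae (Eventually.of_forall fun X => ?_)
  have hp : ∀ Y : ι → E, ∑ i ∈ H, G (Hᶜ.piecewise X Y) (Hᶜ.piecewise X Y i)
      = ∑ i ∈ H, G X (Y i) := fun Y => by
    rw [hdep (Hᶜ.piecewise X Y) X fun i hi => by simp [Finset.piecewise, hi]]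
    exact Finset.sum_congr rfl fun i hi => by simp [Finset.piecewise, hi]
  simp only [hp]
  exact integral_sq_sum_eval μ (hG.1.comp measurable_prodMk_left) (fun y => hB' (X, y)) (h0 X) H

theorem integral_mul_fresh {ρ : E → ℝ} (hρ : BddMeas ρ) {K : (ι → E) → ℝ} (hK : BddMeas K)
    (hdep : ∀ X Y, (∀ i ∉ H, X i = Y i) → K X = K Y) {i : ι} (hi : i ∈ H) :
    ∫ X, ρ (X i) * K X ∂Measure.pi (fun _ : ι => μ)
      = (∫ y, ρ y ∂μ) * ∫ X, K X ∂Measure.pi (fun _ : ι => μ) := by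
  have hs := (hρ.comp (measurable_pi_apply (X := fun _ : ι => E) i)).mul hK
  obtain ⟨B, hB⟩ := hs.2
  rw [integral_pi_piecewise (μ := fun _ : ι => μ) Hᶜ hs.1 hB, ← integral_const_mul]
  refine integral_congr_ae (Eventually.of_forall fun X => ?_)
  have hp : ∀ Y : ι → E, ρ (Hᶜ.piecewise X Y i) * K (Hᶜ.piecewise X Y) = ρ (Y i) * K X :=
    fun Y => by
    rw [hdep (Hᶜ.piecewise X Y) X fun i hi => by simp [Finset.piecewise, hi]]
    simp [Finset.piecewise, hi]
  simp only [hp]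
  rw [integral_mul_const, integral_pi_eval (μ := fun _ : ι => μ) i hρ.1]

end Fresh

/-! ### Second moments of the three error components -/

namespace Setting

variable {d n : ℕ} {SS : Finset (Finset (Fin d))} (P : Setting SS) {N : SS → ℕ} {S : SS}

/-- The error of an estimated nuisance function, in mean square. -/
def msq (P : Setting SS) (S : SS) (Δ : (Fin n → Fin d → ℝ) → (S.1 → ℝ) → ℝ) : ℝ :=
  ∫ X, ∫ x, Δ X (proj S.1 x) ^ 2 ∂P.μ ∂Measure.pi (fun _ : Fin n => P.μ)

theorem integral_sq_r_le (S : SS) : ∫ x, P.r S (proj S.1 x) ^ 2 ∂P.μ ≤ P.C := by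
  have h : ∫ x, P.r S (proj S.1 x) ^ 2 ∂P.μ ≤ ∫ x, P.C * P.r S (proj S.1 x) ∂P.μ := by
    refine integral_mono (((P.bddMeas_r S).comp (measurable_proj _)).pow.integrable _)
      ((P.integrable_r S).const_mul _) fun x => ?_
    simp only
    rw [sq]
    exact mul_le_mul_of_nonneg_right (P.r_le _ _) (P.r_pos _ _).le
  rwa [integral_const_mul, P.r_mean, mul_one] at h

variable {H : Finset (Fin n)} {Δ : (Fin n → Fin d → ℝ) → (S.1 → ℝ) → ℝ}

theorem bddMeas_comp_proj (hΔ : BddMeas fun z : (Fin n → Fin d → ℝ) × (S.1 → ℝ) => Δ z.1 z.2) :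
    BddMeas fun z : (Fin n → Fin d → ℝ) × (Fin d → ℝ) => Δ z.1 (proj S.1 z.2) :=
  hΔ.comp (measurable_fst.prodMk ((measurable_proj _).comp measurable_snd))

/-- The error on the complete data. -/
theorem integral_sq_complete_le (hΔ : BddMeas fun z : (Fin n → Fin d → ℝ) × (S.1 → ℝ) => Δ z.1 z.2)
    (hdep : ∀ X Y, (∀ i ∉ H, X i = Y i) → Δ X = Δ Y) :
    ∫ X, (∑ i ∈ H, (Δ X (proj S.1 (X i)) - (∫ y, Δ X (proj S.1 y) ∂P.μ) *
        P.r S (proj S.1 (X i)))) ^ 2 ∂Measure.pi (fun _ : Fin n => P.μ)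
      ≤ H.card * ((2 + 2 * P.C) * P.msq S Δ) := by
  have hp := bddMeas_comp_proj hΔ
  have hm := bddMeas_integral P.μ (G := fun X y => Δ X (proj S.1 y)) hp
  have hr := (P.bddMeas_r S).comp (measurable_proj S.1)
  have hΔX : ∀ X, BddMeas fun y => Δ X (proj S.1 y) := fun X => hp.comp measurable_prodMk_left
  set m : (Fin n → Fin d → ℝ) → ℝ := fun X => ∫ y, Δ X (proj S.1 y) ∂P.μ with hmdef
  have hG : BddMeas fun z : (Fin n → Fin d → ℝ) × (Fin d → ℝ) =>
      Δ z.1 (proj S.1 z.2) - m z.1 * P.r S (proj S.1 z.2) :=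
    hp.sub ((hm.comp measurable_fst).mul (hr.comp measurable_snd))
  -- Since r has mean one, subtracting m(X) r, rather than the constant m(X), also centres each
  -- summand conditionally.
  rw [integral_sq_sum_fresh P.μ (G := fun X y => Δ X (proj S.1 y) - m X * P.r S (proj S.1 y)) hG
    (fun X => by
      rw [integral_sub ((hΔX X).integrable _) ((hr.integrable _).const_mul _), integral_const_mul,
        P.r_mean, mul_one, sub_self])
    (fun X Y hXY => by simp only [hmdef, hdep X Y hXY])]
  refine mul_le_mul_of_nonneg_left ?_ (Nat.cast_nonneg _)
  rw [msq, ← integral_const_mul]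
  refine integral_mono ((bddMeas_integral P.μ (G := fun X y =>
    (Δ X (proj S.1 y) - m X * P.r S (proj S.1 y)) ^ 2) hG.pow).integrable _)
    (((bddMeas_integral P.μ (G := fun X y => Δ X (proj S.1 y) ^ 2) hp.pow).integrable _).const_mul
      _) fun X => ?_
  -- The factor 2 + 2C comes from (u-v)² ≤ 2u² + 2v², m(X)² ≤ E Δ² and E r² ≤ C.
  have h1 : ∫ y, (Δ X (proj S.1 y) - m X * P.r S (proj S.1 y)) ^ 2 ∂P.μ
      ≤ ∫ y, (2 * Δ X (proj S.1 y) ^ 2 + 2 * m X ^ 2 * P.r S (proj S.1 y) ^ 2) ∂P.μ := by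
    refine integral_mono ((hG.comp measurable_prodMk_left).pow.integrable _)
      ((((hΔX X).pow.const_mul 2).add (hr.pow.const_mul _)).integrable _) fun y => ?_
    simp only
    nlinarith [sq_nonneg (Δ X (proj S.1 y) + m X * P.r S (proj S.1 y))]
  rw [integral_add (((hΔX X).pow.const_mul 2).integrable _) ((hr.pow.const_mul _).integrable _),
    integral_const_mul, integral_const_mul] at h1
  have h2 : m X ^ 2 ≤ ∫ y, Δ X (proj S.1 y) ^ 2 ∂P.μ := sq_integral_le ((hΔX X).memLp _ 2)
  have h3 := P.integral_sq_r_le S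
  have h4 : m X ^ 2 * ∫ y, P.r S (proj S.1 y) ^ 2 ∂P.μ
      ≤ (∫ y, Δ X (proj S.1 y) ^ 2 ∂P.μ) * P.C :=
    mul_le_mul h2 h3 (integral_nonneg fun y => sq_nonneg _) ((sq_nonneg _).trans h2)
  simp only
  linarith

/-- The conditional error on the incomplete data. -/
theorem integral_sq_incomplete_le {D : (S.1 → ℝ) → ℝ} (hD : BddMeas D) (k : ℕ) :
    ∫ Y, ((k : ℝ)⁻¹ * ∑ j, (D (Y j) / P.r S (Y j) - ∫ y, D (proj S.1 y) ∂P.μ)) ^ 2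
        ∂Measure.pi (fun _ : Fin k => P.shifted S)
      ≤ (k : ℝ)⁻¹ * (P.c⁻¹ * ∫ y, D (proj S.1 y) ^ 2 ∂P.μ) := by
  have hd := P.bddMeas_div_r S hD
  have hp := hD.comp (measurable_proj S.1)
  set m := ∫ y, D (proj S.1 y) ∂P.μ with hm
  have hd0 : ∫ x, D x / P.r S x ∂P.shifted S = m := P.integral_shifted_div S hD
  rw [integral_sq_mean_eq (P.shifted S) (F := fun x => D x / P.r S x - m)
    (hd.sub (bddMeas_const m)) (by
      rw [integral_sub (hd.integrable _) (integrable_const _), hd0]; simp)]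
  refine mul_le_mul_of_nonneg_left ?_ (by positivity)
  have h1 : ∫ x, (D x / P.r S x - m) ^ 2 ∂P.shifted S ≤ ∫ x, (D x / P.r S x) ^ 2 ∂P.shifted S := by
    have h2 : ∫ x, (D x / P.r S x - m) ^ 2 ∂P.shifted S
        = variance (fun x => D x / P.r S x) (P.shifted S) := by
      rw [variance_eq_integral hd.1.aemeasurable, hd0]
    rw [h2, variance_eq_sub (hd.memLp _ 2)]
    have := sq_nonneg (∫ x, D x / P.r S x ∂P.shifted S)
    simp only [Pi.pow_apply]
    linarith
  refine h1.trans ?_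
  rw [P.integral_shifted_sq_div S hD, ← integral_const_mul]
  refine integral_mono ((hp.pow.mul ((P.bddMeas_inv_r S).comp (measurable_proj _))).integrable _)
    (hp.pow.integrable _ |>.const_mul _) fun x => ?_
  simp only
  rw [mul_comm]
  exact mul_le_mul_of_nonneg_right (inv_anti₀ P.c_pos (P.r_ge _ _)) (sq_nonneg _)

/-- The error on the incomplete data. -/
theorem integral_sq_sum_r_mul_incomplete_le
    (hΔ : BddMeas fun z : (Fin n → Fin d → ℝ) × (S.1 → ℝ) => Δ z.1 z.2)
    (hdep : ∀ X Y, (∀ i ∉ H, X i = Y i) → Δ X = Δ Y) :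
    ∫ Z : Data SS n N, ((∑ i ∈ H, P.r S (proj S.1 (Z.1 i))) * ((N S : ℝ)⁻¹ * ∑ j,
        (Δ Z.1 (Z.2 S j) / P.r S (Z.2 S j) - ∫ y, Δ Z.1 (proj S.1 y) ∂P.μ))) ^ 2 ∂P.dataM n N
      ≤ (H.card : ℝ) ^ 2 * ((N S : ℝ)⁻¹ * (P.C / P.c * P.msq S Δ)) := by
  have hp := bddMeas_comp_proj hΔ
  have hm := bddMeas_integral P.μ (G := fun X y => Δ X (proj S.1 y)) hp
  have hq := bddMeas_integral P.μ (G := fun X y => Δ X (proj S.1 y) ^ 2) hp.pow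
  have hr := (P.bddMeas_r S).comp (measurable_proj S.1)
  have hri : ∀ i, BddMeas fun X : Fin n → Fin d → ℝ => P.r S (proj S.1 (X i)) := fun i =>
    hr.comp (measurable_pi_apply i)
  have hR : BddMeas fun X : Fin n → Fin d → ℝ => ∑ i ∈ H, P.r S (proj S.1 (X i)) :=
    BddMeas.sum H hri
  have hF1 : BddMeas fun Z : Data SS n N => (N S : ℝ)⁻¹ * ∑ j,
      (Δ Z.1 (Z.2 S j) / P.r S (Z.2 S j) - ∫ y, Δ Z.1 (proj S.1 y) ∂P.μ) := by
    refine (BddMeas.sum _ fun j => ?_).const_mul _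
    have hz : Measurable fun Z : Data SS n N => Z.2 S j :=
      (measurable_pi_apply j).comp ((measurable_pi_apply S).comp measurable_snd)
    simp_rw [div_eq_mul_inv]
    exact ((hΔ.comp (measurable_fst.prodMk hz)).mul ((P.bddMeas_inv_r S).comp hz)).sub
      (hm.comp measurable_fst)
  have hF := ((hR.comp (measurable_fst (β := (S : SS) → Fin (N S) → S.1 → ℝ))).mul hF1).pow
  rw [dataM, integral_prod _ (hF.integrable _)]
  have h1 : ∀ X : Fin n → Fin d → ℝ,
      ∫ Y : (S : SS) → Fin (N S) → S.1 → ℝ, ((∑ i ∈ H, P.r S (proj S.1 (X i))) * ((N S : ℝ)⁻¹ * ∑ j,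
        (Δ X (Y S j) / P.r S (Y S j) - ∫ y, Δ X (proj S.1 y) ∂P.μ))) ^ 2
        ∂Measure.pi (fun S : SS => Measure.pi fun _ : Fin (N S) => P.shifted S)
      ≤ (H.card * ((N S : ℝ)⁻¹ * P.c⁻¹)) * ∑ i ∈ H, P.r S (proj S.1 (X i)) ^ 2 *
        ∫ y, Δ X (proj S.1 y) ^ 2 ∂P.μ := by
    intro X
    have hDX : BddMeas (Δ X) := hΔ.comp measurable_prodMk_left
    have hdX := P.bddMeas_div_r S hDX
    simp_rw [mul_pow (∑ i ∈ H, P.r S (proj S.1 (X i)))]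
    rw [integral_const_mul, integral_pi_eval
      (μ := fun S : SS => Measure.pi fun _ : Fin (N S) => P.shifted S) S
      (F := fun Y : Fin (N S) → S.1 → ℝ => ((N S : ℝ)⁻¹ * ∑ j,
        (Δ X (Y j) / P.r S (Y j) - ∫ y, Δ X (proj S.1 y) ∂P.μ)) ^ 2)
      (bddMeas_mean (hdX.sub (bddMeas_const (∫ y, Δ X (proj S.1 y) ∂P.μ)))).pow.1]
    have h2 := P.integral_sq_incomplete_le hDX (N S)
    have h3 : (∑ i ∈ H, P.r S (proj S.1 (X i))) ^ 2
        ≤ H.card * ∑ i ∈ H, P.r S (proj S.1 (X i)) ^ 2 := sq_sum_le_card_mul_sum_sq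
    refine (mul_le_mul h3 h2 (integral_nonneg fun _ => sq_nonneg _)
      ((sq_nonneg _).trans h3)).trans (le_of_eq ?_)
    rw [← Finset.sum_mul]
    ring
  have hsum : BddMeas fun X : Fin n → Fin d → ℝ => ∑ i ∈ H, P.r S (proj S.1 (X i)) ^ 2 *
      ∫ y, Δ X (proj S.1 y) ^ 2 ∂P.μ := BddMeas.sum H fun i => (hri i).pow.mul hq
  refine (integral_mono ((hF.integrable _).integral_prod_left)
    ((hsum.integrable _).const_mul _) h1).trans ?_
  rw [integral_const_mul, integral_finsetSum _ fun i _ => ((hri i).pow.mul hq).integrable _]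
  -- The fitted function does not read X_i for i in H, so r(X_i)² and its squared norm are
  -- independent.
  have h4 : ∀ i ∈ H, ∫ X : Fin n → Fin d → ℝ, P.r S (proj S.1 (X i)) ^ 2 *
      ∫ y, Δ X (proj S.1 y) ^ 2 ∂P.μ ∂Measure.pi (fun _ : Fin n => P.μ) ≤ P.C * P.msq S Δ := by
    intro i hi
    rw [integral_mul_fresh P.μ (ρ := fun x => P.r S (proj S.1 x) ^ 2) hr.pow hq
      (fun X Y hXY => by simp only [hdep X Y hXY]) hi]
    exact mul_le_mul_of_nonneg_right (P.integral_sq_r_le S)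
      (integral_nonneg fun _ => integral_nonneg fun _ => sq_nonneg _)
  have hc := P.c_pos
  calc _ ≤ (H.card * ((N S : ℝ)⁻¹ * P.c⁻¹)) * ∑ i ∈ H, P.C * P.msq S Δ :=
        mul_le_mul_of_nonneg_left (Finset.sum_le_sum h4) (by positivity)
    _ = _ := by rw [Finset.sum_const, nsmul_eq_mul]; ring

/-- The error due to the estimated normalisation of the shifts. -/
theorem integral_sq_normalisation_le {α : (S : SS) → (S.1 → ℝ) → ℝ} (hα : P.BddH α) (S : SS) :
    ∫ Z : Data SS n N, ((∑ i, (P.r S (proj S.1 (Z.1 i)) - 1)) *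
        ((N S : ℝ)⁻¹ * ∑ j, α S (Z.2 S j) / P.r S (Z.2 S j))) ^ 2 ∂P.dataM n N
      ≤ n * (P.C * ((N S : ℝ)⁻¹ *
        ∫ x, α S (proj S.1 x) ^ 2 * (P.r S (proj S.1 x))⁻¹ ∂P.μ)) := by
  have hd := P.bddMeas_div_r S (hα S).1
  have hr : BddMeas fun x => P.r S (proj S.1 x) - 1 :=
    ((P.bddMeas_r S).comp (measurable_proj S.1)).sub (bddMeas_const 1)
  have hr0 : ∫ x, (P.r S (proj S.1 x) - 1) ∂P.μ = 0 := by
    rw [integral_sub (P.integrable_r S) (integrable_const _), P.r_mean]; simp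
  simp_rw [mul_pow (∑ i, (P.r S (proj S.1 _) - 1))]
  rw [dataM, integral_prod_mul
    (fun X : Fin n → Fin d → ℝ => (∑ i, (P.r S (proj S.1 (X i)) - 1)) ^ 2)
    (fun Y : (S : SS) → Fin (N S) → S.1 → ℝ =>
      ((N S : ℝ)⁻¹ * ∑ j, α S (Y S j) / P.r S (Y S j)) ^ 2),
    integral_pi_eval (μ := fun S : SS => Measure.pi fun _ : Fin (N S) => P.shifted S) S
      (F := fun Y : Fin (N S) → S.1 → ℝ => ((N S : ℝ)⁻¹ * ∑ j, α S (Y j) / P.r S (Y j)) ^ 2)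
      (bddMeas_mean hd).pow.1,
    integral_sq_mean_eq (P.shifted S) hd (by rw [P.integral_shifted_div S (hα S).1, (hα S).2]),
    P.integral_shifted_sq_div S (hα S).1]
  obtain ⟨B, hB⟩ := hr.2
  rw [integral_sq_sum_eval P.μ (G := fun x => P.r S (proj S.1 x) - 1) hr.1 hB hr0, mul_assoc]
  simp only [Finset.card_univ, Fintype.card_fin]
  gcongr
  · exact mul_nonneg (by positivity) (integral_sq_mul_inv_r_nonneg P α S)
  · exact P.integral_sq_r_sub_one_le S

end Setting

/-! ### Cross-fitting: comparing the estimator with the oracle -/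

theorem mem_half {n : ℕ} {l : Bool} {i : Fin n} :
    i ∈ half n l ↔ decide ((n + 1) / 2 ≤ (i : ℕ)) = l := by
  simp [half]

theorem notMem_half_not {n : ℕ} {l : Bool} {i : Fin n} (hi : i ∈ half n l) :
    i ∉ half n (!l) := by
  rw [mem_half] at hi ⊢
  rw [hi]
  cases l <;> simp

theorem sum_half_add {n : ℕ} (F : Fin n → ℝ) :
    ∑ i ∈ half n true, F i + ∑ i ∈ half n false, F i = ∑ i, F i := by
  have h := Finset.sum_filter_add_sum_filter_not Finset.univ
    (fun i : Fin n => decide ((n + 1) / 2 ≤ (i : ℕ)) = true) F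
  rw [← h]
  congr 1
  refine Finset.sum_congr ?_ fun _ _ => rfl
  ext i; simp [half]

theorem card_half_add (n : ℕ) : ((half n true).card : ℝ) + (half n false).card = n := by
  have := sum_half_add (n := n) fun _ => 1
  simpa using this

/-- Multiplying by the size of the evaluation half clears its denominators. It remains valid when
that half is empty, which happens for n = 1, because both sides are then 0. -/
theorem card_mul_thetaHatHalf {d n M : ℕ} {SS : Finset (Finset (Fin d))} {N : SS → ℕ}
    (a : (Fin d → ℝ) → ℝ) (r : (S : SS) → (S.1 → ℝ) → ℝ) (lam : SS → ℝ) (h T : ℝ)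
    (g : Fin n → Fin M) (Z : Data SS n N) (l : Bool) :
    ((half n (!l)).card : ℝ) * thetaHatHalf a r lam h T g Z l
      = ∑ i ∈ half n (!l),
          (a (Z.1 i) - ∑ S : SS, alphaHat a r lam Z.1 h T g l S (proj S.1 (Z.1 i)))
        + ∑ S : SS, (∑ i ∈ half n (!l), r S (proj S.1 (Z.1 i))) * ((N S : ℝ)⁻¹ * ∑ j : Fin (N S),
          alphaHat a r lam Z.1 h T g l S (Z.2 S j) / r S (Z.2 S j)) := by
  have hcancel : ∀ x : ℝ, ((half n (!l)).card = 0 → x = 0) →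
      ((half n (!l)).card : ℝ) * (x / (half n (!l)).card) = x := fun x hx => by
    by_cases hc : (half n (!l)).card = 0
    · rw [hx hc]; simp
    · exact mul_div_cancel₀ _ (by exact_mod_cast hc)
  have hz : ∀ F : Fin n → ℝ, (half n (!l)).card = 0 → ∑ i ∈ half n (!l), F i = 0 := fun F hc => by
    rw [Finset.card_eq_zero.1 hc, Finset.sum_empty]
  unfold thetaHatHalf
  rw [mul_add, inv_mul_eq_div, hcancel _ (hz _), Finset.mul_sum]
  congr 1
  refine Finset.sum_congr rfl fun S _ => ?_
  have e : ∑ j : Fin (N S), alphaHat a r lam Z.1 h T g l S (Z.2 S j) *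
      rhat r Z.1 (half n (!l)) S / r S (Z.2 S j)
      = rhat r Z.1 (half n (!l)) S * ∑ j : Fin (N S),
        alphaHat a r lam Z.1 h T g l S (Z.2 S j) / r S (Z.2 S j) := by
    rw [Finset.mul_sum]
    exact Finset.sum_congr rfl fun j _ => by ring
  rw [e]
  have e2 : ((half n (!l)).card : ℝ) * rhat r Z.1 (half n (!l)) S
      = ∑ i ∈ half n (!l), r S (proj S.1 (Z.1 i)) := by
    unfold rhat
    exact hcancel _ (hz _)
  rw [← e2]
  ring

namespace Setting

variable {d n M : ℕ} {SS : Finset (Finset (Fin d))} (P : Setting SS) {N : SS → ℕ}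

/-- The error of the estimated nuisance function. -/
def nerr (h T : ℝ) (g : Fin n → Fin M) (l : Bool) (S : SS) (X : Fin n → Fin d → ℝ)
    (x : S.1 → ℝ) : ℝ :=
  alphaHat P.a P.r P.lam X h T g l S x - P.alphaPop M S x

/-- The part of the error that comes from the complete data. -/
def errComplete (h T : ℝ) (g : Fin n → Fin M) (l : Bool) (S : SS) (Z : Data SS n N) : ℝ :=
  ∑ i ∈ half n (!l), (P.nerr h T g l S Z.1 (proj S.1 (Z.1 i))
    - (∫ y, P.nerr h T g l S Z.1 (proj S.1 y) ∂P.μ) * P.r S (proj S.1 (Z.1 i)))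

/-- The part of the error that comes from the incomplete data. -/
def errIncomplete (h T : ℝ) (g : Fin n → Fin M) (l : Bool) (S : SS) (Z : Data SS n N) : ℝ :=
  (∑ i ∈ half n (!l), P.r S (proj S.1 (Z.1 i))) * ((N S : ℝ)⁻¹ * ∑ j : Fin (N S),
    (P.nerr h T g l S Z.1 (Z.2 S j) / P.r S (Z.2 S j) - ∫ y, P.nerr h T g l S Z.1 (proj S.1 y) ∂P.μ))

/-- The part of the error that comes from the estimated normalisation. -/
def errNorm (M : ℕ) (S : SS) (Z : Data SS n N) : ℝ :=
  (∑ i, (P.r S (proj S.1 (Z.1 i)) - 1)) *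
    ((N S : ℝ)⁻¹ * ∑ j, P.alphaPop M S (Z.2 S j) / P.r S (Z.2 S j))

variable {h T : ℝ} {g : Fin n → Fin M}

/-- Let m be the conditional mean of the nuisance error. Adding and subtracting m ∑ r(X_i) centres
the complete-data and incomplete-data contributions at once, because the empirical normalisation
multiplies the latter by that same sum of r. -/
theorem card_mul_thetaHatHalf_sub (hN : ∀ S, 1 ≤ N S) (Z : Data SS n N) (l : Bool) :
    ((half n (!l)).card : ℝ) * thetaHatHalf P.a P.r P.lam h T g Z l
      - (∑ i ∈ half n (!l), (P.a (Z.1 i) - ∑ S : SS, P.alphaPop M S (proj S.1 (Z.1 i)))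
        + (half n (!l)).card * ∑ S : SS, (N S : ℝ)⁻¹ * ∑ j, P.alphaPop M S (Z.2 S j) / P.r S (Z.2 S j))
      = ∑ S : SS, (-P.errComplete h T g l S Z + P.errIncomplete h T g l S Z
        + (∑ i ∈ half n (!l), (P.r S (proj S.1 (Z.1 i)) - 1)) *
          ((N S : ℝ)⁻¹ * ∑ j, P.alphaPop M S (Z.2 S j) / P.r S (Z.2 S j))) := by
  have e1 : ∑ i ∈ half n (!l),
        (P.a (Z.1 i) - ∑ S : SS, alphaHat P.a P.r P.lam Z.1 h T g l S (proj S.1 (Z.1 i)))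
      = ∑ i ∈ half n (!l), (P.a (Z.1 i) - ∑ S : SS, P.alphaPop M S (proj S.1 (Z.1 i)))
        - ∑ S : SS, ∑ i ∈ half n (!l), P.nerr h T g l S Z.1 (proj S.1 (Z.1 i)) := by
    rw [Finset.sum_comm, ← Finset.sum_sub_distrib]
    refine Finset.sum_congr rfl fun i _ => ?_
    simp only [nerr, Finset.sum_sub_distrib]
    ring
  rw [card_mul_thetaHatHalf, e1, Finset.mul_sum]
  have e2 : ∀ A B C D : ℝ, A - B + C - (A + D) = -B + C - D := fun A B C D => by ring
  rw [e2, ← Finset.sum_neg_distrib, ← Finset.sum_add_distrib, ← Finset.sum_sub_distrib]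
  refine Finset.sum_congr rfl fun S _ => ?_
  have hNS : (N S : ℝ) ≠ 0 := by have := hN S; positivity
  unfold errComplete errIncomplete
  have e3 : ∑ j, alphaHat P.a P.r P.lam Z.1 h T g l S (Z.2 S j) / P.r S (Z.2 S j)
      = ∑ j, P.nerr h T g l S Z.1 (Z.2 S j) / P.r S (Z.2 S j)
        + ∑ j, P.alphaPop M S (Z.2 S j) / P.r S (Z.2 S j) := by
    rw [← Finset.sum_add_distrib]
    exact Finset.sum_congr rfl fun j _ => by unfold nerr; ring
  rw [e3, Finset.sum_sub_distrib, Finset.sum_sub_distrib, Finset.sum_sub_distrib, ← Finset.mul_sum]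
  simp only [Finset.sum_const, Finset.card_univ, Fintype.card_fin, nsmul_eq_mul, mul_one]
  field_simp
  ring

/-- Decomposition of the difference between the estimator and the oracle. -/
theorem mul_thetaHat_sub_oracle (hn : 1 ≤ n) (hN : ∀ S, 1 ≤ N S) (Z : Data SS n N) :
    n * (thetaHat P.a P.r P.lam h T g Z - P.oracle (P.alphaPop M) Z)
      = ∑ S : SS, (-(P.errComplete h T g false S Z + P.errComplete h T g true S Z)
        + (P.errIncomplete h T g false S Z + P.errIncomplete h T g true S Z) + P.errNorm M S Z) := by
  have hn0 : (n : ℝ) ≠ 0 := by positivity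
  have h1 := P.card_mul_thetaHatHalf_sub (h := h) (T := T) (g := g) hN Z false
  have h2 := P.card_mul_thetaHatHalf_sub (h := h) (T := T) (g := g) hN Z true
  simp only [Bool.not_false, Bool.not_true] at h1 h2
  have h3 := sum_half_add fun i => P.a (Z.1 i) - ∑ S : SS, P.alphaPop M S (proj S.1 (Z.1 i))
  have h4 := card_half_add n
  have e : n * (thetaHat P.a P.r P.lam h T g Z - P.oracle (P.alphaPop M) Z)
      = (((half n true).card : ℝ) * thetaHatHalf P.a P.r P.lam h T g Z false
      - (∑ i ∈ half n true, (P.a (Z.1 i) - ∑ S : SS, P.alphaPop M S (proj S.1 (Z.1 i)))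
        + (half n true).card * ∑ S : SS, (N S : ℝ)⁻¹ * ∑ j, P.alphaPop M S (Z.2 S j) / P.r S (Z.2 S j)))
      + (((half n false).card : ℝ) * thetaHatHalf P.a P.r P.lam h T g Z true
      - (∑ i ∈ half n false, (P.a (Z.1 i) - ∑ S : SS, P.alphaPop M S (proj S.1 (Z.1 i)))
        + (half n false).card * ∑ S : SS, (N S : ℝ)⁻¹ * ∑ j, P.alphaPop M S (Z.2 S j) / P.r S (Z.2 S j))) := by
    unfold thetaHat oracle
    rw [mul_sub, mul_div_cancel₀ _ hn0, mul_add, mul_inv_cancel_left₀ hn0, ← h3]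
    conv_lhs => rw [← h4]
    ring
  rw [e, h1, h2, ← Finset.sum_add_distrib]
  refine Finset.sum_congr rfl fun S _ => ?_
  unfold errNorm
  rw [← sum_half_add fun i => P.r S (proj S.1 (Z.1 i)) - 1]
  ring

theorem bddMeas_nerr (hh : 0 < h) (l : Bool) (S : SS) :
    BddMeas fun z : (Fin n → Fin d → ℝ) × (S.1 → ℝ) => P.nerr h T g l S z.1 z.2 := by
  refine BddMeas.sub ⟨P.measurable_alphaHat hh T g l S measurable_fst measurable_snd, _, fun z =>
    P.abs_alphaHat_le hh z.1 S z.2⟩ ((P.bddMeas_alphaPop M S).comp measurable_snd)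

/-- The freshness condition for the evaluation half: the nuisance functions were fitted on the other
one. -/
theorem nerr_congr (l : Bool) (S : SS) (X Y : Fin n → Fin d → ℝ)
    (hXY : ∀ i ∉ half n (!l), X i = Y i) : P.nerr h T g l S X = P.nerr h T g l S Y := by
  funext x
  unfold nerr
  rw [alphaHat_congr P.a P.r P.lam h T g l (fun i hi => hXY i (notMem_half_not hi)) S x]

theorem bddMeas_integral_nerr (hh : 0 < h) (l : Bool) (S : SS) :
    BddMeas fun X : Fin n → Fin d → ℝ => ∫ y, P.nerr h T g l S X (proj S.1 y) ∂P.μ :=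
  bddMeas_integral P.μ (G := fun X y => P.nerr h T g l S X (proj S.1 y))
    (bddMeas_comp_proj (P.bddMeas_nerr hh l S))

theorem bddMeas_r_eval (S : SS) (i : Fin n) :
    BddMeas fun X : Fin n → Fin d → ℝ => P.r S (proj S.1 (X i)) :=
  (P.bddMeas_r S).comp ((measurable_proj _).comp (measurable_pi_apply i))

theorem measurable_data_eval (S : SS) (j : Fin (N S)) :
    Measurable fun Z : Data SS n N => Z.2 S j :=
  (measurable_pi_apply j).comp ((measurable_pi_apply S).comp measurable_snd)

theorem bddMeas_errComplete_fst (hh : 0 < h) (l : Bool) (S : SS) :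
    BddMeas fun X : Fin n → Fin d → ℝ => ∑ i ∈ half n (!l), (P.nerr h T g l S X (proj S.1 (X i))
      - (∫ y, P.nerr h T g l S X (proj S.1 y) ∂P.μ) * P.r S (proj S.1 (X i))) :=
  BddMeas.sum _ fun i => ((P.bddMeas_nerr hh l S).comp
    (measurable_id.prodMk ((measurable_proj _).comp (measurable_pi_apply i)))).sub
      ((P.bddMeas_integral_nerr hh l S).mul (P.bddMeas_r_eval S i))

theorem bddMeas_errComplete (hh : 0 < h) (l : Bool) (S : SS) :
    BddMeas fun Z : Data SS n N => P.errComplete h T g l S Z :=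
  (P.bddMeas_errComplete_fst hh l S).comp measurable_fst

theorem bddMeas_errIncomplete (hh : 0 < h) (l : Bool) (S : SS) :
    BddMeas fun Z : Data SS n N => P.errIncomplete h T g l S Z := by
  refine ((BddMeas.sum _ fun i => P.bddMeas_r_eval S i).comp measurable_fst).mul
    ((BddMeas.sum _ fun j => ?_).const_mul _)
  simp_rw [div_eq_mul_inv]
  exact (((P.bddMeas_nerr hh l S).comp (measurable_fst.prodMk (measurable_data_eval S j))).mul
    ((P.bddMeas_inv_r S).comp (measurable_data_eval S j))).sub
      ((P.bddMeas_integral_nerr hh l S).comp measurable_fst)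

theorem bddMeas_errNorm (M : ℕ) (S : SS) :
    BddMeas fun Z : Data SS n N => P.errNorm M S Z :=
  ((BddMeas.sum _ fun i => (P.bddMeas_r_eval S i).sub (bddMeas_const 1)).comp measurable_fst).mul
    ((BddMeas.sum _ fun j => (P.bddMeas_div_r S (P.bddMeas_alphaPop M S)).comp
      (measurable_data_eval S j)).const_mul _)

theorem bddMeas_oracle (M : ℕ) : BddMeas fun Z : Data SS n N => P.oracle (P.alphaPop M) Z := by
  refine BddMeas.add ((BddMeas.sum _ fun i => ?_).const_mul _) (BddMeas.sum _ fun S =>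
    (BddMeas.sum _ fun j => (P.bddMeas_div_r S (P.bddMeas_alphaPop M S)).comp
      (measurable_data_eval S j)).const_mul _)
  have hi : Measurable fun Z : Data SS n N => Z.1 i := (measurable_pi_apply i).comp measurable_fst
  exact (P.bddMeas_a.comp hi).sub (BddMeas.sum _ fun S =>
    (P.bddMeas_alphaPop M S).comp ((measurable_proj _).comp hi))

/-- Read off from the decomposition around the oracle, all of whose terms are bounded and
measurable; it yields integrability of the squared error. -/
theorem bddMeas_thetaHat (hh : 0 < h) (hn : 1 ≤ n) (hN : ∀ S, 1 ≤ N S) :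
    BddMeas fun Z : Data SS n N => thetaHat P.a P.r P.lam h T g Z := by
  have hn0 : (n : ℝ) ≠ 0 := by positivity
  have e : ∀ Z : Data SS n N, thetaHat P.a P.r P.lam h T g Z
      = (n : ℝ)⁻¹ * ∑ S : SS, (-1 * (P.errComplete h T g false S Z + P.errComplete h T g true S Z)
        + (P.errIncomplete h T g false S Z + P.errIncomplete h T g true S Z) + P.errNorm M S Z)
        + P.oracle (P.alphaPop M) Z := fun Z => by
    simp only [neg_one_mul]
    rw [← P.mul_thetaHat_sub_oracle hn hN, inv_mul_cancel_left₀ hn0]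
    ring
  simp_rw [e]
  exact ((BddMeas.sum _ fun S => ((((P.bddMeas_errComplete hh false S).add
    (P.bddMeas_errComplete hh true S)).const_mul (-1)).add ((P.bddMeas_errIncomplete hh false S).add
      (P.bddMeas_errIncomplete hh true S))).add (P.bddMeas_errNorm M S)).const_mul _).add
        (P.bddMeas_oracle M)

theorem integral_sq_errComplete_le (hh : 0 < h) (l : Bool) (S : SS) :
    ∫ Z, P.errComplete h T g l S Z ^ 2 ∂P.dataM n N
      ≤ (half n (!l)).card * ((2 + 2 * P.C) * P.msq S (P.nerr h T g l S)) := by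
  unfold errComplete
  rw [dataM, integral_fun_fst (fun X : Fin n → Fin d → ℝ => (∑ i ∈ half n (!l),
    (P.nerr h T g l S X (proj S.1 (X i)) - (∫ y, P.nerr h T g l S X (proj S.1 y) ∂P.μ) *
      P.r S (proj S.1 (X i)))) ^ 2)]
  simp only [probReal_univ, one_smul]
  exact P.integral_sq_complete_le (P.bddMeas_nerr hh l S) (P.nerr_congr l S)

theorem integral_sq_errIncomplete_le (hh : 0 < h) (l : Bool) (S : SS) :
    ∫ Z, P.errIncomplete h T g l S Z ^ 2 ∂P.dataM n N
      ≤ ((half n (!l)).card : ℝ) ^ 2 * ((N S : ℝ)⁻¹ * (P.C / P.c * P.msq S (P.nerr h T g l S))) :=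
  P.integral_sq_sum_r_mul_incomplete_le (P.bddMeas_nerr hh l S) (P.nerr_congr l S)

theorem integral_sq_errNorm_le (M : ℕ) (S : SS) :
    ∫ Z, P.errNorm M S Z ^ 2 ∂P.dataM n N
      ≤ n * (P.C * ((N S : ℝ)⁻¹ *
        ∫ x, P.alphaPop M S (proj S.1 x) ^ 2 * (P.r S (proj S.1 x))⁻¹ ∂P.μ)) :=
  P.integral_sq_normalisation_le (P.bddH_alphaPop M) S

/-- The mean squared difference between the estimator and the oracle. -/
theorem mul_integral_sq_thetaHat_sub_oracle_le (hh : 0 < h) (hn : 1 ≤ n) (hN : ∀ S, 1 ≤ N S)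
    {D : ℝ} (hD : ∀ S l, P.msq S (P.nerr h T g l S) ≤ D) :
    n * ∫ Z, (thetaHat P.a P.r P.lam h T g Z - P.oracle (P.alphaPop M) Z) ^ 2 ∂P.dataM n N
      ≤ 3 * SS.card * ∑ S : SS, ((4 + 4 * P.C + 2 * (P.C / P.c) * (n / N S)) * D
        + P.C / N S * ∫ x, P.alphaPop M S (proj S.1 x) ^ 2 * (P.r S (proj S.1 x))⁻¹ ∂P.μ) := by
  have hn0 : (0 : ℝ) < n := by positivity
  have hth := (P.bddMeas_thetaHat (T := T) (g := g) (N := N) hh hn hN).sub (P.bddMeas_oracle M)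
  have hA := fun l S => (P.bddMeas_errComplete (N := N) (T := T) (g := g) hh l S).pow
  have hB := fun l S => (P.bddMeas_errIncomplete (N := N) (T := T) (g := g) hh l S).pow
  have hC := fun S => (P.bddMeas_errNorm (n := n) (N := N) M S).pow
  -- Cauchy–Schwarz over S, then over the three kinds of error (factor 3), then over the two halves
  -- (factor 2). The normalisation error is not split, so it has no factor 2.
  have hsq : ∀ Z : Data SS n N,
      (n * (thetaHat P.a P.r P.lam h T g Z - P.oracle (P.alphaPop M) Z)) ^ 2
      ≤ 3 * SS.card * ∑ S : SS, (2 * P.errComplete h T g false S Z ^ 2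
        + 2 * P.errComplete h T g true S Z ^ 2 + 2 * P.errIncomplete h T g false S Z ^ 2
        + 2 * P.errIncomplete h T g true S Z ^ 2 + P.errNorm M S Z ^ 2) := by
    intro Z
    rw [P.mul_thetaHat_sub_oracle hn hN]
    refine (sq_sum_le_card_mul_sum_sq).trans ?_
    rw [mul_comm (3 : ℝ), mul_assoc, Finset.card_univ, Fintype.card_coe]
    refine mul_le_mul_of_nonneg_left ?_ (Nat.cast_nonneg _)
    rw [Finset.mul_sum]
    refine Finset.sum_le_sum fun S _ => ?_
    generalize P.errComplete h T g false S Z = a1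
    generalize P.errComplete h T g true S Z = a2
    generalize P.errIncomplete h T g false S Z = b1
    generalize P.errIncomplete h T g true S Z = b2
    generalize P.errNorm M S Z = c1
    nlinarith [sq_nonneg (a1 - a2), sq_nonneg (b1 - b2), sq_nonneg ((a1 + a2) + (b1 + b2)),
      sq_nonneg ((b1 + b2) - c1), sq_nonneg ((a1 + a2) + c1)]
  have hterm : ∀ S : SS, BddMeas fun Z : Data SS n N => 2 * P.errComplete h T g false S Z ^ 2
        + 2 * P.errComplete h T g true S Z ^ 2 + 2 * P.errIncomplete h T g false S Z ^ 2
        + 2 * P.errIncomplete h T g true S Z ^ 2 + P.errNorm M S Z ^ 2 := fun S =>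
    (((((hA false S).const_mul 2).add ((hA true S).const_mul 2)).add ((hB false S).const_mul 2)).add
      ((hB true S).const_mul 2)).add (hC S)
  have h1 := integral_mono ((hth.const_mul n).pow.integrable (P.dataM n N))
    (((BddMeas.sum Finset.univ hterm).integrable (P.dataM n N)).const_mul (3 * (SS.card : ℝ))) hsq
  have e1 : ∫ Z, (n * (thetaHat P.a P.r P.lam h T g Z - P.oracle (P.alphaPop M) Z)) ^ 2 ∂P.dataM n N
      = n * (n * ∫ Z, (thetaHat P.a P.r P.lam h T g Z - P.oracle (P.alphaPop M) Z) ^ 2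
        ∂P.dataM n N) := by
    simp_rw [mul_pow]
    rw [integral_const_mul]
    ring
  rw [e1, integral_const_mul, integral_finsetSum _ fun S _ => (hterm S).integrable _] at h1
  have h2 : ∀ S : SS, ∫ Z, (2 * P.errComplete h T g false S Z ^ 2
        + 2 * P.errComplete h T g true S Z ^ 2 + 2 * P.errIncomplete h T g false S Z ^ 2
        + 2 * P.errIncomplete h T g true S Z ^ 2 + P.errNorm M S Z ^ 2) ∂P.dataM n N
      ≤ n * ((4 + 4 * P.C + 2 * (P.C / P.c) * (n / N S)) * D
        + P.C / N S * ∫ x, P.alphaPop M S (proj S.1 x) ^ 2 * (P.r S (proj S.1 x))⁻¹ ∂P.μ) := by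
    intro S
    have i1 := fun l => ((hA l S).const_mul 2).integrable (P.dataM n N)
    have i2 := fun l => ((hB l S).const_mul 2).integrable (P.dataM n N)
    rw [integral_add ((((i1 false).fun_add (i1 true)).fun_add (i2 false)).fun_add (i2 true))
        ((hC S).integrable _),
      integral_add (((i1 false).fun_add (i1 true)).fun_add (i2 false)) (i2 true),
      integral_add ((i1 false).fun_add (i1 true)) (i2 false),
      integral_add (i1 false) (i1 true)]
    simp only [integral_const_mul]
    have a1 := P.integral_sq_errComplete_le (N := N) (T := T) (g := g) hh false S
    have a2 := P.integral_sq_errComplete_le (N := N) (T := T) (g := g) hh true S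
    have b1 := P.integral_sq_errIncomplete_le (N := N) (T := T) (g := g) hh false S
    have b2 := P.integral_sq_errIncomplete_le (N := N) (T := T) (g := g) hh true S
    have c1 := P.integral_sq_errNorm_le (n := n) (N := N) M S
    simp only [Bool.not_false, Bool.not_true] at a1 a2 b1 b2
    have hCp := P.C_pos S
    have hcp := P.c_pos
    have hNS : (0 : ℝ) < N S := by have := hN S; positivity
    have hc := card_half_add n
    have hD0 : 0 ≤ D := le_trans (integral_nonneg fun _ => integral_nonneg fun _ => sq_nonneg _)
      (hD S false)
    set k1 : ℝ := ((half n true).card : ℝ) with hk1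
    set k2 : ℝ := ((half n false).card : ℝ) with hk2
    have hk10 : 0 ≤ k1 := by positivity
    have hk20 : 0 ≤ k2 := by positivity
    have a1' : k1 * ((2 + 2 * P.C) * P.msq S (P.nerr h T g false S)) ≤ k1 * ((2 + 2 * P.C) * D) := by
      gcongr; exact hD S false
    have a2' : k2 * ((2 + 2 * P.C) * P.msq S (P.nerr h T g true S)) ≤ k2 * ((2 + 2 * P.C) * D) := by
      gcongr; exact hD S true
    have b1' : k1 ^ 2 * ((N S : ℝ)⁻¹ * (P.C / P.c * P.msq S (P.nerr h T g false S)))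
        ≤ k1 ^ 2 * ((N S : ℝ)⁻¹ * (P.C / P.c * D)) := by
      gcongr; exact hD S false
    have b2' : k2 ^ 2 * ((N S : ℝ)⁻¹ * (P.C / P.c * P.msq S (P.nerr h T g true S)))
        ≤ k2 ^ 2 * ((N S : ℝ)⁻¹ * (P.C / P.c * D)) := by
      gcongr; exact hD S true
    have hkk : k1 ^ 2 + k2 ^ 2 ≤ (n : ℝ) ^ 2 := by rw [← hc]; nlinarith
    have b3 : (k1 ^ 2 + k2 ^ 2) * ((N S : ℝ)⁻¹ * (P.C / P.c * D))
        ≤ (n : ℝ) ^ 2 * ((N S : ℝ)⁻¹ * (P.C / P.c * D)) := by gcongr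
    have a3 : k1 * ((2 + 2 * P.C) * D) + k2 * ((2 + 2 * P.C) * D) = n * ((2 + 2 * P.C) * D) := by
      rw [← hc]; ring
    have e3 : n * ((4 + 4 * P.C + 2 * (P.C / P.c) * (n / N S)) * D
        + P.C / N S * ∫ x, P.alphaPop M S (proj S.1 x) ^ 2 * (P.r S (proj S.1 x))⁻¹ ∂P.μ)
        = 2 * (n * ((2 + 2 * P.C) * D)) + 2 * ((n : ℝ) ^ 2 * ((N S : ℝ)⁻¹ * (P.C / P.c * D)))
          + n * (P.C * ((N S : ℝ)⁻¹ *
            ∫ x, P.alphaPop M S (proj S.1 x) ^ 2 * (P.r S (proj S.1 x))⁻¹ ∂P.μ)) := by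
      ring
    rw [e3]
    linarith
  have h3 : n * (n * ∫ Z, (thetaHat P.a P.r P.lam h T g Z - P.oracle (P.alphaPop M) Z) ^ 2
        ∂P.dataM n N)
      ≤ n * (3 * SS.card * ∑ S : SS, ((4 + 4 * P.C + 2 * (P.C / P.c) * (n / N S)) * D
        + P.C / N S * ∫ x, P.alphaPop M S (proj S.1 x) ^ 2 * (P.r S (proj S.1 x))⁻¹ ∂P.μ)) := by
    refine h1.trans ((mul_le_mul_of_nonneg_left (Finset.sum_le_sum fun S _ => h2 S)
      (by positivity)).trans (le_of_eq ?_))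
    rw [← Finset.mul_sum]
    ring
  exact le_of_mul_le_mul_left h3 hn0

end Setting

/-! ### From the oracle to the risk; sizes of the pieces -/

theorem sq_integral_mul_le {E : Type*} [MeasurableSpace E] {μ : Measure E} {F G : E → ℝ}
    (hF : MemLp F 2 μ) (hG : MemLp G 2 μ) :
    (∫ x, F x * G x ∂μ) ^ 2 ≤ (∫ x, F x ^ 2 ∂μ) * ∫ x, G x ^ 2 ∂μ := by
  have h := abs_real_inner_le_norm (hF.toLp F) (hG.toLp G)
  have e : inner ℝ (hF.toLp F) (hG.toLp G) = ∫ x, F x * G x ∂μ := by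
    rw [L2.inner_def]
    refine integral_congr_ae ?_
    filter_upwards [hF.coeFn_toLp, hG.coeFn_toLp] with x hx hy
    rw [hx, hy]
    simp [mul_comm]
  rw [e] at h
  have h2 := pow_le_pow_left₀ (abs_nonneg _) h 2
  rwa [sq_abs, mul_pow, norm_toLp_sq, norm_toLp_sq] at h2

/-- Perturbation of a mean square. -/
theorem abs_integral_sq_add_sub_le {E : Type*} [MeasurableSpace E] {μ : Measure E}
    {U W : E → ℝ} (hU : MemLp U 2 μ) (hW : MemLp W 2 μ) {k u e : ℝ} (hk : 0 ≤ k)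
    (hu : k * ∫ x, U x ^ 2 ∂μ ≤ u) (he : k * ∫ x, W x ^ 2 ∂μ ≤ e) :
    |k * ∫ x, (U x + W x) ^ 2 ∂μ - k * ∫ x, U x ^ 2 ∂μ| ≤ 2 * √(u * e) + e := by
  have hUW : Integrable (fun x => U x * W x) μ := hU.integrable_mul hW
  have hU0 : 0 ≤ ∫ x, U x ^ 2 ∂μ := integral_nonneg fun _ => sq_nonneg _
  have hW0 : 0 ≤ ∫ x, W x ^ 2 ∂μ := integral_nonneg fun _ => sq_nonneg _
  have e1 : ∫ x, (U x + W x) ^ 2 ∂μ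
      = ∫ x, U x ^ 2 ∂μ + 2 * ∫ x, U x * W x ∂μ + ∫ x, W x ^ 2 ∂μ := by
    rw [← integral_const_mul, ← integral_add hU.integrable_sq (hUW.const_mul 2),
      ← integral_add (hU.integrable_sq.fun_add (hUW.const_mul 2)) hW.integrable_sq]
    exact integral_congr_ae (Eventually.of_forall fun x => by simp only; ring)
  have e2 : k * ∫ x, (U x + W x) ^ 2 ∂μ - k * ∫ x, U x ^ 2 ∂μ
      = 2 * (k * ∫ x, U x * W x ∂μ) + k * ∫ x, W x ^ 2 ∂μ := by
    rw [e1]; ring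
  have h1 : |k * ∫ x, U x * W x ∂μ| ≤ √(u * e) := by
    refine Real.abs_le_sqrt ?_
    calc (k * ∫ x, U x * W x ∂μ) ^ 2 = k ^ 2 * (∫ x, U x * W x ∂μ) ^ 2 := by ring
      _ ≤ k ^ 2 * ((∫ x, U x ^ 2 ∂μ) * ∫ x, W x ^ 2 ∂μ) := by
        gcongr; exact sq_integral_mul_le hU hW
      _ = (k * ∫ x, U x ^ 2 ∂μ) * (k * ∫ x, W x ^ 2 ∂μ) := by ring
      _ ≤ u * e := mul_le_mul hu he (by positivity) ((by positivity : 0 ≤ k * _).trans hu)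
  rw [e2]
  refine (abs_add_le _ _).trans (add_le_add ?_ ?_)
  · rw [abs_mul, abs_two]; linarith
  · rw [abs_of_nonneg (by positivity)]; exact he

theorem two_mul_card_half (n : ℕ) (l : Bool) : n ≤ 2 * (half n l).card + 1 := by
  have h1 : (half n false).card = (n + 1) / 2 := by
    have e : half n false = Finset.univ.filter fun i : Fin n => (i : ℕ) < (n + 1) / 2 := by
      ext i; simp [half]
    rw [e, Fin.card_filter_val_lt]
    omega
  have h2 : (half n true).card + (half n false).card = n := by
    exact_mod_cast card_half_add n
  cases l <;> omega

/-- Every piece has at most one more element than piece m, and piece m itself strictly fewer than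
that, which gains the +1. -/
theorem Balanced.card_half_add_one_le {n M : ℕ} {g : Fin n → Fin M} (hg : Balanced g) (l : Bool)
    {m : ℕ} (hm : m < M) : (half n l).card + 1 ≤ M * ((piece g l m).card + 1) := by
  have h1 : (half n l).card = ∑ p : Fin M, (piece g l p).card := by
    rw [Finset.card_eq_sum_card_fiberwise (f := g) (t := Finset.univ) fun _ _ => by simp]
    refine Finset.sum_congr rfl fun p _ => ?_
    congr 1
    ext i
    simp [piece, Fin.ext_iff]
  have h2 : ∑ p : Fin M, (piece g l p).card < ∑ _p : Fin M, ((piece g l m).card + 1) :=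
    Finset.sum_lt_sum (fun p _ => hg l p ⟨m, hm⟩) ⟨⟨m, hm⟩, Finset.mem_univ _, Nat.lt_succ_self _⟩
  rw [h1]
  simpa using h2

/-- Since n ≤ 2|half| + 1, the previous bound gives n ≤ 2M(|piece| + 1). The form with +1 also
covers an empty piece, for which it says that 2M/n is at least 1. -/
theorem Balanced.inv_card_add_one_le {n M : ℕ} {g : Fin n → Fin M} (hg : Balanced g) (l : Bool)
    (hn : 1 ≤ n) {m : ℕ} (hm : m < M) :
    1 / (((piece g l m).card : ℝ) + 1) ≤ 2 * (M / n) := by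
  have h1 := hg.card_half_add_one_le l hm
  have h2 := two_mul_card_half n l
  have h3 : n ≤ 2 * M * ((piece g l m).card + 1) := by nlinarith
  have h4 : (n : ℝ) ≤ 2 * M * ((piece g l m).card + 1) := by exact_mod_cast h3
  have hn0 : (0 : ℝ) < n := by positivity
  rw [← mul_div_assoc, div_le_div_iff₀ (by positivity) hn0]
  linarith

namespace Setting

variable {d n M : ℕ} {SS : Finset (Finset (Fin d))} (P : Setting SS) {N : SS → ℕ}
variable {h T : ℝ} {g : Fin n → Fin M}

/-- The risk of the estimator, compared with the objective function at the iterate. -/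
theorem abs_mul_risk_sub_energy_le (hh : 0 < h) (hn : 1 ≤ n) (hN : ∀ S, 1 ≤ N S)
    (hNn : ∀ S, |(n : ℝ) * P.lam S / N S - 1| ≤ 1 / n) {e : ℝ}
    (he : n * ∫ Z, (thetaHat P.a P.r P.lam h T g Z - P.oracle (P.alphaPop M) Z) ^ 2 ∂P.dataM n N
      ≤ e) :
    |n * ∫ Z, (thetaHat P.a P.r P.lam h T g Z - P.θ) ^ 2 ∂P.dataM n N - P.energy (P.alphaPop M)|
      ≤ P.energy (P.alphaPop M) / n + (2 * √(2 * P.energy (P.alphaPop M) * e) + e) := by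
  have hn1 : (1 : ℝ) ≤ n := by exact_mod_cast hn
  have hL := P.energy_nonneg (P.alphaPop M)
  have h1 := (P.bddH_alphaPop M).abs_mul_integral_sq_oracle_sub_le (N := N) hn hNn
  have hLn : P.energy (P.alphaPop M) / n ≤ P.energy (P.alphaPop M) := div_le_self hL hn1
  have h2 : n * ∫ Z, (P.oracle (P.alphaPop M) Z - P.θ) ^ 2 ∂P.dataM n N
      ≤ 2 * P.energy (P.alphaPop M) := by
    have := (abs_le.1 h1).2
    linarith
  have h3 := abs_integral_sq_add_sub_le
    (((P.bddMeas_oracle (n := n) (N := N) M).sub (bddMeas_const P.θ)).memLp (P.dataM n N) 2)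
    (((P.bddMeas_thetaHat (T := T) (g := g) (N := N) hh hn hN).sub
      (P.bddMeas_oracle M)).memLp (P.dataM n N) 2) (Nat.cast_nonneg n) h2 he
  simp only [sub_add_sub_cancel'] at h3
  have e1 := abs_add_le (n * ∫ Z, (thetaHat P.a P.r P.lam h T g Z - P.θ) ^ 2 ∂P.dataM n N
    - n * ∫ Z, (P.oracle (P.alphaPop M) Z - P.θ) ^ 2 ∂P.dataM n N)
    (n * ∫ Z, (P.oracle (P.alphaPop M) Z - P.θ) ^ 2 ∂P.dataM n N - P.energy (P.alphaPop M))
  rw [sub_add_sub_cancel] at e1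
  linarith

theorem energy_alphaPop_antitone (hSS : SS.Nonempty) (t : ℕ) :
    P.energy (P.alphaPop (t + 1)) ≤ P.energy (P.alphaPop t) := by
  have hcard : (0 : ℝ) < SS.card := by exact_mod_cast hSS.card_pos
  have h1 := P.integral_wnorm_jacobi_le hSS t
  have h2 : 0 ≤ ∫ x, P.wnorm (P.jacobi (P.alphaPop t)) x ∂P.μ := integral_nonneg fun x =>
    Finset.sum_nonneg fun S _ => mul_nonneg (mul_self_nonneg _) (inv_pos.2 (P.w_pos _ _)).le
  have := nonneg_of_mul_nonneg_right (h2.trans h1) hcard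
  linarith

theorem energy_alphaPop_le_sq (hSS : SS.Nonempty) (t : ℕ) :
    P.energy (P.alphaPop t) ≤ P.b ^ 2 := by
  induction t with
  | zero =>
    rw [energy_alphaPop_zero]
    refine (variance_le_expectation_sq P.a_meas.aestronglyMeasurable).trans ?_
    have : ∫ x, P.a x ^ 2 ∂P.μ ≤ ∫ _x, P.b ^ 2 ∂P.μ :=
      integral_mono (P.bddMeas_a.pow.integrable _) (integrable_const _) fun x =>
        sq_le_sq' (neg_le_of_abs_le (P.a_bdd x)) (le_of_abs_le (P.a_bdd x))
    simpa using this
  | succ t ih => exact (P.energy_alphaPop_antitone hSS t).trans ih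

theorem sum_inv_lam_mul_le_energy (M : ℕ) :
    ∑ S : SS, (P.lam S)⁻¹ *
      ∫ x, P.alphaPop M S (proj S.1 x) ^ 2 * (P.r S (proj S.1 x))⁻¹ ∂P.μ
      ≤ P.energy (P.alphaPop M) := by
  rw [(P.bddH_alphaPop M).energy_eq]
  exact le_add_of_nonneg_left (integral_nonneg fun _ => sq_nonneg _)

variable {t L₁ L₂ L₃ Err : ℝ} {K : ℕ}

theorem ofReal_msq {S : SS} {Δ : (Fin n → Fin d → ℝ) → (S.1 → ℝ) → ℝ}
    (hΔ : BddMeas fun z : (Fin n → Fin d → ℝ) × (S.1 → ℝ) => Δ z.1 z.2) :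
    ENNReal.ofReal (P.msq S Δ) = ∫⁻ X, ∫⁻ x, ENNReal.ofReal (Δ X x ^ 2) ∂P.μ.map (proj S.1)
      ∂Measure.pi (fun _ : Fin n => P.μ) := by
  have hp := bddMeas_comp_proj hΔ
  rw [msq, ofReal_integral_eq_lintegral_ofReal
    ((bddMeas_integral P.μ (G := fun X y => Δ X (proj S.1 y) ^ 2) hp.pow).integrable
      _) (Eventually.of_forall fun X => integral_nonneg fun _ => sq_nonneg _)]
  refine lintegral_congr fun X => ?_
  have hX : BddMeas (Δ X) := hΔ.comp measurable_prodMk_left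
  rw [ofReal_integral_eq_lintegral_ofReal ((hX.comp (measurable_proj _)).pow.integrable _)
    (Eventually.of_forall fun _ => sq_nonneg _),
    lintegral_map hX.pow.1.ennreal_ofReal (measurable_proj _)]

theorem msq_nerr_le (hh : 0 < h) (hO : P.OscBound h t L₁ L₂ L₃) (hK : 1 ≤ K)
    (hKT : 2 * T ≤ K * h) (hErr : 0 ≤ Err) (l : Bool) (hSB : P.StepBound g l T t L₁ L₂ L₃ K Err)
    (S : SS) : P.msq S (P.nerr h T g l S) ≤ ((SS.card : ℝ)⁻¹ * (1 + 2 * √P.amp) ^ M) ^ 2 * Err := by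
  have h0 : 0 ≤ ((SS.card : ℝ)⁻¹ * (1 + 2 * √P.amp) ^ M) ^ 2 * Err :=
    mul_nonneg (sq_nonneg _) hErr
  rw [← ENNReal.ofReal_le_ofReal_iff h0, P.ofReal_msq (P.bddMeas_nerr hh l S)]
  exact P.lintegral_sq_alphaHat_sub_le hh hO hK hKT hErr hSB S

end Setting

/-! ### Explicit constants -/

/-- As err ≤ 3, one has err ≤ 2√err, so all three terms are of order √err. Their constants are 2,
2·70 and 4860, with sum 5002, below the available 4·3200. -/
theorem risk_bound_arith {k X Y L E m err : ℝ} (hk : 1 ≤ k) (hY : 1 ≤ Y) (hL : 0 ≤ L)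
    (hLX : L ≤ X) (hE : E ≤ 2430 * k * Y * X * err) (hm : 1 / m ≤ err)
    (h0 : 0 ≤ err) (h3 : err ≤ 3) :
    L / m + (2 * √(2 * L * E) + E) ≤ 4 * Y * (3200 * k ^ 2 * X) * √err := by
  have hX : 0 ≤ X := hL.trans hLX
  set s := √err with hs
  have hs0 : 0 ≤ s := Real.sqrt_nonneg _
  have hss : s ^ 2 = err := Real.sq_sqrt h0
  have hs2 : s ≤ 2 := by nlinarith
  have herr : err ≤ 2 * s := by nlinarith
  have hkY : 1 ≤ k * Y := by nlinarith
  have hkYX : X ≤ k * Y * X := by nlinarith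
  have h1 : L / m ≤ 2 * (k * Y * X) * s := by
    rw [div_eq_mul_one_div]
    calc L * (1 / m) ≤ L * err := mul_le_mul_of_nonneg_left hm hL
      _ ≤ X * err := mul_le_mul_of_nonneg_right hLX h0
      _ ≤ (k * Y * X) * (2 * s) := mul_le_mul hkYX herr h0 (hX.trans hkYX)
      _ = _ := by ring
  have h2 : E ≤ 4860 * (k * Y * X) * s := by
    calc E ≤ 2430 * k * Y * X * err := hE
      _ = 2430 * (k * Y * X) * err := by ring
      _ ≤ 2430 * (k * Y * X) * (2 * s) :=
        mul_le_mul_of_nonneg_left herr (by have := hX.trans hkYX; positivity)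
      _ = _ := by ring
  have h4 : √(2 * L * E) ≤ 70 * (k * Y * X) * s := by
    refine Real.sqrt_le_iff.2 ⟨by have := hX.trans hkYX; positivity, ?_⟩
    calc 2 * L * E ≤ 2 * L * (2430 * k * Y * X * err) :=
          mul_le_mul_of_nonneg_left hE (by positivity)
      _ ≤ 2 * X * (2430 * k * Y * X * err) := by
          refine mul_le_mul_of_nonneg_right (by linarith) ?_
          have : 0 ≤ k * Y * X * err := mul_nonneg (hX.trans hkYX) h0
          linarith
      _ = 4860 * (k * Y) * (X ^ 2 * err) := by ring
      _ ≤ 4900 * (k * Y) ^ 2 * (X ^ 2 * err) := by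
          refine mul_le_mul_of_nonneg_right ?_ (by positivity)
          nlinarith
      _ = (70 * (k * Y * X) * s) ^ 2 := by rw [← hss]; ring
  have h5 : k * Y * X * s ≤ k ^ 2 * Y * X * s := by
    have hYXs : 0 ≤ Y * X * s := by positivity
    nlinarith [mul_nonneg (mul_nonneg (by linarith : (0 : ℝ) ≤ k) (by linarith : 0 ≤ k - 1)) hYXs]
  have h6 : 0 ≤ k ^ 2 * Y * X * s := by positivity
  calc _ ≤ 5002 * (k * Y * X * s) := by linarith
    _ ≤ 5002 * (k ^ 2 * Y * X * s) := by linarith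
    _ ≤ 12800 * (k ^ 2 * Y * X * s) := by linarith
    _ = _ := by ring

/-- For y ≥ 4 one has 1 ≤ y and 4√y ≤ 2y. The 7 is one of the two factors of 28 in the constant A.
-/
theorem sq_one_add_two_sqrt_le {y : ℝ} (hy : 4 ≤ y) : (1 + 2 * √y) ^ 2 ≤ 7 * y := by
  have h0 : 0 ≤ y := by linarith
  have h1 := Real.sq_sqrt h0
  have h2 : 2 ≤ √y := Real.le_sqrt_of_sq_le (by linarith)
  nlinarith

namespace Setting

variable {d n M : ℕ} {SS : Finset (Finset (Fin d))} (P : Setting SS) {N : SS → ℕ}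
variable {h T t L₁ L₂ L₃ W G : ℝ} {K : ℕ} {g : Fin n → Fin M}

theorem one_le_div (S : SS) : 1 ≤ P.C / P.c := by
  rw [le_div_iff₀ P.c_pos, one_mul]; exact P.c_le_C S

theorem C_le_div (S : SS) : P.C ≤ P.C / P.c :=
  le_div_self (P.C_pos S).le P.c_pos (P.c_le_one S)

theorem four_le_two_pow (hd : 2 ≤ d) : (4 : ℝ) ≤ 2 ^ d := by
  calc (4 : ℝ) = 2 ^ 2 := by norm_num
    _ ≤ 2 ^ d := pow_le_pow_right₀ one_le_two hd

theorem five_le_amp (hd : 2 ≤ d) (S : SS) : 5 ≤ P.amp := by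
  have h1 := P.one_le_div S
  have h2 := four_le_two_pow hd
  unfold amp
  linarith

/-- The growth 2^m of the oscillation matches 4^m after squaring; the factor 1/c is traded for C/c,
as C ≥ 1, and absorbed into powers of `amp`. -/
theorem sq_oscC_le (hd : 2 ≤ d) (S : SS) (hL₁ : 0 ≤ L₁) (hL₂ : 0 ≤ L₂) (hL₃ : 0 ≤ L₃)
    (hW : P.b ^ 2 ≤ W) (hW1 : 1 ≤ W) (hG : (L₁ + L₂ + L₃) ^ 2 ≤ G) (m : ℕ) :
    P.oscC t L₁ L₂ L₃ m ^ 2 ≤ 4 ^ m * P.amp ^ (m + 1) * (W * G * t ^ 2) := by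
  have hy := P.five_le_amp hd S
  set s := √W with hs
  have hW0 : 0 ≤ W := by linarith
  have hss : s ^ 2 = W := Real.sq_sqrt hW0
  have hs1 : 1 ≤ s := Real.one_le_sqrt.2 hW1
  have hb0 := P.b_nonneg
  have hbs : P.b ≤ s := Real.le_sqrt_of_sq_le hW
  have hu : (1 : ℝ) ≤ 2 ^ m := one_le_pow₀ one_le_two
  have hc := P.c_pos
  have hcq : L₃ / (4 * P.c) ≤ L₃ * (P.C / P.c) / 4 := by
    have : 1 / P.c ≤ P.C / P.c := div_le_div_of_nonneg_right (P.one_le_C S) hc.le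
    calc L₃ / (4 * P.c) = L₃ * (1 / P.c) / 4 := by field_simp
      _ ≤ _ := by gcongr
  set inner := L₁ + (2 ^ (m + 1) - 2) * P.b * (L₂ + L₃ / (4 * P.c)) + 2 ^ (m + 1) * P.b * L₂
    with hinner
  have hp : (2 : ℝ) ^ (m + 1) = 2 * 2 ^ m := by ring
  have hin0 : 0 ≤ inner := by
    have : 0 ≤ (2 : ℝ) ^ (m + 1) - 2 := by rw [hp]; linarith
    positivity
  -- For m ≥ 1 one can take z = `amp`. At m = 0 only one power is available, but the L₃ term is then
  -- absent and z = 2 suffices.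
  have key : ∃ z : ℝ, 0 ≤ z ∧ z ^ 2 ≤ P.amp ^ (m + 1) ∧
      inner ≤ 2 ^ m * s * ((L₁ + L₂ + L₃) * z) := by
    rcases Nat.eq_zero_or_pos m with rfl | hm
    · refine ⟨2, by norm_num, by rw [zero_add, pow_one]; linarith, ?_⟩
      rw [hinner]
      have h1 : P.b * L₂ ≤ s * L₂ := by gcongr
      have h2 : L₁ ≤ s * L₁ := le_mul_of_one_le_left hL₁ hs1
      have h3 : 0 ≤ s * L₃ := by positivity
      norm_num
      nlinarith
    · refine ⟨P.amp, by linarith, pow_le_pow_right₀ (by linarith) (by omega), ?_⟩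
      have hqy : P.C / P.c ≤ P.amp := by
        unfold amp; have := four_le_two_pow hd; linarith
      have hq0 : 0 ≤ P.C / P.c := by have := P.one_le_div S; linarith
      have h1 : inner ≤ L₁ + 2 * 2 ^ m * s * (L₂ + L₃ * (P.C / P.c) / 4)
          + 2 * 2 ^ m * s * L₂ := by
        rw [hinner, hp]
        gcongr
        linarith
      have h2 : L₁ ≤ 2 ^ m * s * L₁ :=
        le_mul_of_one_le_left hL₁ (by nlinarith)
      have h3 : L₁ + 4 * L₂ + L₃ * (P.C / P.c) / 2 ≤ (L₁ + L₂ + L₃) * P.amp := by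
        have e1 : L₁ * 1 ≤ L₁ * P.amp := mul_le_mul_of_nonneg_left (by linarith) hL₁
        have e2 : L₂ * 4 ≤ L₂ * P.amp := mul_le_mul_of_nonneg_left (by linarith) hL₂
        have e3 : L₃ * (P.C / P.c) ≤ L₃ * P.amp := mul_le_mul_of_nonneg_left hqy hL₃
        have e4 : 0 ≤ L₃ * (P.C / P.c) := by positivity
        linarith
      calc inner ≤ 2 ^ m * s * (L₁ + 4 * L₂ + L₃ * (P.C / P.c) / 2) := by linarith
        _ ≤ _ := mul_le_mul_of_nonneg_left h3 (by positivity)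
  obtain ⟨z, hz0, hz, hle⟩ := key
  have h4 : (4 : ℝ) ^ m = (2 ^ m) ^ 2 := by rw [← pow_mul, mul_comm, pow_mul]; norm_num
  calc P.oscC t L₁ L₂ L₃ m ^ 2 = t ^ 2 * inner ^ 2 := by rw [oscC, ← hinner]; ring
    _ ≤ t ^ 2 * (2 ^ m * s * ((L₁ + L₂ + L₃) * z)) ^ 2 := by gcongr
    _ = t ^ 2 * ((2 ^ m) ^ 2 * W * ((L₁ + L₂ + L₃) ^ 2 * z ^ 2)) := by rw [← hss]; ring
    _ ≤ t ^ 2 * ((2 ^ m) ^ 2 * W * (G * P.amp ^ (m + 1))) := by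
        have hG0 : 0 ≤ G := (sq_nonneg _).trans hG
        gcongr
    _ = _ := by rw [h4]; ring

/-- The ball of radius T is covered by at most (3T/h)^d cubes. The 3^d is absorbed by 16^d = 2^d
8^d, the first factor from `amp` and the second from G; equality holds at d = 2. -/
theorem three_pow_le (hd : 2 ≤ d) : (256 : ℝ) * 3 ^ d ≤ 9 * (2 ^ d * 8 ^ d) := by
  have h1 : (2 : ℝ) ^ d * 8 ^ d = 16 ^ d := by rw [← mul_pow]; norm_num
  obtain ⟨k, rfl⟩ := Nat.exists_eq_add_of_le hd
  have h2 : (3 : ℝ) ^ k ≤ 16 ^ k := pow_le_pow_left₀ (by norm_num) (by norm_num) k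
  rw [h1, pow_add, pow_add]
  nlinarith

/-- The per-step errors are controlled. -/
theorem stepBound (hd : 2 ≤ d) (S : SS) (hn : 1 ≤ n) (hg : Balanced g) (hT : 1 ≤ T) (hh : 0 < h)
    (hh1 : h ≤ 1) (hK : (K : ℝ) ≤ 3 * (T / h)) (hL₁ : 0 ≤ L₁) (hL₂ : 0 ≤ L₂) (hL₃ : 0 ≤ L₃)
    (hW : P.b ^ 2 ≤ W) (hW1 : 1 ≤ W) (hGq : (P.C / P.c) ^ 2 ≤ G) (hGL : (L₁ + L₂ + L₃) ^ 2 ≤ G)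
    (hGd : 8 ^ d ≤ G) (l : Bool) :
    P.StepBound g l T t L₁ L₂ L₃ K
      (101 * W * G * (M * T ^ d / (n * h ^ d) + t ^ 2 + P.μ.real {x | T ≤ ‖x‖})) := by
  have hy := P.five_le_amp hd S
  have hq1 := P.one_le_div S
  have hCq := P.C_le_div S
  have hG64 : (64 : ℝ) ≤ G := by
    refine le_trans ?_ hGd
    calc (64 : ℝ) = 8 ^ 2 := by norm_num
      _ ≤ 8 ^ d := pow_le_pow_right₀ (by norm_num) hd
  have hn0 : (0 : ℝ) < n := by positivity
  set τ := (M : ℝ) * T ^ d / (n * h ^ d) with hτ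
  set p := P.μ.real {x | T ≤ ‖x‖} with hp
  have hp0 : 0 ≤ p := measureReal_nonneg
  have hTh : 1 ≤ T / h := by rw [le_div_iff₀ hh]; linarith
  have hτe : τ = M / n * (T / h) ^ d := by rw [hτ, div_pow]; field_simp
  have hMτ : (M : ℝ) / n ≤ τ := by
    rw [hτe]; exact le_mul_of_one_le_right (by positivity) (one_le_pow₀ hTh)
  have hτ0 : 0 ≤ τ := le_trans (by positivity) hMτ
  have ht0 : 0 ≤ t ^ 2 := sq_nonneg t
  have hqy : P.C / P.c ≤ P.amp := by unfold amp; have := four_le_two_pow hd; linarith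
  have h2y : (2 : ℝ) ^ d ≤ P.amp := by unfold amp; linarith
  have hyG : 0 ≤ P.amp * G := by positivity
  have hW0 : 0 ≤ W := by linarith
  have c1 : (64 : ℝ) * 2 ^ d ≤ P.amp * G := by
    calc (64 : ℝ) * 2 ^ d = 2 ^ d * 64 := by ring
      _ ≤ P.amp * G := mul_le_mul h2y hG64 (by norm_num) (by linarith)
  have c2 : 5 * (P.C / P.c) ^ 2 ≤ P.amp * G :=
    mul_le_mul hy hGq (by positivity) (by linarith)
  have c3 : (320 : ℝ) ≤ P.amp * G := by nlinarith
  have c4 : 64 * P.C ≤ P.amp * G := by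
    calc 64 * P.C ≤ P.amp * 64 := by linarith
      _ ≤ P.amp * G := mul_le_mul_of_nonneg_left hG64 (by linarith)
  have c5 : 256 * (3 : ℝ) ^ d ≤ 9 * (P.amp * G) := by
    refine (three_pow_le hd).trans ?_
    gcongr
  intro m hm
  have hu0 : (0 : ℝ) < 4 ^ m := by positivity
  have h4 : (2 ^ m * P.b) ^ 2 = 4 ^ m * P.b ^ 2 := by
    rw [mul_pow, ← pow_mul, mul_comm m 2, pow_mul]; norm_num
  have hyp : P.amp ≤ P.amp ^ (m + 1) := le_self_pow₀ (by linarith) (by omega)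
  have hcard := hg.inv_card_add_one_le l hn hm
  have hlift : ∀ v c : ℝ, 0 ≤ v → c * v ≤ 101 * v →
      4 ^ m * W * v * (c * (P.amp * G)) ≤ 4 ^ m * P.amp ^ (m + 1) * (101 * W * G * v) := by
    intro v c hv hcv
    have e1 : 4 ^ m * W * v * (c * (P.amp * G)) = 4 ^ m * W * G * (P.amp * (c * v)) := by ring
    have e2 : 4 ^ m * P.amp ^ (m + 1) * (101 * W * G * v)
        = 4 ^ m * W * G * (P.amp ^ (m + 1) * (101 * v)) := by ring
    rw [e1, e2]
    refine mul_le_mul_of_nonneg_left ?_ (by positivity)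
    exact (mul_le_mul_of_nonneg_left hcv (by linarith)).trans
      (mul_le_mul_of_nonneg_right hyp (by positivity))
  constructor
  · intro hne
    have hNpos : (1 : ℝ) ≤ (piece g l m).card := by exact_mod_cast hne.card_pos
    -- For a nonempty piece 1/N ≤ 2/(N+1), which doubles the constant of the balancing bound.
    have hinv : 1 / ((piece g l m).card : ℝ) ≤ 4 * (M / n) := by
      have : 1 / ((piece g l m).card : ℝ) ≤ 2 * (1 / (((piece g l m).card : ℝ) + 1)) := by
        rw [← mul_div_assoc, mul_one, div_le_div_iff₀ (by linarith) (by linarith)]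
        linarith
      linarith
    have s1 : (2 ^ m * P.b) ^ 2 * p * (27 * 2 ^ d + 72 * (P.C / P.c) ^ 2 + 4)
        ≤ 4 ^ m * P.amp ^ (m + 1) * (101 * W * G * p) := by
      rw [h4]
      refine le_trans ?_ (hlift p 15 hp0 (by linarith))
      have : 27 * 2 ^ d + 72 * (P.C / P.c) ^ 2 + 4 ≤ 15 * (P.amp * G) := by linarith
      gcongr
    have hKd : M / n * (K : ℝ) ^ d ≤ 3 ^ d * τ := by
      calc M / n * (K : ℝ) ^ d ≤ M / n * (3 * (T / h)) ^ d := by gcongr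
        _ = 3 ^ d * τ := by rw [hτe, mul_pow]; ring
    have s2 : (2 ^ m * P.b) ^ 2 / (piece g l m).card *
        (243 * (K : ℝ) ^ d + 144 * P.C + 72 * (P.C / P.c) ^ 2)
        ≤ 4 ^ m * P.amp ^ (m + 1) * (101 * W * G * τ) := by
      rw [h4, div_eq_mul_one_div]
      refine le_trans ?_ (hlift τ 101 hτ0 (by linarith))
      have hC0 := P.C_pos S
      have e1 : 1 / ((piece g l m).card : ℝ) *
          (243 * (K : ℝ) ^ d + 144 * P.C + 72 * (P.C / P.c) ^ 2) ≤ τ * (101 * (P.amp * G)) := by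
        calc _ ≤ 4 * (M / n) * (243 * (K : ℝ) ^ d + 144 * P.C + 72 * (P.C / P.c) ^ 2) := by gcongr
          _ = 4 * (243 * (M / n * (K : ℝ) ^ d) + (144 * P.C + 72 * (P.C / P.c) ^ 2) * (M / n)) := by
            ring
          _ ≤ 4 * (243 * (3 ^ d * τ) + (144 * P.C + 72 * (P.C / P.c) ^ 2) * τ) := by gcongr
          _ = τ * (4 * (243 * 3 ^ d + 144 * P.C + 72 * (P.C / P.c) ^ 2)) := by ring
          -- Origin of 101: by `c5`, `c4` and `c2` the bracket is at most 972·9/256 + 576/64 + 288/5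
          -- < 101 times `amp` G.
          _ ≤ _ := mul_le_mul_of_nonneg_left (by linarith) hτ0
      calc _ = 4 ^ m * P.b ^ 2 * (1 / ((piece g l m).card : ℝ) *
            (243 * (K : ℝ) ^ d + 144 * P.C + 72 * (P.C / P.c) ^ 2)) := by ring
        _ ≤ 4 ^ m * W * (τ * (101 * (P.amp * G))) := by gcongr
        _ = _ := by ring
    have s3 : 27 * P.oscC t L₁ L₂ L₃ m ^ 2 ≤ 4 ^ m * P.amp ^ (m + 1) * (101 * W * G * t ^ 2) := by
      have := P.sq_oscC_le (t := t) hd S hL₁ hL₂ hL₃ hW hW1 hGL m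
      have h0 : 0 ≤ 4 ^ m * P.amp ^ (m + 1) * (W * G * t ^ 2) := by positivity
      linarith
    unfold stepErr
    linarith
  · intro hempty
    rw [hempty] at hcard
    simp only [Finset.card_empty, Nat.cast_zero, zero_add, div_one] at hcard
    -- An empty piece forces n ≤ 2M, so the stochastic error is at least 1/2 and dominates the
    -- bounded exact step.
    have hτ1 : 1 ≤ 2 * τ := by linarith
    have s1 : (2 * (2 ^ m * P.b)) ^ 2 ≤ 4 ^ m * P.amp ^ (m + 1) * (101 * W * G * τ) := by
      refine le_trans ?_ (hlift τ 1 hτ0 (by linarith))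
      rw [mul_pow, h4]
      calc (2 : ℝ) ^ 2 * (4 ^ m * P.b ^ 2) ≤ 2 ^ 2 * (4 ^ m * W) := by gcongr
        _ = 4 ^ m * W * 4 := by ring
        _ ≤ 4 ^ m * W * (τ * (1 * (P.amp * G))) := by
          refine mul_le_mul_of_nonneg_left ?_ (by positivity)
          nlinarith
        _ = _ := by ring
    have s2 : 0 ≤ 4 ^ m * P.amp ^ (m + 1) * (101 * W * G * t ^ 2) := by positivity
    have s3 : 0 ≤ 4 ^ m * P.amp ^ (m + 1) * (101 * W * G * p) := by positivity
    linarith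

theorem iInf_lam_pos (hSS : SS.Nonempty) : 0 < ⨅ S, P.lam S := by
  have : Nonempty SS := hSS.to_subtype
  obtain ⟨S, hS⟩ := exists_eq_ciInf_of_finite (f := P.lam)
  rw [← hS]
  exact P.lam_pos S

/-- Finite-sample bound for the risk. -/
theorem abs_mul_risk_sub_energy_alphaPop_le (hd : 2 ≤ d) (hSS : SS.Nonempty) (hn : 1 ≤ n)
    (hM : 1 ≤ M) (hN : ∀ S, 1 ≤ N S) (hNn : ∀ S, |(n : ℝ) * P.lam S / N S - 1| ≤ 1 / n)
    (hg : Balanced g) (hT : 1 ≤ T) (hh : 0 < h) (hh1 : h ≤ 1) (hO : P.OscBound h t L₁ L₂ L₃)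
    (hL₁ : 0 ≤ L₁) (hL₂ : 0 ≤ L₂) (hL₃ : 0 ≤ L₃) (hW : P.b ^ 2 ≤ W) (hW1 : 1 ≤ W)
    (hGq : (P.C / P.c) ^ 2 ≤ G) (hGL : (L₁ + L₂ + L₃) ^ 2 ≤ G) (hGd : 8 ^ d ≤ G)
    (hτ : M * T ^ d / (n * h ^ d) ≤ 1) (ht0 : 0 ≤ t) (ht : t ≤ 1) :
    |n * ∫ Z, (thetaHat P.a P.r P.lam h T g Z - P.θ) ^ 2 ∂P.dataM n N - P.energy (P.alphaPop M)|
      ≤ (28 * P.amp) ^ M * (200 * (SS.card : ℝ) ^ 2 * (P.C / P.c) * (1 + (⨅ S, P.lam S)⁻¹) *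
        (16 * W * G)) *
        √(M * T ^ d / (n * h ^ d) + t ^ 2 + P.μ.real {x | T ≤ ‖x‖}) := by
  obtain ⟨S₀, hS₀⟩ := id hSS
  have hy := P.five_le_amp hd ⟨S₀, hS₀⟩
  have hq1 := P.one_le_div ⟨S₀, hS₀⟩
  have hCq := P.C_le_div ⟨S₀, hS₀⟩
  have hC0 := P.C_pos ⟨S₀, hS₀⟩
  have hk : (1 : ℝ) ≤ SS.card := by exact_mod_cast hSS.card_pos
  have hlm := P.iInf_lam_pos hSS
  have hn0 : (0 : ℝ) < n := by positivity
  have hM1 : (1 : ℝ) ≤ M := by exact_mod_cast hM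
  have hW0 : 0 ≤ W := by linarith
  have hG1 : 1 ≤ G := le_trans (one_le_pow₀ (by norm_num)) hGd
  set err := M * T ^ d / (n * h ^ d) + t ^ 2 + P.μ.real {x | T ≤ ‖x‖} with herr
  have hp0 : 0 ≤ P.μ.real {x | T ≤ ‖x‖} := measureReal_nonneg
  have hp1 : P.μ.real {x | T ≤ ‖x‖} ≤ 1 := measureReal_le_one
  have hτn : 1 / (n : ℝ) ≤ M * T ^ d / (n * h ^ d) := by
    rw [div_le_div_iff₀ hn0 (by positivity)]
    have h1 : h ^ d ≤ 1 := pow_le_one₀ hh.le hh1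
    have h2 : 1 ≤ T ^ d := one_le_pow₀ hT
    have h3 : h ^ d ≤ M * T ^ d := h1.trans (by nlinarith)
    nlinarith
  have hτ0 : 0 ≤ M * T ^ d / (n * h ^ d) := le_trans (by positivity) hτn
  have herr0 : 0 ≤ err := by positivity
  have herr3 : err ≤ 3 := by
    have : t ^ 2 ≤ 1 := pow_le_one₀ ht0 ht
    rw [herr]; linarith
  have hnerr : 1 / (n : ℝ) ≤ err := by
    have := sq_nonneg t
    rw [herr]; linarith
  -- resolution of the cover
  set K := ⌈2 * T / h⌉₊ with hKdef
  have hTh : 1 ≤ T / h := by rw [le_div_iff₀ hh]; linarith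
  have hKle : (K : ℝ) ≤ 3 * (T / h) := by
    have := (Nat.ceil_lt_add_one (by positivity : 0 ≤ 2 * T / h)).le
    have e : 2 * T / h = 2 * (T / h) := by ring
    rw [hKdef]
    linarith
  have hKT : 2 * T ≤ K * h := by
    have := Nat.le_ceil (2 * T / h)
    rwa [div_le_iff₀ hh] at this
  have hK1 : 1 ≤ K := Nat.one_le_ceil_iff.2 (by positivity)
  set Err := 101 * W * G * err with hErr
  have hErr0 : 0 ≤ Err := by positivity
  -- Upper bound for (1 + 2√`amp`)^(2M), the growth of the mean squared error of the nuisance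
  -- functions.
  set Y := (7 * P.amp) ^ M with hY
  have hY1 : 1 ≤ Y := one_le_pow₀ (by linarith)
  set D := (SS.card : ℝ)⁻¹ ^ 2 * Y * Err with hD
  have hD0 : 0 ≤ D := by positivity
  have hmsq : ∀ S l, P.msq S (P.nerr h T g l S) ≤ D := by
    intro S l
    refine (P.msq_nerr_le hh hO hK1 hKT hErr0 l (P.stepBound hd S hn hg hT hh hh1 hKle hL₁ hL₂ hL₃
      hW hW1 hGq hGL hGd l) S).trans ?_
    rw [hD, mul_pow, ← pow_mul, mul_comm M 2, pow_mul]
    refine mul_le_mul_of_nonneg_right (mul_le_mul_of_nonneg_left ?_ (by positivity)) hErr0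
    exact pow_le_pow_left₀ (sq_nonneg _) (sq_one_add_two_sqrt_le (by linarith)) M
  have hE2 := P.mul_integral_sq_thetaHat_sub_oracle_le (N := N) (T := T) (g := g) hh hn hN hmsq
  set q := P.C / P.c with hq
  set lm := ⨅ S, P.lam S with hlmdef
  set L := P.energy (P.alphaPop M) with hL
  have hL0 : 0 ≤ L := P.energy_nonneg _
  have hLW : L ≤ W := (P.energy_alphaPop_le_sq hSS M).trans hW
  -- The assumption on the sample sizes gives nλ/N ≤ 1 + 1/n ≤ 2.
  have hratio : ∀ S, (n : ℝ) / N S ≤ 2 * (P.lam S)⁻¹ := by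
    intro S
    have h1 := (abs_le.1 (hNn S)).2
    have h2 : 1 / (n : ℝ) ≤ 1 := by
      rw [div_le_one hn0]; exact_mod_cast hn
    have h3 : (n : ℝ) / N S * P.lam S ≤ 2 := by
      have : (n : ℝ) / N S * P.lam S = n * P.lam S / N S := by ring
      linarith
    rw [← div_eq_mul_inv, le_div_iff₀ (P.lam_pos S)]
    exact h3
  have hlmS : ∀ S, (P.lam S)⁻¹ ≤ lm⁻¹ := fun S =>
    inv_anti₀ hlm (ciInf_le (Set.finite_range _).bddBelow S)
  -- The constant 2430 is 2424 = 24·101 from the nuisance errors plus 6 from the normalisation.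
  have hsum : 3 * (SS.card : ℝ) * ∑ S : SS, ((4 + 4 * P.C + 2 * q * (n / N S)) * D
      + P.C / N S * ∫ x, P.alphaPop M S (proj S.1 x) ^ 2 * (P.r S (proj S.1 x))⁻¹ ∂P.μ)
      ≤ 2430 * SS.card * Y * (q * (1 + lm⁻¹) * (W * G)) * err := by
    have h1 : ∀ S : SS, (4 + 4 * P.C + 2 * q * (n / N S)) * D
        + P.C / N S * ∫ x, P.alphaPop M S (proj S.1 x) ^ 2 * (P.r S (proj S.1 x))⁻¹ ∂P.μ
        ≤ 8 * q * (1 + lm⁻¹) * D + 2 * (q * (1 / n)) * ((P.lam S)⁻¹ *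
          ∫ x, P.alphaPop M S (proj S.1 x) ^ 2 * (P.r S (proj S.1 x))⁻¹ ∂P.μ) := by
      intro S
      have hI := integral_sq_mul_inv_r_nonneg P (P.alphaPop M) S
      set I := ∫ x, P.alphaPop M S (proj S.1 x) ^ 2 * (P.r S (proj S.1 x))⁻¹ ∂P.μ
      have e1 : 2 * q * (n / N S) ≤ 2 * q * (2 * lm⁻¹) := by
        gcongr
        exact (hratio S).trans (by linarith [hlmS S])
      have e2 : 4 + 4 * P.C + 2 * q * (n / N S) ≤ 8 * q * (1 + lm⁻¹) := by
        have : 0 ≤ q * lm⁻¹ := by positivity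
        linarith
      have e3 : P.C / N S * I ≤ 2 * (q * (1 / n)) * ((P.lam S)⁻¹ * I) := by
        calc P.C / N S * I = P.C * (1 / n) * (n / N S) * I := by field_simp
          _ ≤ q * (1 / n) * (2 * (P.lam S)⁻¹) * I := by gcongr; exact hratio S
          _ = _ := by ring
      exact add_le_add (mul_le_mul_of_nonneg_right e2 hD0) e3
    have h2 : ∑ S : SS, ((4 + 4 * P.C + 2 * q * (n / N S)) * D
        + P.C / N S * ∫ x, P.alphaPop M S (proj S.1 x) ^ 2 * (P.r S (proj S.1 x))⁻¹ ∂P.μ)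
        ≤ SS.card * (8 * q * (1 + lm⁻¹) * D) + 2 * (q * err) * W := by
      refine (Finset.sum_le_sum fun S _ => h1 S).trans ?_
      rw [Finset.sum_add_distrib, Finset.sum_const, ← Finset.mul_sum, nsmul_eq_mul,
        Finset.card_univ, Fintype.card_coe]
      refine add_le_add le_rfl ?_
      have h3 := (P.sum_inv_lam_mul_le_energy M).trans hLW
      refine mul_le_mul (by gcongr) h3 (Finset.sum_nonneg fun S _ =>
        mul_nonneg (inv_pos.2 (P.lam_pos S)).le (integral_sq_mul_inv_r_nonneg P _ S))
        (by positivity)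
    -- The factor |SS|⁻² in D cancels the |SS| from the sum over S and the one from Cauchy–Schwarz.
    have hkD : (SS.card : ℝ) * (SS.card * D) = Y * Err := by
      rw [hD]; field_simp
    calc _ ≤ 3 * (SS.card : ℝ) * (SS.card * (8 * q * (1 + lm⁻¹) * D) + 2 * (q * err) * W) :=
          mul_le_mul_of_nonneg_left h2 (by positivity)
      _ = 24 * q * (1 + lm⁻¹) * (SS.card * (SS.card * D)) + 6 * SS.card * (q * W) * err := by ring
      _ = 2424 * Y * (q * (1 + lm⁻¹) * (W * G)) * err + 6 * SS.card * (q * W) * err := by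
          rw [hkD, hErr]; ring
      _ ≤ 2424 * SS.card * Y * (q * (1 + lm⁻¹) * (W * G)) * err
          + 6 * SS.card * Y * (q * (1 + lm⁻¹) * (W * G)) * err := by
          refine add_le_add (mul_le_mul_of_nonneg_right (mul_le_mul_of_nonneg_right
            (mul_le_mul_of_nonneg_right ?_ (by linarith)) (by positivity)) herr0)
            (mul_le_mul_of_nonneg_right ?_ herr0)
          · linarith
          · have e1 : q * W ≤ q * (1 + lm⁻¹) * (W * G) := by
              have e2 : q * 1 ≤ q * (1 + lm⁻¹) :=
                mul_le_mul_of_nonneg_left (by linarith [inv_pos.2 hlm]) (by linarith)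
              have e3 : W ≤ W * G := le_mul_of_one_le_right hW0 hG1
              rw [mul_one] at e2
              exact mul_le_mul e2 e3 hW0 (by positivity)
            have e4 : 6 * (SS.card : ℝ) ≤ 6 * SS.card * Y :=
              le_mul_of_one_le_right (by positivity) hY1
            exact mul_le_mul e4 e1 (by positivity) (by positivity)
      _ = _ := by ring
  have hfin := P.abs_mul_risk_sub_energy_le (N := N) (T := T) (g := g) hh hn hN hNn hE2
  refine hfin.trans ?_
  have hLX : L ≤ q * (1 + lm⁻¹) * (W * G) := by
    have e2 : 1 ≤ q * (1 + lm⁻¹) := by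
      have := mul_nonneg (by linarith : 0 ≤ q) (inv_pos.2 hlm).le
      linarith
    have e3 : W ≤ W * G := le_mul_of_one_le_right hW0 hG1
    exact hLW.trans (e3.trans (le_mul_of_one_le_left (by positivity) e2))
  refine (risk_bound_arith hk hY1 hL0 hLX hsum hnerr herr0 herr3).trans ?_
  -- Here 28 = 4·7; since M ≥ 1, the leftover factor 4 fits into 4^M.
  have hAM : 4 * Y ≤ (28 * P.amp) ^ M := by
    have e1 : (28 * P.amp) ^ M = 4 ^ M * Y := by rw [hY, ← mul_pow]; congr 1; ring
    rw [e1]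
    exact mul_le_mul_of_nonneg_right (le_self_pow₀ (by norm_num) (by omega)) (by linarith)
  have e5 : 3200 * (SS.card : ℝ) ^ 2 * (q * (1 + lm⁻¹) * (W * G))
      = 200 * (SS.card : ℝ) ^ 2 * q * (1 + lm⁻¹) * (16 * W * G) := by ring
  rw [e5]
  have : 0 ≤ 200 * (SS.card : ℝ) ^ 2 * q * (1 + lm⁻¹) * (16 * W * G) := by positivity
  gcongr

end Setting

/-! ### Reduction to normalised shifts -/

/-- Supplies the measurability of the target and of the normalised shifts, which is not assumed
separately. -/
theorem continuous_of_holder {ι : Type*} [Fintype ι] {φ : (ι → ℝ) → ℝ} {β L : ℝ} (hβ : 0 < β)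
    (hφ : ∀ x x' : ι → ℝ, ‖x - x'‖ ≤ 1 → |φ x - φ x'| ≤ L * ‖x - x'‖ ^ β) : Continuous φ := by
  rw [continuous_iff_continuousAt]
  intro x
  have h1 : Tendsto (fun x' : ι → ℝ => ‖x' - x‖) (𝓝 x) (𝓝 0) := by
    have : Continuous fun x' : ι → ℝ => ‖x' - x‖ := by fun_prop
    simpa using this.tendsto x
  have h2 : Tendsto (fun x' : ι → ℝ => L * ‖x' - x‖ ^ β) (𝓝 x) (𝓝 0) := by
    have := (h1.rpow_const (Or.inr hβ.le)).const_mul L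
    simpa [Real.zero_rpow hβ.ne'] using this
  rw [ContinuousAt, tendsto_iff_dist_tendsto_zero]
  refine squeeze_zero' (Eventually.of_forall fun _ => dist_nonneg) ?_ h2
  filter_upwards [h1.eventually (gt_mem_nhds one_pos)] with x' hx'
  rw [Real.dist_eq]
  exact hφ x' x hx'.le

section Scale

variable {d n M : ℕ} {SS : Finset (Finset (Fin d))} {r r' : (S : SS) → (S.1 → ℝ) → ℝ} {k : SS → ℝ}

theorem rhat_scale (hr : ∀ S x, r' S x = r S x / k S) (X : Fin n → Fin d → ℝ)
    (I : Finset (Fin n)) (S : SS) : rhat r' X I S = rhat r X I S / k S := by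
  unfold rhat
  simp_rw [hr]
  rw [← Finset.sum_div]
  ring

/-- Rescaling r rescales its empirical mean by the same factor, so the weight is unchanged;
everything else in the regression depends on r only through the weight. -/
theorem what_scale (hk : ∀ S, k S ≠ 0) (hr : ∀ S x, r' S x = r S x / k S) (lam : SS → ℝ)
    (X : Fin n → Fin d → ℝ) (I : Finset (Fin n)) (S : SS) (x : S.1 → ℝ) :
    what r' lam X I S x = what r lam X I S x := by
  unfold what
  rw [rhat_scale hr, hr]
  have := hk S
  rw [← mul_div_assoc, ← add_div, div_div_div_cancel_right₀ this]

theorem regStep_scale (hk : ∀ S, k S ≠ 0) (hr : ∀ S x, r' S x = r S x / k S) (lam : SS → ℝ)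
    (X : Fin n → Fin d → ℝ) (h T : ℝ) (I : Finset (Fin n)) (S : SS) (φ : (Fin d → ℝ) → ℝ)
    (x : S.1 → ℝ) : regStep r' lam X h T I S φ x = regStep r lam X h T I S φ x := by
  unfold regStep
  simp_rw [what_scale hk hr]

theorem ahat_scale (hk : ∀ S, k S ≠ 0) (hr : ∀ S x, r' S x = r S x / k S) (a : (Fin d → ℝ) → ℝ)
    (lam : SS → ℝ) (X : Fin n → Fin d → ℝ) (h T : ℝ) (g : Fin n → Fin M) (l : Bool) :
    ∀ (m : ℕ) (s : Fin m → SS), ahat a r' lam X h T g l m s = ahat a r lam X h T g l m s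
  | 0, _ => rfl
  | m + 1, s => by
    funext x
    simp only [ahat]
    rw [ahat_scale hk hr a lam X h T g l m, regStep_scale hk hr]

theorem alphaHat_scale (hk : ∀ S, k S ≠ 0) (hr : ∀ S x, r' S x = r S x / k S)
    (a : (Fin d → ℝ) → ℝ) (lam : SS → ℝ) (X : Fin n → Fin d → ℝ) (h T : ℝ) (g : Fin n → Fin M)
    (l : Bool) (S : SS) (x : S.1 → ℝ) :
    alphaHat a r' lam X h T g l S x = alphaHat a r lam X h T g l S x := by
  unfold alphaHat
  simp_rw [ahat_scale hk hr, regStep_scale hk hr]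

/-- The estimator does not depend on the normalisation of the shifts. -/
theorem thetaHat_scale {N : SS → ℕ} (hk : ∀ S, k S ≠ 0) (hr : ∀ S x, r' S x = r S x / k S)
    (a : (Fin d → ℝ) → ℝ) (lam : SS → ℝ) (h T : ℝ) (g : Fin n → Fin M) (Z : Data SS n N) :
    thetaHat a r' lam h T g Z = thetaHat a r lam h T g Z := by
  have h1 : ∀ (I : Finset (Fin n)) (S : SS) (y : S.1 → ℝ) (v : ℝ),
      v * rhat r' Z.1 I S / r' S y = v * rhat r Z.1 I S / r S y := fun I S y v => by
    rw [rhat_scale hr, hr, ← mul_div_assoc, div_div_div_cancel_right₀ (hk S)]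
  unfold thetaHat thetaHatHalf
  simp_rw [h1, alphaHat_scale hk hr]

end Scale

section Build

variable {d : ℕ} {SS : Finset (Finset (Fin d))} {f : (Fin d → ℝ) → ℝ} {a : (Fin d → ℝ) → ℝ}
  {r : (S : SS) → (S.1 → ℝ) → ℝ}

theorem isProbabilityMeasure_law (hf_one : ∫⁻ x, ENNReal.ofReal (f x) = 1) :
    IsProbabilityMeasure (law f) :=
  ⟨by rw [law, withDensity_apply _ MeasurableSet.univ, Measure.restrict_univ, hf_one]⟩

/-- The model with normalised shifts obtained from the data of the problem. -/
def mkSetting (hf_one : ∫⁻ x, ENNReal.ofReal (f x) = 1)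
    (ha : BddAbove (Set.range fun x => |a x|)) (ha_meas : Measurable a)
    (hr_meas : ∀ S, Measurable (rbar f r S)) (hr_mean : ∀ S, ∫ y, r S (proj S.1 y) ∂law f ≠ 0)
    {lam : SS → ℝ} (hlam : ∀ S, 0 < lam S) {c C : ℝ} (hc : 0 < c)
    (hrbar : ∀ S x, c ≤ rbar f r S x ∧ rbar f r S x ≤ C)
    (Q : (S : SS) → Kernel (S.1 → ℝ) ((S.1ᶜ : Finset (Fin d)) → ℝ)) (hQ : ∀ S, IsMarkovKernel (Q S))
    (hQd : ∀ S : SS, (marginal f S.1).compProd (Q S)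
      = (law f).map fun x => (proj S.1 x, proj S.1ᶜ x)) : Setting SS where
  μ := law f
  prob := isProbabilityMeasure_law hf_one
  a := a
  b := supNorm a
  a_meas := ha_meas
  a_bdd := fun x => le_ciSup ha x
  r := rbar f r
  r_meas := hr_meas
  c := c
  C := C
  c_pos := hc
  r_ge := fun S x => (hrbar S x).1
  r_le := fun S x => (hrbar S x).2
  r_mean := fun S => by
    unfold rbar
    rw [integral_div, div_self (hr_mean S)]
  lam := lam
  lam_pos := hlam
  Q := Q
  markov := hQ
  disint := hQd

theorem rpow_le_of_le {x h β β' L : ℝ} (hx0 : 0 ≤ x) (hx : x ≤ h) (h0 : 0 < h) (h1 : h ≤ 1)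
    (hβ : 0 ≤ β) (hββ' : β' ≤ β) (hL : 0 ≤ L) : L * x ^ β ≤ L * h ^ β' :=
  mul_le_mul_of_nonneg_left ((Real.rpow_le_rpow hx0 hx hβ).trans
    (Real.rpow_le_rpow_of_exponent_ge h0 h1 hββ')) hL

end Build

/-- The bandwidth condition bounds the stochastic part of the error. -/
theorem stochastic_le_one {d n M : ℕ} {T h : ℝ} (hd : d ≠ 0) (hn : 1 ≤ n) (hT : 0 ≤ T) (hh : 0 < h)
    (hTh : T * ((M : ℝ) / n) ^ (1 / (d : ℝ)) ≤ h) : M * T ^ d / (n * h ^ d) ≤ 1 := by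
  have hn0 : (0 : ℝ) < n := by positivity
  have h1 : (T * ((M : ℝ) / n) ^ (1 / (d : ℝ))) ^ d ≤ h ^ d :=
    pow_le_pow_left₀ (mul_nonneg hT (Real.rpow_nonneg (by positivity) _)) hTh d
  rw [mul_pow, one_div, Real.rpow_inv_natCast_pow (by positivity) hd] at h1
  rw [div_le_one (by positivity)]
  calc M * T ^ d = n * (T ^ d * (M / n)) := by field_simp
    _ ≤ n * h ^ d := by gcongr

end DataFusion

end

/-! ### The main theorem -/

theorem theorem4 (d : ℕ) (hd : 2 ≤ d)
    (SS : Finset (Finset (Fin d))) (hSS : SS.Nonempty) (hfull : Finset.univ ∉ SS)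
    (f : (Fin d → ℝ) → ℝ) (hf_meas : Measurable f) (hf_nonneg : ∀ x, 0 ≤ f x)
    (hf_one : ∫⁻ x, ENNReal.ofReal (f x) = 1)
    (a : (Fin d → ℝ) → ℝ) (ha : BddAbove (Set.range fun x => |a x|))
    (r : (S : SS) → (S.1 → ℝ) → ℝ) (hr : ∀ S x, 0 < r S x)
    (lam : SS → ℝ) (hlam : ∀ S, 0 < lam S)
    (c C : ℝ) (hc : 0 < c)
    (hrbar : ∀ S x, c ≤ DataFusion.rbar f r S x ∧ DataFusion.rbar f r S x ≤ C)
    (β₁ β₂ β₃ L₁ L₂ L₃ : ℝ)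
    (hβ₁ : β₁ ∈ Set.Ioc (0 : ℝ) 1) (hβ₂ : β₂ ∈ Set.Ioc (0 : ℝ) 1) (hβ₃ : β₃ ∈ Set.Ioc (0 : ℝ) 1)
    (hL₁ : 0 < L₁) (hL₂ : 0 < L₂) (hL₃ : 0 < L₃)
    (hA1 : DataFusion.SmoothTarget a β₁ L₁)
    (hA2 : DataFusion.SmoothConditionals SS f β₂ L₂)
    (hA3 : DataFusion.SmoothShifts f r β₃ L₃) :
    ∃ αstar ∈ DataFusion.HSpace SS f,
      IsMinOn (DataFusion.objective f a r lam) (DataFusion.HSpace SS f) αstar ∧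
      -- the finite-sample bound
      (∀ (n M : ℕ) (N : SS → ℕ) (g : Fin n → Fin M) (T h : ℝ),
        1 ≤ n → 1 ≤ M → 1 ≤ T → (∀ S, 1 ≤ N S) →
        (∀ S, |(n : ℝ) * lam S / N S - 1| ≤ 1 / n) →
        DataFusion.Balanced g →
        T * ((M : ℝ) / n) ^ (1 / (d : ℝ)) ≤ h → h ≤ 1 →
        Integrable
          (fun Z : DataFusion.Data SS n N =>
            (DataFusion.thetaHat a r lam h T g Z - DataFusion.theta f a) ^ 2)
          (DataFusion.dataLaw f r n N) ∧
        n * DataFusion.risk f a r lam N h T g - DataFusion.objective f a r lam αstar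
          ≤ DataFusion.constA d c C ^ M * DataFusion.constD a lam c C L₁ L₂ L₃ *
              √(DataFusion.errTerm f (min (min β₁ β₂) β₃) n M T h)
            + 4 * DataFusion.condNumber lam C * variance a (DataFusion.law f) *
              Real.exp (-(M / DataFusion.condNumber lam C))) ∧
      -- the asymptotic expansion, along sequences of sample sizes and tuning parameters
      (∀ (n M : ℕ → ℕ) (N : ℕ → SS → ℕ) (g : (k : ℕ) → Fin (n k) → Fin (M k)) (T h : ℕ → ℝ),
        Tendsto n atTop atTop → Tendsto M atTop atTop → Tendsto T atTop atTop →
        (∀ k, 0 < h k) → (∀ k S, 1 ≤ N k S) →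
        (∀ k S, |(n k : ℝ) * lam S / N k S - 1| ≤ 1 / n k) →
        (∀ k, DataFusion.Balanced (g k)) →
        Tendsto (fun k => DataFusion.constA d c C ^ (2 * M k) *
            DataFusion.errTerm f (min (min β₁ β₂) β₃) (n k) (M k) (T k) (h k)) atTop (𝓝 0) →
        (fun k => DataFusion.risk f a r lam (N k) (h k) (T k) (g k)
            - DataFusion.objective f a r lam αstar / n k)
          =o[atTop] fun k => 1 / (n k : ℝ)) := by
  have hprob := DataFusion.isProbabilityMeasure_law hf_one
  -- A zero value, including the default value for a non-integrable r, would make the normalised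
  -- shift 0 by the division convention, contradicting the lower bound c.
  have hE : ∀ S : SS, ∫ y, r S (DataFusion.proj S.1 y) ∂DataFusion.law f ≠ 0 := by
    intro S h0
    have h1 := (hrbar S 0).1
    rw [DataFusion.rbar, h0, div_zero] at h1
    linarith
  have ha_meas : Measurable a := (DataFusion.continuous_of_holder hβ₁.1 hA1).measurable
  have hr_meas : ∀ S, Measurable (DataFusion.rbar f r S) := fun S =>
    (DataFusion.continuous_of_holder hβ₃.1 (hA3 S)).measurable
  choose Q hQ hQd hQtv using fun S : SS => hA2 S.1 S.2
  set P : DataFusion.Setting SS :=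
    DataFusion.mkSetting hf_one ha ha_meas hr_meas hE hlam hc hrbar Q hQ hQd with hP
  set β := min (min β₁ β₂) β₃ with hβ
  have hβ0 : 0 < β := lt_min (lt_min hβ₁.1 hβ₂.1) hβ₃.1
  set κ := DataFusion.condNumber lam C with hκ
  have hκ1 : 1 ≤ κ := P.one_le_kappa hSS
  set V := variance a (DataFusion.law f) with hV
  have hV0 : 0 ≤ V := variance_nonneg _ _
  obtain ⟨αs, hαs, hmin⟩ := P.exists_minimiser hSS
  -- A two-sided bound serving both parts. It needs only h ≤ 1 and a stochastic term of at most 1,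
  -- which the asymptotic regime provides eventually.
  have hrisk : ∀ (n M : ℕ) (N : SS → ℕ) (g : Fin n → Fin M) (T h : ℝ), 1 ≤ n → 1 ≤ M → 1 ≤ T →
      (∀ S, 1 ≤ N S) → (∀ S, |(n : ℝ) * lam S / N S - 1| ≤ 1 / n) → DataFusion.Balanced g →
      0 < h → h ≤ 1 → M * T ^ d / (n * h ^ d) ≤ 1 →
      |n * DataFusion.risk f a r lam N h T g - DataFusion.objective f a r lam αs|
        ≤ DataFusion.constA d c C ^ M * DataFusion.constD a lam c C L₁ L₂ L₃ *
            √(DataFusion.errTerm f β n M T h) + V * Real.exp (-(M / κ)) := by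
    intro n M N g T h hn hM hT hN hNn hg hh hh1 hτ
    -- As h ≤ 1, all three moduli at scale h are bounded using the smallest exponent.
    have hO : P.OscBound h (h ^ β) L₁ L₂ L₃ :=
      ⟨fun x x' hx => (hA1 x x' (hx.trans hh1)).trans (DataFusion.rpow_le_of_le (norm_nonneg _) hx hh
          hh1 hβ₁.1.le ((min_le_left _ _).trans (min_le_left _ _)) hL₁.le),
        fun S x x' hx => (hQtv S x x' (hx.trans hh1)).trans (DataFusion.rpow_le_of_le (norm_nonneg _)
          hx hh hh1 hβ₂.1.le ((min_le_left _ _).trans (min_le_right _ _)) hL₂.le),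
        fun S x x' hx => (hA3 S x x' (hx.trans hh1)).trans (DataFusion.rpow_le_of_le (norm_nonneg _)
          hx hh hh1 hβ₃.1.le (min_le_right _ _) hL₃.le)⟩
    have key := P.abs_mul_risk_sub_energy_alphaPop_le (N := N) (g := g) hd hSS hn hM hN hNn hg hT hh
      hh1 hO hL₁.le hL₂.le hL₃.le (W := max (DataFusion.supNorm a ^ 2) 1)
      (G := max (max ((C / c) ^ 2) ((L₁ + L₂ + L₃) ^ 2)) (8 ^ d)) (le_max_left _ _) (le_max_right _ _)
      ((le_max_left _ _).trans (le_max_left _ _)) ((le_max_right _ _).trans (le_max_left _ _))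
      (le_max_right _ _) hτ (Real.rpow_nonneg hh.le _) (Real.rpow_le_one hh.le hh1 hβ0.le)
    have e1 : ∫ Z, (DataFusion.thetaHat P.a P.r P.lam h T g Z - P.θ) ^ 2 ∂P.dataM n N
        = DataFusion.risk f a r lam N h T g := by
      refine integral_congr_ae (Eventually.of_forall fun Z => ?_)
      have := DataFusion.thetaHat_scale (r' := DataFusion.rbar f r) hE (fun S x => rfl) a lam h T g Z
      simp only
      rw [← this]
      rfl
    have e2 : (h ^ β) ^ 2 = h ^ (2 * β) := by
      rw [← Real.rpow_natCast, ← Real.rpow_mul hh.le, mul_comm]; norm_num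
    rw [e1, e2] at key
    have hub := P.energy_alphaPop_le hSS hαs M
    have hlb := hmin _ (P.bddH_alphaPop M).memH
    have hVe : 0 ≤ V * Real.exp (-(M / κ)) := by positivity
    have hk := abs_le.1 key
    -- From below the iterate's energy is at least the minimum; from above linear convergence
    -- applies.
    refine abs_le.2 ⟨?_, ?_⟩
    · have h1 : -(DataFusion.constA d c C ^ M * DataFusion.constD a lam c C L₁ L₂ L₃ *
          √(DataFusion.errTerm f β n M T h))
          ≤ n * DataFusion.risk f a r lam N h T g - P.energy (P.alphaPop M) := hk.1
      have h2 : DataFusion.objective f a r lam αs ≤ P.energy (P.alphaPop M) := hlb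
      linarith
    · have h1 : n * DataFusion.risk f a r lam N h T g - P.energy (P.alphaPop M)
          ≤ DataFusion.constA d c C ^ M * DataFusion.constD a lam c C L₁ L₂ L₃ *
          √(DataFusion.errTerm f β n M T h) := hk.2
      have h2 : P.energy (P.alphaPop M)
          ≤ DataFusion.objective f a r lam αs + V * Real.exp (-(M / κ)) := hub
      linarith
  refine ⟨αs, hαs, fun α hα => hmin α hα, ?_, ?_⟩
  · intro n M N g T h hn hM hT hN hNn hg hTh hh1
    have hn0 : (0 : ℝ) < n := by positivity
    have hM0 : (0 : ℝ) < M := by positivity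
    have hh : 0 < h :=
      lt_of_lt_of_le (mul_pos (by linarith) (Real.rpow_pos_of_pos (div_pos hM0 hn0) _)) hTh
    have hτ := DataFusion.stochastic_le_one (by omega : d ≠ 0) hn (by linarith) hh hTh
    constructor
    · have hb := ((P.bddMeas_thetaHat (T := T) (g := g) (N := N) hh hn hN).sub
        (DataFusion.bddMeas_const (DataFusion.theta f a))).pow.integrable (P.dataM n N)
      refine Integrable.congr hb (Eventually.of_forall fun Z => ?_)
      have := DataFusion.thetaHat_scale (r' := DataFusion.rbar f r) hE (fun S x => rfl) a lam h T g Z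
      simp only
      rw [← this]
      rfl
    · have h1 := (abs_le.1 (hrisk n M N g T h hn hM hT hN hNn hg hh hh1 hτ)).2
      -- The factor 4κ of the stated bound is slack, as κ ≥ 1.
      have h2 : V * Real.exp (-(M / κ)) ≤ 4 * κ * V * Real.exp (-(M / κ)) := by
        have : V ≤ 4 * κ * V := le_mul_of_one_le_left hV0 (by linarith)
        exact mul_le_mul_of_nonneg_right this (Real.exp_pos _).le
      linarith
  · intro n M N g T h hn hM hT hh hN hNn hg hlim
    have hq0 : 0 ≤ C / c := by
      obtain ⟨S, hS⟩ := hSS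
      have := hrbar ⟨S, hS⟩ 0
      exact div_nonneg (hc.le.trans (this.1.trans this.2)) hc.le
    have hA1' : 1 ≤ DataFusion.constA d c C := by
      have : (1 : ℝ) ≤ 2 ^ d := one_le_pow₀ one_le_two
      unfold DataFusion.constA
      linarith
    have hterm : ∀ k, 0 ≤ T k → 0 ≤ M k * T k ^ d / (n k * h k ^ d) := fun k hk => by
      have := hh k
      positivity
    -- Since A ≥ 1, the error term itself is eventually below 1, hence so is each of its nonnegative
    -- parts; for h^{2β} this forces h ≤ 1.
    have hev : ∀ᶠ k in atTop, 1 ≤ n k ∧ 1 ≤ M k ∧ 1 ≤ T k ∧ h k ≤ 1 ∧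
        M k * T k ^ d / (n k * h k ^ d) ≤ 1 := by
      filter_upwards [hn.eventually_ge_atTop 1, hM.eventually_ge_atTop 1, hT.eventually_ge_atTop 1,
        hlim.eventually (gt_mem_nhds one_pos)] with k h1 h2 h3 h4
      have hp : 0 ≤ (DataFusion.law f).real {x | T k ≤ ‖x‖} := measureReal_nonneg
      have hr0 : 0 ≤ h k ^ (2 * β) := Real.rpow_nonneg (hh k).le _
      have ht0 := hterm k (by linarith)
      have herr0 : 0 ≤ DataFusion.errTerm f β (n k) (M k) (T k) (h k) := by
        unfold DataFusion.errTerm; positivity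
      have herr1 : DataFusion.errTerm f β (n k) (M k) (T k) (h k) < 1 :=
        lt_of_le_of_lt (le_mul_of_one_le_left herr0 (one_le_pow₀ hA1')) h4
      unfold DataFusion.errTerm at herr1
      refine ⟨h1, h2, h3, ?_, by linarith⟩
      by_contra hcon
      have : 1 ≤ h k ^ (2 * β) := Real.one_le_rpow (not_le.1 hcon).le (by linarith)
      linarith
    have hzero : Tendsto (fun k => DataFusion.constA d c C ^ (M k) *
        DataFusion.constD a lam c C L₁ L₂ L₃ *
        √(DataFusion.errTerm f β (n k) (M k) (T k) (h k)) + V * Real.exp (-(M k / κ)))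
        atTop (𝓝 0) := by
      have h1 : Tendsto (fun k => DataFusion.constD a lam c C L₁ L₂ L₃ *
          √(DataFusion.constA d c C ^ (2 * M k) *
            DataFusion.errTerm f β (n k) (M k) (T k) (h k))) atTop (𝓝 0) := by
        have := (hlim.sqrt).const_mul (DataFusion.constD a lam c C L₁ L₂ L₃)
        simpa using this
      have h2 : Tendsto (fun k => V * Real.exp (-(M k / κ))) atTop (𝓝 0) := by
        have h3 : Tendsto (fun k => (M k : ℝ) / κ) atTop atTop :=
          (tendsto_natCast_atTop_atTop.comp hM).atTop_div_const (by linarith)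
        have := (Real.tendsto_exp_neg_atTop_nhds_zero.comp h3).const_mul V
        simpa using this
      have h4 := h1.add h2
      rw [add_zero] at h4
      refine h4.congr fun k => ?_
      -- The factor A^M outside the square root is A^{2M} inside it, which is why the rate condition
      -- carries the exponent 2M.
      have e : DataFusion.constA d c C ^ (2 * M k) = (DataFusion.constA d c C ^ M k) ^ 2 := by
        rw [← pow_mul, mul_comm]
      rw [e, Real.sqrt_mul (sq_nonneg _), Real.sqrt_sq (by positivity)]
      ring
    rw [isLittleO_iff_tendsto' (by
      filter_upwards [hn.eventually_ge_atTop 1] with k hk h0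
      have : (0 : ℝ) < n k := by exact_mod_cast hk
      exact absurd h0 (by positivity))]
    refine squeeze_zero_norm' ?_ hzero
    filter_upwards [hev] with k hk
    obtain ⟨h1, h2, h3, h4, h5⟩ := hk
    have hn0 : (n k : ℝ) ≠ 0 := by positivity
    have e : (DataFusion.risk f a r lam (N k) (h k) (T k) (g k)
        - DataFusion.objective f a r lam αs / n k) / (1 / (n k : ℝ))
        = n k * DataFusion.risk f a r lam (N k) (h k) (T k) (g k)
          - DataFusion.objective f a r lam αs := by
      field_simp
    rw [e, Real.norm_eq_abs]
    exact hrisk (n k) (M k) (N k) (g k) (T k) (h k) h1 h2 h3 (hN k) (hNn k) (hg k) (hh k) h4 h5
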